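/- **Setting.** Let $\mathbb R_\tau=\{x+\tau y: x,y\in\mathbb R\}$, $\tau^2=1$, $\overline{x+\tau y}=x-\tau y$, and let $\mathbf q(z,w)=z^tQ\bar w$ on $\mathbb R_\tau^{2m+1}$, $Q$ the anti-diagonal matrix of ones. The para-complex hyperbolic space is $\mathbb H^{2m}_\tau=\{z:\mathbf q(z,z)=-1\}/\{c\in\mathbb R_\tau:c\bar c=1\}$. Its tangent space at $[z]$ is identified with $z^{\perp_{\mathbf q}}$, and it carries the para-complex structure $\mathbf P$ (multiplication by $\tau$), the pseudo-Riemannian metric $g=\operatorname{Re}\mathbf q$ (para-holomorphic sectional curvature $-4$) and the symplectic form $\omega=g(\cdot,\mathbf P\cdot)$. A para-complex hyperbolic subspace is the set of classes of points of the quadric that lie in a $\mathbf q$-non-degenerate $\mathbb R_\tau$-submodule. Let $S$ be a connected oriented smooth surface, $m\ge 2$, and $\sigma:S\to\mathbb H^{2m}_\tau$ a smooth isotropic $\mathbf P$-alternating immersion. This means: $\sigma$ is a smooth spacelike immersion and, with $\nabla$ the pull-back of the Levi-Civita connection, there is a $g$-orthogonal splitting $\sigma^*T\mathbb H^{2m}_\tau=\mathscr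 L_1\oplus\cdots\oplus\mathscr L_{2m}$ into smooth rank-$2$ bundles with definite induced metrics such that $\mathscr L_1=d\sigma(TS)$; the $\mathscr L_i$-component of $\nabla_X\nu$ vanishes for every local section $\nu$ of $\mathscr L_j$ if $|i-j|\ge2$; the $1$-forms $\eta_i$ with values in $\mathrm{Hom}(\mathscr L_{i-1},\mathscr L_i)$, defined by $\eta_i(X)\nu=$ the $\mathscr L_i$-component of $\nabla_X\nu$ ($2\le i\le 2m$), are pointwise conformal (possibly zero); $g>0$ on $\mathscr L_i$ for $i$ odd; $\mathbf P(\mathscr L_{2k-1})=\mathscr L_{2m-2(k-1)}$ for $1\le k\le m$; and $\omega$ vanishes on each $\mathscr L_i$. Let $J_1$ be the complex structure on $TS\cong\mathscr L_1$ given by the orientation and the induced metric, and $X=(S,J_1)$ the resulting Riemann surface. **Theorem A.** Assume that $\sigma(S)$ is not contained in any para-complex hyperbolic subspace of real codimension $4$. Then: 1. None of $\eta_2,\dots,\eta_m$ is identically zero. 2. The bundles $\mathscr L_2,\dots,\mathscr L_{2m}$ can be oriented, compatibly with $\mathbf P:\mathscr L_i\to\mathscr L_{2m+1-i}$ and with the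 given orientation of $\mathscr L_1$, so that with the resulting complex structures $J_i$ (rotation by $\pi/2$), the induced metrics and the induced connections $\nabla^i$ they are holomorphic Hermitian line bundles over $X$, with $\bar\partial=(\nabla^i)^{0,1}$ and Chern connection $\nabla^i$. Write $L_1,\dots,L_m$ for the bundles obtained from $\mathscr L_1,\dots,\mathscr L_m$; here $L_1\cong K^{-1}$, i.e. $\partial_z$ is a holomorphic frame of $L_1$ for each holomorphic coordinate $z$, under the identification $Y\mapsto (Y-iJ_1Y)/2$ of $TS$ with $T^{1,0}X$. 3. For $2\le i\le m$, $\eta_i$ is a holomorphic $(1,0)$-form with values in $\mathrm{Hom}_{\mathbb C}(L_{i-1},L_i)$; and $\eta_{m+1}$ is a holomorphic $(1,0)$-form with values in $\mathrm{Hom}_{\mathbb C}(L_m,\overline{L_m})$, where $\overline{L_m}$ is $\mathbf P(\mathscr L_m)=\mathscr L_{m+1}$ with the complex structure $-J_{m+1}$ and $\bar\partial$-operator given by $\nabla^{m+1}$. The remaining structural data are determined by these: $g(\eta_{2m+2-i}(X)\mathbf P\xi,\mathbf P\zeta)=g(\xi,\eta_i(X)\zeta)$ for $2\le i\le 2m$,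 $\xi\in\mathscr L_i$, $\zeta\in\mathscr L_{i-1}$, and $\nabla^{2m+1-i}\circ\mathbf P=\mathbf P\circ\nabla^i$ for $1\le i\le 2m$. 4. The splitting is unique: every orthogonal splitting of $\sigma^*T\mathbb H^{2m}_\tau$ with the listed properties (conformality of the $\eta_i$ is not needed) has the same $\mathscr L_1,\dots,\mathscr L_{2m}$. 5. Let $z$ be a local holomorphic coordinate of $X$ and let $\ell_1=\partial_z,\ell_2,\dots,\ell_m$ be local holomorphic frames of $L_1,\dots,L_m$. Put $\boldsymbol h_i=\tfrac12|g(\ell_i,\ell_i)|$ (so that the first fundamental form is $2\boldsymbol h_1|dz|^2$), and write $\eta_i=f_i\,dz\otimes\ell_{i-1}^*\otimes\ell_i$ ($2\le i\le m$) and $\eta_{m+1}=f_{m+1}\,dz\otimes\ell_m^*\otimes(\boldsymbol h_m^{-1}\mathbf P\ell_m)$. Then the $f_i$ are holomorphic and, with $|\eta_i|^2:=|f_i|^2$, $$\begin{cases}\partial^2_{z\bar z}\log\boldsymbol h_m-|\eta_m|^2\boldsymbol h_m\boldsymbol h_{m-1}^{-1}+|\eta_{m+1}|^2\boldsymbol h_m^{-2}=0,\\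 \partial^2_{z\bar z}\log\boldsymbol h_j-|\eta_j|^2\boldsymbol h_j\boldsymbol h_{j-1}^{-1}+|\eta_{j+1}|^2\boldsymbol h_{j+1}\boldsymbol h_j^{-1}=0,\quad 2\le j\le m-1,\\ \partial^2_{z\bar z}\log\boldsymbol h_1-\boldsymbol h_1+|\eta_2|^2\boldsymbol h_2\boldsymbol h_1^{-1}=0.\end{cases}$$ -/

import Mathlib

open Set
open scoped Manifold ContDiff Topology

namespace ParaHyp

/-! ### Para-complex numbers and the para-Hermitian form -/

/-- The algebra `ℝ_τ` of para-complex numbers `x + τ y`, `τ² = 1`, written in the basis of the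
idempotents `e₊ = (1 + τ)/2`, `e₋ = (1 - τ)/2`: the pair `(x + y, x - y)` stands for `x + τ y`,
and the ring structure is that of the product ring `ℝ × ℝ`. -/
abbrev PC : Type := ℝ × ℝ

/-- The para-complex unit `τ`. -/
def tau : PC := (1, -1)

/-- Para-complex conjugation `x + τ y ↦ x - τ y`. -/
def conj (z : PC) : PC := (z.2, z.1)

/-- The real part `x` of `x + τ y`. -/
noncomputable def re (z : PC) : ℝ := (z.1 + z.2) / 2

/-- The `τ`-imaginary part `y` of `x + τ y`. -/
noncomputable def im (z : PC) : ℝ := (z.1 - z.2) / 2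

theorem tau_mul_tau : tau * tau = 1 := by
  ext <;> simp [tau]

theorem eq_re_add_tau_im (z : PC) : z = re z • (1 : PC) + im z • tau := by
  ext <;> simp [tau, re, im] <;> ring

/-- The space `ℝ_τ^{n+1}`. -/
abbrev PVec (n : ℕ) : Type := Fin (n + 1) → PC

/-- The para-Hermitian form `q(z, w) = zᵗ Q w̄`, with `Q` the anti-diagonal matrix of ones. -/
def q {n : ℕ} (z w : PVec n) : PC := ∑ i, z i * conj (w (Fin.rev i))

theorem q_add_left {n : ℕ} (x y w : PVec n) : q (x + y) w = q x w + q y w := by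
  simp [q, add_mul, Finset.sum_add_distrib]

theorem q_smul_left {n : ℕ} (c : PC) (x w : PVec n) : q (c • x) w = c * q x w := by
  simp [q, Finset.mul_sum, mul_assoc]

theorem q_rsmul_left {n : ℕ} (c : ℝ) (x w : PVec n) : q (c • x) w = c • q x w := by
  simp [q, Finset.smul_sum]

theorem conj_mul (a b : PC) : conj (a * b) = conj a * conj b := rfl

theorem q_smul_right {n : ℕ} (c : PC) (x w : PVec n) : q x (c • w) = conj c * q x w := by
  simp only [q, Finset.mul_sum, Pi.smul_apply, smul_eq_mul, conj_mul]
  exact Finset.sum_congr rfl fun i _ => by ring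

/-! ### The para-complex hyperbolic space -/

/-- The quadric `{z | q(z, z) = -1}`. -/
def Quadric (n : ℕ) : Type := {z : PVec n // q z z = -1}

/-- `z ∼ w` iff `w = c z` for a para-complex number `c` with `c c̄ = 1`. -/
def quadricSetoid (n : ℕ) : Setoid (Quadric n) where
  r z w := ∃ c : PC, c * conj c = 1 ∧ w.1 = c • z.1
  iseqv :=
    { refl := fun z => ⟨1, by ext <;> simp [conj], by simp⟩
      symm := by
        rintro z w ⟨c, hc, h⟩
        refine ⟨conj c, by rw [mul_comm]; exact hc, ?_⟩
        rw [h, smul_smul, mul_comm, hc, one_smul]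
      trans := by
        rintro x y z ⟨c, hc, h⟩ ⟨d, hd, h'⟩
        refine ⟨d * c, ?_, by rw [h', h, smul_smul]⟩
        rw [conj_mul, mul_mul_mul_comm, hd, hc, one_mul] }

/-- The para-complex hyperbolic space `ℍ^n_τ`, of real dimension `2 n`. -/
def Hyp (n : ℕ) : Type := Quotient (quadricSetoid n)

/-- The projection of the quadric onto `ℍ^n_τ`. -/
def toHyp {n : ℕ} (z : Quadric n) : Hyp n := Quotient.mk (quadricSetoid n) z

/-- A chosen point of the quadric above `p`. -/
noncomputable def rep {n : ℕ} (p : Hyp n) : PVec n := (@Quotient.out _ (quadricSetoid n) p).1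

/-- Real-linear endomorphisms of `ℝ_τ^{n+1}`. -/
abbrev PEnd (n : ℕ) : Type := PVec n →L[ℝ] PVec n

/-- For `q(z, z) = -1`, the `q`-orthogonal projection `w ↦ - q(w, z) z` onto the line `ℝ_τ z`. -/
noncomputable def lineMap {n : ℕ} (z : PVec n) : PEnd n :=
  LinearMap.toContinuousLinearMap
    { toFun := fun w => (-(q w z)) • z
      map_add' := fun x y => by rw [q_add_left, neg_add, add_smul]
      map_smul' := fun c x => by
        rw [q_rsmul_left, RingHom.id_apply, ← smul_neg, smul_assoc] }

/-- The `q`-orthogonal projection `Π_p` of `ℝ_τ^{n+1}` onto the line `ℓ = ℝ_τ z`, for `p = [z]`. -/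
noncomputable def lineProj {n : ℕ} (p : Hyp n) : PEnd n :=
  Quotient.lift (fun z : Quadric n => lineMap z.1) (by
    rintro z w ⟨c, hc, h⟩
    ext1 x
    change (-(q x z.1)) • z.1 = (-(q x w.1)) • w.1
    rw [h, q_smul_right, smul_smul]
    congr 1
    linear_combination (q x z.1) * hc) p

/-- The tangent space `T_p ℍ^n_τ = Hom_{ℝ_τ}(ℓ, ℓ^⊥)`, `p = [z]`, `ℓ = ℝ_τ z`, where `ℓ^⊥` is the
`q`-orthogonal complement of `z`. A homomorphism `ℓ → ℓ^⊥` is extended by zero on `ℓ^⊥`.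
Evaluation `A ↦ A z` identifies `T_p ℍ^n_τ` with the `q`-orthogonal complement of `z`
(horizontal vectors at `z`); replacing `z` by `c z` replaces `A z` by `c (A z)`. -/
noncomputable def tangentAt {n : ℕ} (p : Hyp n) : Submodule ℝ (PEnd n) where
  carrier := {A | (∀ (c : PC) (w : PVec n), A (c • w) = c • A w) ∧
    A ∘L lineProj p = A ∧ lineProj p ∘L A = 0}
  add_mem' := by
    rintro A B ⟨h1, h2, h3⟩ ⟨k1, k2, k3⟩
    refine ⟨fun c w => by simp [h1, k1], ?_, ?_⟩
    · rw [ContinuousLinearMap.add_comp, h2, k2]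
    · rw [ContinuousLinearMap.comp_add, h3, k3, add_zero]
  zero_mem' := ⟨by simp, by simp, by simp⟩
  smul_mem' := by
    rintro r A ⟨h1, h2, h3⟩
    refine ⟨fun c w => by
      rw [smul_apply, h1, smul_apply, smul_comm], ?_, ?_⟩
    · rw [ContinuousLinearMap.smul_comp, h2]
    · rw [ContinuousLinearMap.comp_smul, h3, smul_zero]

/-- The para-complex structure `𝐏`: multiplication by `τ`. -/
noncomputable def paraP (n : ℕ) : PEnd n →ₗ[ℝ] PEnd n where
  toFun A := (LinearMap.toContinuousLinearMap
    { toFun := fun w : PVec n => tau • w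
      map_add' := fun x y => smul_add _ _ _
      map_smul' := fun c x => by rw [RingHom.id_apply, smul_comm] } : PEnd n) ∘L A
  map_add' A B := by rw [ContinuousLinearMap.comp_add]
  map_smul' c A := by rw [ContinuousLinearMap.comp_smul, RingHom.id_apply]

/-- The pseudo-Riemannian metric `g_p(A, B) = Re q(A z, B z)`, `p = [z]` (on tangent vectors it
does not depend on `z`). Its para-holomorphic sectional curvature is `-4`. -/
noncomputable def gmet {n : ℕ} (p : Hyp n) (A B : PEnd n) : ℝ := re (q (A (rep p)) (B (rep p)))

theorem gmet_eq {n : ℕ} (z : Quadric n) {A B : PEnd n}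
    (hA : A ∈ tangentAt (toHyp z)) (hB : B ∈ tangentAt (toHyp z)) :
    gmet (toHyp z) A B = re (q (A z.1) (B z.1)) := by
  obtain ⟨c, hc, h⟩ : ∃ c : PC, c * conj c = 1 ∧ rep (toHyp z) = c • z.1 := by
    have := (quadricSetoid n).symm (@Quotient.mk_out _ (quadricSetoid n) z)
    exact this
  have : c * (conj c * q (A z.1) (B z.1)) = q (A z.1) (B z.1) := by
    rw [← mul_assoc, hc, one_mul]
  rw [gmet, h, hA.1, hB.1, q_smul_left, q_smul_right, this]

/-- The symplectic form `ω = g(·, 𝐏 ·)`. -/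
noncomputable def omegaForm {n : ℕ} (p : Hyp n) (A B : PEnd n) : ℝ := gmet p A (paraP n B)

/-- `(1 - Π_p) A Π_p`: the component of `A` in `Hom(ℓ, ℓ^⊥)`. -/
noncomputable def hor {n : ℕ} (p : Hyp n) (A : PEnd n) : PEnd n :=
  (ContinuousLinearMap.id ℝ (PVec n) - lineProj p) ∘L A ∘L lineProj p

/-- The component of `A` in `W` for the `g_p`-orthogonal splitting defined by a subspace `W` on
which `g_p` is definite: the element `B` of `W` with `A - B` orthogonal to `W`. -/
noncomputable def orthoProj {n : ℕ} (p : Hyp n) (W : Submodule ℝ (PEnd n)) (A : PEnd n) :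
    PEnd n :=
  open Classical in
  if h : ∃ B ∈ W, ∀ C ∈ W, gmet p (A - B) C = 0 then h.choose else 0

/-! ### Maps into the para-complex hyperbolic space -/

section Maps

variable {E : Type*} [NormedAddCommGroup E] [NormedSpace ℝ E] {H : Type*} [TopologicalSpace H]
  (I : ModelWithCorners ℝ E H) {N : Type*} [TopologicalSpace N] [ChartedSpace H N] {n : ℕ}

/-- `f` is smooth: locally it lifts to a smooth map into the quadric (which is a principal
bundle over `ℍ^n_τ`). -/
def SmoothMap (f : N → Hyp n) : Prop :=
  ∀ x₀ : N, ∃ U : Set N, IsOpen U ∧ x₀ ∈ U ∧ ∃ F : N → PVec n,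
    ContMDiffOn I 𝓘(ℝ, PVec n) ∞ F U ∧
    ∀ x ∈ U, ∃ z : Quadric n, z.1 = F x ∧ toHyp z = f x

/-- The derivative of an endomorphism-valued function. -/
noncomputable def deriv₁ (A : N → PEnd n) (x : N) (v : TangentSpace I x) : PEnd n :=
  (mfderiv I 𝓘(ℝ, PEnd n) A x : TangentSpace I x →L[ℝ] PEnd n) v

/-- The differential `df_x(v) ∈ T_{f(x)} ℍ^n_τ`. If `z` is a local lift of `f`, then `df_x(v)` sends
`z(x)` to the horizontal part of `dz_x(v)`. -/
noncomputable def dmap (f : N → Hyp n) (x : N) (v : TangentSpace I x) : PEnd n :=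
  hor (f x) (deriv₁ I (fun y => lineProj (f y)) x v)

/-- The pull-back to `f^* T ℍ^n_τ` of the Levi-Civita connection of `g`: the derivative of the
section `A`, viewed as a function with values in endomorphisms of `ℝ_τ^{n+1}`, projected to
`Hom(ℓ, ℓ^⊥)`. In terms of a local lift `z` with `q(dz, z) = 0`, the vector field `A z` is
differentiated in `ℝ_τ^{n+1}` and the result is projected to the `q`-orthogonal complement
of `z`. -/
noncomputable def cov (f : N → Hyp n) (A : N → PEnd n) (x : N) (v : TangentSpace I x) : PEnd n :=
  hor (f x) (deriv₁ I A x v)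

/-- `ν` is a smooth section over the open set `U` of the family of subspaces `W`. -/
def IsSection (W : N → Submodule ℝ (PEnd n)) (U : Set N) (ν : N → PEnd n) : Prop :=
  IsOpen U ∧ ContMDiffOn I 𝓘(ℝ, PEnd n) ∞ ν U ∧ ∀ x ∈ U, ν x ∈ W x

/-- The connection induced on a subbundle `W` of `f^* T ℍ^n_τ`: the `W`-component of `∇_v ν`. -/
noncomputable def covOn (f : N → Hyp n) (W : N → Submodule ℝ (PEnd n)) (ν : N → PEnd n) (x : N)
    (v : TangentSpace I x) : PEnd n :=
  orthoProj (f x) (W x) (cov I f ν x v)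

/-- The `Hom(W, W')`-valued `1`-form given, for orthogonal subbundles `W`, `W'` of
`f^* T ℍ^n_τ`, by the `W'`-component of `∇_v ν`, `ν` any section of `W` with `ν(x) = ξ` (this depends
only on `ξ`). The section used here is the projection to `W` of the constant function `ξ`. -/
noncomputable def offDiag (f : N → Hyp n) (W W' : N → Submodule ℝ (PEnd n)) (x : N)
    (v : TangentSpace I x) (ξ : PEnd n) : PEnd n :=
  orthoProj (f x) (W' x)
    (cov I f (fun y => orthoProj (f y) (W y) (hor (f y) ξ)) x v)

end Maps

/-! ### Isotropic `𝐏`-alternating surfaces -/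

section Surfaces

variable {S : Type*} [TopologicalSpace S] [ChartedSpace (EuclideanSpace ℝ (Fin 2)) S]

/-- `σ` is a smooth spacelike immersion. -/
def IsSpacelikeImmersion {n : ℕ} (σ : S → Hyp n) : Prop :=
  SmoothMap (𝓡 2) σ ∧
    ∀ (s : S) (X : TangentSpace (𝓡 2) s), X ≠ 0 →
      0 < gmet (σ s) (dmap (𝓡 2) σ s X) (dmap (𝓡 2) σ s X)

/-- The `1`-form `η_i` with values in `Hom(𝓛_{i-1}, 𝓛_i)`. -/
noncomputable def eta {n : ℕ} (σ : S → Hyp n) (𝓛 : ℕ → S → Submodule ℝ (PEnd n)) (i : ℕ) (s : S)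
    (X : TangentSpace (𝓡 2) s) (ξ : PEnd n) : PEnd n :=
  offDiag (𝓡 2) σ (𝓛 (i - 1)) (𝓛 i) s X ξ

/-- `σ^* T ℍ^{2m}_τ = 𝓛_1 ⊕ ⋯ ⊕ 𝓛_{2m}` is a Frenet splitting. -/
structure IsFrenetSplitting (m : ℕ) (σ : S → Hyp (2 * m))
    (𝓛 : ℕ → S → Submodule ℝ (PEnd (2 * m))) : Prop where
  iSup_eq : ∀ s, (⨆ i ∈ Icc 1 (2 * m), 𝓛 i s) = tangentAt (σ s)
  orthogonal : ∀ i ∈ Icc 1 (2 * m), ∀ j ∈ Icc 1 (2 * m), i ≠ j → ∀ s, ∀ A ∈ 𝓛 i s, ∀ B ∈ 𝓛 j s,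
    gmet (σ s) A B = 0
  rank_two : ∀ i ∈ Icc 1 (2 * m), ∀ s, Module.finrank ℝ (𝓛 i s) = 2
  smooth : ∀ i ∈ Icc 1 (2 * m), ∀ s₀ : S, ∃ U, s₀ ∈ U ∧ ∃ u v : S → PEnd (2 * m),
    IsSection (𝓡 2) (𝓛 i) U u ∧ IsSection (𝓡 2) (𝓛 i) U v ∧
    ∀ s ∈ U, 𝓛 i s = Submodule.span ℝ {u s, v s}
  tangent : ∀ s, (𝓛 1 s : Set (PEnd (2 * m))) = range (dmap (𝓡 2) σ s)
  definite : ∀ i ∈ Icc 1 (2 * m), ∀ s, (∀ A ∈ 𝓛 i s, A ≠ 0 → 0 < gmet (σ s) A A) ∨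
    (∀ A ∈ 𝓛 i s, A ≠ 0 → gmet (σ s) A A < 0)
  tridiagonal : ∀ i ∈ Icc 1 (2 * m), ∀ j ∈ Icc 1 (2 * m), (i + 2 ≤ j ∨ j + 2 ≤ i) →
    ∀ (U : Set S) (ν : S → PEnd (2 * m)), IsSection (𝓡 2) (𝓛 j) U ν →
      ∀ s ∈ U, ∀ X : TangentSpace (𝓡 2) s, orthoProj (σ s) (𝓛 i s) (cov (𝓡 2) σ ν s X) = 0

/-- Superconformality: each `η_i(X) : 𝓛_{i-1} → 𝓛_i` is a conformal linear map (possibly zero) on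
each fibre, with respect to the norms `|g|^{1/2}`. -/
def IsSuperconformal (m : ℕ) (σ : S → Hyp (2 * m))
    (𝓛 : ℕ → S → Submodule ℝ (PEnd (2 * m))) : Prop :=
  ∀ i ∈ Icc 2 (2 * m), ∀ (s : S) (X : TangentSpace (𝓡 2) s), ∃ c : ℝ, 0 ≤ c ∧
    ∀ ξ ∈ 𝓛 (i - 1) s,
      |gmet (σ s) (eta σ 𝓛 i s X ξ) (eta σ 𝓛 i s X ξ)| = c * |gmet (σ s) ξ ξ|

/-- The splitting is `𝐏`-alternating and isotropic. -/
structure IsPAlternating (m : ℕ) (σ : S → Hyp (2 * m))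
    (𝓛 : ℕ → S → Submodule ℝ (PEnd (2 * m))) : Prop where
  pos_odd : ∀ i ∈ Icc 1 (2 * m), Odd i → ∀ s, ∀ A ∈ 𝓛 i s, A ≠ 0 → 0 < gmet (σ s) A A
  map_paraP : ∀ k ∈ Icc 1 m, ∀ s,
    (𝓛 (2 * k - 1) s).map (paraP (2 * m)) = 𝓛 (2 * m - 2 * (k - 1)) s
  isotropic : ∀ i ∈ Icc 1 (2 * m), ∀ s, ∀ A ∈ 𝓛 i s, ∀ B ∈ 𝓛 i s, omegaForm (σ s) A B = 0

/-- The image of `σ` lies in a para-complex hyperbolic subspace of real codimension `4`: the set of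
classes of the points of the quadric that lie in an `ℝ_τ`-submodule `V` of real codimension `4`
on which `q` is non-degenerate. -/
def InCodimFour {n : ℕ} (σ : S → Hyp n) : Prop :=
  ∃ V : Submodule PC (PVec n),
    (∀ v ∈ V, (∀ w ∈ V, q v w = 0) → v = 0) ∧
    Module.finrank ℝ (V.restrictScalars ℝ) + 4 = Module.finrank ℝ (PVec n) ∧
    ∀ (s : S) (z : Quadric n), toHyp z = σ s → z.1 ∈ V

/-! ### Holomorphic data -/

/-- `J` is a smooth orthogonal complex structure on the rank `2` bundle `W` with definite
metric, i.e. the rotation by `π/2` for an orientation of `W`. (Only the values of `J s` on `W s`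
matter.) -/
structure IsComplexStr {n : ℕ} (σ : S → Hyp n) (W : S → Submodule ℝ (PEnd n))
    (J : S → PEnd n →ₗ[ℝ] PEnd n) : Prop where
  mem : ∀ s, ∀ ξ ∈ W s, J s ξ ∈ W s
  sq : ∀ s, ∀ ξ ∈ W s, J s (J s ξ) = -ξ
  isometry : ∀ s, ∀ ξ ∈ W s, gmet (σ s) (J s ξ) (J s ξ) = gmet (σ s) ξ ξ
  smooth : ∀ U ν, IsSection (𝓡 2) W U ν → IsSection (𝓡 2) W U (fun s => J s (ν s))

/-- `φ : D → S`, `D ⊆ ℂ` open, is the inverse of a holomorphic local coordinate `z` of the Riemann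
surface `X = (S, J₁)`, where `J₁` is a complex structure on `dσ(TS)`. -/
structure IsHolParam {n : ℕ} (σ : S → Hyp n) (J₁ : S → PEnd n →ₗ[ℝ] PEnd n) (φ : ℂ → S)
    (D : Set ℂ) : Prop where
  isOpen : IsOpen D
  injOn : InjOn φ D
  smooth : ContMDiffOn 𝓘(ℝ, ℂ) (𝓡 2) ∞ φ D
  immersion : ∀ w ∈ D, mfderiv 𝓘(ℝ, ℂ) (𝓡 2) φ w (1 : ℂ) ≠ 0
  conformal : ∀ w ∈ D, dmap (𝓡 2) σ (φ w) (mfderiv 𝓘(ℝ, ℂ) (𝓡 2) φ w Complex.I) =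
    J₁ (φ w) (dmap (𝓡 2) σ (φ w) (mfderiv 𝓘(ℝ, ℂ) (𝓡 2) φ w (1 : ℂ)))

/-- The coordinate vector `∂_x` at `φ(w)`, where `z = x + i y` is the coordinate inverse to `φ`. The
complex line bundles `(TS, J₁)` and `T^{1,0}X` are identified by `X ↦ (X - i J₁ X)/2`, so that `∂_x`
corresponds to `∂_z`. -/
noncomputable def dx (φ : ℂ → S) (w : ℂ) : TangentSpace (𝓡 2) (φ w) :=
  mfderiv 𝓘(ℝ, ℂ) (𝓡 2) φ w (1 : ℂ)

/-- `ℓ : D → σ^* T ℍ^n_τ` is a holomorphic local section, in the coordinate inverse to `φ`, of the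
bundle `W` with complex structure `J` and the operator `∂̄ = (∇^W)^{0,1}`, where `∇^W` is the
connection induced on `W`. -/
structure IsHolSection {n : ℕ} (σ : S → Hyp n) (W : S → Submodule ℝ (PEnd n))
    (J : S → PEnd n →ₗ[ℝ] PEnd n) (φ : ℂ → S) (D : Set ℂ) (ℓ : ℂ → PEnd n) : Prop where
  smooth : ContDiffOn ℝ ∞ ℓ D
  mem : ∀ w ∈ D, ℓ w ∈ W (φ w)
  dbar : ∀ w ∈ D,
    covOn 𝓘(ℝ, ℂ) (fun w => σ (φ w)) (fun w => W (φ w)) ℓ w Complex.I =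
      J (φ w) (covOn 𝓘(ℝ, ℂ) (fun w => σ (φ w)) (fun w => W (φ w)) ℓ w (1 : ℂ))

/-- `(W, J)`, with the metric and connection induced on `W`, is a holomorphic Hermitian line
bundle over the Riemann surface `(S, J₁)`: the induced connection is compatible with the metric and
complex-linear, and its `(0,1)`-part is the `∂̄`-operator of a holomorphic structure, i.e. there are
nowhere vanishing holomorphic sections near each point. The induced connection is then the
Chern connection. -/
structure IsHolHermitianLineBundle {n : ℕ} (σ : S → Hyp n) (J₁ : S → PEnd n →ₗ[ℝ] PEnd n)
    (W : S → Submodule ℝ (PEnd n)) (J : S → PEnd n →ₗ[ℝ] PEnd n) : Prop where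
  complexStr : IsComplexStr σ W J
  metric : ∀ U ν, IsSection (𝓡 2) W U ν → ∀ s ∈ U, ∀ X : TangentSpace (𝓡 2) s,
    (mfderiv (𝓡 2) 𝓘(ℝ, ℝ) (fun t => gmet (σ t) (ν t) (ν t)) s X : ℝ) =
      2 * gmet (σ s) (covOn (𝓡 2) σ W ν s X) (ν s)
  parallel : ∀ U ν, IsSection (𝓡 2) W U ν → ∀ s ∈ U, ∀ X : TangentSpace (𝓡 2) s,
    covOn (𝓡 2) σ W (fun t => J t (ν t)) s X = J s (covOn (𝓡 2) σ W ν s X)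
  frame : ∀ φ D, IsHolParam σ J₁ φ D → ∀ w₀ ∈ D, ∃ D' ⊆ D, IsOpen D' ∧ w₀ ∈ D' ∧
    ∃ ℓ, IsHolSection σ W J φ D' ℓ ∧ ∀ w ∈ D', ℓ w ≠ 0

/-- `β` is a holomorphic `(1,0)`-form on `(S, J₁)` with values in `Hom_ℂ((W, J), (W', J'))`. -/
structure IsHolOneForm {n : ℕ} (σ : S → Hyp n) (J₁ : S → PEnd n →ₗ[ℝ] PEnd n)
    (W : S → Submodule ℝ (PEnd n)) (J : S → PEnd n →ₗ[ℝ] PEnd n)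
    (W' : S → Submodule ℝ (PEnd n)) (J' : S → PEnd n →ₗ[ℝ] PEnd n)
    (β : (s : S) → TangentSpace (𝓡 2) s → PEnd n → PEnd n) : Prop where
  mem : ∀ s X, ∀ ξ ∈ W s, β s X ξ ∈ W' s
  complexLinear : ∀ s X, ∀ ξ ∈ W s, β s X (J s ξ) = J' s (β s X ξ)
  oneZero : ∀ s X Y, dmap (𝓡 2) σ s Y = J₁ s (dmap (𝓡 2) σ s X) →
    ∀ ξ ∈ W s, β s Y ξ = J' s (β s X ξ)
  holomorphic : ∀ φ D, IsHolParam σ J₁ φ D → ∀ ℓ, IsHolSection σ W J φ D ℓ →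
    IsHolSection σ W' J' φ D (fun w => β (φ w) (dx φ w) (ℓ w))

/-- Multiplication by the complex number `c` for the complex structure `J`. -/
noncomputable def cmul {n : ℕ} (J : PEnd n →ₗ[ℝ] PEnd n) (c : ℂ) (ξ : PEnd n) : PEnd n :=
  c.re • ξ + c.im • J ξ

/-- The Hermitian metric, as a squared norm: `𝒉(ξ) = |g(ξ, ξ)| / 2`. (The metric of `W` is the one
induced by `W → W^{1,0}`, `ξ ↦ (ξ - i J ξ)/2`; on `TS` the first fundamental form is `2 Re 𝒉`.) -/
noncomputable def herm {n : ℕ} (p : Hyp n) (ξ : PEnd n) : ℝ := |gmet p ξ ξ| / 2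

/-- `∂²_{z z̄} u = (u_xx + u_yy) / 4`. -/
noncomputable def ddbar (u : ℂ → ℝ) (w : ℂ) : ℝ :=
  (fderiv ℝ (fun w' => fderiv ℝ u w' 1) w 1 +
    fderiv ℝ (fun w' => fderiv ℝ u w' Complex.I) w Complex.I) / 4

/-- The Toda-type system for positive functions `h_1, …, h_m` and functions
`f_2, …, f_{m+1}` on `D`. -/
structure IsTodaSolution (m : ℕ) (D : Set ℂ) (h : ℕ → ℂ → ℝ) (f : ℕ → ℂ → ℂ) : Prop where
  eq_last : ∀ w ∈ D, ddbar (fun w => Real.log (h m w)) w - ‖f m w‖ ^ 2 * h m w * (h (m - 1) w)⁻¹ +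
    ‖f (m + 1) w‖ ^ 2 * ((h m w) ^ 2)⁻¹ = 0
  eq_mid : ∀ j, 2 ≤ j → j + 1 ≤ m → ∀ w ∈ D,
    ddbar (fun w => Real.log (h j w)) w - ‖f j w‖ ^ 2 * h j w * (h (j - 1) w)⁻¹ +
      ‖f (j + 1) w‖ ^ 2 * h (j + 1) w * (h j w)⁻¹ = 0
  eq_first : ∀ w ∈ D, ddbar (fun w => Real.log (h 1 w)) w - h 1 w +
    ‖f 2 w‖ ^ 2 * h 2 w * (h 1 w)⁻¹ = 0

end Surfaces

end ParaHyp

open ParaHyp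

-- The inhomogeneous Cauchy–Riemann equation in the plane.

section

open MeasureTheory

-- Everything is moved into one fixed vector space. Tangent vectors are endomorphisms of the
-- para-complex vector space, and `gform` is a constant symmetric form there that restricts to the
-- metric on every tangent space (`gmet_eq_gform`). The bundles of the splitting become families of
-- definite planes in this space, the connection is differentiation followed by orthogonal
-- projection, and `η_{j+1}` is the component in `𝓛_{j+1}` of the derivative of the projection to
-- `𝓛_j`. Torsion and curvature come from differentiating the idempotent `lineProj` (`hor_torsion`,
-- `hor_curvature`). On a parameter domain the outcome is `FrenetData`.
--
-- Because the connection is tridiagonal, the curvature identity splits by components: from `j` to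
-- `j+1` it is the Codazzi equation, from `j` to `j+2` it says that consecutive `η` have zero wedge
-- product, and from `j` to `j` it is the Ricci equation. Symmetry of the second fundamental form
-- together with conformality makes `η_2` of type `(1,0)` (`one_zero_two`). Conformality makes each
-- value `η_{j+1}(X)` linear or antilinear at each point, once the planes are locally oriented. By
-- Codazzi, the linear and the antilinear part both solve first-order elliptic equations `∂₂u = κ
-- ∂₁u + γ u`. Unique continuation (`unique_continuation_ball`) forces one of the two to vanish on a
-- whole disc, and makes `η_{j+1}` nonzero on a dense set unless it vanishes identically. Hence the
-- orientation of `𝓛_j` induces one of `𝓛_{j+1}`, the local choices agree by density, and the wedge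
-- identity passes type `(1,0)` from `η_{j+1}` to `η_{j+2}`. Arbitrary charts suffice: the
-- coefficient `κ` records how far a chart is from being conformal, and a Carleman estimate handles
-- variable `κ`. For the middle form, `𝐏 η_{m+1}` is symmetric on `𝓛_m`; combined with type `(1,0)`
-- this forces it to be antilinear (`middle_antilinear`).
--
-- If some `η_{a+1}` with `1 ≤ a < m` vanished, the sum of `𝓛_1, …, 𝓛_a` and their images under `𝐏`
-- would be parallel. Adding the tautological line gives a constant submodule of the ambient space,
-- orthogonal to the values of `𝓛_m`, so the surface would lie in codimension four (`inCodimFour`).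
-- Uniqueness of the splitting is an induction: where `η_{j+1}` is nonzero its values span
-- `𝓛_{j+1}`, and such points are dense (`splitting_eq`).
--
-- Holomorphic frames come from solving a `∂̄`-equation (`exists_isHolSec`). In such a frame the
-- Laplacian of the logarithm of the norm is the curvature of the line bundle (`ddbar_log`), and the
-- Ricci equation expresses it through the neighbouring `η`. The last equation has the same form as
-- the others once the `𝐏`-image of the metric dual of `ℓ_m` is used as the holomorphic frame of the
-- conjugate bundle (`isHolSec_dual`). The alternating signs of the metric produce the signs of the
-- Toda system.

/-- `∂₁ + i ∂₂` -/
noncomputable def dbarOp (f : ℂ → ℂ) (w : ℂ) : ℂ :=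
  fderiv ℝ f w 1 + Complex.I * fderiv ℝ f w Complex.I

/-- The left side is antilinear in `e`, hence determined by its value at `1`. For `e` on the unit
circle this rewrites `∂₁ + i ∂₂` through radial and angular derivatives. -/
theorem fderiv_exp_add_fderiv_I_mul_exp (L : ℂ →L[ℝ] ℂ) (e : ℂ) :
    L e + Complex.I * L (Complex.I * e) =
      (starRingEnd ℂ) e * (L 1 + Complex.I * L Complex.I) := by
  have h1 : L e = e.re * L 1 + e.im * L Complex.I := by
    conv_lhs => rw [show e = e.re • (1 : ℂ) + e.im • Complex.I by simp [Complex.re_add_im]]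
    rw [map_add, map_smul, map_smul]; simp
  have h2 : L (Complex.I * e) = -e.im * L 1 + e.re * L Complex.I := by
    conv_lhs => rw [show Complex.I * e = (-e.im) • (1 : ℂ) + e.re • Complex.I by
      apply Complex.ext <;> simp]
    rw [map_add, map_smul, map_smul]; simp
  have h3 : (starRingEnd ℂ) e = e.re - e.im * Complex.I := by
    apply Complex.ext <;> simp
  rw [h1, h2, h3]
  linear_combination (e.im * L Complex.I) * Complex.I_mul_I

/-- The Cauchy–Pompeiu formula. In polar coordinates about `x` the Jacobian cancels the kernel,
leaving a radial derivative `F₁` plus `i` times an angular derivative `F₂`. -/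
theorem integral_inv_mul_dbarOp {g : ℂ → ℂ} (hg : ContDiff ℝ ∞ g) (hc : HasCompactSupport g)
    (x : ℂ) : ∫ t : ℂ, t⁻¹ * dbarOp g (x - t) = 2 * Real.pi * g x := by
  set E : ℝ → ℂ := fun θ => Complex.exp (θ * Complex.I) with hE
  have hEc : Continuous E := by fun_prop
  have hEn : ∀ θ, ‖E θ‖ = 1 := fun θ => Complex.norm_exp_ofReal_mul_I θ
  have hE0 : ∀ θ, E θ ≠ 0 := fun θ => Complex.exp_ne_zero _
  have hgd : Differentiable ℝ g := hg.differentiable (by simp)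
  have hfc : Continuous (fderiv ℝ g) := hg.continuous_fderiv (by simp)
  set F₁ : ℝ × ℝ → ℂ := fun p => fderiv ℝ g (x - p.1 * E p.2) (E p.2) with hF₁
  set F₂ : ℝ × ℝ → ℂ := fun p => fderiv ℝ g (x - p.1 * E p.2) (Complex.I * E p.2) with hF₂
  have hF₁c : Continuous F₁ := by fun_prop
  have hF₂c : Continuous F₂ := by fun_prop
  obtain ⟨R, hR⟩ := hc.isCompact.isBounded.subset_closedBall x
  have hz : ∀ p : ℝ × ℝ, max R 0 < p.1 → fderiv ℝ g (x - p.1 * E p.2) = 0 := by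
    intro p hp
    by_contra h
    have h1 : x - p.1 * E p.2 ∈ tsupport g := support_fderiv_subset ℝ h
    have := hR h1
    have hp0 : 0 < p.1 := lt_of_le_of_lt (le_max_right _ _) hp
    rw [Metric.mem_closedBall, dist_eq_norm] at this
    rw [show x - p.1 * E p.2 - x = -(p.1 * E p.2) by ring, norm_neg, norm_mul, hEn,
      Complex.norm_real, Real.norm_eq_abs, abs_of_pos hp0] at this
    have := lt_of_le_of_lt (le_max_left R 0) hp
    linarith
  have hint : ∀ F : ℝ × ℝ → ℂ, Continuous F → (∀ p : ℝ × ℝ, max R 0 < p.1 → F p = 0) →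
      IntegrableOn F (Ioi 0 ×ˢ Ioo (-Real.pi) Real.pi) (volume.prod volume) := by
    intro F hF h0
    have : IntegrableOn F (Icc 0 (max R 0) ×ˢ Icc (-Real.pi) Real.pi) (volume.prod volume) :=
      hF.continuousOn.integrableOn_compact (isCompact_Icc.prod isCompact_Icc)
    refine this.of_forall_sdiff_eq_zero (measurableSet_Ioi.prod measurableSet_Ioo) ?_
    rintro p ⟨⟨h1, h2⟩, h3⟩
    apply h0
    by_contra h
    exact h3 ⟨⟨le_of_lt h1, not_lt.1 h⟩, ⟨le_of_lt h2.1, le_of_lt h2.2⟩⟩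
  have hi₁ := hint F₁ hF₁c fun p hp => by simp [hF₁, hz p hp]
  have hi₂ := hint F₂ hF₂c fun p hp => by simp [hF₂, hz p hp]
  -- On each ray the fundamental theorem of calculus gives `g x`, by compact support; the angle
  -- contributes the factor `2π`.
  have e₁ : ∫ p in Ioi (0:ℝ) ×ˢ Ioo (-Real.pi) Real.pi, F₁ p ∂(volume.prod volume) =
      2 * Real.pi * g x := by
    rw [← setIntegral_prod_swap, setIntegral_prod (fun z => F₁ z.swap) hi₁.swap]
    have : ∀ θ : ℝ, ∫ r in Ioi (0:ℝ), F₁ (r, θ) = g x := by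
      intro θ
      have hcd : ContDiff ℝ 1 (fun r : ℝ => g (x - r * E θ)) := by
        have : ContDiff ℝ 1 (fun r : ℝ => x - (r : ℂ) * E θ) := by
          have := Complex.ofRealCLM.contDiff (n := 1)
          exact contDiff_const.sub (this.mul contDiff_const)
        exact (hg.of_le (by simp)).comp this
      have hder : ∀ r : ℝ, HasDerivAt (fun r : ℝ => g (x - r * E θ)) (-F₁ (r, θ)) r := by
        intro r
        have h1 : HasDerivAt (fun r : ℝ => x - (r : ℂ) * E θ) (-(E θ)) r := by
          have := (Complex.ofRealCLM.hasDerivAt (x := r)).mul_const (E θ)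
          simpa using this.const_sub x
        have := (hgd (x - r * E θ)).hasFDerivAt.comp_hasDerivAt r h1
        rw [map_neg] at this
        exact this
      have hcs : HasCompactSupport (fun r : ℝ => g (x - r * E θ)) := by
        refine HasCompactSupport.of_support_subset_isCompact
          (isCompact_Icc (a := -max R 0) (b := max R 0)) ?_
        intro r hr
        have := hR (subset_tsupport g hr)
        rw [Metric.mem_closedBall, dist_eq_norm,
          show x - r * E θ - x = -(r * E θ) by ring, norm_neg, norm_mul, hEn,
          Complex.norm_real, mul_one, Real.norm_eq_abs] at this
        exact abs_le.1 (this.trans (le_max_left _ _))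
      have h3 := hcs.integral_Ioi_deriv_eq hcd 0
      have h4 : deriv (fun r : ℝ => g (x - r * E θ)) = fun r => -F₁ (r, θ) :=
        funext fun r => (hder r).deriv
      rw [h4, integral_neg] at h3
      simpa using h3
    simp only [Prod.swap_prod_mk, this]
    rw [setIntegral_const]
    simp only [Real.volume_real_Ioo, Complex.real_smul]
    rw [max_eq_left (by linarith [Real.pi_pos])]
    push_cast; ring
  -- On each circle `-r F₂` is the derivative of a periodic function of the angle.
  have e₂ : ∫ p in Ioi (0:ℝ) ×ˢ Ioo (-Real.pi) Real.pi, F₂ p ∂(volume.prod volume) = 0 := by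
    rw [setIntegral_prod _ hi₂]
    refine setIntegral_eq_zero_of_forall_eq_zero fun r hr => ?_
    have hder : ∀ θ : ℝ, HasDerivAt (fun θ : ℝ => g (x - r * E θ)) (-(r * F₂ (r, θ))) θ := by
      intro θ
      have h1 : HasDerivAt (fun θ : ℝ => x - (r : ℂ) * E θ) (-(r • (Complex.I * E θ))) θ := by
        have h0 : HasDerivAt E (Complex.I * E θ) θ := by
          have := ((Complex.ofRealCLM.hasDerivAt (x := θ)).mul_const Complex.I).cexp
          simpa [hE, mul_comm] using this
        simpa using (h0.const_mul (r : ℂ)).const_sub x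
      have := (hgd (x - r * E θ)).hasFDerivAt.comp_hasDerivAt θ h1
      rw [map_neg, map_smul, Complex.real_smul] at this
      exact this
    have h5 := intervalIntegral.integral_eq_sub_of_hasDerivAt (a := -Real.pi) (b := Real.pi)
      (fun θ _ => hder θ) (by
        apply Continuous.intervalIntegrable
        fun_prop)
    have h6 : E Real.pi = E (-Real.pi) := by
      simp [hE, Complex.exp_neg, Complex.exp_pi_mul_I]
    rw [h6, sub_self, intervalIntegral.integral_neg, neg_eq_zero,
      intervalIntegral.integral_const_mul, mul_eq_zero] at h5
    rcases h5 with h5 | h5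
    · exact absurd h5 (by exact_mod_cast ne_of_gt hr)
    · rwa [intervalIntegral.integral_of_le (by linarith [Real.pi_pos]),
        integral_Ioc_eq_integral_Ioo] at h5
  rw [← Complex.integral_comp_polarCoord_symm, polarCoord_target]
  have e₃ : ∀ p ∈ Ioi (0:ℝ) ×ˢ Ioo (-Real.pi) Real.pi,
      p.1 • ((Complex.polarCoord.symm p)⁻¹ * dbarOp g (x - Complex.polarCoord.symm p)) =
        F₁ p + Complex.I * F₂ p := by
    intro p hp
    have hp0 : (p.1 : ℂ) ≠ 0 := by exact_mod_cast ne_of_gt hp.1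
    have : Complex.polarCoord.symm p = p.1 * E p.2 := by
      rw [Complex.polarCoord_symm_apply, hE]
      simp only [Complex.exp_mul_I]
      push_cast; ring
    rw [this, hF₁, hF₂]
    simp only []
    rw [fderiv_exp_add_fderiv_I_mul_exp, Complex.real_smul, dbarOp,
      ← Complex.inv_eq_conj (hEn _)]
    field_simp
  rw [setIntegral_congr_fun (measurableSet_Ioi.prod measurableSet_Ioo) e₃]
  rw [Measure.volume_eq_prod, integral_add hi₁ (hi₂.const_mul _), integral_const_mul, e₁, e₂]
  simp

/-- Convolution with the fundamental solution `1/(2πt)`: derivatives fall on the smooth factor `g`,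
and Cauchy–Pompeiu evaluates the result. -/
theorem exists_dbarOp_eq {g : ℂ → ℂ} (hg : ContDiff ℝ ∞ g) (hc : HasCompactSupport g) :
    ∃ f : ℂ → ℂ, ContDiff ℝ ∞ f ∧ ∀ x, dbarOp f x = g x := by
  set k : ℂ → ℂ := fun t => (2 * Real.pi : ℂ)⁻¹ * t⁻¹ with hk
  have hkl : LocallyIntegrable k := by
    -- A singularity of order `1` is locally integrable because the real dimension is `2`.
    refine locallyIntegrable_of_norm_le_rpow (C := (2 * Real.pi)⁻¹) (α := 1) (by simp) (by simp) ?_ ?_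
    · refine Filter.Eventually.of_forall fun t => ?_
      rw [hk, norm_mul, norm_inv, norm_inv, Real.rpow_neg_one]
      simp [abs_of_pos Real.pi_pos]
    · apply Measurable.aestronglyMeasurable
      fun_prop
  refine ⟨convolution k g (ContinuousLinearMap.mul ℝ ℂ) volume,
    hc.contDiff_convolution_right _ hkl hg, fun x => ?_⟩
  have h1 := hc.hasFDerivAt_convolution_right (ContinuousLinearMap.mul ℝ ℂ) hkl
    (hg.of_le (by simp)) x
  have hfc : Continuous (fderiv ℝ g) := hg.continuous_fderiv (by simp)
  have hex : ∀ v : ℂ, fderiv ℝ (convolution k g (ContinuousLinearMap.mul ℝ ℂ) volume) x v =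
      ∫ t, k t * fderiv ℝ g (x - t) v := by
    intro v
    rw [h1.fderiv, convolution, ContinuousLinearMap.integral_apply]
    · rfl
    · exact (hc.fderiv ℝ).convolutionExists_right _ hkl hfc x
  have hint : ∀ v : ℂ, Integrable (fun t => k t * fderiv ℝ g (x - t) v) := by
    intro v
    exact ((hc.fderiv_apply ℝ v).convolutionExists_right (ContinuousLinearMap.mul ℝ ℂ) hkl
      (by fun_prop) x)
  rw [dbarOp, hex, hex, ← integral_const_mul, ← integral_add (hint _) ((hint _).const_mul _)]
  have : ∀ t, k t * fderiv ℝ g (x - t) 1 + Complex.I * (k t * fderiv ℝ g (x - t) Complex.I) =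
      (2 * Real.pi : ℂ)⁻¹ * (t⁻¹ * dbarOp g (x - t)) := by
    intro t; rw [hk, dbarOp]; ring
  simp_rw [this]
  rw [integral_const_mul, integral_inv_mul_dbarOp hg hc, ← mul_assoc, inv_mul_cancel₀, one_mul]
  exact mul_ne_zero two_ne_zero (by exact_mod_cast Real.pi_ne_zero)

theorem exists_local_dbarOp_eq {g : ℂ → ℂ} {U : Set ℂ} (hU : IsOpen U)
    (hg : ContDiffOn ℝ ∞ g U) {w₀ : ℂ} (hw : w₀ ∈ U) :
    ∃ r > 0, Metric.ball w₀ r ⊆ U ∧ ∃ f : ℂ → ℂ, ContDiff ℝ ∞ f ∧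
      ∀ w ∈ Metric.ball w₀ r, dbarOp f w = g w := by
  obtain ⟨r, hr, hrU⟩ := Metric.nhds_basis_closedBall.mem_iff.1 (hU.mem_nhds hw)
  let χ : ContDiffBump w₀ := ⟨r / 2, r, by positivity, by linarith⟩
  have hs : tsupport χ ⊆ U := by rw [χ.tsupport_eq]; exact hrU
  have h1 : ContDiff ℝ ∞ (fun w => χ w • g w) := by
    rw [contDiff_iff_contDiffAt]
    intro w
    by_cases hwU : w ∈ U
    · exact χ.contDiff.contDiffAt.smul (hg.contDiffAt (hU.mem_nhds hwU))
    · have : (fun w => χ w • g w) =ᶠ[𝓝 w] fun _ => 0 := by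
        filter_upwards [(isClosed_tsupport χ).isOpen_compl.mem_nhds (fun h => hwU (hs h))] with y hy
        rw [image_eq_zero_of_notMem_tsupport hy, zero_smul]
      exact contDiffAt_const.congr_of_eventuallyEq this
  obtain ⟨f, hf, hf'⟩ := exists_dbarOp_eq h1 (χ.hasCompactSupport.smul_right)
  refine ⟨r / 2, by positivity,
    (Metric.ball_subset_closedBall.trans (Metric.closedBall_subset_closedBall (by linarith))).trans hrU, f, hf, fun w hw' => ?_⟩
  rw [hf', χ.one_of_mem_closedBall (Metric.ball_subset_closedBall hw'), one_smul]

end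

-- Smooth cut-offs and the Carleman inequality for first-order operators in the plane.

section

open MeasureTheory

theorem ContDiffBump.contDiff_smul_of_contDiffOn {F : Type*} [NormedAddCommGroup F]
    [NormedSpace ℝ F] {c : ℂ} (χ : ContDiffBump c) {g : ℂ → F} {U : Set ℂ} (hU : IsOpen U)
    (hχ : Metric.closedBall c χ.rOut ⊆ U) (hg : ContDiffOn ℝ ∞ g U) :
    ContDiff ℝ ∞ (fun w => χ w • g w) := by
  have hs : tsupport χ ⊆ U := by rw [χ.tsupport_eq]; exact hχ
  rw [contDiff_iff_contDiffAt]
  intro w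
  by_cases hwU : w ∈ U
  · exact χ.contDiff.contDiffAt.smul (hg.contDiffAt (hU.mem_nhds hwU))
  · have : (fun w => χ w • g w) =ᶠ[𝓝 w] fun _ => 0 := by
      filter_upwards [(isClosed_tsupport χ).isOpen_compl.mem_nhds (fun h => hwU (hs h))] with y hy
      rw [image_eq_zero_of_notMem_tsupport hy, zero_smul]
    exact contDiffAt_const.congr_of_eventuallyEq this

theorem exists_contDiff_eqOn_closedBall {F : Type*} [NormedAddCommGroup F] [NormedSpace ℝ F]
    {q : ℂ} {R R' : ℝ} (hR : 0 < R) (hRR' : R < R') {g : ℂ → F}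
    (hg : ContDiffOn ℝ ∞ g (Metric.ball q R')) :
    ∃ h : ℂ → F, ContDiff ℝ ∞ h ∧ EqOn h g (Metric.closedBall q R) := by
  let χ : ContDiffBump q := ⟨R, (R + R') / 2, hR, by linarith⟩
  refine ⟨_, χ.contDiff_smul_of_contDiffOn Metric.isOpen_ball
    (Metric.closedBall_subset_ball (show (R + R') / 2 < R' by linarith)) hg, fun w hw => ?_⟩
  simp only [χ.one_of_mem_closedBall hw, one_smul]

/-- A Jacobian determinant is a null Lagrangian: integrate by parts and use the symmetry of the
second derivative of `f`. -/
theorem integral_fderiv_mul_fderiv_swap {f g : ℂ → ℝ} (hf : ContDiff ℝ 2 f) (hg : ContDiff ℝ 2 g)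
    (hgc : HasCompactSupport g) (v v' : ℂ) :
    ∫ z, fderiv ℝ f z v * fderiv ℝ g z v' = ∫ z, fderiv ℝ f z v' * fderiv ℝ g z v := by
  have key : ∀ a b : ℂ, ∫ z, fderiv ℝ f z a * fderiv ℝ g z b =
      - ∫ z, fderiv ℝ (fun y => fderiv ℝ f y a) z b * g z := by
    intro a b
    have h1 : ContDiff ℝ 1 (fun y => fderiv ℝ f y a) :=
      (hf.fderiv_right (m := 1) (by norm_num)).clm_apply contDiff_const
    have c1 : Continuous (fun y => fderiv ℝ g y b) :=
      (hg.continuous_fderiv (by simp)).clm_apply continuous_const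
    have c2 : Continuous (fun z => fderiv ℝ (fun y => fderiv ℝ f y a) z b) :=
      (h1.continuous_fderiv (by simp)).clm_apply continuous_const
    apply integral_mul_fderiv_eq_neg_fderiv_mul_of_integrable
    · exact (c2.mul hg.continuous).integrable_of_hasCompactSupport hgc.mul_left
    · exact (h1.continuous.mul c1).integrable_of_hasCompactSupport (hgc.fderiv_apply ℝ b).mul_left
    · exact (h1.continuous.mul hg.continuous).integrable_of_hasCompactSupport hgc.mul_left
    · exact fun z _ => h1.differentiable (by simp) z
    · exact fun z _ => hg.differentiable (by simp) z
  rw [key, key]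
  congr 2
  ext z
  congr 1
  have hs : IsSymmSndFDerivAt ℝ f z := (hf.contDiffAt).isSymmSndFDerivAt (by simp)
  have hd : DifferentiableAt ℝ (fderiv ℝ f) z :=
    (hf.fderiv_right (m := 1) (by norm_num)).differentiable (by simp) z
  rw [fderiv_clm_apply hd (by fun_prop), fderiv_clm_apply hd (by fun_prop)]
  simpa using hs v' v

/-- A Carleman identity for `X + i Y`, `X = a ∂₂ + b ∂₁`, `Y = c ∂₁` with `a c` constant. -/
theorem carleman_inequality {a b c φ f g : ℂ → ℝ} (ha : ContDiff ℝ ∞ a) (hb : ContDiff ℝ ∞ b)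
    (hc : ContDiff ℝ ∞ c) (hφ : ContDiff ℝ ∞ φ) (hf : ContDiff ℝ ∞ f) (hg : ContDiff ℝ ∞ g)
    (hfc : HasCompactSupport f) (hgc : HasCompactSupport g) {δ : ℝ}
    (hδ : ∀ z ∈ tsupport f, a z * c z = δ) {τ : ℝ} (X Y : (ℂ → ℝ) → ℂ → ℝ)
    (hX : ∀ h z, X h z = a z * fderiv ℝ h z Complex.I + b z * fderiv ℝ h z 1)
    (hY : ∀ h z, Y h z = c z * fderiv ℝ h z 1) :
    τ * ∫ z, (fderiv ℝ (fun z => b z * X φ z + c z * Y φ z) z 1 +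
        fderiv ℝ (fun z => a z * X φ z) z Complex.I) * (f z ^ 2 + g z ^ 2) ≤
      ∫ z, ((X f z - τ * X φ z * f z - (Y g z - τ * Y φ z * g z)) ^ 2 +
        (X g z - τ * X φ z * g z + (Y f z - τ * Y φ z * f z)) ^ 2) := by
  have dc : ∀ {h : ℂ → ℝ}, ContDiff ℝ ∞ h → ∀ v, ContDiff ℝ ∞ (fun z => fderiv ℝ h z v) :=
    fun hh v => (hh.fderiv_right (m := ∞) (by simp)).clm_apply contDiff_const
  have hXs : ∀ {h : ℂ → ℝ}, ContDiff ℝ ∞ h → ContDiff ℝ ∞ (X h) := fun {h} hh => by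
    rw [show X h = _ from funext (hX h)]
    exact (ha.mul (dc hh _)).add (hb.mul (dc hh _))
  have hYs : ∀ {h : ℂ → ℝ}, ContDiff ℝ ∞ h → ContDiff ℝ ∞ (Y h) := fun {h} hh => by
    rw [show Y h = _ from funext (hY h)]
    exact hc.mul (dc hh _)
  set V₁ : ℂ → ℝ := fun z => b z * X φ z + c z * Y φ z with hV₁
  set V₂ : ℂ → ℝ := fun z => a z * X φ z with hV₂
  set N : ℂ → ℝ := fun z => f z ^ 2 + g z ^ 2 with hN
  have hV₁s : ContDiff ℝ ∞ V₁ := (hb.mul (hXs hφ)).add (hc.mul (hYs hφ))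
  have hV₂s : ContDiff ℝ ∞ V₂ := ha.mul (hXs hφ)
  have hNs : ContDiff ℝ ∞ N := (hf.pow 2).add (hg.pow 2)
  have hNc : HasCompactSupport N := by
    refine HasCompactSupport.of_support_subset_isCompact (hfc.isCompact.union hgc.isCompact) ?_
    intro z hz
    by_contra h
    rw [mem_union, not_or] at h
    apply hz
    simp [hN, image_eq_zero_of_notMem_tsupport h.1, image_eq_zero_of_notMem_tsupport h.2]
  have parts : ∀ {V : ℂ → ℝ}, ContDiff ℝ ∞ V → ∀ v, Integrable (fun z => V z * fderiv ℝ N z v) ∧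
      Integrable (fun z => fderiv ℝ V z v * N z) ∧
      ∫ z, V z * fderiv ℝ N z v = - ∫ z, fderiv ℝ V z v * N z := by
    intro V hV v
    have i1 : Integrable (fun z => V z * fderiv ℝ N z v) :=
      (hV.continuous.mul (dc hNs v).continuous).integrable_of_hasCompactSupport
        (hNc.fderiv_apply ℝ v).mul_left
    have i2 : Integrable (fun z => fderiv ℝ V z v * N z) :=
      ((dc hV v).continuous.mul hNs.continuous).integrable_of_hasCompactSupport hNc.mul_left
    refine ⟨i1, i2, integral_mul_fderiv_eq_neg_fderiv_mul_of_integrable i2 i1 ?_ ?_ ?_⟩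
    · exact (hV.continuous.mul hNs.continuous).integrable_of_hasCompactSupport hNc.mul_left
    · exact fun z _ => hV.differentiable (by simp) z
    · exact fun z _ => hNs.differentiable (by simp) z
  obtain ⟨p1, p2, p3⟩ := parts hV₁s 1
  obtain ⟨q1, q2, q3⟩ := parts hV₂s Complex.I
  have n1 : Integrable (fun z => fderiv ℝ f z 1 * fderiv ℝ g z Complex.I) :=
    ((dc hf _).continuous.mul (dc hg _).continuous).integrable_of_hasCompactSupport
      (hgc.fderiv_apply ℝ _).mul_left
  have n2 : Integrable (fun z => fderiv ℝ f z Complex.I * fderiv ℝ g z 1) :=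
    ((dc hf _).continuous.mul (dc hg _).continuous).integrable_of_hasCompactSupport
      (hgc.fderiv_apply ℝ _).mul_left
  have n3 := integral_fderiv_mul_fderiv_swap (hf.of_le (by norm_cast)) (hg.of_le (by norm_cast)) hgc 1 Complex.I
  -- The Jacobian of `(f, g)` integrates to zero because its coefficient is constant; the remaining
  -- term becomes a divergence against `N` by parts.
  have e1 : τ * ∫ z, (fderiv ℝ V₁ z 1 + fderiv ℝ V₂ z Complex.I) * N z =
      ∫ z, (2 * δ * (fderiv ℝ f z 1 * fderiv ℝ g z Complex.I - fderiv ℝ f z Complex.I * fderiv ℝ g z 1)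
        - τ * (V₁ z * fderiv ℝ N z 1 + V₂ z * fderiv ℝ N z Complex.I)) := by
    rw [integral_sub, integral_const_mul, integral_const_mul, integral_sub n1 n2, n3, sub_self,
      integral_add p1 q1, p3, q3]
    · simp_rw [add_mul]
      rw [integral_add p2 q2]; ring
    · exact (n1.sub n2).const_mul _
    · exact (p1.add q1).const_mul _
  rw [e1]
  -- Expanding the squares leaves the Jacobian and the transport term of `e1`, plus a sum of four
  -- squares that may be dropped.
  have pointwise : ∀ z, (X f z - τ * X φ z * f z - (Y g z - τ * Y φ z * g z)) ^ 2 +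
        (X g z - τ * X φ z * g z + (Y f z - τ * Y φ z * f z)) ^ 2 =
      (2 * δ * (fderiv ℝ f z 1 * fderiv ℝ g z Complex.I - fderiv ℝ f z Complex.I * fderiv ℝ g z 1)
        - τ * (V₁ z * fderiv ℝ N z 1 + V₂ z * fderiv ℝ N z Complex.I)) +
      ((X f z + τ * Y φ z * g z) ^ 2 + (X g z - τ * Y φ z * f z) ^ 2 +
        (Y f z - τ * X φ z * g z) ^ 2 + (Y g z + τ * X φ z * f z) ^ 2) := by
    intro z
    have hNd : ∀ v, fderiv ℝ N z v = 2 * f z * fderiv ℝ f z v + 2 * g z * fderiv ℝ g z v := by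
      intro v
      have hfd := (hf.differentiable (by simp) z)
      have hgd := (hg.differentiable (by simp) z)
      rw [hN, fderiv_fun_add (hfd.fun_pow 2) (hgd.fun_pow 2), fderiv_fun_pow 2 hfd, fderiv_fun_pow 2 hgd]
      simp
    -- The product `a c` is known only on the support of `f`; elsewhere the derivative of `f`
    -- vanishes.
    have hδ' : (a z * c z - δ) * (fderiv ℝ f z 1 * fderiv ℝ g z Complex.I - fderiv ℝ f z Complex.I * fderiv ℝ g z 1) = 0 := by
      by_cases hz : z ∈ tsupport f
      · rw [hδ z hz, sub_self, zero_mul]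
      · have : fderiv ℝ f z = 0 := by
          by_contra h
          exact hz (support_fderiv_subset ℝ h)
        simp [this]
    simp only [hNd, hV₁, hV₂]
    rw [hX f, hX g, hY f, hY g]
    linear_combination 2 * hδ'
  simp_rw [pointwise]
  have iA : Integrable (fun z => 2 * δ * (fderiv ℝ f z 1 * fderiv ℝ g z Complex.I - fderiv ℝ f z Complex.I * fderiv ℝ g z 1)
        - τ * (V₁ z * fderiv ℝ N z 1 + V₂ z * fderiv ℝ N z Complex.I)) :=
    ((n1.sub n2).const_mul _).sub ((p1.add q1).const_mul _)
  have hXYc : ∀ {h : ℂ → ℝ} {z}, z ∉ tsupport h → X h z = 0 ∧ Y h z = 0 ∧ h z = 0 := by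
    intro h z hz
    have : fderiv ℝ h z = 0 := by
      by_contra h'
      exact hz (support_fderiv_subset ℝ h')
    simp [hX, hY, this, image_eq_zero_of_notMem_tsupport hz]
  have iB : Integrable (fun z => (X f z + τ * Y φ z * g z) ^ 2 + (X g z - τ * Y φ z * f z) ^ 2 +
        (Y f z - τ * X φ z * g z) ^ 2 + (Y g z + τ * X φ z * f z) ^ 2) := by
    have := (hXs hf).continuous
    have := (hXs hg).continuous
    have := (hXs hφ).continuous
    have := (hYs hf).continuous
    have := (hYs hg).continuous
    have := (hYs hφ).continuous
    have := hf.continuous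
    have := hg.continuous
    refine Continuous.integrable_of_hasCompactSupport (by fun_prop) ?_
    refine HasCompactSupport.of_support_subset_isCompact (hfc.isCompact.union hgc.isCompact) ?_
    intro z hz
    by_contra h
    rw [mem_union, not_or] at h
    obtain ⟨h1, h2, h3⟩ := hXYc h.1
    obtain ⟨k1, k2, k3⟩ := hXYc h.2
    apply hz
    simp [h1, h2, h3, k1, k2, k3]
  rw [integral_add iA iB]
  refine le_add_of_nonneg_right (integral_nonneg fun z => ?_)
  simp only [Pi.zero_apply]
  positivity

end

-- A radial Carleman weight.

section

open MeasureTheory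

/-- The weight is `exp(-λ |z - q|²)`. In the divergence, the square of the gradient of the exponent
enters with `λ²` and every other term with `λ`, so a large `λ` makes it positive. The disc of radius
`ε` is excluded because that gradient vanishes at `q`. -/
theorem exists_carleman_weight {a b c : ℂ → ℝ} (ha : ContDiff ℝ ∞ a) (hb : ContDiff ℝ ∞ b)
    (hc : ContDiff ℝ ∞ c) {q : ℂ} {ε R : ℝ} (hε : 0 < ε)
    (hac : ∀ z ∈ Metric.closedBall q R, a z * c z ≠ 0) (X Y : (ℂ → ℝ) → ℂ → ℝ)
    (hX : ∀ h z, X h z = a z * fderiv ℝ h z Complex.I + b z * fderiv ℝ h z 1)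
    (hY : ∀ h z, Y h z = c z * fderiv ℝ h z 1) :
    ∃ φ : ℂ → ℝ, ContDiff ℝ ∞ φ ∧ (∀ z w, ‖z - q‖ < ‖w - q‖ → φ w < φ z) ∧
      ∃ μ > 0, ∀ z ∈ Metric.closedBall q R, z ∉ Metric.ball q ε →
        μ ≤ fderiv ℝ (fun z => b z * X φ z + c z * Y φ z) z 1 +
          fderiv ℝ (fun z => a z * X φ z) z Complex.I := by
  set ρ : ℂ → ℝ := fun z => ‖z - q‖ ^ 2 with hρ
  have hρs : ContDiff ℝ ∞ ρ := (contDiff_id.sub contDiff_const).norm_sq ℝ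
  have hρd : ∀ z v, fderiv ℝ ρ z v = 2 * inner ℝ (z - q) v := by
    intro z v
    have := ((hasFDerivAt_id (𝕜 := ℝ) z).sub_const q).norm_sq
    have h' : fderiv ℝ ρ z = _ := this.fderiv
    rw [h']
    simp
    ring
  have dc : ∀ {h : ℂ → ℝ}, ContDiff ℝ ∞ h → ∀ v, ContDiff ℝ ∞ (fun z => fderiv ℝ h z v) :=
    fun hh v => (hh.fderiv_right (m := ∞) (by simp)).clm_apply contDiff_const
  have hXs : ∀ {h : ℂ → ℝ}, ContDiff ℝ ∞ h → ContDiff ℝ ∞ (X h) := fun {h} hh => by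
    rw [show X h = _ from funext (hX h)]
    exact (ha.mul (dc hh _)).add (hb.mul (dc hh _))
  have hYs : ∀ {h : ℂ → ℝ}, ContDiff ℝ ∞ h → ContDiff ℝ ∞ (Y h) := fun {h} hh => by
    rw [show Y h = _ from funext (hY h)]
    exact hc.mul (dc hh _)
  set W₁ : ℂ → ℝ := fun z => b z * X ρ z + c z * Y ρ z with hW₁
  set W₂ : ℂ → ℝ := fun z => a z * X ρ z with hW₂
  have hW₁s : ContDiff ℝ ∞ W₁ := (hb.mul (hXs hρs)).add (hc.mul (hYs hρs))
  have hW₂s : ContDiff ℝ ∞ W₂ := ha.mul (hXs hρs)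
  set K := Metric.closedBall q R \ Metric.ball q ε with hK
  have hKc : IsCompact K := (isCompact_closedBall q R).diff Metric.isOpen_ball
  -- Since `a c ≠ 0` the fields `X` and `Y` are independent, so both can kill `ρ` only at its
  -- critical point `q`.
  have hpos : ∀ z ∈ K, 0 < X ρ z ^ 2 + Y ρ z ^ 2 := by
    intro z hz
    by_contra h
    have h1 : X ρ z = 0 := by nlinarith [sq_nonneg (X ρ z), sq_nonneg (Y ρ z)]
    have h2 : Y ρ z = 0 := by nlinarith [sq_nonneg (X ρ z), sq_nonneg (Y ρ z)]
    have h3 := hac z hz.1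
    rw [hY, mul_eq_zero_iff_left (right_ne_zero_of_mul h3)] at h2
    rw [hX, h2, mul_zero, add_zero, mul_eq_zero_iff_left (left_ne_zero_of_mul h3)] at h1
    rw [hρd] at h1 h2
    simp [Complex.inner] at h1 h2
    apply hz.2
    rw [Metric.mem_ball, dist_eq_norm, show z - q = 0 from Complex.ext (by simp; linarith) (by simp; linarith)]
    simpa using hε
  have hcX := (hXs hρs).continuous
  have hcY := (hYs hρs).continuous
  obtain ⟨c₀, hc₀, hc₀'⟩ : ∃ c₀ > 0, ∀ z ∈ K, c₀ ≤ X ρ z ^ 2 + Y ρ z ^ 2 := by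
    rcases K.eq_empty_or_nonempty with h | h
    · exact ⟨1, one_pos, by simp [h]⟩
    · obtain ⟨z, hz, hz'⟩ := hKc.exists_isMinOn h
        (f := fun z => X ρ z ^ 2 + Y ρ z ^ 2) (by fun_prop)
      exact ⟨_, hpos z hz, fun w hw => hz' hw⟩
  have hcd1 := (dc hW₁s 1).continuous
  have hcd2 := (dc hW₂s Complex.I).continuous
  obtain ⟨C, hC⟩ := hKc.exists_bound_of_continuousOn
    (f := fun z => fderiv ℝ W₁ z 1 + fderiv ℝ W₂ z Complex.I) (by fun_prop)
  -- Chosen so that `λ c₀` exceeds the bound for the lower-order divergence by `1`.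
  set lam : ℝ := (|C| + 1) / c₀ with hlam
  have hl : 0 < lam := by positivity
  set φ : ℂ → ℝ := fun z => Real.exp (-lam * ρ z) with hφ
  have hφs : ContDiff ℝ ∞ φ := (contDiff_const.mul hρs).exp
  have hφd : ∀ z v, fderiv ℝ φ z v = - lam * φ z * fderiv ℝ ρ z v := by
    intro z v
    have := ((hρs.differentiable (by simp) z).hasFDerivAt.const_mul (-lam)).exp
    rw [this.fderiv]
    simp [hφ]; ring
  have hVX : (fun z => b z * X φ z + c z * Y φ z) = fun z => φ z * (-lam * W₁ z) := by
    ext z; simp only [hX, hY, hφd, hW₁]; ring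
  have hVY : (fun z => a z * X φ z) = fun z => φ z * (-lam * W₂ z) := by
    ext z; simp only [hX, hφd, hW₂]; ring
  refine ⟨φ, hφs, fun z w h => ?_, lam * Real.exp (-lam * R ^ 2), by positivity, fun z hz hz' => ?_⟩
  · simp only [hφ, hρ, Real.exp_lt_exp]
    have : ‖z - q‖ ^ 2 < ‖w - q‖ ^ 2 := by gcongr
    nlinarith
  · have hd := hφs.differentiable (by simp) z
    have hd1 := hW₁s.differentiable (by simp) z
    have hd2 := hW₂s.differentiable (by simp) z
    rw [hVX, hVY, fderiv_fun_mul hd (hd1.const_mul _), fderiv_fun_mul hd (hd2.const_mul _),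
      fderiv_const_mul hd1, fderiv_const_mul hd2]
    simp only [add_apply, smul_apply, smul_eq_mul, hφd]
    have e : W₁ z * fderiv ℝ ρ z 1 + W₂ z * fderiv ℝ ρ z Complex.I = X ρ z ^ 2 + Y ρ z ^ 2 := by
      simp only [hW₁, hW₂, hX, hY]; ring
    have h1 := hc₀' z ⟨hz, hz'⟩
    have h2 := hC z ⟨hz, hz'⟩
    rw [Real.norm_eq_abs] at h2
    have h3 : lam * c₀ = |C| + 1 := by rw [hlam]; field_simp
    have h4 : Real.exp (-lam * R ^ 2) ≤ φ z := by
      simp only [hφ, hρ, Real.exp_le_exp]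
      rw [Metric.mem_closedBall, dist_eq_norm] at hz
      have : ‖z - q‖ ^ 2 ≤ R ^ 2 := by gcongr
      nlinarith
    have h5 : 0 < φ z := Real.exp_pos _
    calc lam * Real.exp (-lam * R ^ 2) ≤ lam * φ z := by gcongr
      _ ≤ lam * φ z * (lam * (X ρ z ^ 2 + Y ρ z ^ 2) - (fderiv ℝ W₁ z 1 + fderiv ℝ W₂ z Complex.I)) := by
        have h6 : fderiv ℝ W₁ z 1 + fderiv ℝ W₂ z Complex.I ≤ |C| :=
          (le_abs_self _).trans (h2.trans (le_abs_self _))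
        have h7 : lam * c₀ ≤ lam * (X ρ z ^ 2 + Y ρ z ^ 2) := by gcongr
        exact le_mul_of_one_le_right (by positivity) (by linarith)
      _ = _ := by rw [← e]; ring

end

-- Vanishing spreads from a small disc to a larger concentric one.

section

open MeasureTheory

-- The Carleman inequality is applied to `χ e^{Tφ} u` with a cut-off `χ`. Near `q`, where the weight
-- gives no positivity, `u` is zero. The error made by `χ` lives where `|z - q| ≥ 3R/4`, and there
-- `φ` is smaller than on the disc of radius `R/2`. Letting `T` tend to infinity kills the integral
-- of `|u|²` over that disc.
set_option maxHeartbeats 1000000 in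
theorem eq_zero_of_eq_zero_on_ball {a b c : ℂ → ℝ} (ha : ContDiff ℝ ∞ a) (hb : ContDiff ℝ ∞ b)
    (hc : ContDiff ℝ ∞ c) {u : ℂ → ℂ} (hu : ContDiff ℝ ∞ u) {q : ℂ} {ε R δ Γ : ℝ} (hε : 0 < ε)
    (hR : 0 < R) (hδ0 : δ ≠ 0) (hδ : ∀ z ∈ Metric.closedBall q R, a z * c z = δ)
    (hΓ : ∀ z ∈ Metric.closedBall q R,
      ‖a z * fderiv ℝ u z Complex.I + b z * fderiv ℝ u z 1 + Complex.I * (c z * fderiv ℝ u z 1)‖ ≤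
        Γ * ‖u z‖) (h0 : ∀ z ∈ Metric.ball q ε, u z = 0) :
    ∀ z ∈ Metric.ball q (R / 2), u z = 0 := by
  obtain ⟨X, hX⟩ : ∃ X : (ℂ → ℝ) → ℂ → ℝ, ∀ h z,
    X h z = a z * fderiv ℝ h z Complex.I + b z * fderiv ℝ h z 1 := ⟨_, fun _ _ => rfl⟩
  obtain ⟨Y, hY⟩ : ∃ Y : (ℂ → ℝ) → ℂ → ℝ, ∀ h z, Y h z = c z * fderiv ℝ h z 1 :=
    ⟨_, fun _ _ => rfl⟩
  obtain ⟨φ, hφ, hmono, μ, hμ, hφμ⟩ := exists_carleman_weight ha hb hc hε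
    (fun z hz => by rw [hδ z hz]; exact hδ0) X Y hX hY
  let χ : ContDiffBump q := ⟨3 * R / 4, R, by positivity, by linarith⟩
  have hχs : ContDiff ℝ ∞ χ := χ.contDiff
  have hχt : tsupport χ = Metric.closedBall q R := χ.tsupport_eq
  have dc : ∀ {h : ℂ → ℝ}, ContDiff ℝ ∞ h → ∀ v, ContDiff ℝ ∞ (fun z => fderiv ℝ h z v) :=
    fun hh v => (hh.fderiv_right (m := ∞) (by simp)).clm_apply contDiff_const
  have hXs : ∀ {h : ℂ → ℝ}, ContDiff ℝ ∞ h → ContDiff ℝ ∞ (X h) := fun {h} hh => by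
    rw [show X h = _ from funext (hX h)]
    exact (ha.mul (dc hh _)).add (hb.mul (dc hh _))
  have hYs : ∀ {h : ℂ → ℝ}, ContDiff ℝ ∞ h → ContDiff ℝ ∞ (Y h) := fun {h} hh => by
    rw [show Y h = _ from funext (hY h)]
    exact hc.mul (dc hh _)
  have hXmul : ∀ {h k : ℂ → ℝ}, ContDiff ℝ ∞ h → ContDiff ℝ ∞ k → ∀ z,
      X (fun z => h z * k z) z = h z * X k z + k z * X h z ∧
      Y (fun z => h z * k z) z = h z * Y k z + k z * Y h z := by
    intro h k hh hk z
    rw [hX, hY, fderiv_fun_mul (hh.differentiable (by simp) z) (hk.differentiable (by simp) z)]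
    simp only [add_apply, smul_apply, smul_eq_mul, hX, hY]
    constructor <;> ring
  set f : ℂ → ℝ := fun z => (u z).re with hf
  set g : ℂ → ℝ := fun z => (u z).im with hg
  have hfs : ContDiff ℝ ∞ f := Complex.reCLM.contDiff.comp hu
  have hgs : ContDiff ℝ ∞ g := Complex.imCLM.contDiff.comp hu
  have hfd : ∀ z v, fderiv ℝ f z v = (fderiv ℝ u z v).re := fun z v => by
    have := (Complex.reCLM.hasFDerivAt (x := u z)).comp z (hu.differentiable (by simp) z).hasFDerivAt
    have h' : fderiv ℝ f z = _ := this.fderiv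
    rw [h']; rfl
  have hgd : ∀ z v, fderiv ℝ g z v = (fderiv ℝ u z v).im := fun z v => by
    have := (Complex.imCLM.hasFDerivAt (x := u z)).comp z (hu.differentiable (by simp) z).hasFDerivAt
    have h' : fderiv ℝ g z = _ := this.fderiv
    rw [h']; rfl
  have hN : ∀ z, f z ^ 2 + g z ^ 2 = ‖u z‖ ^ 2 := fun z => by
    rw [← Complex.normSq_eq_norm_sq, Complex.normSq_apply, hf, hg]; ring
  have hL : ∀ z ∈ Metric.closedBall q R,
      (X f z - Y g z) ^ 2 + (X g z + Y f z) ^ 2 ≤ Γ ^ 2 * (f z ^ 2 + g z ^ 2) := by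
    intro z hz
    have h1 := hΓ z hz
    rw [hN, ← mul_pow]
    calc _ = ‖(a z * fderiv ℝ u z Complex.I + b z * fderiv ℝ u z 1 +
          Complex.I * (c z * fderiv ℝ u z 1) : ℂ)‖ ^ 2 := by
          rw [← Complex.normSq_eq_norm_sq, Complex.normSq_apply, hX, hY, hX, hY, hfd, hfd, hgd, hgd]
          simp
          ring
      _ ≤ _ := by gcongr
  have hχ0 : ∀ z, z ∉ Metric.closedBall q R → χ z = 0 ∧ X χ z = 0 ∧ Y χ z = 0 := by
    intro z hz
    rw [← hχt] at hz
    have : fderiv ℝ χ z = 0 := by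
      by_contra h'
      exact hz (support_fderiv_subset ℝ h')
    simp [hX, hY, this, image_eq_zero_of_notMem_tsupport hz]
  have hχ1 : ∀ z ∈ Metric.ball q (3 * R / 4), X χ z = 0 ∧ Y χ z = 0 := by
    intro z hz
    have h1 : χ =ᶠ[𝓝 z] fun _ => (1 : ℝ) := by
      filter_upwards [Metric.isOpen_ball.mem_nhds hz] with y hy
      exact χ.one_of_mem_closedBall (Metric.ball_subset_closedBall hy)
    have : fderiv ℝ χ z = 0 := by rw [h1.fderiv_eq]; simp
    simp [hX, hY, this]
  -- a bound for the commutator term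
  have hcχX := (hXs hχs).continuous
  have hcχY := (hYs hχs).continuous
  have hcf := hfs.continuous
  have hcg := hgs.continuous
  have hcφ := hφ.continuous
  have hcχ := hχs.continuous
  obtain ⟨C₁, hC₁⟩ := (isCompact_closedBall q R).exists_bound_of_continuousOn
    (f := fun z => (f z * X χ z - g z * Y χ z) ^ 2 + (g z * X χ z + f z * Y χ z) ^ 2) (by fun_prop)
  have hC₁0 : 0 ≤ C₁ := (norm_nonneg _).trans (hC₁ q (Metric.mem_closedBall_self hR.le))
  set p₀ : ℂ := q + (3 * R / 4 : ℝ) with hp₀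
  set p₁ : ℂ := q + (R / 2 : ℝ) with hp₁
  have hn₀ : ‖p₀ - q‖ = 3 * R / 4 := by
    rw [hp₀, add_sub_cancel_left, Complex.norm_real, Real.norm_eq_abs, abs_of_pos (by positivity)]
  have hn₁ : ‖p₁ - q‖ = R / 2 := by
    rw [hp₁, add_sub_cancel_left, Complex.norm_real, Real.norm_eq_abs, abs_of_pos (by positivity)]
  have hφ01 : φ p₀ < φ p₁ := hmono _ _ (by rw [hn₀, hn₁]; linarith)
  have hφle : ∀ z, z ∉ Metric.ball q (3 * R / 4) → φ z ≤ φ p₀ := by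
    intro z hz
    rw [Metric.mem_ball, dist_eq_norm, not_lt] at hz
    -- Monotonicity of `φ` is strict in the radius and says nothing about equal radii, so `z` is
    -- approached from slightly larger ones.
    refine le_of_tendsto_of_tendsto (f := fun t : ℝ => φ (q + (1 + t : ℝ) * (z - q)))
      (b := 𝓝[>] (0:ℝ)) (g := fun _ => φ p₀) ?_ tendsto_const_nhds ?_
    · have : Filter.Tendsto (fun t : ℝ => φ (q + (1 + t : ℝ) * (z - q))) (𝓝 0) (𝓝 (φ (q + (1 + 0 : ℝ) * (z - q)))) := by
        apply Continuous.tendsto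
        fun_prop
      simpa using this.mono_left nhdsWithin_le_nhds
    · filter_upwards [self_mem_nhdsWithin] with t ht
      rw [mem_Ioi] at ht
      refine (hmono _ _ ?_).le
      rw [hn₀, add_sub_cancel_left, norm_mul, Complex.norm_real, Real.norm_eq_abs, abs_of_pos (by linarith)]
      nlinarith
  set Vb := (volume (Metric.closedBall q R)).toReal with hVb
  have hball : ∀ T : ℝ, 2 * Γ ^ 2 + 1 ≤ T * μ → 0 ≤ T →
      ∫ z in Metric.ball q (R / 2), ‖u z‖ ^ 2 ≤ 2 * C₁ * Vb * Real.exp (-(2 * T * (φ p₁ - φ p₀))) := by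
    intro T hT hT0
    set F : ℂ → ℝ := fun z => (χ z * Real.exp (T * φ z)) * f z with hF
    set G : ℂ → ℝ := fun z => (χ z * Real.exp (T * φ z)) * g z with hG
    have hexp : ContDiff ℝ ∞ (fun z => Real.exp (T * φ z)) := (contDiff_const.mul hφ).exp
    have hcexp := hexp.continuous
    have hχe := hχs.mul hexp
    have hFs : ContDiff ℝ ∞ F := hχe.mul hfs
    have hGs : ContDiff ℝ ∞ G := hχe.mul hgs
    have hFc : HasCompactSupport F := χ.hasCompactSupport.mul_right.mul_right
    have hGc : HasCompactSupport G := χ.hasCompactSupport.mul_right.mul_right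
    have key := carleman_inequality ha hb hc hφ hFs hGs hFc hGc (δ := δ) (τ := T) (by
      intro z hz
      apply hδ
      rw [← hχt]
      refine closure_mono ?_ hz
      intro y hy h
      apply hy
      simp [hF, h]) X Y hX hY
    have hXexp : ∀ z, X (fun z => Real.exp (T * φ z)) z = T * Real.exp (T * φ z) * X φ z ∧
        Y (fun z => Real.exp (T * φ z)) z = T * Real.exp (T * φ z) * Y φ z := by
      intro z
      have := ((hφ.differentiable (by simp) z).hasFDerivAt.const_mul T).exp
      rw [hX, hY, this.fderiv]
      simp only [smul_apply, smul_eq_mul, hX, hY]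
      constructor <;> ring
    -- The terms with `T` cancel the derivative of the exponential factor; the cut-off leaves a
    -- commutator.
    have hcomm : ∀ z, X F z - T * X φ z * F z = Real.exp (T * φ z) * (χ z * X f z + f z * X χ z) ∧
        X G z - T * X φ z * G z = Real.exp (T * φ z) * (χ z * X g z + g z * X χ z) ∧
        Y F z - T * Y φ z * F z = Real.exp (T * φ z) * (χ z * Y f z + f z * Y χ z) ∧
        Y G z - T * Y φ z * G z = Real.exp (T * φ z) * (χ z * Y g z + g z * Y χ z) := by
      intro z
      rw [hF, hG, (hXmul hχe hfs z).1, (hXmul hχe hfs z).2, (hXmul hχe hgs z).1,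
        (hXmul hχe hgs z).2, (hXmul hχs hexp z).1, (hXmul hχs hexp z).2, (hXexp z).1, (hXexp z).2]
      refine ⟨?_, ?_, ?_, ?_⟩ <;> ring
    -- The first term is later absorbed on the left for large `T`; the second bounds the commutator
    -- through the value of `φ` at radius `3R/4`.
    have hub : ∀ z, (X F z - T * X φ z * F z - (Y G z - T * Y φ z * G z)) ^ 2 +
        (X G z - T * X φ z * G z + (Y F z - T * Y φ z * F z)) ^ 2 ≤
        2 * Γ ^ 2 * (F z ^ 2 + G z ^ 2) +
          (Metric.closedBall q R).indicator (fun _ => 2 * C₁ * Real.exp (2 * T * φ p₀)) z := by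
      intro z
      obtain ⟨h1, h2, h3, h4⟩ := hcomm z
      rw [h1, h2, h3, h4]
      by_cases hz : z ∈ Metric.closedBall q R
      · rw [indicator_of_mem hz]
        have h5 := hL z hz
        have h6 : Real.exp (T * φ z) ^ 2 * ((f z * X χ z - g z * Y χ z) ^ 2 +
            (g z * X χ z + f z * Y χ z) ^ 2) ≤ C₁ * Real.exp (2 * T * φ p₀) := by
          by_cases hz' : z ∈ Metric.ball q (3 * R / 4)
          · rw [(hχ1 z hz').1, (hχ1 z hz').2]
            have : 0 ≤ C₁ * Real.exp (2 * T * φ p₀) := by positivity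
            simpa using this
          · have h7 := hC₁ z hz
            rw [Real.norm_eq_abs, abs_of_nonneg (by positivity)] at h7
            have h8 : Real.exp (T * φ z) ^ 2 ≤ Real.exp (2 * T * φ p₀) := by
              rw [← Real.exp_nat_mul]
              apply Real.exp_le_exp.2
              have := mul_le_mul_of_nonneg_left (hφle z hz') hT0
              push_cast; linarith
            rw [mul_comm C₁]
            gcongr
        set e := Real.exp (T * φ z)
        have h9 : e ^ 2 * χ z ^ 2 * ((X f z - Y g z) ^ 2 + (X g z + Y f z) ^ 2) ≤
            e ^ 2 * χ z ^ 2 * (Γ ^ 2 * (f z ^ 2 + g z ^ 2)) := by gcongr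
        have h10 : F z ^ 2 + G z ^ 2 = e ^ 2 * χ z ^ 2 * (f z ^ 2 + g z ^ 2) := by
          simp only [hF, hG]; ring
        rw [h10]
        nlinarith [sq_nonneg (e * (χ z * (X f z - Y g z)) - e * (f z * X χ z - g z * Y χ z)),
          sq_nonneg (e * (χ z * (X g z + Y f z)) - e * (g z * X χ z + f z * Y χ z))]
      · rw [indicator_of_notMem hz]
        obtain ⟨k1, k2, k3⟩ := hχ0 z hz
        simp [k1, k2, k3, hF, hG]
    have hlb : ∀ z, μ * (F z ^ 2 + G z ^ 2) ≤
        (fderiv ℝ (fun z => b z * X φ z + c z * Y φ z) z 1 +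
          fderiv ℝ (fun z => a z * X φ z) z Complex.I) * (F z ^ 2 + G z ^ 2) := by
      intro z
      by_cases hz : z ∈ Metric.closedBall q R
      · by_cases hz' : z ∈ Metric.ball q ε
        · have : u z = 0 := h0 z hz'
          simp [hF, hG, hf, hg, this]
        · exact mul_le_mul_of_nonneg_right (hφμ z hz hz') (add_nonneg (sq_nonneg _) (sq_nonneg _))
      · simp [hF, hG, (hχ0 z hz).1]
    have hFGc : HasCompactSupport (fun z => F z ^ 2 + G z ^ 2) := by
      refine HasCompactSupport.of_support_subset_isCompact (isCompact_closedBall q R) ?_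
      intro z hz
      by_contra h
      apply hz
      simp [hF, hG, (hχ0 z h).1]
    have iN : Integrable (fun z => F z ^ 2 + G z ^ 2) :=
      ((hFs.continuous.pow 2).add (hGs.continuous.pow 2)).integrable_of_hasCompactSupport hFGc
    have iD : Integrable (fun z => (fderiv ℝ (fun z => b z * X φ z + c z * Y φ z) z 1 +
          fderiv ℝ (fun z => a z * X φ z) z Complex.I) * (F z ^ 2 + G z ^ 2)) := by
      refine Continuous.integrable_of_hasCompactSupport ?_ hFGc.mul_left
      refine Continuous.mul (Continuous.add ?_ ?_)
        ((hFs.continuous.pow 2).add (hGs.continuous.pow 2))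
      · exact (dc ((hb.mul (hXs hφ)).add (hc.mul (hYs hφ))) 1).continuous
      · exact (dc (ha.mul (hXs hφ)) Complex.I).continuous
    have iI : Integrable ((Metric.closedBall q R).indicator
        (fun _ => 2 * C₁ * Real.exp (2 * T * φ p₀))) := by
      rw [integrable_indicator_iff measurableSet_closedBall]
      exact integrableOn_const (measure_closedBall_lt_top.ne)
    have k1 := integral_mono (iN.const_mul μ) iD hlb
    have k2 : ∫ z, ((X F z - T * X φ z * F z - (Y G z - T * Y φ z * G z)) ^ 2 +
        (X G z - T * X φ z * G z + (Y F z - T * Y φ z * F z)) ^ 2) ≤ _ :=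
      integral_mono_of_nonneg (Filter.Eventually.of_forall fun z => by
        simp only [Pi.zero_apply]; positivity) ((iN.const_mul (2 * Γ ^ 2)).add iI)
        (Filter.Eventually.of_forall hub)
    simp only [Pi.add_apply] at k2
    rw [integral_add (iN.const_mul _) iI, integral_const_mul, integral_indicator
      measurableSet_closedBall, setIntegral_const, smul_eq_mul] at k2
    rw [integral_const_mul] at k1
    set M := ∫ z, (F z ^ 2 + G z ^ 2) with hM
    have hM0 : 0 ≤ M := integral_nonneg fun z => by simp only [Pi.zero_apply]; positivity
    have k3 := mul_le_mul_of_nonneg_left k1 hT0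
    have k4 : M ≤ 2 * C₁ * Vb * Real.exp (2 * T * φ p₀) := by
      have hV' : volume.real (Metric.closedBall q R) = Vb := rfl
      rw [hV'] at k2
      nlinarith
    have k5 : Real.exp (2 * T * φ p₁) * ∫ z in Metric.ball q (R / 2), ‖u z‖ ^ 2 ≤ M := by
      rw [← integral_const_mul, hM]
      have iu : IntegrableOn (fun z => Real.exp (2 * T * φ p₁) * ‖u z‖ ^ 2) (Metric.ball q (R / 2)) := by
        have : Continuous (fun z => Real.exp (2 * T * φ p₁) * ‖u z‖ ^ 2) := by
          have := hu.continuous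
          fun_prop
        exact (this.continuousOn.integrableOn_compact (isCompact_closedBall q (R/2))).mono_set
          Metric.ball_subset_closedBall
      refine (setIntegral_mono_on iu iN.integrableOn measurableSet_ball ?_).trans
        (setIntegral_le_integral iN (Filter.Eventually.of_forall fun z => by
          simp only [Pi.zero_apply]; positivity))
      intro z hz
      have hz1 : χ z = 1 := χ.one_of_mem_closedBall
        (Metric.closedBall_subset_closedBall (show R / 2 ≤ 3 * R / 4 by linarith) (Metric.ball_subset_closedBall hz))
      rw [Metric.mem_ball, dist_eq_norm] at hz
      have h3 : φ p₁ ≤ φ z := (hmono z p₁ (by rw [hn₁]; exact hz)).le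
      have h4 : Real.exp (2 * T * φ p₁) ≤ Real.exp (T * φ z) ^ 2 := by
        rw [← Real.exp_nat_mul]
        apply Real.exp_le_exp.2
        have := mul_le_mul_of_nonneg_left h3 hT0
        push_cast; linarith
      calc _ ≤ Real.exp (T * φ z) ^ 2 * ‖u z‖ ^ 2 := by gcongr
        _ = _ := by rw [← hN]; simp only [hF, hG, hz1]; ring
    have k6 := k5.trans k4
    rw [show -(2 * T * (φ p₁ - φ p₀)) = 2 * T * φ p₀ - 2 * T * φ p₁ by ring, Real.exp_sub,
      mul_div_assoc', le_div_iff₀ (Real.exp_pos _)]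
    linarith
  have hI0 : ∫ z in Metric.ball q (R / 2), ‖u z‖ ^ 2 ≤ 0 := by
    have hlim : Filter.Tendsto (fun T : ℝ => 2 * C₁ * Vb * Real.exp (-(2 * T * (φ p₁ - φ p₀))))
        Filter.atTop (𝓝 (2 * C₁ * Vb * 0)) := by
      apply Filter.Tendsto.const_mul
      apply Real.tendsto_exp_neg_atTop_nhds_zero.comp
      have : (fun T : ℝ => 2 * T * (φ p₁ - φ p₀)) = fun T => (2 * (φ p₁ - φ p₀)) * T := by ext; ring
      rw [this]
      exact Filter.tendsto_id.const_mul_atTop (by linarith)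
    rw [mul_zero] at hlim
    refine ge_of_tendsto hlim ?_
    filter_upwards [Filter.eventually_ge_atTop ((2 * Γ ^ 2 + 1) / μ), Filter.eventually_ge_atTop 0] with T h1 h2
    exact hball T (by rwa [div_le_iff₀ hμ] at h1) h2
  have hcu : Continuous (fun z => ‖u z‖ ^ 2) := by
    have := hu.continuous
    fun_prop
  have hi : IntegrableOn (fun z => ‖u z‖ ^ 2) (Metric.ball q (R / 2)) :=
    (hcu.continuousOn.integrableOn_compact (isCompact_closedBall q (R/2))).mono_set
          Metric.ball_subset_closedBall
  have hI : ∫ z in Metric.ball q (R / 2), ‖u z‖ ^ 2 = 0 :=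
    le_antisymm hI0 (integral_nonneg fun z => by simp only [Pi.zero_apply]; positivity)
  rw [setIntegral_eq_zero_iff_of_nonneg_ae (Filter.Eventually.of_forall fun z => by
    simp only [Pi.zero_apply]; positivity) hi] at hI
  have := Measure.eqOn_open_of_ae_eq hI Metric.isOpen_ball hcu.continuousOn continuousOn_const
  intro z hz
  simpa using this hz

end

-- Unique continuation for `∂₂u = κ ∂₁u + γ u` on a disc.

section

open MeasureTheory

/-- Ellipticity means that `Im κ` has no zero. Multiplying `∂₂ - κ ∂₁` by the real factor `|Im
κ|^{-1/2}` gives an operator `X + iY` with constant `a c`, so the previous estimate applies near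
every point. Connectedness of the disc does the rest. -/
theorem unique_continuation_ball {u κ γ : ℂ → ℂ} {w₀ : ℂ} {r : ℝ}
    (hu : ContDiffOn ℝ ∞ u (Metric.ball w₀ r)) (hκ : ContDiffOn ℝ ∞ κ (Metric.ball w₀ r))
    (hκ0 : ∀ z ∈ Metric.ball w₀ r, (κ z).im ≠ 0) (hγ : ContinuousOn γ (Metric.ball w₀ r))
    (heq : ∀ z ∈ Metric.ball w₀ r,
      fderiv ℝ u z Complex.I = κ z * fderiv ℝ u z 1 + γ z * u z)
    {V : Set ℂ} (hV : IsOpen V) (hVn : (V ∩ Metric.ball w₀ r).Nonempty)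
    (h0 : ∀ z ∈ V, u z = 0) :
    ∀ z ∈ Metric.ball w₀ r, u z = 0 := by
  set B := Metric.ball w₀ r with hB
  have hBo : IsOpen B := Metric.isOpen_ball
  have hBp : IsPreconnected B := (convex_ball w₀ r).isPreconnected
  have hκi : ContDiffOn ℝ ∞ (fun z => (κ z).im) B := Complex.imCLM.contDiff.comp_contDiffOn hκ
  have hκr : ContDiffOn ℝ ∞ (fun z => (κ z).re) B := Complex.reCLM.contDiff.comp_contDiffOn hκ
  -- `e` is the sign of `Im κ`, constant by the intermediate value theorem.
  obtain ⟨e, he, hep⟩ : ∃ e : ℝ, e * e = 1 ∧ ∀ z ∈ B, 0 < e * (κ z).im := by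
    by_cases h : ∀ z ∈ B, 0 < (κ z).im
    · exact ⟨1, by norm_num, by simpa using h⟩
    · push Not at h
      obtain ⟨z₁, hz₁, h1⟩ := h
      refine ⟨-1, by norm_num, fun z hz => ?_⟩
      by_contra h2
      have h3 : (0:ℝ) ∈ (fun z => (κ z).im) '' B :=
        hBp.intermediate_value hz₁ hz hκi.continuousOn ⟨h1, by linarith⟩
      obtain ⟨y, hy, hy'⟩ := h3
      exact hκ0 y hy hy'
  set s : ℂ → ℝ := fun z => (Real.sqrt (e * (κ z).im))⁻¹ with hs
  have hss : ContDiffOn ℝ ∞ s B :=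
    ((contDiffOn_const.mul hκi).sqrt (fun z hz => (hep z hz).ne')).inv
      (fun z hz => (Real.sqrt_pos.2 (hep z hz)).ne')
  have hsq : ∀ z ∈ B, s z * (-(s z * (κ z).im)) = -e := by
    intro z hz
    have h1 := Real.mul_self_sqrt (hep z hz).le
    have h2 := (Real.sqrt_pos.2 (hep z hz)).ne'
    simp only [hs]
    field_simp
    rw [sq, h1]
    linear_combination ((κ z).im) * he
  have step : ∀ q R, 0 < R → Metric.ball q (2 * R) ⊆ B → (∃ ε > 0, ∀ z ∈ Metric.ball q ε, u z = 0) →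
      ∀ z ∈ Metric.ball q (R / 2), u z = 0 := by
    rintro q R hR hq ⟨ε, hε, hε0⟩
    have hRR : R < 2 * R := by linarith
    have hKB : Metric.closedBall q R ⊆ B := (Metric.closedBall_subset_ball hRR).trans hq
    obtain ⟨a, ha, ha'⟩ := exists_contDiff_eqOn_closedBall hR hRR (hss.mono hq)
    obtain ⟨b, hb, hb'⟩ := exists_contDiff_eqOn_closedBall hR hRR (g := fun z => -(s z * (κ z).re))
      ((hss.mul hκr).neg.mono hq)
    obtain ⟨c, hc, hc'⟩ := exists_contDiff_eqOn_closedBall hR hRR (g := fun z => -(s z * (κ z).im))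
      ((hss.mul hκi).neg.mono hq)
    obtain ⟨v, hv, hv'⟩ := exists_contDiff_eqOn_closedBall hR hRR (hu.mono hq)
    obtain ⟨Γ, hΓ⟩ := (isCompact_closedBall q R).exists_bound_of_continuousOn
      (f := fun z => s z * ‖γ z‖) ((hss.continuousOn.mono hKB).mul (hγ.mono hKB).norm)
    have hRε : 0 < min ε R := lt_min hε hR
    have hderiv : ∀ z ∈ Metric.closedBall q R, fderiv ℝ v z = fderiv ℝ u z := by
      have h1 : EqOn (fderiv ℝ v) (fderiv ℝ u) (Metric.ball q R) := by
        intro z hz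
        refine Filter.EventuallyEq.fderiv_eq ?_
        filter_upwards [Metric.isOpen_ball.mem_nhds hz] with y hy
        exact hv' (Metric.ball_subset_closedBall hy)
      have h2 := h1.of_subset_closure (t := Metric.closedBall q R)
        ((hv.continuous_fderiv (by simp)).continuousOn)
        ((hu.continuousOn_fderiv_of_isOpen hBo (by simp)).mono hKB) Metric.ball_subset_closedBall
        (by rw [closure_ball q hR.ne'])
      exact h2
    have := eq_zero_of_eq_zero_on_ball ha hb hc hv hRε hR (δ := -e) (Γ := Γ)
      (by intro h; rw [neg_eq_zero] at h; simp [h] at he)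
      (fun z hz => by rw [ha' hz, hc' hz]; exact hsq z (hKB hz)) ?_ ?_
    · intro z hz
      rw [← hv' (Metric.ball_subset_closedBall (Metric.ball_subset_ball (by linarith) hz))]
      exact this z hz
    · intro z hz
      rw [hderiv z hz, ha' hz, hb' hz, hc' hz, hv' hz, heq z (hKB hz)]
      have h1 : ((s z : ℝ) : ℂ) * (κ z * fderiv ℝ u z 1 + γ z * u z) + ((-(s z * (κ z).re) : ℝ) : ℂ) * fderiv ℝ u z 1 +
          Complex.I * (((-(s z * (κ z).im) : ℝ) : ℂ) * fderiv ℝ u z 1) = s z * γ z * u z := by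
        have hk := Complex.re_add_im (κ z)
        push_cast
        linear_combination (-(s z : ℂ) * fderiv ℝ u z 1) * hk
      rw [h1, norm_mul]
      have h2 := hΓ z hz
      have h3 : ‖(s z : ℂ) * γ z‖ ≤ Γ := by
        refine le_trans ?_ h2
        rw [norm_mul, norm_mul, norm_norm, Complex.norm_real]
      gcongr
    · intro z hz
      rw [hv' (Metric.ball_subset_closedBall (Metric.ball_subset_ball (min_le_right _ _) hz))]
      exact hε0 z (Metric.ball_subset_ball (min_le_left _ _) hz)
  -- connectedness
  set Z := interior {z | u z = 0} with hZ
  have hsub : B ⊆ Z := by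
    refine hBp.subset_of_closure_inter_subset isOpen_interior ?_ ?_
    · obtain ⟨z, hz, hz'⟩ := hVn
      exact ⟨z, hz', interior_maximal (fun y hy => h0 y hy) hV hz⟩
    · rintro p ⟨hp, hpB⟩
      obtain ⟨ρ, hρ, hρB⟩ := Metric.isOpen_iff.1 hBo p hpB
      -- With `R = ρ/4`, a centre `q` this close has its disc of radius `2R` inside the disc of
      -- radius `ρ` about `p`, while `p` is inside the disc of radius `R/2` about `q`.
      obtain ⟨q, hq, hpq⟩ := Metric.mem_closure_iff.1 hp (ρ / 8) (by positivity)
      obtain ⟨ε, hε, hε'⟩ := Metric.isOpen_iff.1 (isOpen_interior (s := {z | u z = 0})) q hq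
      have h1 := step q (ρ / 4) (by positivity) (fun y hy => hρB (by
        rw [Metric.mem_ball] at hy ⊢
        linarith [dist_triangle y q p, dist_comm p q])) ⟨ε, hε, fun z hz => show z ∈ {z | u z = 0} from interior_subset (hε' hz)⟩
      refine interior_maximal (t := Metric.ball q (ρ / 4 / 2)) h1 Metric.isOpen_ball ?_
      rw [Metric.mem_ball]
      linarith
  exact fun z hz => show z ∈ {z | u z = 0} from interior_subset (hsub hz)

end

namespace ParaHyp

-- Para-Hermitian linear algebra and the constant ambient metric.

section Algebra

variable {n : ℕ}

theorem conj_conj (z : PC) : conj (conj z) = z := rfl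
theorem conj_add (z w : PC) : conj (z + w) = conj z + conj w := rfl
theorem conj_neg (z : PC) : conj (-z) = -conj z := rfl
theorem conj_rsmul (c : ℝ) (z : PC) : conj (c • z) = c • conj z := rfl
theorem conj_tau : conj tau = -tau := by ext <;> simp [conj, tau]
theorem conj_sum {ι : Type*} (s : Finset ι) (f : ι → PC) :
    conj (∑ i ∈ s, f i) = ∑ i ∈ s, conj (f i) := by
  ext <;> simp [conj, Prod.fst_sum, Prod.snd_sum]

theorem re_add (z w : PC) : re (z + w) = re z + re w := by simp [re]; ring
theorem re_neg (z : PC) : re (-z) = -re z := by simp [re]; ring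
theorem re_rsmul (c : ℝ) (z : PC) : re (c • z) = c * re z := by simp [re]; ring
theorem re_sum {ι : Type*} (s : Finset ι) (f : ι → PC) :
    re (∑ i ∈ s, f i) = ∑ i ∈ s, re (f i) := by
  simp [re, Prod.fst_sum, Prod.snd_sum, ← Finset.sum_add_distrib, Finset.sum_div]
theorem re_conj (z : PC) : re (conj z) = re z := by simp [re, conj]; ring

theorem conj_q (z w : PVec n) : conj (q z w) = q w z := by
  rw [q, q, conj_sum]
  refine Fintype.sum_equiv (Fin.revPerm) _ _ fun i => ?_
  simp [conj_mul, conj_conj, mul_comm]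

theorem q_add_right (x y w : PVec n) : q w (x + y) = q w x + q w y := by
  rw [← conj_q, q_add_left, conj_add, conj_q, conj_q]

theorem q_rsmul_right (c : ℝ) (x w : PVec n) : q w (c • x) = c • q w x := by
  rw [← conj_q, q_rsmul_left, conj_rsmul, conj_q]

theorem q_zero_left (w : PVec n) : q 0 w = 0 := by simp [q]
theorem q_zero_right (w : PVec n) : q w 0 = 0 := by rw [← conj_q, q_zero_left]; rfl
theorem q_neg_left (x w : PVec n) : q (-x) w = -q x w := by simp [q]
theorem q_neg_right (x w : PVec n) : q w (-x) = -q w x := by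
  rw [← conj_q, q_neg_left, conj_neg, conj_q]
theorem q_sub_left (x y w : PVec n) : q (x - y) w = q x w - q y w := by
  rw [sub_eq_add_neg, q_add_left, q_neg_left, sub_eq_add_neg]
theorem q_sub_right (x y w : PVec n) : q w (x - y) = q w x - q w y := by
  rw [sub_eq_add_neg, q_add_right, q_neg_right, sub_eq_add_neg]

theorem q_sum_left {ι : Type*} (s : Finset ι) (f : ι → PVec n) (w : PVec n) :
    q (∑ i ∈ s, f i) w = ∑ i ∈ s, q (f i) w := by
  classical
  induction s using Finset.induction_on with
  | empty => simp [q_zero_left]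
  | insert a s ha ih => rw [Finset.sum_insert ha, Finset.sum_insert ha, q_add_left, ih]

/-- The standard basis of `ℝ_τ^{n+1}`. -/
def stdVec (i : Fin (n + 1)) : PVec n := Pi.single i 1

theorem q_stdVec_left (i : Fin (n + 1)) (z : PVec n) : q (stdVec i) z = conj (z (Fin.rev i)) := by
  rw [q, Finset.sum_eq_single i]
  · simp [stdVec]
  · intro j _ hj
    simp [stdVec, Pi.single_eq_of_ne hj]
  · simp

theorem sum_smul_stdVec (z : PVec n) : ∑ i, z i • stdVec i = z := by
  ext1 j
  rw [Finset.sum_apply, Finset.sum_eq_single j]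
  · simp [stdVec]
  · intro i _ hi
    simp [stdVec, Pi.single_eq_of_ne hi.symm]
  · simp

theorem eq_zero_of_q_left {v : PVec n} (h : ∀ w, q v w = 0) : v = 0 := by
  funext i
  have := h (stdVec (Fin.rev i))
  rw [← conj_q, q_stdVec_left, Fin.rev_rev, conj_conj] at this
  simpa using this

/-- The `ℝ_τ`-linear endomorphisms. -/
def plin (n : ℕ) : Submodule ℝ (PEnd n) where
  carrier := {A | ∀ (c : PC) (w : PVec n), A (c • w) = c • A w}
  add_mem' := fun h k c w => by simp [h c w, k c w]
  zero_mem' := fun c w => by simp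
  smul_mem' := fun r A h c w => by rw [smul_apply, h c w, smul_apply, smul_comm]

theorem tangentAt_le_plin (p : Hyp n) : tangentAt p ≤ plin n := fun _ hA => hA.1

/-- The constant symmetric form `-Re tr(B* A)` on endomorphisms. On tangent vectors at any point
it is the metric. -/
noncomputable def gform (n : ℕ) : PEnd n →L[ℝ] PEnd n →L[ℝ] ℝ :=
  (LinearMap.mk₂ ℝ (fun A B : PEnd n =>
      -∑ i : Fin (n + 1), re (q (A (stdVec i)) (B (stdVec (Fin.rev i)))))
    (fun A A' B => by simp [q_add_left, re_add, Finset.sum_add_distrib]; ring)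
    (fun c A B => by simp [q_rsmul_left, re_rsmul, Finset.mul_sum])
    (fun A B B' => by simp [q_add_right, re_add, Finset.sum_add_distrib]; ring)
    (fun c A B => by simp [q_rsmul_right, re_rsmul, Finset.mul_sum])).toContinuousBilinearMap

theorem gform_apply (A B : PEnd n) :
    gform n A B = -∑ i : Fin (n + 1), re (q (A (stdVec i)) (B (stdVec (Fin.rev i)))) := rfl

theorem gform_comm (A B : PEnd n) : gform n A B = gform n B A := by
  rw [gform_apply, gform_apply]
  congr 1
  refine Fintype.sum_equiv (Fin.revPerm) _ _ fun i => ?_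
  rw [Fin.revPerm_apply, Fin.rev_rev, ← conj_q, re_conj]

theorem q_rep (p : Hyp n) : q (rep p) (rep p) = -1 := (@Quotient.out _ (quadricSetoid n) p).2

theorem lineProj_toHyp (z : Quadric n) : lineProj (toHyp z) = lineMap z.1 := rfl

theorem lineProj_eq (p : Hyp n) : lineProj p = lineMap (rep p) := by
  conv_lhs => rw [← @Quotient.out_eq _ (quadricSetoid n) p]
  rfl

theorem lineMap_apply (z w : PVec n) : lineMap z w = (-(q w z)) • z := rfl

theorem lineProj_apply (p : Hyp n) (w : PVec n) : lineProj p w = (-(q w (rep p))) • rep p := by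
  rw [lineProj_eq]; rfl

theorem lineProj_mem_plin (p : Hyp n) : lineProj p ∈ plin n := fun c w => by
  rw [lineProj_apply, lineProj_apply, q_smul_left, smul_smul, mul_neg]

theorem lineProj_comp_lineProj (p : Hyp n) : lineProj p ∘L lineProj p = lineProj p := by
  ext1 w
  rw [ContinuousLinearMap.comp_apply, lineProj_apply p w, lineProj_mem_plin, lineProj_apply, q_rep]
  simp

theorem lineProj_rep (p : Hyp n) : lineProj p (rep p) = rep p := by
  rw [lineProj_apply, q_rep]; simp

theorem q_lineProj_left (p : Hyp n) (v w : PVec n) : q (lineProj p v) w = q v (lineProj p w) := by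
  rw [lineProj_apply, lineProj_apply, q_smul_left, q_smul_right, conj_neg, conj_q, neg_mul, neg_mul,
    mul_comm]

theorem tangent_apply {p : Hyp n} {A : PEnd n} (hA : A ∈ tangentAt p) (w : PVec n) :
    A w = (-(q w (rep p))) • A (rep p) := by
  conv_lhs => rw [← hA.2.1]
  rw [ContinuousLinearMap.comp_apply, lineProj_apply, hA.1]

theorem q_tangent_rep {p : Hyp n} {A : PEnd n} (hA : A ∈ tangentAt p) (w : PVec n) :
    q (A w) (rep p) = 0 := by
  have h := congrArg (fun B : PEnd n => q (B w) (rep p)) hA.2.2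
  simp only [ContinuousLinearMap.comp_apply, lineProj_apply, q_smul_left, q_rep,
    zero_apply, q_zero_left] at h
  simpa using h

theorem tangent_ext {p : Hyp n} {A B : PEnd n} (hA : A ∈ tangentAt p) (hB : B ∈ tangentAt p)
    (h : A (rep p) = B (rep p)) : A = B := by
  ext1 w
  rw [tangent_apply hA, tangent_apply hB, h]

/-- A tangent `B` is `w ↦ -q(w, z) B z`, so the trace over the standard basis and its reversed dual
basis reassembles `A z`. Only `B` must be tangent; this allows derivatives of sections in the place
of `A`. -/
theorem gform_eq_re_q {p : Hyp n} {A B : PEnd n} (hA : A ∈ plin n) (hB : B ∈ tangentAt p) :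
    gform n A B = re (q (A (rep p)) (B (rep p))) := by
  have h : ∀ i : Fin (n + 1), q (A (stdVec i)) (B (stdVec (Fin.rev i))) =
      -q (A ((rep p) i • stdVec i)) (B (rep p)) := by
    intro i
    rw [tangent_apply hB, q_smul_right, conj_neg, conj_q, hA, q_smul_left, neg_mul,
      ← conj_q, q_stdVec_left, conj_conj, Fin.rev_rev]
  rw [gform_apply]
  simp_rw [h, re_neg]
  rw [Finset.sum_neg_distrib, neg_neg, ← re_sum, ← q_sum_left, ← map_sum, sum_smul_stdVec]

theorem gmet_eq_gform {p : Hyp n} {A B : PEnd n} (hA : A ∈ plin n) (hB : B ∈ tangentAt p) :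
    gmet p A B = gform n A B := (gform_eq_re_q hA hB).symm

theorem hor_apply (p : Hyp n) (A : PEnd n) :
    hor p A = A ∘L lineProj p - lineProj p ∘L A ∘L lineProj p := by
  rw [hor, ContinuousLinearMap.sub_comp, ContinuousLinearMap.id_comp]

theorem hor_mem_tangentAt (p : Hyp n) {A : PEnd n} (hA : A ∈ plin n) : hor p A ∈ tangentAt p := by
  have h1 := lineProj_comp_lineProj p
  refine ⟨fun c w => ?_, ?_, ?_⟩
  · rw [hor_apply]
    simp only [sub_apply, ContinuousLinearMap.comp_apply]
    rw [lineProj_mem_plin, hA, lineProj_mem_plin, smul_sub]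
  · rw [hor_apply, ContinuousLinearMap.sub_comp]
    simp only [ContinuousLinearMap.comp_assoc, h1]
  · rw [hor_apply, ContinuousLinearMap.comp_sub]
    simp only [← ContinuousLinearMap.comp_assoc, h1, sub_self]

/-- `A z` and its horizontal part differ by a multiple of `z`, which is orthogonal to `B z`. Hence
`hor` can be dropped before every projection to a tangent subspace. -/
theorem gform_hor {p : Hyp n} {A B : PEnd n} (hA : A ∈ plin n) (hB : B ∈ tangentAt p) :
    gform n (hor p A) B = gform n A B := by
  rw [gform_eq_re_q (hor_mem_tangentAt p hA).1 hB, gform_eq_re_q hA hB, hor_apply]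
  simp only [sub_apply, ContinuousLinearMap.comp_apply, lineProj_rep]
  rw [q_sub_left, q_lineProj_left, lineProj_apply, ← conj_q (rep p), conj_q, q_tangent_rep hB]
  simp [q_zero_right]

/-- Multiplication by `τ`, as a continuous linear map on endomorphisms. -/
noncomputable def tauMul (n : ℕ) : PEnd n →L[ℝ] PEnd n := LinearMap.toContinuousLinearMap (paraP n)

theorem tauMul_eq (A : PEnd n) : tauMul n A = paraP n A := rfl

theorem tauMul_apply (A : PEnd n) (w : PVec n) : tauMul n A w = tau • A w := rfl

theorem tauMul_tauMul (A : PEnd n) : tauMul n (tauMul n A) = A := by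
  ext1 w
  rw [tauMul_apply, tauMul_apply, smul_smul, tau_mul_tau, one_smul]

theorem gform_tauMul (A B : PEnd n) : gform n (tauMul n A) (tauMul n B) = -gform n A B := by
  rw [gform_apply, gform_apply]
  congr 1
  rw [← Finset.sum_neg_distrib]
  refine Finset.sum_congr rfl fun i _ => ?_
  rw [tauMul_apply, tauMul_apply, q_smul_left, q_smul_right, conj_tau, ← mul_assoc, mul_neg,
    tau_mul_tau, neg_one_mul, re_neg]

theorem tauMul_mem_tangentAt {p : Hyp n} {A : PEnd n} (hA : A ∈ tangentAt p) :
    tauMul n A ∈ tangentAt p := by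
  refine ⟨fun c w => ?_, ?_, ?_⟩
  · rw [tauMul_apply, tauMul_apply, hA.1, smul_comm]
  · ext1 w
    rw [ContinuousLinearMap.comp_apply, tauMul_apply, tauMul_apply,
      ← ContinuousLinearMap.comp_apply, hA.2.1]
  · ext1 w
    rw [ContinuousLinearMap.comp_apply, tauMul_apply, lineProj_mem_plin,
      ← ContinuousLinearMap.comp_apply, hA.2.2]
    simp

/-- The real part of `q` is the metric and its `τ`-part is, up to sign, the symplectic form. On
isotropic subspaces `q` is therefore real. -/
theorem q_eq_gform {p : Hyp n} {A B : PEnd n} (hA : A ∈ tangentAt p) (hB : B ∈ tangentAt p) :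
    q (A (rep p)) (B (rep p)) = gform n A B • (1 : PC) - gform n A (tauMul n B) • tau := by
  rw [gform_eq_re_q hA.1 hB, gform_eq_re_q hA.1 (tauMul_mem_tangentAt hB), tauMul_apply,
    q_smul_right, conj_tau]
  ext <;> simp [re, tau] <;> ring

end Algebra


-- Orthogonal projections and rotations for definite planes.

section OrthProj

variable {V : Type*} [NormedAddCommGroup V] [NormedSpace ℝ V]

/-- `p` is the `G`-orthogonal projection onto `W`. -/
structure IsOrthProj (G : V →L[ℝ] V →L[ℝ] ℝ) (W : Submodule ℝ V) (p : V →L[ℝ] V) : Prop where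
  mem : ∀ A, p A ∈ W
  orth : ∀ A, ∀ C ∈ W, G (A - p A) C = 0

/-- The `G`-orthogonal projection onto `W`, if there is one. -/
noncomputable def gproj (G : V →L[ℝ] V →L[ℝ] ℝ) (W : Submodule ℝ V) : V →L[ℝ] V :=
  open Classical in if h : ∃ p, IsOrthProj G W p then h.choose else 0

theorem isOrthProj_gproj {G : V →L[ℝ] V →L[ℝ] ℝ} {W : Submodule ℝ V} {p : V →L[ℝ] V}
    (h : IsOrthProj G W p) : IsOrthProj G W (gproj G W) := by
  have h' : ∃ p, IsOrthProj G W p := ⟨p, h⟩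
  rw [gproj, dif_pos h']
  exact h'.choose_spec

/-- `G` is definite of sign `ε` on `W`. -/
def DefiniteOn (G : V →L[ℝ] V →L[ℝ] ℝ) (ε : ℝ) (W : Submodule ℝ V) : Prop :=
  ∀ A ∈ W, A ≠ 0 → 0 < ε * G A A

variable {G : V →L[ℝ] V →L[ℝ] ℝ} {ε : ℝ} {W : Submodule ℝ V}

theorem DefiniteOn.eq_of_orth (hW : DefiniteOn G ε W) {A B : V} (hA : A ∈ W) (hB : B ∈ W)
    (h : ∀ C ∈ W, G A C = G B C) : A = B := by
  by_contra hne
  have h1 := hW (A - B) (W.sub_mem hA hB) (sub_ne_zero.2 hne)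
  have h2 := h (A - B) (W.sub_mem hA hB)
  rw [show G (A - B) (A - B) = G A (A - B) - G B (A - B) by rw [map_sub G, sub_apply], h2, sub_self,
    mul_zero] at h1
  exact lt_irrefl _ h1

theorem IsOrthProj.apply_eq (hW : DefiniteOn G ε W) {p : V →L[ℝ] V} (hp : IsOrthProj G W p)
    {A B : V} (hB : B ∈ W) (h : ∀ C ∈ W, G A C = G B C) : p A = B := by
  refine hW.eq_of_orth (hp.mem A) hB fun C hC => ?_
  rw [← h C hC]
  have := hp.orth A C hC
  rw [map_sub, sub_apply] at this
  linarith

theorem IsOrthProj.unique (hW : DefiniteOn G ε W) {p p' : V →L[ℝ] V} (hp : IsOrthProj G W p)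
    (hp' : IsOrthProj G W p') : p = p' := by
  ext1 A
  refine hp.apply_eq hW (hp'.mem A) fun C hC => ?_
  have := hp'.orth A C hC
  rw [map_sub, sub_apply] at this
  linarith

theorem IsOrthProj.apply_of_mem (hW : DefiniteOn G ε W) {p : V →L[ℝ] V} (hp : IsOrthProj G W p)
    {A : V} (hA : A ∈ W) : p A = A :=
  hp.apply_eq hW hA fun _ _ => rfl

theorem IsOrthProj.mem_iff (hW : DefiniteOn G ε W) {p : V →L[ℝ] V} (hp : IsOrthProj G W p)
    {A : V} : A ∈ W ↔ p A = A :=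
  ⟨hp.apply_of_mem hW, fun h => h ▸ hp.mem A⟩

theorem IsOrthProj.selfadj (hG : ∀ A B, G A B = G B A) {p : V →L[ℝ] V} (hp : IsOrthProj G W p)
    (A B : V) : G (p A) B = G A (p B) := by
  have h1 := hp.orth A _ (hp.mem B)
  have h2 := hp.orth B _ (hp.mem A)
  rw [map_sub, sub_apply] at h1 h2
  have h3 := hG (p A) (p B)
  have h4 := hG B (p A)
  linarith

/-- The `G`-orthogonal projection onto the span of `u`, `v`. -/
noncomputable def proj₂ (G : V →L[ℝ] V →L[ℝ] ℝ) (u v : V) : V →L[ℝ] V :=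
  (G u u * G v v - G u v ^ 2)⁻¹ • ((G v v • G u - G u v • G v).smulRight u +
    (G u u • G v - G u v • G u).smulRight v)

/-- The rotation in the span of `u`, `v` for the orientation of this basis. -/
noncomputable def rot₂ (G : V →L[ℝ] V →L[ℝ] ℝ) (u v : V) : V →L[ℝ] V :=
  (Real.sqrt (G u u * G v v - G u v ^ 2))⁻¹ • ((G u).smulRight v - (G v).smulRight u)

theorem proj₂_apply (u v A : V) : proj₂ G u v A = (G u u * G v v - G u v ^ 2)⁻¹ •
    ((G v v * G u A - G u v * G v A) • u + (G u u * G v A - G u v * G u A) • v) := by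
  simp [proj₂]

theorem rot₂_apply (u v A : V) : rot₂ G u v A =
    (Real.sqrt (G u u * G v v - G u v ^ 2))⁻¹ • (G u A • v - G v A • u) := by
  simp [rot₂]

/-- For `x = G(u,u) v - G(u,v) u ≠ 0`, the positive number `ε G(x,x)` is `ε G(u,u)` times the Gram
determinant. The sign of the form drops out, so one formula serves both types of plane. -/
theorem gram_pos (hG : ∀ A B, G A B = G B A) (hW : DefiniteOn G ε W) {u v : V}
    (huv : W = Submodule.span ℝ {u, v}) (h2 : Module.finrank ℝ W = 2) :
    0 < G u u * G v v - G u v ^ 2 := by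
  have hu : u ∈ W := huv ▸ Submodule.subset_span (by simp)
  have hv : v ∈ W := huv ▸ Submodule.subset_span (by simp)
  have hdim : ∀ x : V, W ≠ Submodule.span ℝ {x} := by
    rintro x rfl
    have := finrank_span_le_card (R := ℝ) ({x} : Set V)
    simp [h2] at this
  have hu0 : u ≠ 0 := by
    rintro rfl
    exact hdim v (by rw [huv, Submodule.span_insert_zero])
  have hx : G u u • v - G u v • u ≠ 0 := by
    intro h
    have h1 := hW u hu hu0
    have h3 : G u u ≠ 0 := right_ne_zero_of_mul h1.ne'
    apply hdim u
    rw [huv, Set.pair_comm, Submodule.span_insert_eq_span]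
    rw [Submodule.mem_span_singleton]
    refine ⟨(G u u)⁻¹ * G u v, ?_⟩
    rw [mul_smul, ← sub_eq_zero.1 h, smul_smul, inv_mul_cancel₀ h3, one_smul]
  have h1 := hW u hu hu0
  have h3 := hW _ (W.sub_mem (W.smul_mem _ hv) (W.smul_mem _ hu)) hx
  simp only [map_sub, map_smul, sub_apply, smul_apply, smul_eq_mul, hG v u] at h3
  have h4 : 0 < (ε * G u u) * (G u u * G v v - G u v ^ 2) := by linarith
  exact pos_of_mul_pos_right h4 h1.le

theorem isOrthProj_proj₂ (hG : ∀ A B, G A B = G B A) {u v : V}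
    (huv : W = Submodule.span ℝ {u, v}) (hΔ : 0 < G u u * G v v - G u v ^ 2) :
    IsOrthProj G W (proj₂ G u v) := by
  have hu : u ∈ W := huv ▸ Submodule.subset_span (by simp)
  have hv : v ∈ W := huv ▸ Submodule.subset_span (by simp)
  refine ⟨fun A => ?_, fun A C hC => ?_⟩
  · rw [proj₂_apply]
    exact W.smul_mem _ (W.add_mem (W.smul_mem _ hu) (W.smul_mem _ hv))
  · rw [huv, Submodule.mem_span_pair] at hC
    obtain ⟨a, b, rfl⟩ := hC
    rw [proj₂_apply]
    simp only [map_sub, map_add, map_smul, sub_apply, smul_apply, add_apply, smul_eq_mul, hG v u,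
      hG A u, hG A v]
    field_simp
    ring

theorem exists_isOrthProj (hG : ∀ A B, G A B = G B A) (hW : DefiniteOn G ε W)
    (h2 : Module.finrank ℝ W = 2) : IsOrthProj G W (gproj G W) := by
  obtain ⟨u, v, huv⟩ : ∃ u v : V, W = Submodule.span ℝ {u, v} := by
    have : Module.Finite ℝ W := Module.finite_of_finrank_eq_succ h2
    let b := Module.finBasisOfFinrankEq ℝ W h2
    refine ⟨b 0, b 1, ?_⟩
    have h := congrArg (Submodule.map W.subtype) b.span_eq
    rw [Submodule.map_span, Submodule.map_top, Submodule.range_subtype, ← range_comp] at h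
    refine h.symm.trans (congrArg _ ?_)
    ext x
    simp [Fin.exists_fin_two, eq_comm]
  exact isOrthProj_gproj (isOrthProj_proj₂ hG huv (gram_pos hG hW huv h2))

/-- The action of complex numbers given by an endomorphism `J`. -/
noncomputable def cact (J : V →L[ℝ] V) (c : ℂ) (ξ : V) : V := c.re • ξ + c.im • J ξ

/-- The complex coordinate of `A` with respect to `ξ`, for the rotation `J`. -/
noncomputable def coef (G : V →L[ℝ] V →L[ℝ] ℝ) (J : V →L[ℝ] V) (ξ A : V) : ℂ :=
  ⟨G A ξ / G ξ ξ, G A (J ξ) / G ξ ξ⟩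

/-- `J` is a rotation by `π/2` in the image of the projection `p`. -/
structure IsRotation (G : V →L[ℝ] V →L[ℝ] ℝ) (p J : V →L[ℝ] V) : Prop where
  proj_rot : ∀ A, p (J A) = J A
  rot_proj : ∀ A, J (p A) = J A
  sq : ∀ A, J (J A) = -p A
  skew : ∀ A B, G (J A) B = -G A (J B)

/-- Skewness is visible in the formula, and the square is minus the Gram formula `proj₂` for the
projection. The rotation is extended by zero on the orthogonal complement, which makes it a smooth
function of the plane and its frame. -/
theorem isRotation_rot₂ (hG : ∀ A B, G A B = G B A) (hW : DefiniteOn G ε W) {u v : V}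
    (huv : W = Submodule.span ℝ {u, v}) (hΔ : 0 < G u u * G v v - G u v ^ 2) {p : V →L[ℝ] V}
    (hp : IsOrthProj G W p) : IsRotation G p (rot₂ G u v) := by
  have hu : u ∈ W := huv ▸ Submodule.subset_span (by simp)
  have hv : v ∈ W := huv ▸ Submodule.subset_span (by simp)
  have hs := Real.mul_self_sqrt hΔ.le
  have hs0 := (Real.sqrt_pos.2 hΔ).ne'
  refine ⟨fun A => ?_, fun A => ?_, fun A => ?_, fun A B => ?_⟩
  · apply hp.apply_of_mem hW
    rw [rot₂_apply]
    exact W.smul_mem _ (W.sub_mem (W.smul_mem _ hv) (W.smul_mem _ hu))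
  · rw [rot₂_apply, rot₂_apply, ← hp.selfadj hG, ← hp.selfadj hG, hp.apply_of_mem hW hu,
      hp.apply_of_mem hW hv]
  · rw [IsOrthProj.unique hW hp (isOrthProj_proj₂ hG huv hΔ), proj₂_apply, rot₂_apply, rot₂_apply]
    simp only [map_sub, map_smul, smul_eq_mul, hG v u]
    rw [show (G u u * G v v - G u v ^ 2)⁻¹ = (Real.sqrt (G u u * G v v - G u v ^ 2))⁻¹ * (Real.sqrt (G u u * G v v - G u v ^ 2))⁻¹ by
      rw [← mul_inv, hs]]
    module
  · simp only [rot₂_apply, map_sub, map_smul, sub_apply, smul_apply, smul_eq_mul, hG A u, hG A v]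
    ring

theorem IsRotation.isometry {p J : V →L[ℝ] V} (hJ : IsRotation G p J) {A B : V} (hB : p B = B) :
    G (J A) (J B) = G A B := by
  rw [hJ.skew, hJ.sq, hB, map_neg, neg_neg]

theorem IsRotation.orth (hG : ∀ A B, G A B = G B A) {p J : V →L[ℝ] V} (hJ : IsRotation G p J)
    (A : V) : G (J A) A = 0 := by
  have := hJ.skew A A
  rw [hG A (J A)] at this
  linarith

theorem IsRotation.neg {p J : V →L[ℝ] V} (hJ : IsRotation G p J) : IsRotation G p (-J) := by
  refine ⟨fun A => ?_, fun A => ?_, fun A => ?_, fun A B => ?_⟩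
  · simp [hJ.proj_rot]
  · simp [hJ.rot_proj]
  · simp [hJ.sq]
  · simp [hJ.skew]

theorem span_pair_of_orth (hG : ∀ A B, G A B = G B A) (hW : DefiniteOn G ε W)
    (h2 : Module.finrank ℝ W = 2) {ξ ζ A : V} (hξ : ξ ∈ W) (hζ : ζ ∈ W) (hA : A ∈ W) (h0 : ξ ≠ 0)
    (h0' : ζ ≠ 0) (h : G ξ ζ = 0) : A = (G A ξ / G ξ ξ) • ξ + (G A ζ / G ζ ζ) • ζ := by
  have hξξ : G ξ ξ ≠ 0 := right_ne_zero_of_mul (hW ξ hξ h0).ne'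
  have hζζ : G ζ ζ ≠ 0 := right_ne_zero_of_mul (hW ζ hζ h0').ne'
  have hli : LinearIndependent ℝ ![ξ, ζ] := by
    rw [LinearIndependent.pair_iff]
    intro s t hst
    have h1 := congrArg (fun x => G x ξ) hst
    have h3 := congrArg (fun x => G x ζ) hst
    simp [h, hG ζ ξ] at h1 h3
    exact ⟨by simpa [hξξ] using h1, by simpa [hζζ] using h3⟩
  have hspan : Submodule.span ℝ {ξ, ζ} = W := by
    have : Module.Finite ℝ W := Module.finite_of_finrank_eq_succ h2
    apply Submodule.eq_of_le_of_finrank_eq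
    · rw [Submodule.span_le]
      rintro x (rfl | rfl)
      exacts [hξ, hζ]
    · have := finrank_span_eq_card hli
      rw [Matrix.range_cons, Matrix.range_cons, Matrix.range_empty, union_empty,
        singleton_union] at this
      simpa [h2] using this
  rw [← hspan, Submodule.mem_span_pair] at hA
  obtain ⟨a, b, rfl⟩ := hA
  simp only [map_add, map_smul, add_apply, smul_apply, smul_eq_mul, h, hG ζ ξ]
  congr 2 <;> field_simp <;> simp

theorem cact_add_left (J : V →L[ℝ] V) (c d : ℂ) (ξ : V) : cact J (c + d) ξ = cact J c ξ + cact J d ξ := by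
  simp only [cact, Complex.add_re, Complex.add_im]; module

theorem cact_I (J : V →L[ℝ] V) (ξ : V) : cact J Complex.I ξ = J ξ := by simp [cact]

theorem IsRotation.cact_mul {p J : V →L[ℝ] V} (hJ : IsRotation G p J) (c d : ℂ) {ξ : V}
    (hξ : p ξ = ξ) : cact J (c * d) ξ = cact J c (cact J d ξ) := by
  simp only [cact, Complex.mul_re, Complex.mul_im, map_add, map_smul, hJ.sq, hξ]
  module

theorem IsRotation.gform_cact (hG : ∀ A B, G A B = G B A) {p J : V →L[ℝ] V}
    (hJ : IsRotation G p J) (c : ℂ) {ξ : V} (hξ : p ξ = ξ) :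
    G (cact J c ξ) (cact J c ξ) = ‖c‖ ^ 2 * G ξ ξ := by
  have h1 := hJ.orth hG ξ
  have h2 := hJ.isometry (A := ξ) hξ
  rw [← Complex.normSq_eq_norm_sq, Complex.normSq_apply]
  simp only [cact, map_add, map_smul, add_apply, smul_apply, smul_eq_mul, hG ξ (J ξ), h1, h2]
  ring

theorem IsRotation.coef_cact (hG : ∀ A B, G A B = G B A) {p J : V →L[ℝ] V}
    (hJ : IsRotation G p J) (c : ℂ) {ξ : V} (hξ : p ξ = ξ) (h0 : G ξ ξ ≠ 0) :
    coef G J ξ (cact J c ξ) = c := by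
  have h1 := hJ.orth hG ξ
  have h2 := hJ.isometry (A := ξ) hξ
  apply Complex.ext <;>
    simp [coef, cact, hG ξ (J ξ), h1, h2, h0]

theorem cact_coef (hG : ∀ A B, G A B = G B A) (hW : DefiniteOn G ε W)
    (h2 : Module.finrank ℝ W = 2) {p J : V →L[ℝ] V} (hp : IsOrthProj G W p)
    (hJ : IsRotation G p J) {ξ A : V} (hξ : ξ ∈ W) (h0 : ξ ≠ 0) (hA : A ∈ W) :
    cact J (coef G J ξ A) ξ = A := by
  have hpξ := hp.apply_of_mem hW hξ
  have hJξ : J ξ ≠ 0 := by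
    intro h
    have := hJ.sq ξ
    rw [h, map_zero, hpξ, eq_comm, neg_eq_zero] at this
    exact h0 this
  have hJm : J ξ ∈ W := by rw [← hJ.proj_rot]; exact hp.mem _
  have := span_pair_of_orth hG hW h2 hξ hJm hA h0 hJξ (by rw [hG, hJ.orth hG])
  rw [hJ.isometry hpξ] at this
  exact this.symm

end OrthProj


-- Plane bundles over plane domains, their connections and holomorphic sections.

section Bundles

variable {V : Type*} [NormedAddCommGroup V] [NormedSpace ℝ V]

/-- A smooth family of definite planes over an open subset `D` of `ℂ`, with the family `p` of
orthogonal projections. -/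
structure PlaneBundle (G : V →L[ℝ] V →L[ℝ] ℝ) (ε : ℝ) (D : Set ℂ) (W : ℂ → Submodule ℝ V)
    (p : ℂ → V →L[ℝ] V) : Prop where
  symm : ∀ A B, G A B = G B A
  isOpen : IsOpen D
  smooth : ContDiffOn ℝ ∞ p D
  proj : ∀ w ∈ D, IsOrthProj G (W w) (p w)
  definite : ∀ w ∈ D, DefiniteOn G ε (W w)
  finrank : ∀ w ∈ D, Module.finrank ℝ (W w) = 2

/-- A plane bundle with a smooth family of rotations by `π/2`. -/
structure RotBundle (G : V →L[ℝ] V →L[ℝ] ℝ) (ε : ℝ) (D : Set ℂ) (W : ℂ → Submodule ℝ V)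
    (p J : ℂ → V →L[ℝ] V) : Prop extends PlaneBundle G ε D W p where
  smooth_rot : ContDiffOn ℝ ∞ J D
  rot : ∀ w ∈ D, IsRotation G (p w) (J w)

/-- `ν` is a smooth section of `W` over `D`. -/
def IsSec (D : Set ℂ) (W : ℂ → Submodule ℝ V) (ν : ℂ → V) : Prop :=
  ContDiffOn ℝ ∞ ν D ∧ ∀ w ∈ D, ν w ∈ W w

variable {G : V →L[ℝ] V →L[ℝ] ℝ} {ε : ℝ} {D : Set ℂ} {W : ℂ → Submodule ℝ V}
  {p J : ℂ → V →L[ℝ] V} {ν : ℂ → V} {w v : ℂ}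

theorem ContDiffOn.differentiableAt_of_isOpen {F : Type*} [NormedAddCommGroup F] [NormedSpace ℝ F]
    {f : ℂ → F} (hf : ContDiffOn ℝ ∞ f D) (hD : IsOpen D) (hw : w ∈ D) :
    DifferentiableAt ℝ f w :=
  (hf.contDiffAt (hD.mem_nhds hw)).differentiableAt (by simp)

theorem ContDiffOn.fderiv_dir {F : Type*} [NormedAddCommGroup F] [NormedSpace ℝ F]
    {f : ℂ → F} (hf : ContDiffOn ℝ ∞ f D) (hD : IsOpen D) (v : ℂ) :
    ContDiffOn ℝ ∞ (fun w => fderiv ℝ f w v) D :=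
  (hf.fderiv_of_isOpen hD (m := ∞) (by simp)).clm_apply contDiffOn_const

theorem fderiv_family_apply {F : Type*} [NormedAddCommGroup F] [NormedSpace ℝ F]
    {L : ℂ → V →L[ℝ] F} {ν : ℂ → V} (hL : DifferentiableAt ℝ L w)
    (hν : DifferentiableAt ℝ ν w) (v : ℂ) :
    fderiv ℝ (fun w => L w (ν w)) w v = (fderiv ℝ L w v) (ν w) + L w (fderiv ℝ ν w v) := by
  rw [fderiv_clm_apply hL hν]
  simp [add_comm]

theorem fderiv_eq_of_eqOn {F : Type*} [NormedAddCommGroup F] [NormedSpace ℝ F] {f g : ℂ → F}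
    (hD : IsOpen D) (hw : w ∈ D) (h : EqOn f g D) : fderiv ℝ f w = fderiv ℝ g w := by
  refine Filter.EventuallyEq.fderiv_eq ?_
  filter_upwards [hD.mem_nhds hw] with y hy using h hy

theorem fderiv_gform {ν μ : ℂ → V} (hν : DifferentiableAt ℝ ν w) (hμ : DifferentiableAt ℝ μ w)
    (v : ℂ) : fderiv ℝ (fun w => G (ν w) (μ w)) w v =
      G (fderiv ℝ ν w v) (μ w) + G (ν w) (fderiv ℝ μ w v) := by
  have h : DifferentiableAt ℝ (fun w => G (ν w)) w := G.differentiableAt.comp w hν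
  have h' : fderiv ℝ (fun w => G (ν w)) w = G.comp (fderiv ℝ ν w) :=
    (G.hasFDerivAt.comp w hν.hasFDerivAt).fderiv
  rw [fderiv_family_apply h hμ, h']
  rfl

namespace PlaneBundle

variable (hW : PlaneBundle G ε D W p)
include hW

theorem apply_of_mem {A : V} (hw : w ∈ D) (hA : A ∈ W w) : p w A = A :=
  (hW.proj w hw).apply_of_mem (hW.definite w hw) hA

theorem selfadj (hw : w ∈ D) (A B : V) : G (p w A) B = G A (p w B) :=
  (hW.proj w hw).selfadj hW.symm A B

theorem gform_proj (hw : w ∈ D) (A : V) {B : V} (hB : B ∈ W w) : G (p w A) B = G A B := by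
  rw [hW.selfadj hw, hW.apply_of_mem hw hB]

theorem isSec_proj {ν : ℂ → V} (hν : ContDiffOn ℝ ∞ ν D) : IsSec D W (fun w => p w (ν w)) :=
  ⟨hW.smooth.clm_apply hν, fun w hw => (hW.proj w hw).mem _⟩

/-- Differentiate `p ∘ p = p`: on its own plane the derivative of a projection has only off-diagonal
components. -/
theorem proj_fderiv_proj (hw : w ∈ D) {ξ : V} (hξ : ξ ∈ W w) (v : ℂ) :
    p w ((fderiv ℝ p w v) ξ) = 0 := by
  have hd := ContDiffOn.differentiableAt_of_isOpen hW.smooth hW.isOpen hw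
  have h1 : EqOn (fun w => p w (p w ξ)) (fun w => p w ξ) D := fun y hy =>
    hW.apply_of_mem hy ((hW.proj y hy).mem ξ)
  have h2 := congrArg (fun L => L v) (fderiv_eq_of_eqOn hW.isOpen hw h1)
  rw [fderiv_family_apply hd (hd.clm_apply (differentiableAt_const ξ)),
    fderiv_family_apply hd (differentiableAt_const ξ), hW.apply_of_mem hw hξ] at h2
  simpa using h2

theorem fderiv_section (hν : IsSec D W ν) (hw : w ∈ D) (v : ℂ) :
    fderiv ℝ ν w v = (fderiv ℝ p w v) (ν w) + p w (fderiv ℝ ν w v) := by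
  rw [← fderiv_family_apply (ContDiffOn.differentiableAt_of_isOpen hW.smooth hW.isOpen hw)
    (ContDiffOn.differentiableAt_of_isOpen hν.1 hW.isOpen hw)]
  exact congrArg (fun L => L v) (fderiv_eq_of_eqOn hW.isOpen hw
    fun y hy => (hW.apply_of_mem hy (hν.2 y hy)).symm)

theorem isSec_nabla (hν : IsSec D W ν) (v : ℂ) : IsSec D W (fun w => p w (fderiv ℝ ν w v)) :=
  hW.isSec_proj (ContDiffOn.fderiv_dir hν.1 hW.isOpen v)

theorem ne_zero (hw : w ∈ D) {A : V} (hA : A ∈ W w) (h0 : A ≠ 0) : G A A ≠ 0 :=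
  right_ne_zero_of_mul (hW.definite w hw A hA h0).ne'

theorem eq_zero_of_orth (hw : w ∈ D) {A : V} (hA : A ∈ W w) (h : ∀ C ∈ W w, G A C = 0) :
    A = 0 :=
  (hW.definite w hw).eq_of_orth hA (Submodule.zero_mem _) fun C hC => by simp [h C hC]

theorem mono {D' : Set ℂ} (h : D' ⊆ D) (h' : IsOpen D') : PlaneBundle G ε D' W p :=
  ⟨hW.symm, h', hW.smooth.mono h, fun w hw => hW.proj w (h hw), fun w hw => hW.definite w (h hw),
    fun w hw => hW.finrank w (h hw)⟩

end PlaneBundle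

theorem contDiffOn_cact {J : ℂ → V →L[ℝ] V} {c : ℂ → ℂ} {ν : ℂ → V} (hJ : ContDiffOn ℝ ∞ J D)
    (hc : ContDiffOn ℝ ∞ c D) (hν : ContDiffOn ℝ ∞ ν D) :
    ContDiffOn ℝ ∞ (fun w => cact (J w) (c w) (ν w)) D :=
  ((Complex.reCLM.contDiff.comp_contDiffOn hc).smul hν).add
    ((Complex.imCLM.contDiff.comp_contDiffOn hc).smul (hJ.clm_apply hν))

theorem contDiffOn_gform {ν μ : ℂ → V} (hν : ContDiffOn ℝ ∞ ν D) (hμ : ContDiffOn ℝ ∞ μ D) :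
    ContDiffOn ℝ ∞ (fun w => G (ν w) (μ w)) D :=
  (G.contDiff.comp_contDiffOn hν).clm_apply hμ

theorem contDiffOn_coef {J : ℂ → V →L[ℝ] V} {ξ ν : ℂ → V} (hJ : ContDiffOn ℝ ∞ J D)
    (hξ : ContDiffOn ℝ ∞ ξ D) (hν : ContDiffOn ℝ ∞ ν D) (h0 : ∀ w ∈ D, G (ξ w) (ξ w) ≠ 0) :
    ContDiffOn ℝ ∞ (fun w => coef G (J w) (ξ w) (ν w)) D := by
  have h1 := (contDiffOn_gform (G := G) hν hξ).div (contDiffOn_gform (G := G) hξ hξ) h0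
  have h2 := (contDiffOn_gform (G := G) hν (hJ.clm_apply hξ)).div
    (contDiffOn_gform (G := G) hξ hξ) h0
  have := Complex.equivRealProdCLM.symm.contDiff.comp_contDiffOn (h1.prodMk h2)
  refine this.congr fun w _ => ?_
  apply Complex.ext <;> simp [coef]

namespace RotBundle

variable (hW : RotBundle G ε D W p J)
include hW

theorem mem (hw : w ∈ D) (A : V) : J w A ∈ W w := by
  rw [← (hW.rot w hw).proj_rot]
  exact (hW.proj w hw).mem _

theorem cact_mem (hw : w ∈ D) (c : ℂ) {A : V} (hA : A ∈ W w) : cact (J w) c A ∈ W w :=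
  (W w).add_mem ((W w).smul_mem _ hA) ((W w).smul_mem _ (hW.mem hw A))

theorem sq (hw : w ∈ D) {A : V} (hA : A ∈ W w) : J w (J w A) = -A := by
  rw [(hW.rot w hw).sq, hW.apply_of_mem hw hA]

theorem cact_coef (hw : w ∈ D) {ξ A : V} (hξ : ξ ∈ W w) (h0 : ξ ≠ 0) (hA : A ∈ W w) :
    cact (J w) (coef G (J w) ξ A) ξ = A :=
  ParaHyp.cact_coef hW.symm (hW.definite w hw) (hW.finrank w hw) (hW.proj w hw) (hW.rot w hw)
    hξ h0 hA

theorem coef_cact (hw : w ∈ D) (c : ℂ) {ξ : V} (hξ : ξ ∈ W w) (h0 : ξ ≠ 0) :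
    coef G (J w) ξ (cact (J w) c ξ) = c :=
  (hW.rot w hw).coef_cact hW.symm c (hW.apply_of_mem hw hξ) (hW.ne_zero hw hξ h0)

theorem cact_mul (hw : w ∈ D) (c d : ℂ) {ξ : V} (hξ : ξ ∈ W w) :
    cact (J w) (c * d) ξ = cact (J w) c (cact (J w) d ξ) :=
  (hW.rot w hw).cact_mul c d (hW.apply_of_mem hw hξ)

theorem gform_cact (hw : w ∈ D) (c : ℂ) {ξ : V} (hξ : ξ ∈ W w) :
    G (cact (J w) c ξ) (cact (J w) c ξ) = ‖c‖ ^ 2 * G ξ ξ :=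
  (hW.rot w hw).gform_cact hW.symm c (hW.apply_of_mem hw hξ)

theorem isSec_rot (hν : ContDiffOn ℝ ∞ ν D) : IsSec D W (fun w => J w (ν w)) :=
  ⟨hW.smooth_rot.clm_apply hν, fun _ hw => hW.mem hw _⟩

theorem neg : RotBundle G ε D W p (fun w => -J w) :=
  ⟨hW.toPlaneBundle, hW.smooth_rot.neg, fun w hw => (hW.rot w hw).neg⟩

theorem mono {D' : Set ℂ} (h : D' ⊆ D) (h' : IsOpen D') : RotBundle G ε D' W p J :=
  ⟨hW.toPlaneBundle.mono h h', hW.smooth_rot.mono h, fun w hw => hW.rot w (h hw)⟩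

/-- Differentiating `G(Jξ, ξ) = 0` and `G(Jξ, Jξ) = G(pξ, ξ)` shows that the derivative of `J` at
`ξ` pairs to zero with `ξ` and with `Jξ`, which span the plane. In rank two, metric compatibility
makes the rotation parallel. -/
theorem proj_fderiv_rot (hw : w ∈ D) {ξ : V} (hξ : ξ ∈ W w) (v : ℂ) :
    p w ((fderiv ℝ J w v) ξ) = 0 := by
  have hJd := ContDiffOn.differentiableAt_of_isOpen hW.smooth_rot hW.isOpen hw
  have hpd := ContDiffOn.differentiableAt_of_isOpen hW.smooth hW.isOpen hw
  have hc := differentiableAt_const (𝕜 := ℝ) ξ (x := w)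
  have hJξ : fderiv ℝ (fun w => J w ξ) w v = (fderiv ℝ J w v) ξ := by
    rw [fderiv_family_apply hJd hc]; simp
  have hpξ : fderiv ℝ (fun w => p w ξ) w v = (fderiv ℝ p w v) ξ := by
    rw [fderiv_family_apply hpd hc]; simp
  have h1 : EqOn (fun w => G (J w ξ) (J w ξ)) (fun w => G (p w ξ) ξ) D := fun y hy => by
    simp only
    rw [(hW.rot y hy).skew, (hW.rot y hy).sq, map_neg, neg_neg, hW.selfadj hy]
  have h2 : EqOn (fun w => G (J w ξ) ξ) (fun _ => 0) D := fun y hy =>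
    (hW.rot y hy).orth hW.symm ξ
  have e1 := congrArg (fun L => L v) (fderiv_eq_of_eqOn hW.isOpen hw h1)
  have e2 := congrArg (fun L => L v) (fderiv_eq_of_eqOn hW.isOpen hw h2)
  rw [fderiv_gform (hJd.clm_apply hc) (hJd.clm_apply hc), fderiv_gform (hpd.clm_apply hc) hc,
    hJξ, hpξ] at e1
  rw [fderiv_gform (hJd.clm_apply hc) hc, hJξ] at e2
  have e3 : G ((fderiv ℝ p w v) ξ) ξ = 0 := by
    rw [← hW.gform_proj hw _ hξ, hW.proj_fderiv_proj hw hξ]; simp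
  simp [e3, hW.symm (J w ξ)] at e1 e2
  refine hW.eq_zero_of_orth hw ((hW.proj w hw).mem _) fun C hC => ?_
  by_cases h0 : ξ = 0
  · simp [h0]
  rw [hW.gform_proj hw _ hC, ← hW.cact_coef hw hξ h0 hC]
  simp [cact, e1, e2]

/-- The rotation is parallel. -/
theorem proj_fderiv_rot_apply (hν : IsSec D W ν) (hw : w ∈ D) (v : ℂ) :
    p w (fderiv ℝ (fun w => J w (ν w)) w v) = J w (p w (fderiv ℝ ν w v)) := by
  rw [fderiv_family_apply (ContDiffOn.differentiableAt_of_isOpen hW.smooth_rot hW.isOpen hw)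
    (ContDiffOn.differentiableAt_of_isOpen hν.1 hW.isOpen hw), map_add,
    hW.proj_fderiv_rot hw (hν.2 w hw), zero_add, (hW.rot w hw).proj_rot, (hW.rot w hw).rot_proj]

/-- The Leibniz rule for the induced connection and complex functions. -/
theorem proj_fderiv_cact {c : ℂ → ℂ} (hc : ContDiffOn ℝ ∞ c D) (hν : IsSec D W ν) (hw : w ∈ D)
    (v : ℂ) : p w (fderiv ℝ (fun w => cact (J w) (c w) (ν w)) w v) =
      cact (J w) (fderiv ℝ c w v) (ν w) + cact (J w) (c w) (p w (fderiv ℝ ν w v)) := by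
  have hcd := ContDiffOn.differentiableAt_of_isOpen hc hW.isOpen hw
  have hνd := ContDiffOn.differentiableAt_of_isOpen hν.1 hW.isOpen hw
  have hJd := ContDiffOn.differentiableAt_of_isOpen hW.smooth_rot hW.isOpen hw
  have hre : HasFDerivAt (fun w => (c w).re) (Complex.reCLM.comp (fderiv ℝ c w)) w :=
    Complex.reCLM.hasFDerivAt.comp w hcd.hasFDerivAt
  have him : HasFDerivAt (fun w => (c w).im) (Complex.imCLM.comp (fderiv ℝ c w)) w :=
    Complex.imCLM.hasFDerivAt.comp w hcd.hasFDerivAt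
  have h : fderiv ℝ (fun w => cact (J w) (c w) (ν w)) w v =
      ((c w).re • fderiv ℝ ν w v + (fderiv ℝ c w v).re • ν w) +
      ((c w).im • fderiv ℝ (fun w => J w (ν w)) w v + (fderiv ℝ c w v).im • J w (ν w)) := by
    have := (hre.smul hνd.hasFDerivAt).add (him.smul (hJd.clm_apply hνd).hasFDerivAt)
    have h' : fderiv ℝ (fun w => cact (J w) (c w) (ν w)) w = _ := this.fderiv
    rw [h']
    simp
  rw [h]
  simp only [map_add, map_smul, hW.proj_fderiv_rot_apply hν hw, hW.apply_of_mem hw (hν.2 w hw),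
    (hW.rot w hw).proj_rot, cact]
  abel

end RotBundle

/-- `ν` is a holomorphic section. -/
def IsHolSec (D : Set ℂ) (W : ℂ → Submodule ℝ V) (p J : ℂ → V →L[ℝ] V) (ν : ℂ → V) : Prop :=
  IsSec D W ν ∧ ∀ w ∈ D, p w (fderiv ℝ ν w Complex.I) = J w (p w (fderiv ℝ ν w 1))

namespace RotBundle

variable (hW : RotBundle G ε D W p J)
include hW

theorem cact_cancel (hw : w ∈ D) {ξ : V} (hξ : ξ ∈ W w) (h0 : ξ ≠ 0) {c d : ℂ}
    (h : cact (J w) c ξ = cact (J w) d ξ) : c = d := by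
  rw [← hW.coef_cact hw c hξ h0, h, hW.coef_cact hw d hξ h0]

/-- The quotient of two holomorphic sections is holomorphic. -/
theorem differentiableOn_coef {ℓ : ℂ → V} (hℓ : IsHolSec D W p J ℓ) (h0 : ∀ w ∈ D, ℓ w ≠ 0)
    (hν : IsHolSec D W p J ν) :
    DifferentiableOn ℂ (fun w => coef G (J w) (ℓ w) (ν w)) D := by
  set f : ℂ → ℂ := fun w => coef G (J w) (ℓ w) (ν w) with hf
  have hfs : ContDiffOn ℝ ∞ f D := contDiffOn_coef hW.smooth_rot hℓ.1.1 hν.1.1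
    fun w hw => hW.ne_zero hw (hℓ.1.2 w hw) (h0 w hw)
  intro w hw
  have hfd := ContDiffOn.differentiableAt_of_isOpen hfs hW.isOpen hw
  have hfν : EqOn (fun w => cact (J w) (f w) (ℓ w)) ν D := fun y hy =>
    hW.cact_coef hy (hℓ.1.2 y hy) (h0 y hy) (hν.1.2 y hy)
  have hder : ∀ v, p w (fderiv ℝ ν w v) = cact (J w) (fderiv ℝ f w v) (ℓ w) +
      cact (J w) (f w) (p w (fderiv ℝ ℓ w v)) := fun v => by
    rw [← fderiv_eq_of_eqOn hW.isOpen hw hfν, hW.proj_fderiv_cact hfs hℓ.1 hw]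
  have h1 := hν.2 w hw
  have hm := (hW.proj w hw).mem (fderiv ℝ ℓ w 1)
  rw [hder, hder, hℓ.2 w hw, map_add, ← cact_I (J w) (cact _ _ _), ← cact_I (J w) (cact _ _ _),
    ← hW.cact_mul hw _ _ (hℓ.1.2 w hw), ← hW.cact_mul hw _ _ hm, ← cact_I (J w) (p w _),
    ← hW.cact_mul hw _ _ hm, mul_comm (f w), add_left_inj] at h1
  have h2 := hW.cact_cancel hw (hℓ.1.2 w hw) (h0 w hw) h1
  refine DifferentiableAt.differentiableWithinAt ?_
  rw [differentiableAt_complex_iff_differentiableAt_real]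
  exact ⟨hfd, by simpa using h2⟩

/-- Local holomorphic frames exist. -/
theorem exists_isHolSec (hw : w ∈ D) {ξ : ℂ → V} (hξ : IsSec D W ξ) (h0 : ∀ w ∈ D, ξ w ≠ 0) :
    ∃ D' ⊆ D, IsOpen D' ∧ w ∈ D' ∧ ∃ ℓ, IsHolSec D' W p J ℓ ∧ ∀ y ∈ D', ℓ y ≠ 0 := by
  set α : ℂ → ℂ → ℂ := fun v y => coef G (J y) (ξ y) (p y (fderiv ℝ ξ y v)) with hα
  have hαs : ∀ v, ContDiffOn ℝ ∞ (α v) D := fun v =>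
    contDiffOn_coef hW.smooth_rot hξ.1 (hW.isSec_nabla hξ v).1
      fun y hy => hW.ne_zero hy (hξ.2 y hy) (h0 y hy)
  have hαξ : ∀ v, ∀ y ∈ D, cact (J y) (α v y) (ξ y) = p y (fderiv ℝ ξ y v) := fun v y hy =>
    hW.cact_coef hy (hξ.2 y hy) (h0 y hy) ((hW.isSec_nabla hξ v).2 y hy)
  -- The frame sought is `exp(f) ξ`; its `∂̄`-derivative vanishes exactly when `f` cancels the
  -- `(0,1)`-part of the connection form `α` of `ξ`.
  obtain ⟨r, hr, hrD, f, hf, hfg⟩ := exists_local_dbarOp_eq hW.isOpen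
    (g := fun y => -(α 1 y + Complex.I * α Complex.I y))
    ((hαs 1).add (contDiffOn_const.mul (hαs _))).neg hw
  have hcs : ContDiff ℝ ∞ (fun y => Complex.exp (f y)) := hf.cexp
  have hWr := hW.mono hrD Metric.isOpen_ball
  have hξr : IsSec (Metric.ball w r) W ξ := ⟨hξ.1.mono hrD, fun y hy => hξ.2 y (hrD hy)⟩
  refine ⟨Metric.ball w r, hrD, Metric.isOpen_ball, Metric.mem_ball_self hr,
    fun y => cact (J y) (Complex.exp (f y)) (ξ y), ⟨⟨contDiffOn_cact hWr.smooth_rot hcs.contDiffOn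
      hξr.1, fun y hy => hWr.cact_mem hy _ (hξr.2 y hy)⟩, fun y hy => ?_⟩, fun y hy h => ?_⟩
  · have hd : ∀ v, fderiv ℝ (fun y => Complex.exp (f y)) y v = Complex.exp (f y) * fderiv ℝ f y v := by
      intro v
      have := (hf.differentiable (by simp) y).hasFDerivAt.cexp
      rw [this.fderiv]; simp
    have hm := hξr.2 y hy
    rw [hWr.proj_fderiv_cact hcs.contDiffOn hξr hy, hWr.proj_fderiv_cact hcs.contDiffOn hξr hy,
      ← hαξ _ y (hrD hy), ← hαξ _ y (hrD hy), hd, hd, ← hWr.cact_mul hy _ _ hm,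
      ← hWr.cact_mul hy _ _ hm, ← cact_add_left, ← cact_add_left, ← cact_I (J y) (cact _ _ _),
      ← hWr.cact_mul hy _ _ hm]
    congr 1
    have := hfg y hy
    rw [dbarOp] at this
    linear_combination (-Complex.I * Complex.exp (f y)) * this + Complex.exp (f y) * (fderiv ℝ f y Complex.I + α Complex.I y) * Complex.I_mul_I
  · have h1 := hWr.coef_cact hy (Complex.exp (f y)) (hξr.2 y hy) (h0 y (hrD hy))
    rw [show cact (J y) (Complex.exp (f y)) (ξ y) = 0 from h] at h1
    apply Complex.exp_ne_zero (f y)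
    rw [← h1]
    apply Complex.ext <;> simp [coef]

/-- In a holomorphic frame the connection coefficients in the directions `1` and `i` are `c` and `i
c`, so the derivatives of `log h` are `2 Re c` and `-2 Im c`. Differentiating again gives half the
`Jℓ`-coefficient of the curvature. The constant `a` drops out and may carry the sign of the metric.
-/
theorem ddbar_log {ℓ : ℂ → V} (hℓ : IsHolSec D W p J ℓ) (h0 : ∀ w ∈ D, ℓ w ≠ 0) (hw : w ∈ D)
    {h : ℂ → ℝ} {a : ℝ} (ha : a ≠ 0) (hh : ∀ w ∈ D, h w = a * G (ℓ w) (ℓ w)) :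
    ddbar (fun w => Real.log (h w)) w =
      G (p w (fderiv ℝ (fun w => p w (fderiv ℝ ℓ w Complex.I)) w 1) -
        p w (fderiv ℝ (fun w => p w (fderiv ℝ ℓ w 1)) w Complex.I)) (J w (ℓ w)) /
        (2 * G (ℓ w) (ℓ w)) := by
  have hne : ∀ w ∈ D, G (ℓ w) (ℓ w) ≠ 0 := fun w hw => hW.ne_zero hw (hℓ.1.2 w hw) (h0 w hw)
  set c : ℂ → ℂ := fun w => coef G (J w) (ℓ w) (p w (fderiv ℝ ℓ w 1)) with hc
  have hcs : ContDiffOn ℝ ∞ c D := contDiffOn_coef hW.smooth_rot hℓ.1.1 (hW.isSec_nabla hℓ.1 1).1 hne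
  have hcd := ContDiffOn.differentiableAt_of_isOpen hcs hW.isOpen hw
  have hc1 : ∀ w ∈ D, p w (fderiv ℝ ℓ w 1) = cact (J w) (c w) (ℓ w) := fun w hw =>
    (hW.cact_coef hw (hℓ.1.2 w hw) (h0 w hw) ((hW.proj w hw).mem _)).symm
  have hc2 : ∀ w ∈ D, p w (fderiv ℝ ℓ w Complex.I) = cact (J w) (Complex.I * c w) (ℓ w) :=
    fun w hw => by
      rw [hℓ.2 w hw, hc1 w hw, hW.cact_mul hw _ _ (hℓ.1.2 w hw), cact_I]
  have hJo : ∀ w ∈ D, G (J w (ℓ w)) (ℓ w) = 0 := fun w hw => (hW.rot w hw).orth hW.symm _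
  have hlog : ∀ w ∈ D, ∀ v d, p w (fderiv ℝ ℓ w v) = cact (J w) d (ℓ w) →
      fderiv ℝ (fun w => Real.log (h w)) w v = 2 * d.re := by
    intro w hw v d hd
    have hℓd := ContDiffOn.differentiableAt_of_isOpen hℓ.1.1 hW.isOpen hw
    have hne' := hne w hw
    have e1 : fderiv ℝ h w v = a * (2 * d.re * G (ℓ w) (ℓ w)) := by
      rw [fderiv_eq_of_eqOn hW.isOpen hw hh]
      have hGd : DifferentiableAt ℝ (fun w => G (ℓ w) (ℓ w)) w :=
        (G.differentiableAt.comp w hℓd).clm_apply hℓd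
      rw [fderiv_const_mul hGd, smul_apply, fderiv_gform hℓd hℓd, hW.symm (ℓ w),
        ← hW.gform_proj hw _ (hℓ.1.2 w hw), hd,
        show G (cact (J w) d (ℓ w)) (ℓ w) = d.re * G (ℓ w) (ℓ w) by simp [cact, hJo w hw]]
      ring
    have hhd : DifferentiableAt ℝ h w := by
      refine DifferentiableAt.congr_of_eventuallyEq (f := fun w => a * G (ℓ w) (ℓ w)) ?_ ?_
      · exact ((G.differentiableAt.comp w hℓd).clm_apply hℓd).const_mul a
      · filter_upwards [hW.isOpen.mem_nhds hw] with y hy using hh y hy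
    rw [fderiv.log hhd (by rw [hh w hw]; exact mul_ne_zero ha hne'), smul_apply, e1, hh w hw,
      smul_eq_mul]
    field_simp
  have hl1 : EqOn (fun w => fderiv ℝ (fun w => Real.log (h w)) w 1) (fun w => 2 * (c w).re) D :=
    fun y hy => hlog y hy 1 _ (hc1 y hy)
  have hl2 : EqOn (fun w => fderiv ℝ (fun w => Real.log (h w)) w Complex.I)
      (fun w => -2 * (c w).im) D := fun y hy => by
    simp only
    rw [hlog y hy Complex.I _ (hc2 y hy)]; simp
  have hre : HasFDerivAt (fun w => 2 * (c w).re) ((2 : ℝ) • (Complex.reCLM.comp (fderiv ℝ c w))) w := by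
    simpa using (Complex.reCLM.hasFDerivAt.comp w hcd.hasFDerivAt).const_mul 2
  have him : HasFDerivAt (fun w => -2 * (c w).im) ((-2 : ℝ) • (Complex.imCLM.comp (fderiv ℝ c w))) w := by
    exact (Complex.imCLM.hasFDerivAt.comp w hcd.hasFDerivAt).const_mul (-2)
  have hm := hℓ.1.2 w hw
  rw [ddbar, fderiv_eq_of_eqOn hW.isOpen hw hl1, fderiv_eq_of_eqOn hW.isOpen hw hl2, hre.fderiv,
    him.fderiv]
  have e3 : p w (fderiv ℝ (fun w => p w (fderiv ℝ ℓ w Complex.I)) w 1) -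
        p w (fderiv ℝ (fun w => p w (fderiv ℝ ℓ w 1)) w Complex.I) =
      cact (J w) (Complex.I * fderiv ℝ c w 1 - fderiv ℝ c w Complex.I) (ℓ w) := by
    have hIc : ContDiffOn ℝ ∞ (fun w => Complex.I * c w) D := contDiffOn_const.mul hcs
    rw [fderiv_eq_of_eqOn hW.isOpen hw hc1, fderiv_eq_of_eqOn hW.isOpen hw hc2,
      hW.proj_fderiv_cact hIc hℓ.1 hw, hW.proj_fderiv_cact hcs hℓ.1 hw, hc1 w hw, hc2 w hw,
      ← hW.cact_mul hw _ _ hm, ← hW.cact_mul hw _ _ hm, fderiv_const_mul hcd]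
    rw [show c w * (Complex.I * c w) = Complex.I * c w * c w by ring, add_sub_add_right_eq_sub]
    simp only [cact, smul_apply, smul_eq_mul, Complex.sub_re, Complex.sub_im]
    module
  rw [e3]
  have hne' := hne w hw
  simp only [cact, map_add, map_smul, add_apply, smul_apply, smul_eq_mul,
    (hW.rot w hw).isometry (hW.apply_of_mem hw hm), hW.symm (ℓ w) (J w (ℓ w)), hJo w hw]
  simp
  field_simp
  ring

end RotBundle

end Bundles


-- Frenet data: components of the curvature identity.

section Frenet

variable {V : Type*} [NormedAddCommGroup V] [NormedSpace ℝ V]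

/-- The data of an isotropic `𝐏`-alternating surface in a parameter domain `D ⊆ ℂ`: a sequence of
mutually orthogonal plane bundles in a fixed vector space, with the structure equations of the
space form, `θ₁`, `θ₂` being the images of the coordinate vectors. -/
structure FrenetData (G : V →L[ℝ] V →L[ℝ] ℝ) (P : V →L[ℝ] V) (m : ℕ) (D : Set ℂ)
    (W : ℕ → ℂ → Submodule ℝ V) (p : ℕ → ℂ → V →L[ℝ] V) (θ₁ θ₂ : ℂ → V) : Prop where
  bundle : ∀ i ∈ Icc 1 (2 * m), PlaneBundle G ((-1) ^ (i + 1)) D (W i) (p i)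
  orth : ∀ i ∈ Icc 1 (2 * m), ∀ j ∈ Icc 1 (2 * m), i ≠ j → ∀ w ∈ D, ∀ A ∈ W i w, ∀ B ∈ W j w,
    G A B = 0
  tri : ∀ i ∈ Icc 1 (2 * m), ∀ j ∈ Icc 1 (2 * m), (i + 2 ≤ j ∨ j + 2 ≤ i) → ∀ w ∈ D, ∀ v,
    ∀ ξ ∈ W j w, p i w ((fderiv ℝ (p j) w v) ξ) = 0
  P_mem : ∀ i ∈ Icc 1 (2 * m), ∀ w ∈ D, ∀ A ∈ W i w, P A ∈ W (2 * m + 1 - i) w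
  sec₁ : IsSec D (W 1) θ₁
  sec₂ : IsSec D (W 1) θ₂
  torsion : ∀ k ∈ Icc 1 (2 * m), ∀ w ∈ D,
    p k w (fderiv ℝ θ₂ w 1) = p k w (fderiv ℝ θ₁ w Complex.I)
  curv : ∀ j ∈ Icc 1 (2 * m), ∀ ν, IsSec D (W j) ν → ∀ k ∈ Icc 1 (2 * m), ∀ w ∈ D,
    ∑ i ∈ Finset.Icc 1 (2 * m), p k w (fderiv ℝ (fun w => p i w (fderiv ℝ ν w Complex.I)) w 1 -
      fderiv ℝ (fun w => p i w (fderiv ℝ ν w 1)) w Complex.I) =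
    p k w (-G (ν w) (θ₂ w) • θ₁ w + G (ν w) (P (θ₂ w)) • P (θ₁ w) + G (ν w) (θ₁ w) • θ₂ w -
      G (ν w) (P (θ₁ w)) • P (θ₂ w))

namespace FrenetData

variable {G : V →L[ℝ] V →L[ℝ] ℝ} {P : V →L[ℝ] V} {m : ℕ} {D : Set ℂ}
  {W : ℕ → ℂ → Submodule ℝ V} {p : ℕ → ℂ → V →L[ℝ] V} {θ₁ θ₂ : ℂ → V}
  (h : FrenetData G P m D W p θ₁ θ₂) {i j k : ℕ} {w : ℂ} {ν : ℂ → V}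
include h

theorem proj_eq_zero (hi : i ∈ Icc 1 (2 * m)) (hj : j ∈ Icc 1 (2 * m)) (hij : i ≠ j) (hw : w ∈ D)
    {A : V} (hA : A ∈ W j w) : p i w A = 0 := by
  refine (h.bundle i hi).eq_zero_of_orth hw (((h.bundle i hi).proj w hw).mem A) fun C hC => ?_
  rw [(h.bundle i hi).gform_proj hw _ hC, h.orth j hj i hi hij.symm w hw A hA C hC]

/-- Off the diagonal, the components of the derivative of a section are tensorial. -/
theorem proj_fderiv (hi : i ∈ Icc 1 (2 * m)) (hj : j ∈ Icc 1 (2 * m)) (hij : i ≠ j) (hw : w ∈ D)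
    (hν : IsSec D (W j) ν) (v : ℂ) :
    p i w (fderiv ℝ ν w v) = p i w ((fderiv ℝ (p j) w v) (ν w)) := by
  rw [(h.bundle j hj).fderiv_section hν hw v, map_add,
    h.proj_eq_zero hi hj hij hw (((h.bundle j hj).proj w hw).mem _), add_zero]

/-- Differentiate the orthogonality of the projections of fixed vectors to the two planes. -/
theorem adjoint (hi : i ∈ Icc 1 (2 * m)) (hj : j ∈ Icc 1 (2 * m)) (hij : i ≠ j) (hw : w ∈ D)
    {ξ ζ : V} (hξ : ξ ∈ W i w) (hζ : ζ ∈ W j w) (v : ℂ) :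
    G (p j w ((fderiv ℝ (p i) w v) ξ)) ζ = -G ξ (p i w ((fderiv ℝ (p j) w v) ζ)) := by
  have bi := h.bundle i hi
  have bj := h.bundle j hj
  have hdi := ContDiffOn.differentiableAt_of_isOpen bi.smooth bi.isOpen hw
  have hdj := ContDiffOn.differentiableAt_of_isOpen bj.smooth bi.isOpen hw
  have hc : ∀ x : V, DifferentiableAt ℝ (fun _ : ℂ => x) w := fun x => differentiableAt_const x
  have h1 : EqOn (fun w => G (p i w ξ) (p j w ζ)) (fun _ => 0) D := fun y hy =>
    h.orth i hi j hj hij y hy _ ((bi.proj y hy).mem _) _ ((bj.proj y hy).mem _)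
  have h2 := congrArg (fun L => L v) (fderiv_eq_of_eqOn bi.isOpen hw h1)
  rw [fderiv_gform (hdi.clm_apply (hc ξ)) (hdj.clm_apply (hc ζ)),
    fderiv_family_apply hdi (hc ξ), fderiv_family_apply hdj (hc ζ), bi.apply_of_mem hw hξ,
    bj.apply_of_mem hw hζ] at h2
  simp at h2
  rw [bj.gform_proj hw _ hζ, bi.symm ξ, bi.gform_proj hw _ hξ, bi.symm _ ξ]
  linarith

theorem isSec_comp (hi : i ∈ Icc 1 (2 * m)) (hν : IsSec D (W j) ν)
    (v : ℂ) : IsSec D (W i) (fun w => p i w (fderiv ℝ ν w v)) :=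
  (h.bundle i hi).isSec_proj (ContDiffOn.fderiv_dir hν.1 (h.bundle i hi).isOpen v)

/-- The term describes a path from `j` through `i` to `k`; it vanishes as soon as one of its two
steps is longer than one. -/
theorem curv_term_eq_zero (hj : j ∈ Icc 1 (2 * m)) (hν : IsSec D (W j) ν)
    (hk : k ∈ Icc 1 (2 * m)) (hi : i ∈ Icc 1 (2 * m)) (hw : w ∈ D)
    (hijk : i + 2 ≤ j ∨ j + 2 ≤ i ∨ i + 2 ≤ k ∨ k + 2 ≤ i) (v v' : ℂ) :
    p k w (fderiv ℝ (fun w => p i w (fderiv ℝ ν w v)) w v') = 0 := by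
  by_cases hij : i + 2 ≤ j ∨ j + 2 ≤ i
  · have : EqOn (fun w => p i w (fderiv ℝ ν w v)) (fun _ => 0) D := fun y hy => by
      simp only
      rw [h.proj_fderiv hi hj (by omega) hy hν, h.tri i hi j hj hij y hy v _ (hν.2 y hy)]
    rw [fderiv_eq_of_eqOn (h.bundle i hi).isOpen hw this]
    simp
  · have hs := h.isSec_comp hi hν v
    rw [h.proj_fderiv hk hi (by omega) hw hs, h.tri k hk i hi (by omega) w hw v' _ (hs.2 w hw)]

/-- The terms of the curvature with `P` pair the section with `P(W 1)`, contained in `W (2m)`, hence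
vanish for the other planes. -/
theorem curv_eq (hj : j ∈ Icc 1 (2 * m)) (hj' : j ≠ 2 * m) (hν : IsSec D (W j) ν)
    (hk : k ∈ Icc 1 (2 * m)) (hw : w ∈ D) :
    ∑ i ∈ Finset.Icc 1 (2 * m), p k w (fderiv ℝ (fun w => p i w (fderiv ℝ ν w Complex.I)) w 1 -
      fderiv ℝ (fun w => p i w (fderiv ℝ ν w 1)) w Complex.I) =
    p k w (G (ν w) (θ₁ w) • θ₂ w - G (ν w) (θ₂ w) • θ₁ w) := by
  rw [h.curv j hj ν hν k hk w hw]
  have h1 : (1 : ℕ) ∈ Icc 1 (2 * m) := ⟨le_rfl, le_trans hj.1 hj.2⟩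
  have h2 : 2 * m ∈ Icc 1 (2 * m) := ⟨le_trans hj.1 hj.2, le_rfl⟩
  have e : ∀ θ ∈ W 1 w, G (ν w) (P θ) = 0 := fun θ hθ => by
    have := h.P_mem 1 h1 w hw θ hθ
    rw [show 2 * m + 1 - 1 = 2 * m by omega] at this
    exact h.orth j hj _ h2 hj' w hw _ (hν.2 w hw) _ this
  rw [e _ (h.sec₁.2 w hw), e _ (h.sec₂.2 w hw)]
  congr 1
  module

theorem curv_rhs_eq_zero (hj : j ∈ Icc 1 (2 * m)) (hν : IsSec D (W j) ν)
    (hk : k ∈ Icc 1 (2 * m)) (hjk : j ≠ 1 ∨ k ≠ 1) (hw : w ∈ D) :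
    p k w (G (ν w) (θ₁ w) • θ₂ w - G (ν w) (θ₂ w) • θ₁ w) = 0 := by
  have h1 : (1 : ℕ) ∈ Icc 1 (2 * m) := ⟨le_rfl, le_trans hj.1 hj.2⟩
  rcases hjk with hj1 | hk1
  · rw [h.orth j hj 1 h1 hj1 w hw _ (hν.2 w hw) _ (h.sec₁.2 w hw),
      h.orth j hj 1 h1 hj1 w hw _ (hν.2 w hw) _ (h.sec₂.2 w hw)]
    simp
  · rw [map_sub, map_smul, map_smul, h.proj_eq_zero hk h1 hk1 hw (h.sec₁.2 w hw),
      h.proj_eq_zero hk h1 hk1 hw (h.sec₂.2 w hw)]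
    simp

/-- The Codazzi equation. -/
theorem codazzi (hj : 1 ≤ j) (hj' : j + 1 ≤ 2 * m) (hν : IsSec D (W j) ν) (hw : w ∈ D) :
    (p (j + 1) w ((fderiv ℝ (p j) w 1) (p j w (fderiv ℝ ν w Complex.I))) -
      p (j + 1) w ((fderiv ℝ (p j) w Complex.I) (p j w (fderiv ℝ ν w 1)))) +
    (p (j + 1) w (fderiv ℝ (fun w => p (j + 1) w ((fderiv ℝ (p j) w Complex.I) (ν w))) w 1) -
      p (j + 1) w (fderiv ℝ (fun w => p (j + 1) w ((fderiv ℝ (p j) w 1) (ν w))) w Complex.I)) =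
    0 := by
  have mj : j ∈ Icc 1 (2 * m) := ⟨hj, by omega⟩
  have mk : j + 1 ∈ Icc 1 (2 * m) := ⟨by omega, hj'⟩
  have hc := h.curv_eq mj (by omega) hν mk hw
  rw [h.curv_rhs_eq_zero mj hν mk (by omega) hw] at hc
  -- Only these two indices lie within one step of both `j` and `j + 1`.
  rw [← Finset.sum_subset (s₁ := {j, j + 1})
    (by intro x hx; simp at hx; rw [Finset.mem_Icc]; rcases hx with rfl | rfl <;> omega)
    (by
      intro i hi hi'
      rw [Finset.mem_Icc] at hi
      simp at hi'
      rw [map_sub, h.curv_term_eq_zero mj hν mk hi hw (by omega),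
        h.curv_term_eq_zero mj hν mk hi hw (by omega), sub_zero]),
    Finset.sum_pair (by omega), map_sub, map_sub] at hc
  have e1 : ∀ v v', p (j + 1) w (fderiv ℝ (fun w => p j w (fderiv ℝ ν w v)) w v') =
      p (j + 1) w ((fderiv ℝ (p j) w v') (p j w (fderiv ℝ ν w v))) := fun v v' =>
    h.proj_fderiv mk mj (by omega) hw (h.isSec_comp mj hν v) v'
  have e2 : ∀ v, fderiv ℝ (fun w => p (j + 1) w (fderiv ℝ ν w v)) w =
      fderiv ℝ (fun w => p (j + 1) w ((fderiv ℝ (p j) w v) (ν w))) w := fun v =>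
    fderiv_eq_of_eqOn (h.bundle j mj).isOpen hw fun y hy => h.proj_fderiv mk mj (by omega) hy hν v
  rw [e1, e1, e2, e2] at hc
  exact hc

/-- `η_{j+2} ∧ η_{j+1} = 0`. -/
theorem wedge (hj : 1 ≤ j) (hj' : j + 2 ≤ 2 * m) {ξ : V} (hξ : ξ ∈ W j w) (hw : w ∈ D) :
    p (j + 2) w ((fderiv ℝ (p (j + 1)) w 1) (p (j + 1) w ((fderiv ℝ (p j) w Complex.I) ξ))) =
    p (j + 2) w ((fderiv ℝ (p (j + 1)) w Complex.I) (p (j + 1) w ((fderiv ℝ (p j) w 1) ξ))) := by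
  have mj : j ∈ Icc 1 (2 * m) := ⟨hj, by omega⟩
  have mk : j + 1 ∈ Icc 1 (2 * m) := ⟨by omega, by omega⟩
  have ml : j + 2 ∈ Icc 1 (2 * m) := ⟨by omega, by omega⟩
  set ν : ℂ → V := fun w => p j w ξ with hνd
  have hν : IsSec D (W j) ν := (h.bundle j mj).isSec_proj contDiffOn_const
  have hνw : ν w = ξ := (h.bundle j mj).apply_of_mem hw hξ
  have hc := h.curv_eq mj (by omega) hν ml hw
  rw [h.curv_rhs_eq_zero mj hν ml (by omega) hw] at hc
  -- The only path from `j` to `j + 2` in two short steps passes through `j + 1`.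
  rw [Finset.sum_eq_single_of_mem (j + 1) (by rw [Finset.mem_Icc]; omega)
    (by
      intro i hi hi'
      rw [Finset.mem_Icc] at hi
      rw [map_sub, h.curv_term_eq_zero mj hν ml hi hw (by omega),
        h.curv_term_eq_zero mj hν ml hi hw (by omega), sub_zero]),
    map_sub, h.proj_fderiv ml mk (by omega) hw (h.isSec_comp mk hν _),
    h.proj_fderiv ml mk (by omega) hw (h.isSec_comp mk hν _),
    h.proj_fderiv mk mj (by omega) hw hν, h.proj_fderiv mk mj (by omega) hw hν, hνw,
    sub_eq_zero] at hc
  exact hc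

theorem isSec_sff (hj : j ∈ Icc 1 (2 * m)) (hi : i ∈ Icc 1 (2 * m)) (hν : IsSec D (W j) ν)
    (v : ℂ) : IsSec D (W i) (fun w => p i w ((fderiv ℝ (p j) w v) (ν w))) :=
  (h.bundle i hi).isSec_proj
    ((ContDiffOn.fderiv_dir (h.bundle j hj).smooth (h.bundle j hj).isOpen v).clm_apply hν.1)

/-- A `(1,0)`-form with complex linear values maps holomorphic sections to holomorphic sections. -/
theorem isHolSec_sff (hj : 1 ≤ j) (hj' : j + 1 ≤ 2 * m) {ε' : ℝ} {J J' : ℂ → V →L[ℝ] V}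
    (hJ' : RotBundle G ε' D (W (j + 1)) (p (j + 1)) J')
    (hlin : ∀ w ∈ D, ∀ ξ ∈ W j w, p (j + 1) w ((fderiv ℝ (p j) w 1) (J w ξ)) =
      J' w (p (j + 1) w ((fderiv ℝ (p j) w 1) ξ)))
    (hone : ∀ w ∈ D, ∀ ξ ∈ W j w, p (j + 1) w ((fderiv ℝ (p j) w Complex.I) ξ) =
      J' w (p (j + 1) w ((fderiv ℝ (p j) w 1) ξ)))
    (hν : IsHolSec D (W j) (p j) J ν) :
    IsHolSec D (W (j + 1)) (p (j + 1)) J' (fun w => p (j + 1) w ((fderiv ℝ (p j) w 1) (ν w))) := by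
  have mj : j ∈ Icc 1 (2 * m) := ⟨hj, by omega⟩
  have mk : j + 1 ∈ Icc 1 (2 * m) := ⟨by omega, hj'⟩
  have hs := h.isSec_sff mj mk hν.1 1
  refine ⟨hs, fun w hw => ?_⟩
  have hc := h.codazzi hj hj' hν.1 hw
  have hm := ((h.bundle j mj).proj w hw).mem (fderiv ℝ ν w 1)
  rw [hν.2 w hw, hlin w hw _ hm, hone w hw _ hm, sub_self, zero_add, sub_eq_zero,
    fderiv_eq_of_eqOn (h.bundle j mj).isOpen hw
      (fun y hy => hone y hy (ν y) (hν.1.2 y hy) : EqOn _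
        (fun w => J' w (p (j + 1) w ((fderiv ℝ (p j) w 1) (ν w)))) D),
    hJ'.proj_fderiv_rot_apply hs hw] at hc
  exact hc.symm

end FrenetData

end Frenet


-- Linear and antilinear parts of the `η`, and unique continuation for them.

section Orientation

variable {V : Type*} [NormedAddCommGroup V] [NormedSpace ℝ V]

namespace FrenetData

variable {G : V →L[ℝ] V →L[ℝ] ℝ} {P : V →L[ℝ] V} {m : ℕ} {w₀ : ℂ} {r : ℝ}
  {W : ℕ → ℂ → Submodule ℝ V} {p : ℕ → ℂ → V →L[ℝ] V} {θ₁ θ₂ : ℂ → V}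
  (h : FrenetData G P m (Metric.ball w₀ r) W p θ₁ θ₂) {j : ℕ} {ε ε' : ℝ} {J J' : ℂ → V →L[ℝ] V}
include h

/-- The part of `η_{j+1}` of a given complex type has the unique continuation property. -/
theorem sff_unique_continuation (hj : 1 ≤ j) (hj' : j + 1 ≤ 2 * m)
    (hJ : RotBundle G ε (Metric.ball w₀ r) (W j) (p j) J)
    (hJ' : RotBundle G ε' (Metric.ball w₀ r) (W (j + 1)) (p (j + 1)) J')
    {κ : ℂ → ℂ} (hκ : ContDiffOn ℝ ∞ κ (Metric.ball w₀ r))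
    (hκ0 : ∀ w ∈ Metric.ball w₀ r, (κ w).im ≠ 0)
    (hone : ∀ w ∈ Metric.ball w₀ r, ∀ ξ ∈ W j w, p (j + 1) w ((fderiv ℝ (p j) w Complex.I) ξ) =
      p (j + 1) w ((fderiv ℝ (p j) w 1) (cact (J w) (κ w) ξ)))
    {ξ e : ℂ → V} (hξ : IsSec (Metric.ball w₀ r) (W j) ξ) (hξ0 : ∀ w ∈ Metric.ball w₀ r, ξ w ≠ 0)
    (he : IsSec (Metric.ball w₀ r) (W (j + 1)) e) (he0 : ∀ w ∈ Metric.ball w₀ r, e w ≠ 0)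
    {O : Set ℂ} (hO : IsOpen O) (hOn : (O ∩ Metric.ball w₀ r).Nonempty)
    (hv : ∀ w ∈ O ∩ Metric.ball w₀ r, p (j + 1) w ((fderiv ℝ (p j) w 1) (J w (ξ w))) =
      J' w (p (j + 1) w ((fderiv ℝ (p j) w 1) (ξ w)))) :
    ∀ w ∈ Metric.ball w₀ r, p (j + 1) w ((fderiv ℝ (p j) w 1) (J w (ξ w))) =
      J' w (p (j + 1) w ((fderiv ℝ (p j) w 1) (ξ w))) := by
  set D := Metric.ball w₀ r with hD
  have hDo : IsOpen D := Metric.isOpen_ball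
  have mj : j ∈ Icc 1 (2 * m) := ⟨hj, by omega⟩
  have mk : j + 1 ∈ Icc 1 (2 * m) := ⟨by omega, hj'⟩
  set B : ℂ → V →L[ℝ] V := fun w => (p (j + 1) w).comp (fderiv ℝ (p j) w 1) with hB
  have hBa : ∀ w A, p (j + 1) w ((fderiv ℝ (p j) w 1) A) = B w A := fun _ _ => rfl
  simp only [hBa] at hv hone ⊢
  have hJξ : IsSec D (W j) (fun w => J w (ξ w)) := hJ.isSec_rot hξ.1
  have hBs : ∀ {ν : ℂ → V}, IsSec D (W j) ν → IsSec D (W (j + 1)) (fun w => B w (ν w)) :=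
    fun hν => h.isSec_sff mj mk hν 1
  set a : ℂ → V := fun w => B w (ξ w) with ha
  set b : ℂ → V := fun w => B w (J w (ξ w)) with hb
  have sa : IsSec D (W (j + 1)) a := hBs hξ
  have sb : IsSec D (W (j + 1)) b := hBs hJξ
  -- The obstruction to complex linearity on `ξ`: up to a nonzero factor, the antilinear part of
  -- `η_{j+1}`.
  set v : ℂ → V := fun w => b w - J' w (a w) with hvd
  have sJa : IsSec D (W (j + 1)) (fun w => J' w (a w)) := hJ'.isSec_rot sa.1
  have sv : IsSec D (W (j + 1)) v := ⟨sb.1.sub sJa.1, fun w hw => (W (j + 1) w).sub_mem (sb.2 w hw) (sJa.2 w hw)⟩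
  -- `ρ` measures how far `ξ` is from being holomorphic in the parameter with coefficient `κ`. It
  -- enters the equation for `v` only at order zero.
  set ρ : ℂ → ℂ := fun w => coef G (J w) (ξ w) (p j w (fderiv ℝ ξ w Complex.I) -
    cact (J w) (κ w) (p j w (fderiv ℝ ξ w 1))) with hρ
  have n1 := hJ.isSec_nabla hξ 1
  have nI := hJ.isSec_nabla hξ Complex.I
  have ρs : ContDiffOn ℝ ∞ ρ D := contDiffOn_coef hJ.smooth_rot hξ.1
    (nI.1.sub (contDiffOn_cact hJ.smooth_rot hκ n1.1)) fun w hw => hJ.ne_zero hw (hξ.2 w hw) (hξ0 w hw)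
  have hρξ : ∀ w ∈ D, p j w (fderiv ℝ ξ w Complex.I) = cact (J w) (κ w) (p j w (fderiv ℝ ξ w 1)) +
      cact (J w) (ρ w) (ξ w) := fun w hw => by
    rw [hJ.cact_coef hw (hξ.2 w hw) (hξ0 w hw) ((W j w).sub_mem (nI.2 w hw)
      (hJ.cact_mem hw _ (n1.2 w hw)))]
    abel
  -- the equation for `v`
  have key : ∀ w ∈ D, p (j + 1) w (fderiv ℝ v w Complex.I) =
      p (j + 1) w (fderiv ℝ (fun w => cact (J' w) ((starRingEnd ℂ) (κ w)) (v w)) w 1) +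
        cact (J' w) ((starRingEnd ℂ) (ρ w)) (v w) := by
    intro w hw
    have cκ1 : ContDiffOn ℝ ∞ (fun w => (κ w).re) D := Complex.reCLM.contDiff.comp_contDiffOn hκ
    have cκ2 : ContDiffOn ℝ ∞ (fun w => (κ w).im) D := Complex.imCLM.contDiff.comp_contDiffOn hκ
    -- `c` and `d` are the values of `η_{j+1}` in the direction `i` on `ξ` and `Jξ`. Codazzi for
    -- these two sections combines into one equation, with `κ` conjugated because `v` depends
    -- antilinearly on `ξ`.
    set c : ℂ → V := fun w => (κ w).re • a w + (κ w).im • b w with hcd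
    set d : ℂ → V := fun w => (κ w).re • b w - (κ w).im • a w with hdd
    have sc : IsSec D (W (j + 1)) c := ⟨(cκ1.smul sa.1).add (cκ2.smul sb.1), fun w hw =>
      (W (j + 1) w).add_mem ((W (j + 1) w).smul_mem _ (sa.2 w hw)) ((W (j + 1) w).smul_mem _ (sb.2 w hw))⟩
    have sd : IsSec D (W (j + 1)) d := ⟨(cκ1.smul sb.1).sub (cκ2.smul sa.1), fun w hw =>
      (W (j + 1) w).sub_mem ((W (j + 1) w).smul_mem _ (sb.2 w hw)) ((W (j + 1) w).smul_mem _ (sa.2 w hw))⟩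
    have sJc : IsSec D (W (j + 1)) (fun w => J' w (c w)) := hJ'.isSec_rot sc.1
    have hc : EqOn (fun w => p (j + 1) w ((fderiv ℝ (p j) w Complex.I) (ξ w))) c D := fun y hy => by
      simp only
      rw [hone y hy _ (hξ.2 y hy)]
      simp [cact, hcd, ha, hb]
    have hd : EqOn (fun w => p (j + 1) w ((fderiv ℝ (p j) w Complex.I) (J w (ξ w)))) d D := fun y hy => by
      simp only
      rw [hone y hy _ (hJξ.2 y hy)]
      simp [cact, hdd, ha, hb, hJ.sq hy (hξ.2 y hy)]
      abel
    have c1 := h.codazzi hj hj' hξ hw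
    have c2 := h.codazzi hj hj' hJξ hw
    have hm := hξ.2 w hw
    simp only [hBa] at c1 c2
    rw [hone w hw _ (n1.2 w hw), ← map_sub, hρξ w hw, add_sub_cancel_left,
      fderiv_eq_of_eqOn hDo hw hc] at c1
    have nJ1 : p j w (fderiv ℝ (fun w => J w (ξ w)) w 1) ∈ W j w := (hJ.isSec_nabla hJξ 1).2 w hw
    rw [hone w hw _ nJ1, ← map_sub, hJ.proj_fderiv_rot_apply hξ hw,
      hJ.proj_fderiv_rot_apply hξ hw, hρξ w hw, map_add,
      show cact (J w) (κ w) (J w (p j w (fderiv ℝ ξ w 1))) =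
        J w (cact (J w) (κ w) (p j w (fderiv ℝ ξ w 1))) by simp [cact], add_sub_cancel_left,
      fderiv_eq_of_eqOn hDo hw hd] at c2
    have r1 : B w (cact (J w) (ρ w) (ξ w)) = (ρ w).re • a w + (ρ w).im • b w := by
      simp [cact, ha, hb]
    have r2 : B w (J w (cact (J w) (ρ w) (ξ w))) = (ρ w).re • b w - (ρ w).im • a w := by
      simp [cact, ha, hb, hJ.sq hw hm]
      abel
    rw [r1] at c1
    rw [r2] at c2
    have dif : ∀ {ν : ℂ → V}, IsSec D (W (j + 1)) ν → DifferentiableAt ℝ ν w := fun hν =>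
      ContDiffOn.differentiableAt_of_isOpen hν.1 hDo hw
    have e1 : p (j + 1) w (fderiv ℝ v w Complex.I) = p (j + 1) w (fderiv ℝ b w Complex.I) -
        J' w (p (j + 1) w (fderiv ℝ a w Complex.I)) := by
      rw [← hJ'.proj_fderiv_rot_apply sa hw, ← map_sub, hvd, fderiv_fun_sub (dif sb) (dif sJa)]
      rfl
    have e2 : EqOn (fun w => cact (J' w) ((starRingEnd ℂ) (κ w)) (v w))
        (fun w => d w - J' w (c w)) D := fun y hy => by
      simp only [cact, hvd, hcd, hdd, map_sub, map_add, map_smul, hJ'.sq hy (sa.2 y hy),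
        Complex.conj_re, Complex.conj_im]
      module
    have e3 : p (j + 1) w (fderiv ℝ (fun w => d w - J' w (c w)) w 1) =
        p (j + 1) w (fderiv ℝ d w 1) - J' w (p (j + 1) w (fderiv ℝ c w 1)) := by
      rw [← hJ'.proj_fderiv_rot_apply sc hw, ← map_sub, fderiv_fun_sub (dif sd) (dif sJc)]
      rfl
    rw [e1, fderiv_eq_of_eqOn hDo hw e2, e3]
    have c1' : p (j + 1) w (fderiv ℝ a w Complex.I) = (ρ w).re • a w + (ρ w).im • b w +
        p (j + 1) w (fderiv ℝ c w 1) := by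
      rw [← sub_eq_zero, ← neg_eq_zero, ← c1]; simp only [hb, ha]; module
    have c2' : p (j + 1) w (fderiv ℝ b w Complex.I) = (ρ w).re • b w - (ρ w).im • a w +
        p (j + 1) w (fderiv ℝ d w 1) := by
      rw [← sub_eq_zero, ← neg_eq_zero, ← c2]; simp only [hb, ha]; module
    rw [c1', c2']
    simp only [cact, hvd, map_sub, map_add, map_smul, hJ'.sq hw (sa.2 w hw), Complex.conj_re,
      Complex.conj_im]
    module
  -- the scalar equation
  set u : ℂ → ℂ := fun w => coef G (J' w) (e w) (v w) with hu
  set α : ℂ → ℂ → ℂ := fun x w => coef G (J' w) (e w) (p (j + 1) w (fderiv ℝ e w x)) with hα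
  have hne : ∀ w ∈ D, G (e w) (e w) ≠ 0 := fun w hw => hJ'.ne_zero hw (he.2 w hw) (he0 w hw)
  have us : ContDiffOn ℝ ∞ u D := contDiffOn_coef hJ'.smooth_rot he.1 sv.1 hne
  have αs : ∀ x, ContDiffOn ℝ ∞ (α x) D := fun x =>
    contDiffOn_coef hJ'.smooth_rot he.1 (hJ'.isSec_nabla he x).1 hne
  have huv : EqOn v (fun w => cact (J' w) (u w) (e w)) D := fun w hw =>
    (hJ'.cact_coef hw (he.2 w hw) (he0 w hw) (sv.2 w hw)).symm
  have hαe : ∀ x, ∀ w ∈ D, p (j + 1) w (fderiv ℝ e w x) = cact (J' w) (α x w) (e w) := fun x w hw =>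
    (hJ'.cact_coef hw (he.2 w hw) (he0 w hw) ((hJ'.isSec_nabla he x).2 w hw)).symm
  set κ' : ℂ → ℂ := fun w => (starRingEnd ℂ) (κ w) with hκ'
  have κs : ContDiffOn ℝ ∞ κ' D := Complex.conjCLE.contDiff.comp_contDiffOn hκ
  have κus : ContDiffOn ℝ ∞ (fun w => κ' w * u w) D := κs.mul us
  -- All contributions of order zero: the derivative of the coefficient, the connection form of the
  -- frame `e`, and `ρ`.
  set γ : ℂ → ℂ := fun w => fderiv ℝ κ' w 1 + κ' w * α 1 w + (starRingEnd ℂ) (ρ w) - α Complex.I w with hγ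
  have heq : ∀ w ∈ D, fderiv ℝ u w Complex.I = κ' w * fderiv ℝ u w 1 + γ w * u w := by
    intro w hw
    have k := key w hw
    have hm := he.2 w hw
    have e2 : EqOn (fun w => cact (J' w) (κ' w) (v w)) (fun w => cact (J' w) (κ' w * u w) (e w)) D :=
      fun y hy => by simp only; rw [huv hy, hJ'.cact_mul hy _ _ (he.2 y hy)]
    rw [fderiv_eq_of_eqOn hDo hw huv, fderiv_eq_of_eqOn hDo hw e2, hJ'.proj_fderiv_cact us he hw,
      hJ'.proj_fderiv_cact κus he hw, hαe _ w hw, hαe _ w hw, huv hw, ← hJ'.cact_mul hw _ _ hm,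
      ← hJ'.cact_mul hw _ _ hm, ← hJ'.cact_mul hw _ _ hm, ← cact_add_left, ← cact_add_left,
      ← cact_add_left] at k
    have k' := hJ'.cact_cancel hw hm (he0 w hw) k
    rw [fderiv_fun_mul (ContDiffOn.differentiableAt_of_isOpen κs hDo hw)
      (ContDiffOn.differentiableAt_of_isOpen us hDo hw)] at k'
    simp only [add_apply, smul_apply, smul_eq_mul] at k'
    rw [hγ]
    linear_combination k'
  have hz := unique_continuation_ball us κs (fun z hz => by simpa [hκ'] using hκ0 z hz)
    (γ := γ) ((((ContDiffOn.fderiv_dir κs hDo 1).continuousOn.add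
      (κs.continuousOn.mul (αs 1).continuousOn)).add
      (Complex.continuous_conj.comp_continuousOn ρs.continuousOn)).sub (αs _).continuousOn) heq
    (hO.inter hDo) (by rwa [inter_assoc, inter_self]) (fun z hz => by
      have : v z = 0 := sub_eq_zero.2 (hv z hz)
      apply Complex.ext <;> simp [hu, coef, this])
  intro w hw
  have := huv hw
  simp only [hz w hw] at this
  exact sub_eq_zero.1 (this.trans (by simp [cact]))

/-- Locally, one of the two orientations of `W (j+1)` makes `η_{j+1}` complex linear, and `η_{j+1}`
has the unique continuation property. -/
theorem exists_local_orientation (hj : 1 ≤ j) (hj' : j + 1 ≤ 2 * m)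
    (hJ : RotBundle G ε (Metric.ball w₀ r) (W j) (p j) J)
    (hJ' : RotBundle G ε' (Metric.ball w₀ r) (W (j + 1)) (p (j + 1)) J')
    {κ : ℂ → ℂ} (hκ : ContDiffOn ℝ ∞ κ (Metric.ball w₀ r))
    (hκ0 : ∀ w ∈ Metric.ball w₀ r, (κ w).im ≠ 0)
    (hone : ∀ w ∈ Metric.ball w₀ r, ∀ ξ ∈ W j w, p (j + 1) w ((fderiv ℝ (p j) w Complex.I) ξ) =
      p (j + 1) w ((fderiv ℝ (p j) w 1) (cact (J w) (κ w) ξ)))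
    {ξ e : ℂ → V} (hξ : IsSec (Metric.ball w₀ r) (W j) ξ) (hξ0 : ∀ w ∈ Metric.ball w₀ r, ξ w ≠ 0)
    (he : IsSec (Metric.ball w₀ r) (W (j + 1)) e) (he0 : ∀ w ∈ Metric.ball w₀ r, e w ≠ 0)
    (hconf : ∀ w ∈ Metric.ball w₀ r, p (j + 1) w ((fderiv ℝ (p j) w 1) (J w (ξ w))) =
        J' w (p (j + 1) w ((fderiv ℝ (p j) w 1) (ξ w))) ∨
      p (j + 1) w ((fderiv ℝ (p j) w 1) (J w (ξ w))) =
        -J' w (p (j + 1) w ((fderiv ℝ (p j) w 1) (ξ w)))) :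
    ∃ J'' : ℂ → V →L[ℝ] V, RotBundle G ε' (Metric.ball w₀ r) (W (j + 1)) (p (j + 1)) J'' ∧
      (J'' = J' ∨ J'' = fun w => -J' w) ∧
      (∀ w ∈ Metric.ball w₀ r, ∀ ζ ∈ W j w, p (j + 1) w ((fderiv ℝ (p j) w 1) (J w ζ)) =
        J'' w (p (j + 1) w ((fderiv ℝ (p j) w 1) ζ))) ∧
      ∀ O, IsOpen O → (O ∩ Metric.ball w₀ r).Nonempty →
        (∀ w ∈ O ∩ Metric.ball w₀ r, p (j + 1) w ((fderiv ℝ (p j) w 1) (ξ w)) = 0) →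
        ∀ w ∈ Metric.ball w₀ r, ∀ ζ ∈ W j w, p (j + 1) w ((fderiv ℝ (p j) w 1) ζ) = 0 := by
  have hDo : IsOpen (Metric.ball w₀ r) := Metric.isOpen_ball
  have mj : j ∈ Icc 1 (2 * m) := ⟨hj, by omega⟩
  have mk : j + 1 ∈ Icc 1 (2 * m) := ⟨by omega, hj'⟩
  have sa := h.isSec_sff mj mk hξ 1
  have sb := h.isSec_sff mj mk (hJ.isSec_rot hξ.1) 1
  obtain ⟨J'', hJ'', hJJ, hl⟩ : ∃ J'' : ℂ → V →L[ℝ] V,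
      RotBundle G ε' (Metric.ball w₀ r) (W (j + 1)) (p (j + 1)) J'' ∧
      (J'' = J' ∨ J'' = fun w => -J' w) ∧ ∀ w ∈ Metric.ball w₀ r,
      p (j + 1) w ((fderiv ℝ (p j) w 1) (J w (ξ w))) =
        J'' w (p (j + 1) w ((fderiv ℝ (p j) w 1) (ξ w))) := by
    -- If linearity fails somewhere it fails on an open set; there the conformal alternative gives
    -- linearity for `-J'`, and unique continuation spreads it to the disc.
    by_cases hall : ∀ w ∈ Metric.ball w₀ r, p (j + 1) w ((fderiv ℝ (p j) w 1) (J w (ξ w))) =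
        J' w (p (j + 1) w ((fderiv ℝ (p j) w 1) (ξ w)))
    · exact ⟨J', hJ', Or.inl rfl, hall⟩
    · push Not at hall
      obtain ⟨w₁, hw₁, hne⟩ := hall
      refine ⟨_, hJ'.neg, Or.inr rfl, ?_⟩
      have hcont : ContinuousOn (fun w => p (j + 1) w ((fderiv ℝ (p j) w 1) (J w (ξ w))) -
          J' w (p (j + 1) w ((fderiv ℝ (p j) w 1) (ξ w)))) (Metric.ball w₀ r) :=
        sb.1.continuousOn.sub (hJ'.smooth_rot.clm_apply sa.1).continuousOn
      have hopen := hcont.isOpen_inter_preimage hDo (isOpen_compl_singleton (x := (0 : V)))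
      refine h.sff_unique_continuation hj hj' hJ hJ'.neg hκ hκ0 hone hξ hξ0 he he0 hopen
        ⟨w₁, ⟨hw₁, sub_ne_zero.2 hne⟩, hw₁⟩ fun w hw => ?_
      exact (hconf w hw.2).resolve_left fun h' => hw.1.2 (sub_eq_zero.2 h')
  have hlin : ∀ w ∈ Metric.ball w₀ r, ∀ ζ ∈ W j w, p (j + 1) w ((fderiv ℝ (p j) w 1) (J w ζ)) =
        J'' w (p (j + 1) w ((fderiv ℝ (p j) w 1) ζ)) := by
    intro w hw ζ hζ
    rw [← hJ.cact_coef hw (hξ.2 w hw) (hξ0 w hw) hζ]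
    simp only [cact, map_add, map_smul, hl w hw, hJ.sq hw (hξ.2 w hw), map_neg,
      hJ''.sq hw (sa.2 w hw)]
  refine ⟨J'', hJ'', hJJ, hlin, fun O hO hOn h0 w hw ζ hζ => ?_⟩
  -- Where the form is zero it is antilinear as well as linear. Antilinearity continues to the disc,
  -- and a form of both kinds is zero.
  have h1 := h.sff_unique_continuation hj hj' hJ hJ''.neg hκ hκ0 hone hξ hξ0 he he0 hO hOn
    (fun w hw => by rw [hl w hw.2, h0 w hw]; simp) w hw
  have h2 := hl w hw
  rw [h1] at h2
  have h3 : J'' w (p (j + 1) w ((fderiv ℝ (p j) w 1) (ξ w))) = 0 := by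
    have : (2 : ℝ) • J'' w (p (j + 1) w ((fderiv ℝ (p j) w 1) (ξ w))) = 0 := by
      rw [two_smul]; nth_rewrite 1 [← h2]; simp
    simpa using this
  have h4 := hJ''.sq hw (sa.2 w hw)
  rw [h3, map_zero, eq_comm, neg_eq_zero] at h4
  rw [← hJ.cact_coef hw (hξ.2 w hw) (hξ0 w hw) hζ]
  simp only [cact, map_add, map_smul, hl w hw, h4, map_zero, smul_zero, add_zero]

end FrenetData

end Orientation


-- The Ricci equations.

section Ricci

variable {V : Type*} [NormedAddCommGroup V] [NormedSpace ℝ V]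

namespace FrenetData

variable {G : V →L[ℝ] V →L[ℝ] ℝ} {P : V →L[ℝ] V} {m : ℕ} {D : Set ℂ}
  {W : ℕ → ℂ → Submodule ℝ V} {p : ℕ → ℂ → V →L[ℝ] V} {θ₁ θ₂ : ℂ → V}
  (h : FrenetData G P m D W p θ₁ θ₂) {i j : ℕ} {w : ℂ} {ν : ℂ → V} {ε ε' : ℝ}
  {J J' : ℂ → V →L[ℝ] V}
include h

/-- The `W i`-part of the curvature of `W j`. -/
theorem gform_curv_term (hi : i ∈ Icc 1 (2 * m)) (hj : j ∈ Icc 1 (2 * m)) (hij : i ≠ j)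
    (hν : IsSec D (W j) ν) (hw : w ∈ D) {ζ : V} (hζ : ζ ∈ W j w) :
    G (p j w (fderiv ℝ (fun w => p i w (fderiv ℝ ν w Complex.I)) w 1 -
      fderiv ℝ (fun w => p i w (fderiv ℝ ν w 1)) w Complex.I)) ζ =
    G (p i w ((fderiv ℝ (p j) w 1) (ν w))) (p i w ((fderiv ℝ (p j) w Complex.I) ζ)) -
    G (p i w ((fderiv ℝ (p j) w Complex.I) (ν w))) (p i w ((fderiv ℝ (p j) w 1) ζ)) := by
  have hm : ∀ v, p i w ((fderiv ℝ (p j) w v) (ν w)) ∈ W i w := fun v =>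
    ((h.bundle i hi).proj w hw).mem _
  rw [map_sub, h.proj_fderiv hj hi hij.symm hw (h.isSec_comp hi hν _),
    h.proj_fderiv hj hi hij.symm hw (h.isSec_comp hi hν _), h.proj_fderiv hi hj hij hw hν,
    h.proj_fderiv hi hj hij hw hν, map_sub, sub_apply, h.adjoint hi hj hij hw (hm _) hζ,
    h.adjoint hi hj hij hw (hm _) hζ]
  ring

/-- The form from `W j` to `W i` is complex linear of type `(1,0)`, so both products in the
curvature term equal the squared norm up to sign, and they add. -/
theorem gform_curv_up (hi : i ∈ Icc 1 (2 * m)) (hj : j ∈ Icc 1 (2 * m)) (hij : i ≠ j)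
    (hJ : RotBundle G ε D (W j) (p j) J) (hJ' : RotBundle G ε' D (W i) (p i) J')
    (hlin : ∀ w ∈ D, ∀ ξ ∈ W j w, p i w ((fderiv ℝ (p j) w 1) (J w ξ)) =
      J' w (p i w ((fderiv ℝ (p j) w 1) ξ)))
    (hone : ∀ w ∈ D, ∀ ξ ∈ W j w, p i w ((fderiv ℝ (p j) w Complex.I) ξ) =
      J' w (p i w ((fderiv ℝ (p j) w 1) ξ)))
    (hν : IsSec D (W j) ν) (hw : w ∈ D) :
    G (p j w (fderiv ℝ (fun w => p i w (fderiv ℝ ν w Complex.I)) w 1 -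
      fderiv ℝ (fun w => p i w (fderiv ℝ ν w 1)) w Complex.I)) (J w (ν w)) =
    -2 * G (p i w ((fderiv ℝ (p j) w 1) (ν w))) (p i w ((fderiv ℝ (p j) w 1) (ν w))) := by
  have hm : p i w ((fderiv ℝ (p j) w 1) (ν w)) ∈ W i w := ((h.bundle i hi).proj w hw).mem _
  rw [h.gform_curv_term hi hj hij hν hw (hJ.mem hw _), hone w hw _ (hJ.mem hw _),
    hone w hw _ (hν.2 w hw), hlin w hw _ (hν.2 w hw), hJ'.sq hw hm,
    (hJ'.rot w hw).isometry (hJ'.apply_of_mem hw hm), map_neg]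
  ring

/-- Here the form from `W i` to `W j` is linear of type `(1,0)`. Its adjoint is still complex linear
but of type `(0,1)`, which reverses the sign found in `gform_curv_up`. -/
theorem gform_curv_down (hi : i ∈ Icc 1 (2 * m)) (hj : j ∈ Icc 1 (2 * m)) (hij : i ≠ j)
    (hJ : RotBundle G ε D (W j) (p j) J) (hJ' : RotBundle G ε' D (W i) (p i) J')
    (hlin : ∀ w ∈ D, ∀ ξ ∈ W i w, p j w ((fderiv ℝ (p i) w 1) (J' w ξ)) =
      J w (p j w ((fderiv ℝ (p i) w 1) ξ)))
    (hone : ∀ w ∈ D, ∀ ξ ∈ W i w, p j w ((fderiv ℝ (p i) w Complex.I) ξ) =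
      J w (p j w ((fderiv ℝ (p i) w 1) ξ)))
    (hν : IsSec D (W j) ν) (hw : w ∈ D) :
    G (p j w (fderiv ℝ (fun w => p i w (fderiv ℝ ν w Complex.I)) w 1 -
      fderiv ℝ (fun w => p i w (fderiv ℝ ν w 1)) w Complex.I)) (J w (ν w)) =
    2 * G (p i w ((fderiv ℝ (p j) w 1) (ν w))) (p i w ((fderiv ℝ (p j) w 1) (ν w))) := by
  have hm : ∀ v ζ, p i w ((fderiv ℝ (p j) w v) ζ) ∈ W i w := fun v ζ =>
    ((h.bundle i hi).proj w hw).mem _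
  have hm' : ∀ v ζ, p j w ((fderiv ℝ (p i) w v) ζ) ∈ W j w := fun v ζ =>
    ((h.bundle j hj).proj w hw).mem _
  have e1 : ∀ ξ ∈ W j w, p i w ((fderiv ℝ (p j) w 1) (J w ξ)) =
      J' w (p i w ((fderiv ℝ (p j) w 1) ξ)) := fun ξ hξ => by
    refine (hJ'.definite w hw).eq_of_orth (hm _ _) (hJ'.mem hw _) fun C hC => ?_
    rw [h.adjoint hj hi hij.symm hw (hJ.mem hw _) hC, (hJ'.rot w hw).skew,
      h.adjoint hj hi hij.symm hw hξ (hJ'.mem hw _), hlin w hw _ hC, (hJ.rot w hw).skew]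
  have e2 : ∀ ξ ∈ W j w, p i w ((fderiv ℝ (p j) w Complex.I) ξ) =
      -J' w (p i w ((fderiv ℝ (p j) w 1) ξ)) := fun ξ hξ => by
    refine (hJ'.definite w hw).eq_of_orth (hm _ _) ((W i w).neg_mem (hJ'.mem hw _)) fun C hC => ?_
    rw [h.adjoint hj hi hij.symm hw hξ hC, map_neg, neg_apply, (hJ'.rot w hw).skew,
      h.adjoint hj hi hij.symm hw hξ (hJ'.mem hw _), hlin w hw _ hC, hone w hw _ hC, neg_neg]
  rw [h.gform_curv_term hi hj hij hν hw (hJ.mem hw _), e2 _ (hJ.mem hw _), e2 _ (hν.2 w hw),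
    e1 _ (hν.2 w hw), hJ'.sq hw (hm _ _), neg_neg, map_neg G (J' w _), neg_apply,
    (hJ'.rot w hw).isometry (hJ'.apply_of_mem hw (hm _ _))]
  ring

/-- The Ricci equation for `W 1`. -/
theorem ricci_first (hm : 2 ≤ 2 * m)
    (hJ : RotBundle G ε D (W 1) (p 1) J) (hJ' : RotBundle G ε' D (W 2) (p 2) J')
    (hlin : ∀ w ∈ D, ∀ ξ ∈ W 1 w, p 2 w ((fderiv ℝ (p 1) w 1) (J w ξ)) =
      J' w (p 2 w ((fderiv ℝ (p 1) w 1) ξ)))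
    (hone : ∀ w ∈ D, ∀ ξ ∈ W 1 w, p 2 w ((fderiv ℝ (p 1) w Complex.I) ξ) =
      J' w (p 2 w ((fderiv ℝ (p 1) w 1) ξ)))
    (hθ : ∀ w ∈ D, θ₂ w = J w (θ₁ w)) (hw : w ∈ D) :
    G (p 1 w (fderiv ℝ (fun w => p 1 w (fderiv ℝ θ₁ w Complex.I)) w 1) -
      p 1 w (fderiv ℝ (fun w => p 1 w (fderiv ℝ θ₁ w 1)) w Complex.I)) (J w (θ₁ w)) =
    G (θ₁ w) (θ₁ w) ^ 2 +
    2 * G (p 2 w ((fderiv ℝ (p 1) w 1) (θ₁ w))) (p 2 w ((fderiv ℝ (p 1) w 1) (θ₁ w))) := by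
  have m1 : 1 ∈ Icc 1 (2 * m) := ⟨le_rfl, by omega⟩
  have m2 : 2 ∈ Icc 1 (2 * m) := ⟨by omega, hm⟩
  have hc := h.curv_eq m1 (by omega) h.sec₁ m1 hw
  have e : Finset.Icc 1 (2 * m) = insert 1 (insert 2 (Finset.Icc 3 (2 * m))) := by
    ext x; simp only [Finset.mem_insert, Finset.mem_Icc]; omega
  rw [e, Finset.sum_insert (by simp), Finset.sum_insert (by simp),
    Finset.sum_eq_zero (s := Finset.Icc 3 (2 * m)) (fun i hi => by
      rw [Finset.mem_Icc] at hi
      have mi : i ∈ Icc 1 (2 * m) := ⟨by omega, hi.2⟩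
      rw [map_sub, h.curv_term_eq_zero m1 h.sec₁ m1 mi hw (by omega),
        h.curv_term_eq_zero m1 h.sec₁ m1 mi hw (by omega), sub_zero]), add_zero] at hc
  have hc' := congrArg (fun A => G A (J w (θ₁ w))) hc
  simp only [map_add, add_apply] at hc'
  have s1 := h.sec₁.2 w hw
  rw [h.gform_curv_up m2 m1 (by omega) hJ hJ' hlin hone h.sec₁ hw,
    hJ.apply_of_mem hw ((W 1 w).sub_mem ((W 1 w).smul_mem _ (h.sec₂.2 w hw))
      ((W 1 w).smul_mem _ s1)), hθ w hw, map_sub (p 1 w)] at hc'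
  simp only [map_sub, map_smul, sub_apply, smul_apply, smul_eq_mul,
    (hJ.rot w hw).isometry (hJ.apply_of_mem hw s1), hJ.symm (θ₁ w) (J w _),
    (hJ.rot w hw).orth hJ.symm] at hc' ⊢
  linarith

/-- The Ricci equation for `W j`, `j ≥ 2`. -/
theorem ricci (hj : 1 ≤ j) (hj' : j + 2 ≤ 2 * m) {Jd Ju : ℂ → V →L[ℝ] V} {ε₁ ε₂ ε₃ : ℝ}
    (hJ : RotBundle G ε₁ D (W (j + 1)) (p (j + 1)) J)
    (hJu : RotBundle G ε₂ D (W (j + 2)) (p (j + 2)) Ju)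
    (hJd : RotBundle G ε₃ D (W j) (p j) Jd)
    (hlin : ∀ w ∈ D, ∀ ξ ∈ W (j + 1) w, p (j + 2) w ((fderiv ℝ (p (j + 1)) w 1) (J w ξ)) =
      Ju w (p (j + 2) w ((fderiv ℝ (p (j + 1)) w 1) ξ)))
    (hone : ∀ w ∈ D, ∀ ξ ∈ W (j + 1) w, p (j + 2) w ((fderiv ℝ (p (j + 1)) w Complex.I) ξ) =
      Ju w (p (j + 2) w ((fderiv ℝ (p (j + 1)) w 1) ξ)))
    (hlin' : ∀ w ∈ D, ∀ ξ ∈ W j w, p (j + 1) w ((fderiv ℝ (p j) w 1) (Jd w ξ)) =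
      J w (p (j + 1) w ((fderiv ℝ (p j) w 1) ξ)))
    (hone' : ∀ w ∈ D, ∀ ξ ∈ W j w, p (j + 1) w ((fderiv ℝ (p j) w Complex.I) ξ) =
      J w (p (j + 1) w ((fderiv ℝ (p j) w 1) ξ)))
    (hν : IsSec D (W (j + 1)) ν) (hw : w ∈ D) :
    G (p (j + 1) w (fderiv ℝ (fun w => p (j + 1) w (fderiv ℝ ν w Complex.I)) w 1) -
      p (j + 1) w (fderiv ℝ (fun w => p (j + 1) w (fderiv ℝ ν w 1)) w Complex.I)) (J w (ν w)) =
    2 * G (p (j + 2) w ((fderiv ℝ (p (j + 1)) w 1) (ν w)))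
        (p (j + 2) w ((fderiv ℝ (p (j + 1)) w 1) (ν w))) -
    2 * G (p j w ((fderiv ℝ (p (j + 1)) w 1) (ν w))) (p j w ((fderiv ℝ (p (j + 1)) w 1) (ν w))) := by
  have m0 : j ∈ Icc 1 (2 * m) := ⟨hj, by omega⟩
  have m1 : j + 1 ∈ Icc 1 (2 * m) := ⟨by omega, by omega⟩
  have m2 : j + 2 ∈ Icc 1 (2 * m) := ⟨by omega, hj'⟩
  have hc := h.curv_eq m1 (by omega) hν m1 hw
  rw [h.curv_rhs_eq_zero m1 hν m1 (by omega) hw,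
    ← Finset.sum_subset (s₁ := {j, j + 1, j + 2})
    (by
      intro x hx
      simp only [Finset.mem_insert, Finset.mem_singleton] at hx
      rw [Finset.mem_Icc]; omega)
    (by
      intro i hi hi'
      rw [Finset.mem_Icc] at hi
      simp only [Finset.mem_insert, Finset.mem_singleton] at hi'
      rw [map_sub, h.curv_term_eq_zero m1 hν m1 hi hw (by omega),
        h.curv_term_eq_zero m1 hν m1 hi hw (by omega), sub_zero]),
    Finset.sum_insert (by simp), Finset.sum_pair (by omega)] at hc
  have hc' := congrArg (fun A => G A (J w (ν w))) hc
  simp only [map_add, add_apply] at hc'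
  rw [h.gform_curv_up m2 m1 (by omega) hJ hJu hlin hone hν hw,
    h.gform_curv_down m0 m1 (by omega) hJ hJd hlin' hone' hν hw, map_sub (p (j + 1) w)] at hc'
  simp only [map_zero, zero_apply] at hc'
  linarith

/-- The squared norm of the adjoint of `η_{j+1}`. -/
theorem gform_adjoint (hj : 1 ≤ j) (hj' : j + 1 ≤ 2 * m)
    (hJ : RotBundle G ε D (W (j + 1)) (p (j + 1)) J)
    (hJ' : RotBundle G ε' D (W j) (p j) J')
    (hlin : ∀ w ∈ D, ∀ ξ ∈ W j w, p (j + 1) w ((fderiv ℝ (p j) w 1) (J' w ξ)) =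
      J w (p (j + 1) w ((fderiv ℝ (p j) w 1) ξ)))
    (hw : w ∈ D) {ξ ζ : V} (hξ : ξ ∈ W j w) (h0 : ξ ≠ 0) (hζ : ζ ∈ W (j + 1) w) {c : ℂ}
    (hc : p (j + 1) w ((fderiv ℝ (p j) w 1) ξ) = cact (J w) c ζ) :
    G (p j w ((fderiv ℝ (p (j + 1)) w 1) ζ)) (p j w ((fderiv ℝ (p (j + 1)) w 1) ζ)) =
      ‖c‖ ^ 2 * G ζ ζ ^ 2 / G ξ ξ := by
  have m0 : j ∈ Icc 1 (2 * m) := ⟨hj, by omega⟩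
  have m1 : j + 1 ∈ Icc 1 (2 * m) := ⟨by omega, by omega⟩
  set b := p j w ((fderiv ℝ (p (j + 1)) w 1) ζ) with hb
  have hbm : b ∈ W j w := ((h.bundle j m0).proj w hw).mem _
  have hne := hJ'.ne_zero hw hξ h0
  have e1 : G b ξ = -(c.re * G ζ ζ) := by
    rw [hb, h.adjoint m1 m0 (by omega) hw hζ hξ, hc]
    simp [cact, hJ.symm ζ (J w ζ), (hJ.rot w hw).orth hJ.symm]
  have e2 : G b (J' w ξ) = c.im * G ζ ζ := by
    rw [hb, h.adjoint m1 m0 (by omega) hw hζ (hJ'.mem hw _), hlin w hw _ hξ, hc]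
    simp [cact, hJ.symm ζ (J w ζ), (hJ.rot w hw).orth hJ.symm, hJ.sq hw hζ]
  -- The coordinates of the adjoint image come from pairing with `ξ` and `J'ξ`, so they are those of
  -- the conjugate of `c` up to a real factor.
  have e3 := hJ'.cact_coef hw hξ h0 hbm
  rw [← e3, hJ'.gform_cact hw _ hξ, coef, e1, e2, ← Complex.normSq_eq_norm_sq,
    ← Complex.normSq_eq_norm_sq, Complex.normSq_apply, Complex.normSq_apply]
  field_simp

end FrenetData

end Ricci

-- Complex types of the `η`.

section Types

variable {V : Type*} [NormedAddCommGroup V] [NormedSpace ℝ V]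

namespace FrenetData

variable {G : V →L[ℝ] V →L[ℝ] ℝ} {P : V →L[ℝ] V} {m : ℕ} {D : Set ℂ}
  {W : ℕ → ℂ → Submodule ℝ V} {p : ℕ → ℂ → V →L[ℝ] V} {θ₁ θ₂ : ℂ → V}
  (h : FrenetData G P m D W p θ₁ θ₂) {i j : ℕ} {w : ℂ} {ν : ℂ → V} {ε ε' : ℝ}
  {J J' : ℂ → V →L[ℝ] V}
include h

/-- The images of `ξ` and `Jξ` are orthogonal of equal norm in a definite plane, so one is plus or
minus the rotation of the other. The choice of sign may depend on the point. -/
theorem conformal_eq_or (hj : 1 ≤ j) (hj' : j + 1 ≤ 2 * m)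
    (hJ : RotBundle G ε D (W j) (p j) J) (hJ' : RotBundle G ε' D (W (j + 1)) (p (j + 1)) J')
    (hw : w ∈ D) {c : ℝ} {v : ℂ} (hc : ∀ ξ ∈ W j w, ∀ ζ ∈ W j w,
      G (p (j + 1) w ((fderiv ℝ (p j) w v) ξ)) (p (j + 1) w ((fderiv ℝ (p j) w v) ζ)) = c * G ξ ζ)
    {ξ : V} (hξ : ξ ∈ W j w) :
    p (j + 1) w ((fderiv ℝ (p j) w v) (J w ξ)) = J' w (p (j + 1) w ((fderiv ℝ (p j) w v) ξ)) ∨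
    p (j + 1) w ((fderiv ℝ (p j) w v) (J w ξ)) = -J' w (p (j + 1) w ((fderiv ℝ (p j) w v) ξ)) := by
  have mk : j + 1 ∈ Icc 1 (2 * m) := ⟨by omega, hj'⟩
  set a := p (j + 1) w ((fderiv ℝ (p j) w v) ξ) with ha
  set b := p (j + 1) w ((fderiv ℝ (p j) w v) (J w ξ)) with hb
  have am : a ∈ W (j + 1) w := ((h.bundle _ mk).proj w hw).mem _
  have bm : b ∈ W (j + 1) w := ((h.bundle _ mk).proj w hw).mem _
  have e1 : G b a = 0 := by rw [hc _ (hJ.mem hw _) _ hξ, (hJ.rot w hw).orth hJ.symm, mul_zero]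
  have e2 : G b b = G a a := by
    rw [hc _ (hJ.mem hw _) _ (hJ.mem hw _), hc _ hξ _ hξ,
      (hJ.rot w hw).isometry (hJ.apply_of_mem hw hξ)]
  by_cases h0 : a = 0
  · have : b = 0 := by
      by_contra hb0
      exact hJ'.ne_zero hw bm hb0 (by rw [e2, h0]; simp)
    simp [h0, this]
  have hne := hJ'.ne_zero hw am h0
  have e3 := hJ'.cact_coef hw am h0 bm
  have e4 := hJ'.gform_cact hw (coef G (J' w) a b) am
  rw [e3, e2] at e4
  have e5 : ‖coef G (J' w) a b‖ ^ 2 = 1 := by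
    have := mul_right_cancel₀ hne (e4.symm.trans (one_mul _).symm); exact this
  rw [← Complex.normSq_eq_norm_sq, Complex.normSq_apply] at e5
  have e6 : (coef G (J' w) a b).re = 0 := by simp [coef, e1]
  rw [e6, mul_zero, zero_add, mul_self_eq_one_iff] at e5
  rw [← e3]
  rcases e5 with e5 | e5
  · left; simp [cact, e5, e6]
  · right; simp [cact, e5, e6]

/-- By the symmetry of the second fundamental form, `η_2` is of type `(1,0)`. -/
theorem one_zero_two (hm : 2 ≤ 2 * m) (hJ : RotBundle G ε D (W 1) (p 1) J)
    (hw : w ∈ D) (hc : ∀ v : ℂ, ∃ c : ℝ, ∀ ξ ∈ W 1 w, ∀ ζ ∈ W 1 w,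
      G (p 2 w ((fderiv ℝ (p 1) w v) ξ)) (p 2 w ((fderiv ℝ (p 1) w v) ζ)) = c * G ξ ζ)
    {κ : ℂ} (hκ : θ₂ w = cact (J w) κ (θ₁ w)) (h0 : θ₁ w ≠ 0) {ξ : V} (hξ : ξ ∈ W 1 w) :
    p 2 w ((fderiv ℝ (p 1) w Complex.I) ξ) = p 2 w ((fderiv ℝ (p 1) w 1) (cact (J w) κ ξ)) := by
  have m1 : 1 ∈ Icc 1 (2 * m) := ⟨le_rfl, by omega⟩
  have m2 : 2 ∈ Icc 1 (2 * m) := ⟨by omega, hm⟩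
  have b2 := h.bundle 2 m2
  have tm := h.sec₁.2 w hw
  have hsym : p 2 w ((fderiv ℝ (p 1) w Complex.I) (θ₁ w)) =
      p 2 w ((fderiv ℝ (p 1) w 1) (cact (J w) κ (θ₁ w))) := by
    rw [← hκ, ← h.proj_fderiv m2 m1 (by omega) hw h.sec₁, ← h.proj_fderiv m2 m1 (by omega) hw h.sec₂,
      h.torsion 2 m2 w hw]
  set a := p 2 w ((fderiv ℝ (p 1) w 1) (θ₁ w)) with ha
  set b := p 2 w ((fderiv ℝ (p 1) w 1) (J w (θ₁ w))) with hb
  set d := p 2 w ((fderiv ℝ (p 1) w Complex.I) (J w (θ₁ w))) with hd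
  have am : a ∈ W 2 w := (b2.proj w hw).mem _
  have bm : b ∈ W 2 w := (b2.proj w hw).mem _
  have dm : d ∈ W 2 w := (b2.proj w hw).mem _
  have hs : p 2 w ((fderiv ℝ (p 1) w Complex.I) (θ₁ w)) = κ.re • a + κ.im • b := by
    rw [hsym]; simp [cact, ha, hb]
  have oJ : G (θ₁ w) (J w (θ₁ w)) = 0 := by rw [hJ.symm, (hJ.rot w hw).orth hJ.symm]
  have iJ : G (J w (θ₁ w)) (J w (θ₁ w)) = G (θ₁ w) (θ₁ w) :=
    (hJ.rot w hw).isometry (hJ.apply_of_mem hw tm)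
  have jm := hJ.mem hw (θ₁ w)
  -- Conformality in the directions `1`, `i` and `1 + i` gives the polarised identity between the
  -- first two. This determines `d`, the value in the direction `i` on `Jθ₁`; symmetry already gives
  -- the value on `θ₁`.
  obtain ⟨c1, h1⟩ := hc 1
  obtain ⟨c2, h2⟩ := hc Complex.I
  obtain ⟨c3, h3⟩ := hc (1 + Complex.I)
  have f1 : G a b = 0 := by rw [ha, hb, h1 _ tm _ jm, oJ, mul_zero]
  have f2 : G a a = G b b := by rw [ha, hb, h1 _ tm _ tm, h1 _ jm _ jm, iJ]
  have f3 := h2 _ tm _ jm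
  have f4 : G (κ.re • a + κ.im • b) (κ.re • a + κ.im • b) = G d d := by
    rw [← hs, hd, h2 _ tm _ tm, h2 _ jm _ jm, iJ]
  have f5 := h3 _ tm _ jm
  have f6 : G (a + (κ.re • a + κ.im • b)) (a + (κ.re • a + κ.im • b)) = G (b + d) (b + d) := by
    have := (h3 _ tm _ tm).trans ((congrArg (c3 * ·) iJ.symm).trans (h3 _ jm _ jm).symm)
    simpa only [map_add, add_apply, ← ha, ← hb, ← hd, hs] using this
  rw [hs, ← hd, oJ] at f3
  rw [oJ] at f5
  simp only [map_add, add_apply, hs, ← ha, ← hb, ← hd] at f5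
  simp only [map_add, add_apply, map_smul, smul_apply, smul_eq_mul, f1, b2.symm b a,
    b2.symm d b] at f3 f4 f5 f6
  have key : d = κ.re • b - κ.im • a := by
    by_cases a0 : a = 0
    · have b0 : b = 0 := by
        by_contra hb0
        exact b2.ne_zero hw bm hb0 (by rw [← f2, a0]; simp)
      have d0 : d = 0 := by
        by_contra hd0
        exact b2.ne_zero hw dm hd0 (by rw [← f4, a0, b0]; simp)
      simp [a0, b0, d0]
    · have hne := b2.ne_zero hw am a0
      have b0 : b ≠ 0 := by
        rintro hb0
        exact hne (by rw [f2, hb0]; simp)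
      rw [span_pair_of_orth b2.symm (b2.definite w hw) (b2.finrank w hw) am bm dm a0 b0 f1,
        b2.symm d a, b2.symm d b, ← f2, show G a d = -κ.im * G a a by
          rw [f2]; linarith,
        show G b d = κ.re * G a a by linarith, mul_div_cancel_right₀ _ hne,
        mul_div_cancel_right₀ _ hne]
      module
  rw [← hJ.cact_coef hw tm h0 hξ]
  simp only [cact, map_add, map_smul, hJ.sq hw tm, ← ha, ← hb, ← hd, hs, map_neg]
  rw [key]
  module

/-- If `η_{j+1}` is of type `(1,0)` and not zero at `w`, then `η_{j+2}` is of type `(1,0)` at `w`. -/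
theorem one_zero_succ (hj : 1 ≤ j) (hj' : j + 2 ≤ 2 * m) (hJ : RotBundle G ε D (W j) (p j) J)
    (hJ' : RotBundle G ε' D (W (j + 1)) (p (j + 1)) J') (hw : w ∈ D) {κ : ℂ}
    (hlin : ∀ ξ ∈ W j w, p (j + 1) w ((fderiv ℝ (p j) w 1) (J w ξ)) =
      J' w (p (j + 1) w ((fderiv ℝ (p j) w 1) ξ)))
    (hone : ∀ ξ ∈ W j w, p (j + 1) w ((fderiv ℝ (p j) w Complex.I) ξ) =
      p (j + 1) w ((fderiv ℝ (p j) w 1) (cact (J w) κ ξ)))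
    {ξ : V} (hξ : ξ ∈ W j w) (h0 : p (j + 1) w ((fderiv ℝ (p j) w 1) ξ) ≠ 0)
    {ζ : V} (hζ : ζ ∈ W (j + 1) w) :
    p (j + 2) w ((fderiv ℝ (p (j + 1)) w Complex.I) ζ) =
      p (j + 2) w ((fderiv ℝ (p (j + 1)) w 1) (cact (J' w) κ ζ)) := by
  have mk : j + 1 ∈ Icc 1 (2 * m) := ⟨by omega, by omega⟩
  have am : p (j + 1) w ((fderiv ℝ (p j) w 1) ξ) ∈ W (j + 1) w := ((h.bundle _ mk).proj w hw).mem _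
  have hl : ∀ c : ℂ, ∀ ξ ∈ W j w, p (j + 1) w ((fderiv ℝ (p j) w 1) (cact (J w) c ξ)) =
      cact (J' w) c (p (j + 1) w ((fderiv ℝ (p j) w 1) ξ)) := fun c ξ hξ => by
    simp only [cact, map_add, map_smul, hlin ξ hξ]
  rw [← hJ'.cact_coef hw am h0 hζ, ← hl _ _ hξ]
  have hm := hJ.cact_mem hw (coef G (J' w) (p (j + 1) w ((fderiv ℝ (p j) w 1) ξ)) ζ) hξ
  -- A nonzero linear value spans the plane over `ℂ`, so `ζ` is a value of `η_{j+1}`, and the wedge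
  -- identity moves the direction `i` onto `η_{j+1}`.
  rw [← h.wedge hj hj' hm hw, hone _ hm, hl _ _ hm]

/-- The complex type of `η_{m+1}`. -/
theorem middle_antilinear (hm : 1 ≤ m) (hJ : RotBundle G ε D (W m) (p m) J) (hw : w ∈ D)
    (hP : ∀ A B, G (P A) (P B) = -G A B) (hPP : ∀ A, P (P A) = A)
    (hpP : ∀ w ∈ D, ∀ A, p (m + 1) w (P A) = P (p m w A)) {κ : ℂ} (hκ : κ.im ≠ 0)
    (hone : ∀ ξ ∈ W m w, p (m + 1) w ((fderiv ℝ (p m) w Complex.I) ξ) =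
      p (m + 1) w ((fderiv ℝ (p m) w 1) (cact (J w) κ ξ))) {ξ : V} (hξ : ξ ∈ W m w) :
    p (m + 1) w ((fderiv ℝ (p m) w 1) (J w ξ)) =
      -P (J w (P (p (m + 1) w ((fderiv ℝ (p m) w 1) ξ)))) := by
  have m0 : m ∈ Icc 1 (2 * m) := ⟨hm, by omega⟩
  have m1 : m + 1 ∈ Icc 1 (2 * m) := ⟨by omega, by omega⟩
  have hPm : ∀ A ∈ W m w, P A ∈ W (m + 1) w := fun A hA => by
    have := h.P_mem m m0 w hw A hA
    rwa [show 2 * m + 1 - m = m + 1 by omega] at this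
  have hdP : ∀ (v : ℂ) (A : V), (fderiv ℝ (p (m + 1)) w v) (P A) = P ((fderiv ℝ (p m) w v) A) := by
    intro v A
    have d0 := ContDiffOn.differentiableAt_of_isOpen (h.bundle m m0).smooth (h.bundle m m0).isOpen hw
    have d1 := ContDiffOn.differentiableAt_of_isOpen (h.bundle _ m1).smooth (h.bundle m m0).isOpen hw
    have h1 : EqOn (fun w => p (m + 1) w (P A)) (fun w => P (p m w A)) D := fun y hy => hpP y hy A
    have h2 := congrArg (fun L => L v) (fderiv_eq_of_eqOn (h.bundle m m0).isOpen hw h1)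
    have hc : ∀ x : V, DifferentiableAt ℝ (fun _ : ℂ => x) w := fun x => differentiableAt_const x
    rw [fderiv_family_apply d1 (hc _)] at h2
    have h3 : fderiv ℝ (fun w => P (p m w A)) w = P.comp (fderiv ℝ (fun w => p m w A) w) :=
      (P.hasFDerivAt.comp w (d0.clm_apply (hc A)).hasFDerivAt).fderiv
    rw [h3, ContinuousLinearMap.comp_apply, fderiv_family_apply d0 (hc _)] at h2
    simpa using h2
  -- `η_{m+1}` carried back to `W m` by `P`. It is symmetric because `P` is an anti-isometry
  -- interchanging the two projections.
  set β : ℂ → V → V := fun v A => P (p (m + 1) w ((fderiv ℝ (p m) w v) A)) with hβ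
  have hPm' : ∀ A, P (p (m + 1) w A) = p m w (P A) := fun A => by
    conv_lhs => rw [← hPP A, hpP w hw, hPP]
  have βm : ∀ v A, β v A ∈ W m w := fun v A => by
    simp only [hβ]; rw [hPm']; exact ((h.bundle m m0).proj w hw).mem _
  have sa : ∀ v, ∀ A ∈ W m w, ∀ B ∈ W m w, G (β v A) B = G A (β v B) := by
    intro v A hA B hB
    have h1 := h.adjoint m0 m1 (by omega) hw hA (hPm B hB) v
    rw [hdP, ← hPm', hJ.symm, ← neg_inj, neg_neg, ← hP, hPP, hJ.symm] at h1
    rw [← neg_inj, ← hP, hPP] at h1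
    rw [← neg_inj]
    simp only [hβ]
    rw [← hP, hPP, h1]
  have hone' : ∀ A ∈ W m w, β Complex.I A = κ.re • β 1 A + κ.im • β 1 (J w A) := fun A hA => by
    simp only [hβ, hone A hA, cact, map_add, map_smul]
  -- In the direction `i` the form is `β 1` composed with `Re κ + Im κ · J`. Since this too is
  -- symmetric and `Im κ ≠ 0`, so is `β 1 ∘ J`; with `J` skew, `β 1` anticommutes with `J`.
  have key : β 1 (J w ξ) = -J w (β 1 ξ) := by
    refine (hJ.definite w hw).eq_of_orth (βm _ _) ((W m w).neg_mem (hJ.mem hw _)) fun C hC => ?_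
    have e1 := sa Complex.I ξ hξ C hC
    rw [hone' _ hξ, hone' _ hC] at e1
    simp only [map_add, map_smul, add_apply, smul_apply, smul_eq_mul, sa 1 ξ hξ C hC,
      add_right_inj] at e1
    rw [mul_left_cancel₀ hκ e1, map_neg, neg_apply, (hJ.rot w hw).skew, neg_neg,
      sa 1 ξ hξ _ (hJ.mem hw _)]
  have := congrArg P key
  rw [map_neg] at this
  simp only [hβ] at this
  rwa [hPP] at this

end FrenetData

end Types


-- The projections of the statement as linear maps on the ambient space.

section Projections

variable {n : ℕ} {p : Hyp n} {W : Submodule ℝ (PEnd n)} {ε : ℝ}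

theorem gproj_hor (hW : W ≤ tangentAt p) (hd : DefiniteOn (gform n) ε W)
    (hp : IsOrthProj (gform n) W (gproj (gform n) W)) {A : PEnd n} (hA : A ∈ plin n) :
    gproj (gform n) W (hor p A) = gproj (gform n) W A := by
  refine hp.apply_eq hd (hp.mem A) fun C hC => ?_
  rw [gform_hor hA (hW hC)]
  have := hp.orth A C hC
  rw [map_sub, sub_apply] at this
  linarith

/-- Definiteness makes the orthogonal component unique, so the pointwise choice agrees with a
continuous linear projection that can be differentiated. -/
theorem orthoProj_eq (hW : W ≤ tangentAt p) (hd : DefiniteOn (gform n) ε W)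
    (hp : IsOrthProj (gform n) W (gproj (gform n) W)) {A : PEnd n} (hA : A ∈ plin n) :
    orthoProj p W A = gproj (gform n) W A := by
  have hm := hp.mem A
  have hex : ∃ B ∈ W, ∀ C ∈ W, gmet p (A - B) C = 0 := ⟨_, hm, fun C hC => by
    rw [gmet_eq_gform ((plin n).sub_mem hA (tangentAt_le_plin p (hW hm))) (hW hC), hp.orth A C hC]⟩
  rw [orthoProj, dif_pos hex]
  obtain ⟨h1, h2⟩ := hex.choose_spec
  refine (hp.apply_eq hd h1 fun C hC => ?_).symm
  have := h2 C hC
  rw [gmet_eq_gform ((plin n).sub_mem hA (tangentAt_le_plin p (hW h1))) (hW hC), map_sub,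
    sub_apply] at this
  linarith

end Projections

-- Derivatives of endomorphism-valued maps and smoothness of the basic families.

section Derivatives

variable {E : Type*} [NormedAddCommGroup E] [NormedSpace ℝ E] {H : Type*} [TopologicalSpace H]
  (I : ModelWithCorners ℝ E H) {N : Type*} [TopologicalSpace N] [ChartedSpace H N] {n : ℕ}

theorem deriv₁_mem_plin {A : N → PEnd n} {x : N} (hA : ∀ᶠ y in 𝓝 x, A y ∈ plin n)
    (v : TangentSpace I x) : deriv₁ I A x v ∈ plin n := by
  by_cases hd : MDifferentiableAt I 𝓘(ℝ, PEnd n) A x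
  · obtain ⟨f, hf⟩ := Submodule.ClosedComplemented.of_finiteDimensional (plin n)
    set π : PEnd n →L[ℝ] PEnd n := (plin n).subtypeL ∘L f with hπ
    have h1 : ∀ B ∈ plin n, π B = B := fun B hB => congrArg Subtype.val (hf ⟨B, hB⟩)
    have h2 : A =ᶠ[𝓝 x] fun y => π (A y) := hA.mono fun y hy => (h1 _ hy).symm
    have h3 : mfderiv I 𝓘(ℝ, PEnd n) (fun y => π (A y)) x = π.comp (mfderiv I 𝓘(ℝ, PEnd n) A x) :=
      ((π.hasMFDerivAt (x := A x)).comp x hd.hasMFDerivAt).mfderiv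
    have h4 : deriv₁ I A x v = π (deriv₁ I A x v) := by
      conv_lhs => rw [deriv₁, h2.mfderiv_eq, h3]
      rfl
    rw [h4]
    exact (f _).2
  · rw [deriv₁, mfderiv_zero_of_not_mdifferentiableAt hd]
    exact (plin n).zero_mem

theorem cov_mem_plin (f : N → Hyp n) {A : N → PEnd n} {x : N} (hA : ∀ᶠ y in 𝓝 x, A y ∈ plin n)
    (v : TangentSpace I x) : cov I f A x v ∈ plin n :=
  tangentAt_le_plin _ (hor_mem_tangentAt _ (deriv₁_mem_plin I hA v))

theorem orthoProj_cov {f : N → Hyp n} {W : Submodule ℝ (PEnd n)} {A : N → PEnd n} {x : N} {ε : ℝ}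
    (hW : W ≤ tangentAt (f x)) (hd : DefiniteOn (gform n) ε W)
    (hp : IsOrthProj (gform n) W (gproj (gform n) W)) (hA : ∀ᶠ y in 𝓝 x, A y ∈ plin n)
    (v : TangentSpace I x) :
    orthoProj (f x) W (cov I f A x v) = gproj (gform n) W (deriv₁ I A x v) := by
  rw [orthoProj_eq hW hd hp (cov_mem_plin I f hA v), cov, gproj_hor hW hd hp (deriv₁_mem_plin I hA v)]

theorem contMDiffOn_clm_of_apply {V V' : Type*} [NormedAddCommGroup V] [NormedSpace ℝ V]
    [FiniteDimensional ℝ V] [NormedAddCommGroup V'] [NormedSpace ℝ V'] {L : N → V →L[ℝ] V'}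
    {U : Set N} (h : ∀ A, ContMDiffOn I 𝓘(ℝ, V') ∞ (fun x => L x A) U) :
    ContMDiffOn I 𝓘(ℝ, V →L[ℝ] V') ∞ L U := by
  set b := Module.finBasis ℝ V
  have hRb : ∀ i, ContDiff ℝ ∞ fun x : V' => (LinearMap.toContinuousLinearMap (b.coord i)).smulRight x :=
    fun i => contDiff_const.smulRight contDiff_id
  have e : L = fun x => ∑ i, (LinearMap.toContinuousLinearMap (b.coord i)).smulRight (L x (b i)) := by
    funext x
    ext1 A
    conv_lhs => rw [← b.sum_repr A, map_sum]
    simp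
  rw [e]
  exact contMDiffOn_finsetSum fun i _ => (hRb i).contMDiff.comp_contMDiffOn (h (b i))

theorem contDiff_lineMap : ContDiff ℝ ∞ (lineMap : PVec n → PEnd n) := by
  rw [contDiff_clm_apply_iff]
  intro w
  set R : PVec n →L[ℝ] PC := LinearMap.toContinuousLinearMap
    { toFun := fun z => q w z
      map_add' := fun x y => q_add_right x y w
      map_smul' := fun c x => q_rsmul_right c x w } with hR
  have : (fun z => lineMap z w) = fun z : PVec n => fun i => -(R z) * z i := by
    funext z i
    simp [lineMap_apply, hR]
  rw [this]
  exact contDiff_pi.2 fun i => R.contDiff.neg.mul (contDiff_apply ℝ PC i)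

theorem contMDiff_lineProj {f : N → Hyp n} (hf : SmoothMap I f) :
    ContMDiff I 𝓘(ℝ, PEnd n) ∞ (fun x => lineProj (f x)) := by
  intro x
  obtain ⟨U, hU, hx, F, hF, h⟩ := hf x
  have h1 : ContMDiffOn I 𝓘(ℝ, PEnd n) ∞ (fun x => lineMap (F x)) U :=
    contDiff_lineMap.contMDiff.comp_contMDiffOn hF
  refine (h1.contMDiffAt (hU.mem_nhds hx)).congr_of_eventuallyEq ?_
  filter_upwards [hU.mem_nhds hx] with y hy
  obtain ⟨z, hz, hzf⟩ := h y hy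
  rw [← hzf, lineProj_toHyp, hz]

theorem contDiffAt_proj₂ {V : Type*} [NormedAddCommGroup V] [NormedSpace ℝ V]
    (G : V →L[ℝ] V →L[ℝ] ℝ) {u v : V} (h : G u u * G v v - G u v ^ 2 ≠ 0) :
    ContDiffAt ℝ ∞ (fun x : V × V => proj₂ G x.1 x.2) (u, v) := by
  have a1 : ContDiffAt ℝ ∞ (fun x : V × V => x.1) (u, v) := contDiffAt_fst
  have a2 : ContDiffAt ℝ ∞ (fun x : V × V => x.2) (u, v) := contDiffAt_snd
  have b1 : ContDiffAt ℝ ∞ (fun x : V × V => G x.1) (u, v) := G.contDiff.contDiffAt.comp _ a1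
  have b2 : ContDiffAt ℝ ∞ (fun x : V × V => G x.2) (u, v) := G.contDiff.contDiffAt.comp _ a2
  have c11 := b1.clm_apply a1
  have c12 := b1.clm_apply a2
  have c22 := b2.clm_apply a2
  exact (((c11.mul c22).sub (c12.pow 2)).inv h).smul
    ((((c22.smul b1).sub (c12.smul b2)).smulRight a1).add
      (((c11.smul b2).sub (c12.smul b1)).smulRight a2))

end Derivatives

-- Charts as parametrizations by discs.

section Params

variable {S : Type*} [TopologicalSpace S] [ChartedSpace (EuclideanSpace ℝ (Fin 2)) S]
  [IsManifold (𝓡 2) ∞ S]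

/-- A chart, as a parametrization near a given point. -/
theorem exists_param (s₀ : S) : ∃ (ψ : ℂ → S) (r : ℝ), 0 < r ∧ ψ 0 = s₀ ∧
    ContMDiffOn 𝓘(ℝ, ℂ) (𝓡 2) ∞ ψ (Metric.ball 0 r) ∧
    (∀ w ∈ Metric.ball (0 : ℂ) r,
      Function.Bijective (mfderiv 𝓘(ℝ, ℂ) (𝓡 2) ψ w : ℂ → TangentSpace (𝓡 2) (ψ w))) ∧
    ∀ O ⊆ Metric.ball (0 : ℂ) r, IsOpen O → IsOpen (ψ '' O) := by
  set e := extChartAt (𝓡 2) s₀ with he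
  obtain ⟨T⟩ : Nonempty (ℂ ≃L[ℝ] EuclideanSpace ℝ (Fin 2)) :=
    ⟨ContinuousLinearEquiv.ofFinrankEq (by simp)⟩
  set τ : ℂ → EuclideanSpace ℝ (Fin 2) := fun w => e s₀ + T w with hτ
  have hτc : ContDiff ℝ ∞ τ := contDiff_const.add T.contDiff
  have hτ0 : τ 0 = e s₀ := by simp [hτ]
  have hto : IsOpen e.target := isOpen_extChartAt_target s₀
  have hpre : IsOpen (τ ⁻¹' e.target) := hto.preimage hτc.continuous
  obtain ⟨r, hr, hrb⟩ := Metric.isOpen_iff.1 hpre 0 (by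
    rw [mem_preimage, hτ0]; exact mem_extChartAt_target s₀)
  have hsymm : ContMDiffOn 𝓘(ℝ, EuclideanSpace ℝ (Fin 2)) (𝓡 2) ∞ e.symm e.target :=
    contMDiffOn_extChartAt_symm s₀
  refine ⟨fun w => e.symm (τ w), r, hr, ?_, ?_, ?_, ?_⟩
  · simp only [hτ0]
    exact extChartAt_to_inv s₀
  · exact hsymm.comp hτc.contMDiff.contMDiffOn hrb
  · intro w hw
    have hwt := hrb hw
    have h0 : HasFDerivAt τ (T : ℂ →L[ℝ] EuclideanSpace ℝ (Fin 2)) w :=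
      T.hasFDerivAt.const_add (e s₀)
    have h1 := h0.hasMFDerivAt
    have h2 := isInvertible_mfderivWithin_extChartAt_symm (I := 𝓡 2) (x := s₀) hwt
    have hd : MDifferentiableAt 𝓘(ℝ, EuclideanSpace ℝ (Fin 2)) (𝓡 2) e.symm (τ w) :=
      ((hsymm (τ w) hwt).contMDiffAt (hto.mem_nhds hwt)).mdifferentiableAt (by simp)
    have h3 : mfderiv 𝓘(ℝ, ℂ) (𝓡 2) (fun w => e.symm (τ w)) w =
        (mfderiv 𝓘(ℝ, EuclideanSpace ℝ (Fin 2)) (𝓡 2) e.symm (τ w)).comp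
          (T : ℂ →L[ℝ] EuclideanSpace ℝ (Fin 2)) :=
      (hd.hasMFDerivAt.comp w h1).mfderiv
    rw [h3]
    have h4 : Function.Bijective (mfderiv 𝓘(ℝ, EuclideanSpace ℝ (Fin 2)) (𝓡 2) e.symm (τ w)) := by
      have := h2.bijective
      rwa [ModelWithCorners.Boundaryless.range_eq_univ, mfderivWithin_univ] at this
    exact h4.comp T.bijective
  · intro O hO hOo
    have h1 : IsOpen (τ '' O) := by
      have : τ '' O = (fun x => e s₀ + x) '' (T '' O) := by rw [image_image]
      rw [this]
      exact (Homeomorph.addLeft (e s₀)).isOpenMap _ (T.toHomeomorph.isOpenMap _ hOo)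
    have h2 : (fun w => e.symm (τ w)) '' O = e.source ∩ e ⁻¹' (τ '' O) := by
      ext s
      constructor
      · rintro ⟨w, hw, rfl⟩
        have := hrb (hO hw)
        exact ⟨e.map_target this, w, hw, (e.right_inv this).symm⟩
      · rintro ⟨hs, w, hw, h⟩
        exact ⟨w, hw, by simp only [h]; exact e.left_inv hs⟩
    rw [h2]
    exact isOpen_extChartAt_preimage' s₀ h1

end Params


-- Calculus of a moving idempotent in a normed algebra.

section MovingProjection

variable {R : Type*} [NormedRing R] [NormedAlgebra ℝ R] {D : Set ℂ} {Q ν : ℂ → R} {w : ℂ}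

theorem fderiv_fderiv_comm {F : Type*} [NormedAddCommGroup F] [NormedSpace ℝ F] {f : ℂ → F}
    (hf : ContDiffOn ℝ ∞ f D) (hD : IsOpen D) (hw : w ∈ D) (v v' : ℂ) :
    fderiv ℝ (fun w => fderiv ℝ f w v) w v' = fderiv ℝ (fun w => fderiv ℝ f w v') w v := by
  have h1 : DifferentiableAt ℝ (fderiv ℝ f) w :=
    ((hf.fderiv_of_isOpen hD (m := ∞) (by simp)).contDiffAt (hD.mem_nhds hw)).differentiableAt
      (by simp)
  have h2 : IsSymmSndFDerivAt ℝ f w :=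
    (hf.contDiffAt (hD.mem_nhds hw)).isSymmSndFDerivAt (by
      rw [minSmoothness_of_isRCLikeNormedField]; exact (WithTop.coe_le_coe.2 le_top : ((2 : ℕ∞) : WithTop ℕ∞) ≤ ∞))
  have e : ∀ v v', fderiv ℝ (fun w => fderiv ℝ f w v) w v' = fderiv ℝ (fderiv ℝ f) w v' v :=
    fun v v' => by
      rw [fderiv_clm_apply h1 (differentiableAt_const v)]; simp
  rw [e, e, h2]

theorem fderiv_mul_of_contDiffOn {f g : ℂ → R} (hf : ContDiffOn ℝ ∞ f D) (hg : ContDiffOn ℝ ∞ g D)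
    (hD : IsOpen D) (hw : w ∈ D) (v : ℂ) :
    fderiv ℝ (fun w => f w * g w) w v = fderiv ℝ f w v * g w + f w * fderiv ℝ g w v := by
  rw [fderiv_fun_mul' (ContDiffOn.differentiableAt_of_isOpen hf hD hw)
    (ContDiffOn.differentiableAt_of_isOpen hg hD hw)]
  simp [add_comm]

theorem fderiv_moving_component (hD : IsOpen D) (hQ : ContDiffOn ℝ ∞ Q D)
    (hν : ContDiffOn ℝ ∞ ν D) (hw : w ∈ D) (v v' : ℂ) :
    fderiv ℝ (fun w => (1 - Q w) * fderiv ℝ ν w v * Q w) w v' =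
      -(fderiv ℝ Q w v' * fderiv ℝ ν w v * Q w) +
      (1 - Q w) * fderiv ℝ (fun w => fderiv ℝ ν w v) w v' * Q w +
      (1 - Q w) * fderiv ℝ ν w v * fderiv ℝ Q w v' := by
  have h1 : ContDiffOn ℝ ∞ (fun w => 1 - Q w) D := contDiffOn_const.sub hQ
  have h2 := ContDiffOn.fderiv_dir hν hD v
  rw [fderiv_mul_of_contDiffOn (h1.mul h2) hQ hD hw, fderiv_mul_of_contDiffOn h1 h2 hD hw,
    fderiv_const_sub]
  simp [add_mul]

section

variable (hD : IsOpen D) (hQ : ContDiffOn ℝ ∞ Q D) (hid : ∀ w ∈ D, Q w * Q w = Q w) (hw : w ∈ D)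
include hD hQ hid hw

theorem fderiv_idempotent (v : ℂ) :
    fderiv ℝ Q w v = fderiv ℝ Q w v * Q w + Q w * fderiv ℝ Q w v := by
  rw [← fderiv_mul_of_contDiffOn hQ hQ hD hw, fderiv_eq_of_eqOn hD hw (hid : EqOn _ _ D)]

theorem idempotent_mul_fderiv_mul (v : ℂ) : Q w * fderiv ℝ Q w v * Q w = 0 := by
  have h := congrArg (Q w * ·) (fderiv_idempotent hD hQ hid hw v)
  simp only [mul_add, ← mul_assoc, hid w hw] at h
  simpa using h

theorem one_sub_mul_fderiv (v : ℂ) : (1 - Q w) * fderiv ℝ Q w v = fderiv ℝ Q w v * Q w := by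
  have h := fderiv_idempotent hD hQ hid hw v
  rw [sub_mul, one_mul, sub_eq_iff_eq_add]
  exact h

/-- All products of two first derivatives of `Q` are killed by `Q Q' Q = 0`; the surviving second
derivative is symmetric in the directions. -/
theorem torsion_component (v v' : ℂ) :
    (1 - Q w) * fderiv ℝ (fun w => (1 - Q w) * fderiv ℝ Q w v * Q w) w v' * Q w =
      (1 - Q w) * fderiv ℝ (fun w => fderiv ℝ Q w v) w v' * Q w := by
  have h0 := idempotent_mul_fderiv_mul hD hQ hid hw
  have h1 := one_sub_mul_fderiv hD hQ hid hw
  have h2 : (1 - Q w) * (1 - Q w) = 1 - Q w := by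
    rw [mul_sub, sub_mul, sub_mul, hid w hw]; simp
  rw [fderiv_moving_component hD hQ hQ hw, mul_add, mul_add, add_mul, add_mul]
  have e1 : (1 - Q w) * -(fderiv ℝ Q w v' * fderiv ℝ Q w v * Q w) * Q w = 0 := by
    rw [mul_neg, neg_mul, ← mul_assoc, ← mul_assoc, h1, mul_assoc (fderiv ℝ Q w v'),
      mul_assoc (fderiv ℝ Q w v'), h0]
    simp
  have e2 : (1 - Q w) * ((1 - Q w) * fderiv ℝ Q w v * fderiv ℝ Q w v') * Q w = 0 := by
    rw [← mul_assoc, ← mul_assoc, h2, h1, mul_assoc, mul_assoc, ← mul_assoc (Q w), h0, mul_zero]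
  have e3 : (1 - Q w) * ((1 - Q w) * fderiv ℝ (fun w => fderiv ℝ Q w v) w v' * Q w) * Q w =
      (1 - Q w) * fderiv ℝ (fun w => fderiv ℝ Q w v) w v' * Q w := by
    rw [← mul_assoc, ← mul_assoc, h2, mul_assoc _ (Q w) (Q w), hid w hw]
  rw [e1, e2, e3]
  simp

/-- The second derivatives of `ν` cancel by symmetry. Its first derivatives are eliminated by
differentiating `ν Q = ν` and `Q ν = 0`, which leaves terms quadratic in the derivative of `Q`: the
Gauss equation of the bundle. -/
theorem curvature_component (hν : ContDiffOn ℝ ∞ ν D) (hr : ∀ w ∈ D, ν w * Q w = ν w)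
    (hl : ∀ w ∈ D, Q w * ν w = 0) (v v' : ℂ) :
    (1 - Q w) * (fderiv ℝ (fun w => (1 - Q w) * fderiv ℝ ν w v * Q w) w v' -
      fderiv ℝ (fun w => (1 - Q w) * fderiv ℝ ν w v' * Q w) w v) * Q w =
    fderiv ℝ Q w v' * fderiv ℝ Q w v * ν w - fderiv ℝ Q w v * fderiv ℝ Q w v' * ν w +
      ν w * fderiv ℝ Q w v * fderiv ℝ Q w v' * Q w -
      ν w * fderiv ℝ Q w v' * fderiv ℝ Q w v * Q w := by
  have h0 := idempotent_mul_fderiv_mul hD hQ hid hw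
  have h1 := one_sub_mul_fderiv hD hQ hid hw
  have h2 : (1 - Q w) * (1 - Q w) = 1 - Q w := by
    rw [mul_sub, sub_mul, sub_mul, hid w hw]; simp
  have h3 : ∀ v, fderiv ℝ ν w v = fderiv ℝ ν w v * Q w + ν w * fderiv ℝ Q w v := fun v => by
    rw [← fderiv_mul_of_contDiffOn hν hQ hD hw, fderiv_eq_of_eqOn hD hw (hr : EqOn _ _ D)]
  have h4 : ∀ v, Q w * fderiv ℝ ν w v = -(fderiv ℝ Q w v * ν w) := fun v => by
    have := fderiv_mul_of_contDiffOn hQ hν hD hw v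
    rw [fderiv_eq_of_eqOn hD hw (hl : EqOn (fun w => Q w * ν w) (fun _ => 0) D)] at this
    simp only [fderiv_fun_const, Pi.zero_apply, zero_apply] at this
    exact (neg_eq_of_add_eq_zero_right this.symm).symm
  have h5 : (1 - Q w) * ν w = ν w := by rw [sub_mul, hl w hw]; simp
  have key : ∀ v v', (1 - Q w) * fderiv ℝ (fun w => (1 - Q w) * fderiv ℝ ν w v * Q w) w v' * Q w =
      fderiv ℝ Q w v' * fderiv ℝ Q w v * ν w +
      (1 - Q w) * fderiv ℝ (fun w => fderiv ℝ ν w v) w v' * Q w +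
      ν w * fderiv ℝ Q w v * fderiv ℝ Q w v' * Q w := fun v v' => by
    rw [fderiv_moving_component hD hQ hν hw, mul_add, mul_add, add_mul, add_mul]
    congr 1
    · congr 1
      · rw [mul_neg, neg_mul, ← mul_assoc, ← mul_assoc, h1, mul_assoc _ (Q w) (fderiv ℝ ν w v), h4,
          mul_neg, neg_mul, neg_mul, neg_neg, mul_assoc _ (Q w) (Q w), hid w hw, ← mul_assoc,
          mul_assoc _ (ν w), hr w hw]
      · rw [← mul_assoc, ← mul_assoc, h2, mul_assoc _ (Q w) (Q w), hid w hw]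
    · rw [← mul_assoc, ← mul_assoc, h2]
      conv_lhs => rw [h3 v]
      rw [mul_add, add_mul, add_mul, mul_assoc (1 - Q w), mul_assoc (1 - Q w), mul_assoc _ (Q w),
        mul_assoc _ (Q w * _), h0, ← mul_assoc (1 - Q w) (ν w), h5]
      simp
  rw [mul_sub, sub_mul, key, key, fderiv_fderiv_comm hν hD hw v' v]
  abel

end

end MovingProjection

-- Torsion and curvature of the pull-back connection.

section Curvature

variable {n : ℕ} {D : Set ℂ} {f : ℂ → Hyp n} {w : ℂ}

theorem hor_eq_mul (p : Hyp n) (A : PEnd n) : hor p A = (1 - lineProj p) * A * lineProj p := rfl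

theorem lineProj_mul_self (p : Hyp n) : lineProj p * lineProj p = lineProj p :=
  lineProj_comp_lineProj p

theorem fderiv_mem_plin (hD : IsOpen D) (hw : w ∈ D) {A : ℂ → PEnd n} (hA : ∀ w ∈ D, A w ∈ plin n) (v : ℂ) :
    fderiv ℝ A w v ∈ plin n := by
  have := deriv₁_mem_plin 𝓘(ℝ, ℂ) (x := w) (A := A)
    (by filter_upwards [hD.mem_nhds hw] with y hy using hA y hy) v
  simp only [deriv₁, mfderiv_eq_fderiv] at this
  exact this

/-- The derivative of a family of self-adjoint maps is self-adjoint. -/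
theorem q_fderiv_selfadj (hD : IsOpen D) {T : ℂ → PEnd n} (hT : ContDiffOn ℝ ∞ T D)
    (hs : ∀ w ∈ D, ∀ x y, q (T w x) y = q x (T w y)) (hw : w ∈ D) (v : ℂ) (x y : PVec n) :
    q ((fderiv ℝ T w v) x) y = q x ((fderiv ℝ T w v) y) := by
  have hd := ContDiffOn.differentiableAt_of_isOpen hT hD hw
  have hx : ∀ x : PVec n, fderiv ℝ (fun w => T w x) w v = (fderiv ℝ T w v) x := fun x => by
    rw [fderiv_clm_apply hd (differentiableAt_const x)]; simp
  set L : PVec n →L[ℝ] PC := LinearMap.toContinuousLinearMap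
    { toFun := fun z => q z y
      map_add' := fun a b => q_add_left a b y
      map_smul' := fun c a => q_rsmul_left c a y } with hL
  set R : PVec n →L[ℝ] PC := LinearMap.toContinuousLinearMap
    { toFun := fun z => q x z
      map_add' := fun a b => q_add_right a b x
      map_smul' := fun c a => q_rsmul_right c a x } with hR
  have h1 : fderiv ℝ (fun w => L (T w x)) w = L.comp (fderiv ℝ (fun w => T w x) w) :=
    (L.hasFDerivAt.comp w (hd.clm_apply (differentiableAt_const x)).hasFDerivAt).fderiv
  have h2 : fderiv ℝ (fun w => R (T w y)) w = R.comp (fderiv ℝ (fun w => T w y) w) :=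
    (R.hasFDerivAt.comp w (hd.clm_apply (differentiableAt_const y)).hasFDerivAt).fderiv
  have h3 : EqOn (fun w => L (T w x)) (fun w => R (T w y)) D := fun w hw => hs w hw x y
  rw [fderiv_eq_of_eqOn hD hw h3, h2] at h1
  have h4 := congrArg (fun A => A v) h1
  simp only [ContinuousLinearMap.comp_apply, hx] at h4
  exact h4.symm

variable (hD : IsOpen D) (hf : ContDiffOn ℝ ∞ (fun w => lineProj (f w)) D) (hw : w ∈ D)
include hD hf hw

theorem q_fderiv_lineProj (v : ℂ) (x y : PVec n) :
    q ((fderiv ℝ (fun w => lineProj (f w)) w v) x) y =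
      q x ((fderiv ℝ (fun w => lineProj (f w)) w v) y) :=
  q_fderiv_selfadj hD hf (fun w _ => q_lineProj_left (f w)) hw v x y

/-- The curvature of the pull-back connection. -/
theorem hor_curvature {ν : ℂ → PEnd n} (hν : ContDiffOn ℝ ∞ ν D)
    (hνt : ∀ w ∈ D, ν w ∈ tangentAt (f w)) {θ : ℂ → PEnd n}
    (hθ : ∀ v, θ v = hor (f w) (fderiv ℝ (fun w => lineProj (f w)) w v))
    (hω : ∀ v v', gform n (θ v) (tauMul n (θ v')) = 0) (v v' : ℂ) :
    hor (f w) (fderiv ℝ (fun w => hor (f w) (fderiv ℝ ν w v)) w v' -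
      fderiv ℝ (fun w => hor (f w) (fderiv ℝ ν w v')) w v) =
    -gform n (ν w) (θ v) • θ v' + gform n (ν w) (tauMul n (θ v)) • tauMul n (θ v') +
      gform n (ν w) (θ v') • θ v - gform n (ν w) (tauMul n (θ v')) • tauMul n (θ v) := by
  have hid : ∀ w ∈ D, lineProj (f w) * lineProj (f w) = lineProj (f w) := fun w _ =>
    lineProj_mul_self _
  set Q' := fun v => fderiv ℝ (fun w => lineProj (f w)) w v with hQ'
  have hpl : ∀ v, Q' v ∈ plin n := fun v =>
    fderiv_mem_plin hD hw (fun w _ => lineProj_mem_plin _) v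
  have hθ' : ∀ v, θ v = Q' v * lineProj (f w) := fun v => by
    rw [hθ, hor_eq_mul, one_sub_mul_fderiv hD hf hid hw, mul_assoc, hid w hw]
  have hθt : ∀ v, θ v ∈ tangentAt (f w) := fun v => by rw [hθ]; exact hor_mem_tangentAt _ (hpl v)
  set z := rep (f w) with hz
  have hθz : ∀ v, (θ v) z = Q' v z := fun v => by
    rw [hθ', mul_apply_eq_comp, lineProj_rep]
  -- The derivative of the line projection exchanges the line and its complement, and
  -- self-adjointness determines this half from its action `θ` on the line.
  have hu : ∀ v u, q u z = 0 → Q' v u = (-(q u (θ v z))) • z := fun v u hu => by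
    have h1 : lineProj (f w) u = 0 := by rw [lineProj_apply, hu]; simp
    have h2 := congrArg (fun A : PEnd n => A u) (fderiv_idempotent hD hf hid hw v)
    simp only [add_apply, mul_apply_eq_comp, h1, map_zero, zero_add] at h2
    rw [hQ']
    simp only
    rw [h2, lineProj_apply, q_fderiv_lineProj hD hf hw, hθz]
  have hνw := hνt w hw
  have hLp : fderiv ℝ (fun w => hor (f w) (fderiv ℝ ν w v)) w v' -
      fderiv ℝ (fun w => hor (f w) (fderiv ℝ ν w v')) w v ∈ plin n := by
    have : ∀ v, ∀ w ∈ D, hor (f w) (fderiv ℝ ν w v) ∈ plin n := fun v w hw =>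
      tangentAt_le_plin _ (hor_mem_tangentAt _ (fderiv_mem_plin hD hw
        (fun w hw => tangentAt_le_plin _ (hνt w hw)) v))
    exact (plin n).sub_mem (fderiv_mem_plin hD hw (this v) v')
      (fderiv_mem_plin hD hw (this v') v)
  refine tangent_ext (hor_mem_tangentAt _ hLp) ?_ ?_
  · have hPt := fun v => tauMul_mem_tangentAt (hθt v)
    refine Submodule.sub_mem _ (Submodule.add_mem _ (Submodule.add_mem _ ?_ ?_) ?_) ?_
    exacts [Submodule.smul_mem _ _ (hθt _), Submodule.smul_mem _ _ (hPt _),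
      Submodule.smul_mem _ _ (hθt _), Submodule.smul_mem _ _ (hPt _)]
  · have hc := curvature_component hD hf hid hw hν (fun w hw => (hνt w hw).2.1)
      (fun w hw => (hνt w hw).2.2) v v'
    refine Eq.trans (b := (Q' v' * Q' v * ν w - Q' v * Q' v' * ν w + ν w * Q' v * Q' v' * lineProj (f w) -
      ν w * Q' v' * Q' v * lineProj (f w)) z) (congrArg (fun A : PEnd n => A z) hc) ?_
    simp only [add_apply, sub_apply, mul_apply_eq_comp, hz, lineProj_rep]
    have hq : ∀ v, q (θ v z) z = 0 := fun v => q_tangent_rep (hθt v) z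
    have e1 : ∀ v v', Q' v' (Q' v (ν w z)) = (-(q (ν w z) (θ v z))) • θ v' z := fun v v' => by
      rw [hu v _ (q_tangent_rep hνw z), hpl v', ← hθz v']
    have e2 : ∀ v v', ν w (Q' v (Q' v' z)) = (-(q (θ v' z) (θ v z))) • ν w z := fun v v' => by
      rw [← hθz v', hu v _ (hq v'), hνw.1]
    -- By isotropy these products are real, hence symmetric in the directions, and the two terms
    -- built from them cancel.
    have e3 : ∀ v v', q (θ v' z) (θ v z) = gform n (θ v') (θ v) • (1 : PC) := fun v v' => by
      rw [q_eq_gform (hθt _) (hθt _), hω]; simp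
    change Q' v' (Q' v (ν w z)) - Q' v (Q' v' (ν w z)) + ν w (Q' v (Q' v' z)) -
      ν w (Q' v' (Q' v z)) = _
    rw [e1, e1, e2, e2, e3, e3, gform_comm (θ v'), q_eq_gform hνw (hθt v), q_eq_gform hνw (hθt v')]
    simp only [add_apply, sub_apply, smul_apply, tauMul_apply, neg_sub, sub_smul, neg_smul,
      smul_assoc, one_smul, ← hz]
    abel

/-- The differential of the surface is the horizontal part of the derivative of `lineProj`, so
torsion-freeness reduces to the symmetry of its second derivative. -/
theorem hor_torsion (v v' : ℂ) :
    hor (f w) (fderiv ℝ (fun w => hor (f w) (fderiv ℝ (fun w => lineProj (f w)) w v)) w v') =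
    hor (f w) (fderiv ℝ (fun w => hor (f w) (fderiv ℝ (fun w => lineProj (f w)) w v')) w v) := by
  have hid : ∀ w ∈ D, lineProj (f w) * lineProj (f w) = lineProj (f w) := fun w _ =>
    lineProj_mul_self _
  have h1 := torsion_component hD hf hid hw v v'
  have h2 := torsion_component hD hf hid hw v' v
  rw [fderiv_fderiv_comm hf hD hw, ← h2] at h1
  exact h1

end Curvature


-- The splitting in the ambient space and its Frenet data.

section Splitting

variable {S : Type*} [TopologicalSpace S] [ChartedSpace (EuclideanSpace ℝ (Fin 2)) S]

/-- An isotropic `𝐏`-alternating surface with its splitting (without superconformality). -/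
structure IsAlternatingSurface (m : ℕ) (σ : S → Hyp (2 * m))
    (𝓛 : ℕ → S → Submodule ℝ (PEnd (2 * m))) : Prop where
  smooth : SmoothMap (𝓡 2) σ
  frenet : IsFrenetSplitting m σ 𝓛
  alt : IsPAlternating m σ 𝓛

/-- The family of orthogonal projections to `𝓛_i`. -/
noncomputable def splitProj {n : ℕ} (𝓛 : ℕ → S → Submodule ℝ (PEnd n)) (i : ℕ) (s : S) :
    PEnd n →L[ℝ] PEnd n := gproj (gform n) (𝓛 i s)

/-- The image of a coordinate vector under the differential of `σ`. -/
noncomputable def coordVec {n : ℕ} (σ : S → Hyp n) (φ : ℂ → S) (v w : ℂ) : PEnd n :=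
  dmap (𝓡 2) σ (φ w) (mfderiv 𝓘(ℝ, ℂ) (𝓡 2) φ w v)

/-- The `1`-form `η_{i+1}`, extended to all endomorphisms. -/
noncomputable def sff {n : ℕ} (𝓛 : ℕ → S → Submodule ℝ (PEnd n)) (i : ℕ) (s : S) :
    TangentSpace (𝓡 2) s →L[ℝ] PEnd n →L[ℝ] PEnd n :=
  (ContinuousLinearMap.compL ℝ (PEnd n) (PEnd n) (PEnd n) (splitProj 𝓛 (i + 1) s)).comp
    (mfderiv (𝓡 2) 𝓘(ℝ, PEnd n →L[ℝ] PEnd n) (splitProj 𝓛 i) s :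
      TangentSpace (𝓡 2) s →L[ℝ] PEnd n →L[ℝ] PEnd n)

theorem deriv₁_comp {n : ℕ} {A : S → PEnd n} {φ : ℂ → S} {w : ℂ}
    (hA : MDifferentiableAt (𝓡 2) 𝓘(ℝ, PEnd n) A (φ w))
    (hφ : MDifferentiableAt 𝓘(ℝ, ℂ) (𝓡 2) φ w) (v : ℂ) :
    deriv₁ (𝓡 2) A (φ w) (mfderiv 𝓘(ℝ, ℂ) (𝓡 2) φ w v) = fderiv ℝ (fun w => A (φ w)) w v := by
  have h : mfderiv 𝓘(ℝ, ℂ) 𝓘(ℝ, PEnd n) (fun w => A (φ w)) w =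
      (mfderiv (𝓡 2) 𝓘(ℝ, PEnd n) A (φ w)).comp (mfderiv 𝓘(ℝ, ℂ) (𝓡 2) φ w) :=
    (hA.hasMFDerivAt.comp w hφ.hasMFDerivAt).mfderiv
  rw [mfderiv_eq_fderiv] at h
  rw [h]
  rfl

theorem mdifferentiableAt_param {φ : ℂ → S} {D : Set ℂ} (hD : IsOpen D)
    (hφ : ContMDiffOn 𝓘(ℝ, ℂ) (𝓡 2) ∞ φ D) {w : ℂ} (hw : w ∈ D) :
    MDifferentiableAt 𝓘(ℝ, ℂ) (𝓡 2) φ w :=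
  (hφ.contMDiffAt (hD.mem_nhds hw)).mdifferentiableAt (by simp)

namespace IsAlternatingSurface

variable {m : ℕ} {σ : S → Hyp (2 * m)} {𝓛 : ℕ → S → Submodule ℝ (PEnd (2 * m))}
  (h : IsAlternatingSurface m σ 𝓛) {i j : ℕ} {s : S}
include h

theorem le_tangentAt (hi : i ∈ Icc 1 (2 * m)) (s : S) : 𝓛 i s ≤ tangentAt (σ s) := by
  rw [← h.frenet.iSup_eq s]
  exact le_iSup₂_of_le i hi le_rfl

theorem gmet_eq (hi : i ∈ Icc 1 (2 * m)) {A B : PEnd (2 * m)} (hA : A ∈ plin (2 * m))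
    (hB : B ∈ 𝓛 i s) : gmet (σ s) A B = gform (2 * m) A B :=
  gmet_eq_gform hA (h.le_tangentAt hi s hB)

theorem mem_plin (hi : i ∈ Icc 1 (2 * m)) {A : PEnd (2 * m)} (hA : A ∈ 𝓛 i s) : A ∈ plin (2 * m) :=
  tangentAt_le_plin _ (h.le_tangentAt hi s hA)

theorem tauMul_mem (hi : i ∈ Icc 1 (2 * m)) {A : PEnd (2 * m)} (hA : A ∈ 𝓛 i s) :
    tauMul (2 * m) A ∈ 𝓛 (2 * m + 1 - i) s := by
  obtain ⟨h1, h2⟩ := hi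
  rcases Nat.even_or_odd' i with ⟨k, rfl | rfl⟩
  · have hk : m + 1 - k ∈ Icc 1 m := ⟨by omega, by omega⟩
    have e := h.alt.map_paraP _ hk s
    rw [show 2 * m - 2 * (m + 1 - k - 1) = 2 * k by omega] at e
    rw [← e] at hA
    obtain ⟨B, hB, rfl⟩ := hA
    rw [← tauMul_eq, tauMul_tauMul, show 2 * m + 1 - 2 * k = 2 * (m + 1 - k) - 1 by omega]
    exact hB
  · have hk : k + 1 ∈ Icc 1 m := ⟨by omega, by omega⟩
    have e := h.alt.map_paraP _ hk s
    rw [show 2 * m - 2 * (k + 1 - 1) = 2 * m + 1 - (2 * k + 1) by omega,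
      show 2 * (k + 1) - 1 = 2 * k + 1 by omega] at e
    rw [← e]
    exact ⟨A, hA, rfl⟩

theorem tauMul_mem_iff (hi : i ∈ Icc 1 (2 * m)) {A : PEnd (2 * m)} :
    tauMul (2 * m) A ∈ 𝓛 (2 * m + 1 - i) s ↔ A ∈ 𝓛 i s := by
  refine ⟨fun hA => ?_, h.tauMul_mem hi⟩
  have hi' : 2 * m + 1 - i ∈ Icc 1 (2 * m) := ⟨by have := hi.2; omega, by have := hi.1; omega⟩
  have := h.tauMul_mem hi' hA
  rwa [tauMul_tauMul, show 2 * m + 1 - (2 * m + 1 - i) = i by have := hi.2; omega] at this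

/-- Positivity is given for odd indices. For even `i` the map `𝐏`, an anti-isometry, carries `𝓛_i`
to the plane with the odd index `2m + 1 - i`. -/
theorem definiteOn (hi : i ∈ Icc 1 (2 * m)) (s : S) :
    DefiniteOn (gform (2 * m)) ((-1) ^ (i + 1)) (𝓛 i s) := by
  intro A hA h0
  rcases Nat.even_or_odd i with he | ho
  · rw [he.add_one.neg_one_pow]
    have hi' : 2 * m + 1 - i ∈ Icc 1 (2 * m) := ⟨by have := hi.2; omega, by have := hi.1; omega⟩
    have ho : Odd (2 * m + 1 - i) := by
      obtain ⟨k, rfl⟩ := he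
      exact ⟨m - k, by have := hi.2; omega⟩
    have hm := h.tauMul_mem hi hA
    have hne : tauMul (2 * m) A ≠ 0 := fun h' => h0 (by rw [← tauMul_tauMul A, h', map_zero])
    have := h.alt.pos_odd _ hi' ho s _ hm hne
    rw [h.gmet_eq hi' (h.mem_plin hi' hm) hm, gform_tauMul] at this
    linarith
  · rw [ho.add_one.neg_one_pow, one_mul, ← h.gmet_eq hi (h.mem_plin hi hA) hA]
    exact h.alt.pos_odd i hi ho s A hA h0

theorem isOrthProj (hi : i ∈ Icc 1 (2 * m)) (s : S) :
    IsOrthProj (gform (2 * m)) (𝓛 i s) (splitProj 𝓛 i s) :=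
  exists_isOrthProj gform_comm (h.definiteOn hi s) (h.frenet.rank_two i hi s)

theorem splitProj_mem (hi : i ∈ Icc 1 (2 * m)) (s : S) (A : PEnd (2 * m)) :
    splitProj 𝓛 i s A ∈ 𝓛 i s := (h.isOrthProj hi s).mem A

theorem splitProj_of_mem (hi : i ∈ Icc 1 (2 * m)) {A : PEnd (2 * m)} (hA : A ∈ 𝓛 i s) :
    splitProj 𝓛 i s A = A := (h.isOrthProj hi s).apply_of_mem (h.definiteOn hi s) hA

theorem orth (hi : i ∈ Icc 1 (2 * m)) (hj : j ∈ Icc 1 (2 * m)) (hij : i ≠ j) {A B : PEnd (2 * m)}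
    (hA : A ∈ 𝓛 i s) (hB : B ∈ 𝓛 j s) : gform (2 * m) A B = 0 := by
  rw [← h.gmet_eq hj (h.mem_plin hi hA) hB]
  exact h.frenet.orthogonal i hi j hj hij s A hA B hB

theorem splitProj_of_mem_ne (hi : i ∈ Icc 1 (2 * m)) (hj : j ∈ Icc 1 (2 * m)) (hij : i ≠ j)
    {A : PEnd (2 * m)} (hA : A ∈ 𝓛 j s) : splitProj 𝓛 i s A = 0 :=
  (h.isOrthProj hi s).apply_eq (h.definiteOn hi s) (Submodule.zero_mem _) fun C hC => by
    rw [h.orth hj hi hij.symm hA hC]; simp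

theorem splitProj_hor (hi : i ∈ Icc 1 (2 * m)) {A : PEnd (2 * m)} (hA : A ∈ plin (2 * m)) :
    splitProj 𝓛 i s (hor (σ s) A) = splitProj 𝓛 i s A :=
  gproj_hor (h.le_tangentAt hi s) (h.definiteOn hi s) (h.isOrthProj hi s) hA

theorem sum_splitProj {A : PEnd (2 * m)} (hA : A ∈ plin (2 * m)) :
    ∑ i ∈ Finset.Icc 1 (2 * m), splitProj 𝓛 i s A = hor (σ s) A := by
  set T : PEnd (2 * m) →ₗ[ℝ] PEnd (2 * m) :=
    ((∑ i ∈ Finset.Icc 1 (2 * m), splitProj 𝓛 i s : PEnd (2 * m) →L[ℝ] PEnd (2 * m)) :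
      PEnd (2 * m) →ₗ[ℝ] PEnd (2 * m)) with hT
  have hTa : ∀ B, T B = ∑ i ∈ Finset.Icc 1 (2 * m), splitProj 𝓛 i s B := fun B => by
    simp [hT]
  have key : tangentAt (σ s) ≤ LinearMap.eqLocus T LinearMap.id := by
    rw [← h.frenet.iSup_eq s]
    refine iSup₂_le fun j hj B hB => ?_
    rw [LinearMap.mem_eqLocus, hTa, LinearMap.id_apply, Finset.sum_eq_single_of_mem j
      (Finset.mem_Icc.2 hj) fun i hi hij => h.splitProj_of_mem_ne (Finset.mem_Icc.1 hi) hj hij hB,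
      h.splitProj_of_mem hj hB]
  have := key (hor_mem_tangentAt (σ s) hA)
  rw [LinearMap.mem_eqLocus, hTa, LinearMap.id_apply] at this
  rw [← this]
  exact Finset.sum_congr rfl fun i hi => (h.splitProj_hor (Finset.mem_Icc.1 hi) hA).symm

theorem splitProj_tauMul (hi : i ∈ Icc 1 (2 * m)) (A : PEnd (2 * m)) :
    splitProj 𝓛 (2 * m + 1 - i) s (tauMul (2 * m) A) = tauMul (2 * m) (splitProj 𝓛 i s A) := by
  have hi' : 2 * m + 1 - i ∈ Icc 1 (2 * m) := ⟨by have := hi.2; omega, by have := hi.1; omega⟩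
  refine (h.isOrthProj hi' s).apply_eq (h.definiteOn hi' s)
    (h.tauMul_mem hi (h.splitProj_mem hi s A)) fun C hC => ?_
  have hC' : tauMul (2 * m) C ∈ 𝓛 i s := by
    rw [← h.tauMul_mem_iff hi, tauMul_tauMul]; exact hC
  have := (h.isOrthProj hi s).orth A _ hC'
  rw [map_sub, sub_apply, sub_eq_zero] at this
  rw [← tauMul_tauMul C, gform_tauMul, gform_tauMul, this]

/-- In a local smooth frame the projection is given by the Gram formula, whose denominator is
positive. -/
theorem contMDiff_splitProj (hi : i ∈ Icc 1 (2 * m)) :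
    ContMDiff (𝓡 2) 𝓘(ℝ, PEnd (2 * m) →L[ℝ] PEnd (2 * m)) ∞ (splitProj 𝓛 i) := by
  intro s₀
  obtain ⟨U, hs, u, v, ⟨hU, hu, hum⟩, ⟨_, hv, hvm⟩, huv⟩ := h.frenet.smooth i hi s₀
  have hΔ : ∀ s ∈ U, 0 < gform (2 * m) (u s) (u s) * gform (2 * m) (v s) (v s) -
      gform (2 * m) (u s) (v s) ^ 2 := fun s hs =>
    gram_pos gform_comm (h.definiteOn hi s) (huv s hs) (h.frenet.rank_two i hi s)
  have h1 : ContMDiffAt (𝓡 2) 𝓘(ℝ, PEnd (2 * m) →L[ℝ] PEnd (2 * m)) ∞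
      (fun s => proj₂ (gform (2 * m)) (u s) (v s)) s₀ :=
    ContDiffAt.comp_contMDiffAt (g := fun x : PEnd (2 * m) × PEnd (2 * m) =>
      proj₂ (gform (2 * m)) x.1 x.2) (f := fun s => (u s, v s))
      (contDiffAt_proj₂ (gform (2 * m)) (hΔ s₀ hs).ne')
      ((hu.contMDiffAt (hU.mem_nhds hs)).prodMk_space (hv.contMDiffAt (hU.mem_nhds hs)))
  refine h1.congr_of_eventuallyEq ?_
  filter_upwards [hU.mem_nhds hs] with s hs
  exact IsOrthProj.unique (h.definiteOn hi s) (h.isOrthProj hi s)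
    (isOrthProj_proj₂ gform_comm (huv s hs) (hΔ s hs))

theorem isSection_splitProj (hi : i ∈ Icc 1 (2 * m)) {U : Set S} (hU : IsOpen U)
    {ν : S → PEnd (2 * m)} (hν : ContMDiffOn (𝓡 2) 𝓘(ℝ, PEnd (2 * m)) ∞ ν U) :
    IsSection (𝓡 2) (𝓛 i) U (fun s => splitProj 𝓛 i s (ν s)) :=
  ⟨hU, (h.contMDiff_splitProj hi).contMDiffOn.clm_apply hν, fun s _ => h.splitProj_mem hi s _⟩

section Pullback

variable {φ : ℂ → S} {D : Set ℂ} (hD : IsOpen D) (hφ : ContMDiffOn 𝓘(ℝ, ℂ) (𝓡 2) ∞ φ D)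
  {w : ℂ} (hw : w ∈ D)

theorem covOn_param (hi : i ∈ Icc 1 (2 * m))
    {ν : ℂ → PEnd (2 * m)} (hν : ∀ᶠ y in 𝓝 w, ν y ∈ plin (2 * m)) (v : ℂ) :
    covOn 𝓘(ℝ, ℂ) (fun w => σ (φ w)) (fun w => 𝓛 i (φ w)) ν w v =
      splitProj 𝓛 i (φ w) (fderiv ℝ ν w v) := by
  have := orthoProj_cov 𝓘(ℝ, ℂ) (f := fun w => σ (φ w)) (h.le_tangentAt hi (φ w))
    (h.definiteOn hi (φ w)) (h.isOrthProj hi (φ w)) hν v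
  refine Eq.trans this ?_
  simp only [deriv₁, mfderiv_eq_fderiv]
  rfl

theorem eta_eq (hi : i ∈ Icc 1 (2 * m)) (hj : i - 1 ∈ Icc 1 (2 * m)) (X : TangentSpace (𝓡 2) s)
    {ξ : PEnd (2 * m)} (hξ : ξ ∈ plin (2 * m)) :
    eta σ 𝓛 i s X ξ = splitProj 𝓛 i s (deriv₁ (𝓡 2) (fun y => splitProj 𝓛 (i - 1) y ξ) s X) := by
  have e : (fun y => orthoProj (σ y) (𝓛 (i - 1) y) (hor (σ y) ξ)) =
      fun y => splitProj 𝓛 (i - 1) y ξ := by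
    funext y
    rw [orthoProj_eq (h.le_tangentAt hj y) (h.definiteOn hj y) (h.isOrthProj hj y)
      (tangentAt_le_plin _ (hor_mem_tangentAt _ hξ))]
    exact h.splitProj_hor hj hξ
  rw [eta, offDiag, e]
  exact orthoProj_cov (𝓡 2) (h.le_tangentAt hi s) (h.definiteOn hi s) (h.isOrthProj hi s)
    (Filter.Eventually.of_forall fun y => h.mem_plin hj (h.splitProj_mem hj y ξ)) X

/-- The section used to define `η` is the projection of the constant `ξ`, so its derivative is that
of the family of projections applied to `ξ`. This makes linearity in both arguments automatic. -/
theorem eta_eq_sff (hi : 1 ≤ i) (hi' : i + 1 ≤ 2 * m) (X : TangentSpace (𝓡 2) s)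
    {ξ : PEnd (2 * m)} (hξ : ξ ∈ plin (2 * m)) :
    eta σ 𝓛 (i + 1) s X ξ = sff 𝓛 i s X ξ := by
  have mi : i ∈ Icc 1 (2 * m) := ⟨hi, by omega⟩
  rw [h.eta_eq ⟨by omega, hi'⟩ mi X hξ]
  set ev := ContinuousLinearMap.apply ℝ (PEnd (2 * m)) ξ
  have h1 : mfderiv (𝓡 2) 𝓘(ℝ, PEnd (2 * m)) (fun y => ev (splitProj 𝓛 i y)) s =
      ev.comp (mfderiv (𝓡 2) 𝓘(ℝ, PEnd (2 * m) →L[ℝ] PEnd (2 * m)) (splitProj 𝓛 i) s) :=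
    ((ev.hasMFDerivAt (x := splitProj 𝓛 i s)).comp s
      ((h.contMDiff_splitProj mi).mdifferentiableAt (by simp)).hasMFDerivAt).mfderiv
  have h2 : deriv₁ (𝓡 2) (fun y => splitProj 𝓛 i y ξ) s X =
      ev.comp (mfderiv (𝓡 2) 𝓘(ℝ, PEnd (2 * m) →L[ℝ] PEnd (2 * m)) (splitProj 𝓛 i) s) X := by
    rw [← h1]; rfl
  exact congrArg _ h2

theorem sff_mem (hi' : i + 1 ≤ 2 * m) (X : TangentSpace (𝓡 2) s) (ξ : PEnd (2 * m)) :
    sff 𝓛 i s X ξ ∈ 𝓛 (i + 1) s := h.splitProj_mem ⟨by omega, hi'⟩ s _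

theorem covOn_eq (hi : i ∈ Icc 1 (2 * m)) {U : Set S} {ν : S → PEnd (2 * m)}
    (hν : IsSection (𝓡 2) (𝓛 i) U ν) (hs : s ∈ U) {k : ℕ} (hk : k ∈ Icc 1 (2 * m))
    (X : TangentSpace (𝓡 2) s) :
    orthoProj (σ s) (𝓛 k s) (cov (𝓡 2) σ ν s X) = splitProj 𝓛 k s (deriv₁ (𝓡 2) ν s X) :=
  orthoProj_cov (𝓡 2) (h.le_tangentAt hk s) (h.definiteOn hk s) (h.isOrthProj hk s)
    (by filter_upwards [hν.1.mem_nhds hs] with y hy using h.mem_plin hi (hν.2.2 y hy)) X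

include hD hφ

include hw

omit hw hD in
theorem contDiffOn_splitProj_param (hi : i ∈ Icc 1 (2 * m)) :
    ContDiffOn ℝ ∞ (fun w => splitProj 𝓛 i (φ w)) D :=
  contMDiffOn_iff_contDiffOn.1 ((h.contMDiff_splitProj hi).comp_contMDiffOn hφ)

omit hw hD in
theorem contDiffOn_lineProj_param : ContDiffOn ℝ ∞ (fun w => lineProj (σ (φ w))) D :=
  contMDiffOn_iff_contDiffOn.1 ((contMDiff_lineProj (𝓡 2) h.smooth).comp_contMDiffOn hφ)

theorem coordVec_eq (v : ℂ) :
    coordVec σ φ v w = hor (σ (φ w)) (fderiv ℝ (fun w => lineProj (σ (φ w))) w v) := by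
  rw [coordVec, dmap, deriv₁_comp
    ((contMDiff_lineProj (𝓡 2) h.smooth).mdifferentiableAt (by simp))
    (mdifferentiableAt_param hD hφ hw)]

theorem sff_param (hj : j ∈ Icc 1 (2 * m)) (v : ℂ) (ξ : PEnd (2 * m)) :
    sff 𝓛 j (φ w) (mfderiv 𝓘(ℝ, ℂ) (𝓡 2) φ w v) ξ =
      splitProj 𝓛 (j + 1) (φ w) ((fderiv ℝ (fun w => splitProj 𝓛 j (φ w)) w v) ξ) := by
  have h1 : mfderiv 𝓘(ℝ, ℂ) 𝓘(ℝ, PEnd (2 * m) →L[ℝ] PEnd (2 * m)) (fun w => splitProj 𝓛 j (φ w)) w =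
      (mfderiv (𝓡 2) 𝓘(ℝ, PEnd (2 * m) →L[ℝ] PEnd (2 * m)) (splitProj 𝓛 j) (φ w)).comp
        (mfderiv 𝓘(ℝ, ℂ) (𝓡 2) φ w) :=
    (((h.contMDiff_splitProj hj).mdifferentiableAt (by simp)).hasMFDerivAt.comp w
      (mdifferentiableAt_param hD hφ hw).hasMFDerivAt).mfderiv
  rw [mfderiv_eq_fderiv] at h1
  rw [h1]
  rfl

omit h in
theorem deriv₁_section {W : S → Submodule ℝ (PEnd (2 * m))} {U : Set S} {ν : S → PEnd (2 * m)}
    (hν : IsSection (𝓡 2) W U ν) (hs : φ w ∈ U) (v : ℂ) :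
    deriv₁ (𝓡 2) ν (φ w) (mfderiv 𝓘(ℝ, ℂ) (𝓡 2) φ w v) = fderiv ℝ (fun w => ν (φ w)) w v :=
  deriv₁_comp ((hν.2.1.contMDiffAt (hν.1.mem_nhds hs)).mdifferentiableAt (by simp))
    (mdifferentiableAt_param hD hφ hw) v

omit hw in
theorem planeBundle (hi : i ∈ Icc 1 (2 * m)) :
    PlaneBundle (gform (2 * m)) ((-1) ^ (i + 1)) D (fun w => 𝓛 i (φ w))
      (fun w => splitProj 𝓛 i (φ w)) :=
  ⟨gform_comm, hD, h.contDiffOn_splitProj_param hφ hi, fun w _ => h.isOrthProj hi _,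
    fun w _ => h.definiteOn hi _, fun w _ => h.frenet.rank_two i hi _⟩

omit hw in
theorem isSec_coordVec (hm : 1 ≤ m) (v : ℂ) : IsSec D (fun w => 𝓛 1 (φ w)) (coordVec σ φ v) := by
  refine ⟨?_, fun w hw => ?_⟩
  · have h1 := h.contDiffOn_lineProj_param hφ
    have h2 : ContDiffOn ℝ ∞ (fun w => (1 - lineProj (σ (φ w))) *
        fderiv ℝ (fun w => lineProj (σ (φ w))) w v * lineProj (σ (φ w))) D :=
      ((contDiffOn_const.sub h1).mul (ContDiffOn.fderiv_dir h1 hD v)).mul h1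
    exact h2.congr fun w hw => h.coordVec_eq hD hφ hw v
  · have : coordVec σ φ v w ∈ (𝓛 1 (φ w) : Set (PEnd (2 * m))) := by
      rw [h.frenet.tangent]; exact mem_range_self _
    exact this

omit hw hφ in
theorem sum_splitProj_fderiv {ν : ℂ → PEnd (2 * m)} (hν : ∀ w ∈ D, ν w ∈ plin (2 * m)) (hw : w ∈ D)
    (v : ℂ) : ∑ i ∈ Finset.Icc 1 (2 * m), splitProj 𝓛 i (φ w) (fderiv ℝ ν w v) =
      hor (σ (φ w)) (fderiv ℝ ν w v) :=
  h.sum_splitProj (fderiv_mem_plin hD hw hν v)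

omit hw in
/-- The structure equations of the surface in a parameter domain. -/
theorem frenetData (hm : 1 ≤ m) : FrenetData (gform (2 * m)) (tauMul (2 * m)) m D
    (fun i w => 𝓛 i (φ w)) (fun i w => splitProj 𝓛 i (φ w)) (coordVec σ φ 1)
    (coordVec σ φ Complex.I) := by
  have hl := h.contDiffOn_lineProj_param hφ
  have m1 : 1 ∈ Icc 1 (2 * m) := ⟨le_rfl, by omega⟩
  refine ⟨fun i hi => h.planeBundle hD hφ hi, fun i hi j hj hij w hw A hA B hB =>
    h.orth hi hj hij hA hB, fun i hi j hj hij w hw v ξ hξ => ?_, fun i hi w hw A hA =>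
    h.tauMul_mem hi hA, h.isSec_coordVec hD hφ hm 1, h.isSec_coordVec hD hφ hm _,
    fun k hk w hw => ?_, fun j hj ν hν k hk w hw => ?_⟩
  · have hs := h.isSection_splitProj hj isOpen_univ (ν := fun _ => ξ) contMDiffOn_const
    have h1 := h.frenet.tridiagonal i hi j hj hij univ _ hs (φ w) (mem_univ _)
      (mfderiv 𝓘(ℝ, ℂ) (𝓡 2) φ w v)
    rw [h.covOn_eq hj hs (mem_univ _) hi, deriv₁_section hD hφ hw hs (mem_univ _),
      fderiv_family_apply (ContDiffOn.differentiableAt_of_isOpen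
      (h.contDiffOn_splitProj_param hφ hj) hD hw) (differentiableAt_const ξ)] at h1
    simpa using h1
  · have hpl : ∀ v v', fderiv ℝ (fun w => hor (σ (φ w)) (fderiv ℝ (fun w => lineProj (σ (φ w))) w v)) w v' ∈
        plin (2 * m) := fun v v' => fderiv_mem_plin hD hw (fun w hw =>
      tangentAt_le_plin _ (hor_mem_tangentAt _ (fderiv_mem_plin hD hw
        (fun w _ => lineProj_mem_plin _) v))) v'
    rw [fderiv_eq_of_eqOn hD hw (fun w hw => h.coordVec_eq hD hφ hw Complex.I : EqOn _ _ D),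
      fderiv_eq_of_eqOn hD hw (fun w hw => h.coordVec_eq hD hφ hw 1 : EqOn _ _ D),
      ← h.splitProj_hor hk (hpl _ _), hor_torsion hD hl hw, h.splitProj_hor hk (hpl _ _)]
  · have hνt : ∀ w ∈ D, ν w ∈ tangentAt (σ (φ w)) := fun w hw => h.le_tangentAt hj _ (hν.2 w hw)
    have hνp : ∀ w ∈ D, ν w ∈ plin (2 * m) := fun w hw => tangentAt_le_plin _ (hνt w hw)
    have hd : ∀ v, ∀ i ∈ Finset.Icc 1 (2 * m),
        DifferentiableAt ℝ (fun w => splitProj 𝓛 i (φ w) (fderiv ℝ ν w v)) w := fun v i hi =>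
      ContDiffOn.differentiableAt_of_isOpen (((h.planeBundle hD hφ (Finset.mem_Icc.1 hi)).isSec_proj
        (ContDiffOn.fderiv_dir hν.1 hD v)).1) hD hw
    -- The components of a derivative add up to its horizontal part, so the sum over `i` is the full
    -- second covariant derivative and `hor_curvature` applies.
    have e : ∀ v v', ∑ i ∈ Finset.Icc 1 (2 * m),
        fderiv ℝ (fun w => splitProj 𝓛 i (φ w) (fderiv ℝ ν w v)) w v' =
        fderiv ℝ (fun w => hor (σ (φ w)) (fderiv ℝ ν w v)) w v' := fun v v' => by
      rw [← fderiv_eq_of_eqOn hD hw (fun w hw => h.sum_splitProj_fderiv hD hνp hw v : EqOn _ _ D),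
        fderiv_fun_sum (hd v), sum_apply]
    have hω : ∀ v v', gform (2 * m) (coordVec σ φ v w) (tauMul (2 * m) (coordVec σ φ v' w)) = 0 :=
      fun v v' => by
        have h1 := (h.isSec_coordVec hD hφ hm v).2 w hw
        have h2 := h.tauMul_mem m1 ((h.isSec_coordVec hD hφ hm v').2 w hw)
        exact h.orth m1 ⟨by omega, by omega⟩ (by omega) h1 h2
    rw [← map_sum, Finset.sum_sub_distrib, e, e, ← hor_curvature hD hl hw hν.1 hνt
      (θ := fun v => coordVec σ φ v w) (fun v => h.coordVec_eq hD hφ hw v) hω, h.splitProj_hor hk]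
    have hpl : ∀ v v', fderiv ℝ (fun w => hor (σ (φ w)) (fderiv ℝ ν w v)) w v' ∈ plin (2 * m) :=
      fun v v' => fderiv_mem_plin hD hw (fun w hw => tangentAt_le_plin _ (hor_mem_tangentAt _
        (fderiv_mem_plin hD hw hνp v))) v'
    exact (plin _).sub_mem (hpl _ _) (hpl _ _)

end Pullback

end IsAlternatingSurface

end Splitting


-- Local parametrizations with open images.

section Params

variable {S : Type*} [TopologicalSpace S] [ChartedSpace (EuclideanSpace ℝ (Fin 2)) S]

/-- A local parametrization of the surface. -/
structure IsParam (φ : ℂ → S) (r : ℝ) : Prop where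
  pos : 0 < r
  smooth : ContMDiffOn 𝓘(ℝ, ℂ) (𝓡 2) ∞ φ (Metric.ball 0 r)
  bijective : ∀ w ∈ Metric.ball (0 : ℂ) r,
    Function.Bijective (mfderiv 𝓘(ℝ, ℂ) (𝓡 2) φ w : ℂ → TangentSpace (𝓡 2) (φ w))
  isOpen_image : ∀ O ⊆ Metric.ball (0 : ℂ) r, IsOpen O → IsOpen (φ '' O)

theorem IsParam.mono {φ : ℂ → S} {r r' : ℝ} (h : IsParam φ r) (hr : 0 < r') (hr' : r' ≤ r) :
    IsParam φ r' := by
  have hs : Metric.ball (0 : ℂ) r' ⊆ Metric.ball 0 r := Metric.ball_subset_ball hr'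
  exact ⟨hr, h.smooth.mono hs, fun w hw => h.bijective w (hs hw), fun O hO =>
    h.isOpen_image O (hO.trans hs)⟩

theorem IsParam.exists_subset {φ : ℂ → S} {r : ℝ} (h : IsParam φ r) {U : Set S} (hU : U ∈ 𝓝 (φ 0)) :
    ∃ r', IsParam φ r' ∧ r' ≤ r ∧ φ '' Metric.ball 0 r' ⊆ U := by
  have h0 : (0 : ℂ) ∈ Metric.ball (0 : ℂ) r := Metric.mem_ball_self h.pos
  have hc : ContinuousAt φ 0 := h.smooth.continuousOn.continuousAt (Metric.isOpen_ball.mem_nhds h0)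
  obtain ⟨r', hr', hr⟩ := Metric.mem_nhds_iff.1 (hc hU)
  refine ⟨min r r', h.mono (lt_min h.pos hr') (min_le_left _ _), min_le_left _ _, ?_⟩
  rintro _ ⟨w, hw, rfl⟩
  exact hr (Metric.ball_subset_ball (min_le_right _ _) hw)

variable [IsManifold (𝓡 2) ∞ S]

theorem exists_isParam (s₀ : S) : ∃ (φ : ℂ → S) (r : ℝ), IsParam φ r ∧ φ 0 = s₀ := by
  obtain ⟨φ, r, hr, h0, h1, h2, h3⟩ := exists_param s₀
  exact ⟨φ, r, ⟨hr, h1, h2, h3⟩, h0⟩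

end Params

-- Smooth rotations, type conditions on the surface, and local orientations.

section Rotations

theorem contDiffAt_rot₂ {V : Type*} [NormedAddCommGroup V] [NormedSpace ℝ V]
    (G : V →L[ℝ] V →L[ℝ] ℝ) {u v : V} (h : G u u * G v v - G u v ^ 2 ≠ 0) :
    ContDiffAt ℝ ∞ (fun x : V × V => rot₂ G x.1 x.2) (u, v) := by
  have a1 : ContDiffAt ℝ ∞ (fun x : V × V => x.1) (u, v) := contDiffAt_fst
  have a2 : ContDiffAt ℝ ∞ (fun x : V × V => x.2) (u, v) := contDiffAt_snd
  have b1 : ContDiffAt ℝ ∞ (fun x : V × V => G x.1) (u, v) := G.contDiff.contDiffAt.comp _ a1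
  have b2 : ContDiffAt ℝ ∞ (fun x : V × V => G x.2) (u, v) := G.contDiff.contDiffAt.comp _ a2
  by_cases hp : 0 < G u u * G v v - G u v ^ 2
  · have d : ContDiffAt ℝ ∞ (fun x : V × V => G x.1 x.1 * G x.2 x.2 - G x.1 x.2 ^ 2) (u, v) :=
      ((b1.clm_apply a1).mul (b2.clm_apply a2)).sub ((b1.clm_apply a2).pow 2)
    have hp' : √(G u u * G v v - G u v ^ 2) ≠ 0 := (Real.sqrt_pos.2 hp).ne'
    have d₁ : ContDiffAt ℝ ∞ (fun x : V × V => √(G x.1 x.1 * G x.2 x.2 - G x.1 x.2 ^ 2)) (u, v) :=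
      d.sqrt h
    have d' : ContDiffAt ℝ ∞
        (fun x : V × V => (√(G x.1 x.1 * G x.2 x.2 - G x.1 x.2 ^ 2))⁻¹) (u, v) :=
      d₁.inv hp'
    have e1 : ContDiffAt ℝ ∞ (fun x : V × V => (G x.1).smulRight x.2) (u, v) := b1.smulRight a2
    have e2 : ContDiffAt ℝ ∞ (fun x : V × V => (G x.2).smulRight x.1) (u, v) := b2.smulRight a1
    unfold rot₂
    exact d'.smul (e1.sub e2)
  -- For a negative determinant the square root is zero and so is its inverse; the map is locally
  -- constant.
  · have hlt : G u u * G v v - G u v ^ 2 < 0 := lt_of_le_of_ne (not_lt.1 hp) h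
    have hc : ContinuousAt (fun x : V × V => G x.1 x.1 * G x.2 x.2 - G x.1 x.2 ^ 2) (u, v) :=
      (((b1.clm_apply a1).mul (b2.clm_apply a2)).sub ((b1.clm_apply a2).pow 2)).continuousAt
    refine (contDiffAt_const (c := 0)).congr_of_eventuallyEq ?_
    filter_upwards [hc (isOpen_Iio.mem_nhds hlt)] with x hx
    rw [rot₂, Real.sqrt_eq_zero_of_nonpos (le_of_lt hx), inv_zero, zero_smul]

variable {S : Type*} [TopologicalSpace S] [ChartedSpace (EuclideanSpace ℝ (Fin 2)) S]

/-- `J` is a smooth family of rotations by `π/2` in `𝓛_i`. -/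
structure IsRotField {n : ℕ} (𝓛 : ℕ → S → Submodule ℝ (PEnd n)) (i : ℕ)
    (J : S → PEnd n →L[ℝ] PEnd n) : Prop where
  smooth : ContMDiff (𝓡 2) 𝓘(ℝ, PEnd n →L[ℝ] PEnd n) ∞ J
  rot : ∀ s, IsRotation (gform n) (splitProj 𝓛 i s) (J s)

/-- `η_{j+1}` is of type `(1,0)`, in the sense that `η_{j+1}(J₁ X) = η_{j+1}(X) ∘ J`. -/
def IsOneZero {n : ℕ} (σ : S → Hyp n) (𝓛 : ℕ → S → Submodule ℝ (PEnd n)) (j : ℕ)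
    (J₁ J : S → PEnd n →L[ℝ] PEnd n) : Prop :=
  ∀ φ r, IsParam φ r → ∀ w ∈ Metric.ball (0 : ℂ) r, ∀ κ : ℂ,
    coordVec σ φ Complex.I w = cact (J₁ (φ w)) κ (coordVec σ φ 1 w) → ∀ ξ ∈ 𝓛 j (φ w),
    sff 𝓛 j (φ w) (mfderiv 𝓘(ℝ, ℂ) (𝓡 2) φ w Complex.I) ξ =
      sff 𝓛 j (φ w) (mfderiv 𝓘(ℝ, ℂ) (𝓡 2) φ w (1 : ℂ)) (cact (J (φ w)) κ ξ)

/-- `η_{j+1}` has complex linear values over `V`. -/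
def IsLinearOn {n : ℕ} (𝓛 : ℕ → S → Submodule ℝ (PEnd n)) (j : ℕ)
    (J J' : S → PEnd n →L[ℝ] PEnd n) (V : Set S) : Prop :=
  ∀ s ∈ V, ∀ X : TangentSpace (𝓡 2) s, ∀ ξ ∈ 𝓛 j s,
    sff 𝓛 j s X (J s ξ) = J' s (sff 𝓛 j s X ξ)

/-- `η_{j+1}` vanishes over `V`. -/
def SffVanishesOn {n : ℕ} (𝓛 : ℕ → S → Submodule ℝ (PEnd n)) (j : ℕ) (V : Set S) : Prop :=
  ∀ s ∈ V, ∀ X : TangentSpace (𝓡 2) s, ∀ ξ ∈ 𝓛 j s, sff 𝓛 j s X ξ = 0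

/-- `σ` is an immersion. -/
def DmapInjective {n : ℕ} (σ : S → Hyp n) : Prop :=
  ∀ (s : S) (X : TangentSpace (𝓡 2) s), dmap (𝓡 2) σ s X = 0 → X = 0

theorem dmap_add {n : ℕ} (σ : S → Hyp n) (s : S) (X Y : TangentSpace (𝓡 2) s) :
    dmap (𝓡 2) σ s (X + Y) = dmap (𝓡 2) σ s X + dmap (𝓡 2) σ s Y := by
  simp only [dmap, deriv₁, hor]
  rw [map_add]
  exact (congrArg _ (ContinuousLinearMap.add_comp _ _ _)).trans (ContinuousLinearMap.comp_add _ _ _)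

theorem dmap_smul {n : ℕ} (σ : S → Hyp n) (s : S) (c : ℝ) (X : TangentSpace (𝓡 2) s) :
    dmap (𝓡 2) σ s (c • X) = c • dmap (𝓡 2) σ s X := by
  simp only [dmap, deriv₁, hor]
  rw [map_smul]
  exact (congrArg _ (ContinuousLinearMap.smul_comp _ _ _)).trans
    (ContinuousLinearMap.comp_smul _ _ _)

theorem coordVec_linear {n : ℕ} (σ : S → Hyp n) (φ : ℂ → S) (v w : ℂ) :
    coordVec σ φ v w = v.re • coordVec σ φ 1 w + v.im • coordVec σ φ Complex.I w := by
  have e : v = v.re • (1 : ℂ) + v.im • Complex.I := by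
    apply Complex.ext <;> simp
  set L : ℂ →L[ℝ] TangentSpace (𝓡 2) (φ w) := mfderiv 𝓘(ℝ, ℂ) (𝓡 2) φ w with hL
  have h1 : L v = v.re • L 1 + v.im • L Complex.I := by
    conv_lhs => rw [e]
    rw [map_add, map_smul, map_smul]
  have h2 : ∀ v, coordVec σ φ v w = dmap (𝓡 2) σ (φ w) (L v) := fun v => rfl
  rw [h2, h2, h2, h1, dmap_add, dmap_smul, dmap_smul]

theorem sff_linear {n : ℕ} (𝓛 : ℕ → S → Submodule ℝ (PEnd n)) (j : ℕ) (φ : ℂ → S) (v w : ℂ)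
    (ξ : PEnd n) :
    sff 𝓛 j (φ w) (mfderiv 𝓘(ℝ, ℂ) (𝓡 2) φ w v) ξ =
      v.re • sff 𝓛 j (φ w) (mfderiv 𝓘(ℝ, ℂ) (𝓡 2) φ w (1 : ℂ)) ξ +
      v.im • sff 𝓛 j (φ w) (mfderiv 𝓘(ℝ, ℂ) (𝓡 2) φ w Complex.I) ξ := by
  have e : v = v.re • (1 : ℂ) + v.im • Complex.I := by
    apply Complex.ext <;> simp
  conv_lhs => rw [e]
  erw [map_add, map_smul, map_smul, map_add, map_smul, map_smul]
  rfl

namespace IsAlternatingSurface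

variable {m : ℕ} {σ : S → Hyp (2 * m)} {𝓛 : ℕ → S → Submodule ℝ (PEnd (2 * m))}
  (h : IsAlternatingSurface m σ 𝓛) {i j : ℕ} {s : S}
include h

theorem rotBundle {φ : ℂ → S} {D : Set ℂ} (hD : IsOpen D) (hφ : ContMDiffOn 𝓘(ℝ, ℂ) (𝓡 2) ∞ φ D)
    (hi : i ∈ Icc 1 (2 * m)) {J : S → PEnd (2 * m) →L[ℝ] PEnd (2 * m)} {U : Set S}
    (hU : φ '' D ⊆ U)
    (hJ : ContMDiffOn (𝓡 2) 𝓘(ℝ, PEnd (2 * m) →L[ℝ] PEnd (2 * m)) ∞ J U)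
    (hJ' : ∀ s ∈ U, IsRotation (gform (2 * m)) (splitProj 𝓛 i s) (J s)) :
    RotBundle (gform (2 * m)) ((-1) ^ (i + 1)) D (fun w => 𝓛 i (φ w))
      (fun w => splitProj 𝓛 i (φ w)) (fun w => J (φ w)) :=
  ⟨h.planeBundle hD hφ hi, contMDiffOn_iff_contDiffOn.1 (hJ.comp hφ (image_subset_iff.1 hU)),
    fun w hw => hJ' _ (hU (mem_image_of_mem φ hw))⟩

theorem rotBundle_field {φ : ℂ → S} {D : Set ℂ} (hD : IsOpen D)
    (hφ : ContMDiffOn 𝓘(ℝ, ℂ) (𝓡 2) ∞ φ D) (hi : i ∈ Icc 1 (2 * m))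
    {J : S → PEnd (2 * m) →L[ℝ] PEnd (2 * m)} (hJ : IsRotField 𝓛 i J) :
    RotBundle (gform (2 * m)) ((-1) ^ (i + 1)) D (fun w => 𝓛 i (φ w))
      (fun w => splitProj 𝓛 i (φ w)) (fun w => J (φ w)) :=
  h.rotBundle hD hφ hi (subset_univ _) hJ.smooth.contMDiffOn fun s _ => hJ.rot s

theorem exists_ne_zero (hi : i ∈ Icc 1 (2 * m)) (s : S) : ∃ ξ ∈ 𝓛 i s, ξ ≠ 0 := by
  have h2 := h.frenet.rank_two i hi s
  have : Nontrivial (𝓛 i s) := Module.nontrivial_of_finrank_pos (R := ℝ) (by omega)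
  obtain ⟨⟨ξ, hξ⟩, h0⟩ := exists_ne (0 : 𝓛 i s)
  exact ⟨ξ, hξ, fun h' => h0 (Subtype.ext h')⟩

/-- A local smooth rotation. -/
theorem exists_rot_near (hi : i ∈ Icc 1 (2 * m)) (s : S) : ∃ U, IsOpen U ∧ s ∈ U ∧
    ∃ J : S → PEnd (2 * m) →L[ℝ] PEnd (2 * m),
      ContMDiffOn (𝓡 2) 𝓘(ℝ, PEnd (2 * m) →L[ℝ] PEnd (2 * m)) ∞ J U ∧
      ∀ s ∈ U, IsRotation (gform (2 * m)) (splitProj 𝓛 i s) (J s) := by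
  obtain ⟨U, hs, u, v, ⟨hU, hu, hum⟩, ⟨_, hv, hvm⟩, huv⟩ := h.frenet.smooth i hi s
  have hΔ : ∀ s ∈ U, 0 < gform (2 * m) (u s) (u s) * gform (2 * m) (v s) (v s) -
      gform (2 * m) (u s) (v s) ^ 2 := fun s hs =>
    gram_pos gform_comm (h.definiteOn hi s) (huv s hs) (h.frenet.rank_two i hi s)
  refine ⟨U, hU, hs, fun s => rot₂ (gform (2 * m)) (u s) (v s), fun s hs => ?_, fun s hs =>
    isRotation_rot₂ gform_comm (h.definiteOn hi s) (huv s hs) (hΔ s hs) (h.isOrthProj hi s)⟩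
  exact (ContDiffAt.comp_contMDiffAt (g := fun x : PEnd (2 * m) × PEnd (2 * m) =>
      rot₂ (gform (2 * m)) x.1 x.2) (f := fun s => (u s, v s))
      (contDiffAt_rot₂ (gform (2 * m)) (hΔ s hs).ne')
      ((hu.contMDiffAt (hU.mem_nhds hs)).prodMk_space
        (hv.contMDiffAt (hU.mem_nhds hs)))).contMDiffWithinAt

/-- The coordinate vectors are independent because the surface is immersed. Hence the second is a
nonreal complex multiple of the first, and `κ = i` exactly for conformal coordinates of the given
orientation. -/
theorem exists_kappa (hm : 1 ≤ m) (himm : DmapInjective σ)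
    {J₁ : S → PEnd (2 * m) →L[ℝ] PEnd (2 * m)} (hJ₁ : IsRotField 𝓛 1 J₁) {φ : ℂ → S} {r : ℝ}
    (hφ : IsParam φ r) : ∃ κ : ℂ → ℂ, ContDiffOn ℝ ∞ κ (Metric.ball 0 r) ∧
      (∀ w ∈ Metric.ball (0 : ℂ) r, (κ w).im ≠ 0) ∧
      (∀ w ∈ Metric.ball (0 : ℂ) r, coordVec σ φ 1 w ≠ 0) ∧
      ∀ w ∈ Metric.ball (0 : ℂ) r,
        coordVec σ φ Complex.I w = cact (J₁ (φ w)) (κ w) (coordVec σ φ 1 w) := by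
  have hD : IsOpen (Metric.ball (0 : ℂ) r) := Metric.isOpen_ball
  have m1 : 1 ∈ Icc 1 (2 * m) := ⟨le_rfl, by omega⟩
  have s1 := h.isSec_coordVec hD hφ.smooth hm 1
  have sI := h.isSec_coordVec hD hφ.smooth hm Complex.I
  have hb := h.rotBundle_field hD hφ.smooth m1 hJ₁
  have hne : ∀ v : ℂ, v ≠ 0 → ∀ w ∈ Metric.ball (0 : ℂ) r, coordVec σ φ v w ≠ 0 := fun v hv w hw h0 => by
    have h1 := himm _ _ h0
    exact hv ((hφ.bijective w hw).1 (h1.trans (map_zero (mfderiv 𝓘(ℝ, ℂ) (𝓡 2) φ w)).symm))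
  have hn1 := hne 1 one_ne_zero
  have hκ : ∀ w ∈ Metric.ball (0 : ℂ) r, coordVec σ φ Complex.I w =
      cact (J₁ (φ w)) (coef (gform (2 * m)) (J₁ (φ w)) (coordVec σ φ 1 w)
        (coordVec σ φ Complex.I w)) (coordVec σ φ 1 w) := fun w hw =>
    (hb.cact_coef hw (s1.2 w hw) (hn1 w hw) (sI.2 w hw)).symm
  refine ⟨_, contDiffOn_coef hb.smooth_rot s1.1 sI.1 fun w hw =>
    hb.ne_zero hw (s1.2 w hw) (hn1 w hw), fun w hw h0 => ?_, hn1, hκ⟩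
  have h1 := hκ w hw
  set κ := coef (gform (2 * m)) (J₁ (φ w)) (coordVec σ φ 1 w) (coordVec σ φ Complex.I w)
  -- If `κ` were real, the differential would kill the coordinate direction `i - κ`.
  refine hne (Complex.I - (κ.re : ℂ)) (fun h' => ?_) w hw ?_
  · simpa using congrArg Complex.im h'
  · rw [coordVec_linear, h1]
    simp only [cact, h0, zero_smul, add_zero, Complex.sub_re, Complex.I_re, Complex.ofReal_re,
      Complex.sub_im, Complex.I_im, Complex.ofReal_im, sub_zero, one_smul, zero_sub]
    exact (add_smul _ _ _).symm.trans (by rw [neg_add_cancel, zero_smul])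

/-- `η_2` is of type `(1,0)`. -/
theorem isOneZero_one (hm : 1 ≤ m) (himm : DmapInjective σ)
    (hconf : ∀ (s : S) (X : TangentSpace (𝓡 2) s), ∃ c : ℝ, ∀ ξ ∈ 𝓛 1 s, ∀ ζ ∈ 𝓛 1 s,
      gform (2 * m) (sff 𝓛 1 s X ξ) (sff 𝓛 1 s X ζ) = c * gform (2 * m) ξ ζ)
    {J₁ : S → PEnd (2 * m) →L[ℝ] PEnd (2 * m)} (hJ₁ : IsRotField 𝓛 1 J₁) :
    IsOneZero σ 𝓛 1 J₁ J₁ := by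
  intro φ r hφ w hw κ hκ ξ hξ
  have hD : IsOpen (Metric.ball (0 : ℂ) r) := Metric.isOpen_ball
  have m1 : 1 ∈ Icc 1 (2 * m) := ⟨le_rfl, by omega⟩
  obtain ⟨_, _, _, hne, _⟩ := h.exists_kappa hm himm hJ₁ hφ
  rw [h.sff_param hD hφ.smooth hw m1, h.sff_param hD hφ.smooth hw m1]
  refine (h.frenetData hD hφ.smooth hm).one_zero_two (by omega)
    (h.rotBundle_field hD hφ.smooth m1 hJ₁) hw (fun v => ?_) hκ (hne w hw) hξ
  obtain ⟨c, hc⟩ := hconf (φ w) (mfderiv 𝓘(ℝ, ℂ) (𝓡 2) φ w v)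
  refine ⟨c, fun ξ hξ ζ hζ => ?_⟩
  rw [← hc ξ hξ ζ hζ, h.sff_param hD hφ.smooth hw m1, h.sff_param hD hφ.smooth hw m1]

/-- The local orientations of `𝓛_{j+1}` induced by `𝓛_j`, and unique continuation for `η_{j+1}`. -/
theorem exists_local_rot [IsManifold (𝓡 2) ∞ S] (hm : 1 ≤ m) (himm : DmapInjective σ)
    (hj : 1 ≤ j) (hj' : j + 1 ≤ 2 * m)
    (hconf : ∀ (s : S) (X : TangentSpace (𝓡 2) s), ∃ c : ℝ, ∀ ξ ∈ 𝓛 j s, ∀ ζ ∈ 𝓛 j s,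
      gform (2 * m) (sff 𝓛 j s X ξ) (sff 𝓛 j s X ζ) = c * gform (2 * m) ξ ζ)
    {J₁ J : S → PEnd (2 * m) →L[ℝ] PEnd (2 * m)} (hJ₁ : IsRotField 𝓛 1 J₁)
    (hJ : IsRotField 𝓛 j J) (hOZ : IsOneZero σ 𝓛 j J₁ J) (s₀ : S) :
    ∃ V, IsOpen V ∧ s₀ ∈ V ∧ ∃ J' : S → PEnd (2 * m) →L[ℝ] PEnd (2 * m),
      ContMDiffOn (𝓡 2) 𝓘(ℝ, PEnd (2 * m) →L[ℝ] PEnd (2 * m)) ∞ J' V ∧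
      (∀ s ∈ V, IsRotation (gform (2 * m)) (splitProj 𝓛 (j + 1) s) (J' s)) ∧
      IsLinearOn 𝓛 j J J' V ∧
      ∀ O, IsOpen O → (O ∩ V).Nonempty → SffVanishesOn 𝓛 j (O ∩ V) → SffVanishesOn 𝓛 j V := by
  have mj : j ∈ Icc 1 (2 * m) := ⟨hj, by omega⟩
  have mk : j + 1 ∈ Icc 1 (2 * m) := ⟨by omega, hj'⟩
  obtain ⟨φ, r₀, hφ₀, rfl⟩ := exists_isParam s₀
  obtain ⟨U, hU, hsU, J₀, hJ₀, hJ₀r⟩ := h.exists_rot_near mk (φ 0)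
  obtain ⟨ξ₀, hξ₀, hξ₀0⟩ := h.exists_ne_zero mj (φ 0)
  obtain ⟨e₀, he₀, he₀0⟩ := h.exists_ne_zero mk (φ 0)
  have hpc : ∀ i ∈ Icc 1 (2 * m), ∀ A ∈ 𝓛 i (φ 0), A ≠ 0 →
      {s | splitProj 𝓛 i s A ≠ 0} ∈ 𝓝 (φ 0) := fun i hi A hA h0 => by
    have hc : Continuous fun s => splitProj 𝓛 i s A :=
      ((h.contMDiff_splitProj hi).clm_apply (contMDiff_const (c := A))).continuous
    refine (isOpen_compl_singleton.preimage hc).mem_nhds ?_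
    change splitProj 𝓛 i (φ 0) A ≠ 0
    rwa [h.splitProj_of_mem hi hA]
  -- The disc is shrunk until the local rotation is defined and the projected constants `ξ₀`, `e₀`
  -- are nowhere zero sections.
  obtain ⟨r, hφ, -, hr⟩ := hφ₀.exists_subset (Filter.inter_mem (hU.mem_nhds hsU)
    (Filter.inter_mem (hpc j mj ξ₀ hξ₀ hξ₀0) (hpc _ mk e₀ he₀ he₀0)))
  have hD : IsOpen (Metric.ball (0 : ℂ) r) := Metric.isOpen_ball
  have hrU : φ '' Metric.ball 0 r ⊆ U := hr.trans inter_subset_left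
  obtain ⟨κ, hκs, hκ0, hθ0, hκ⟩ := h.exists_kappa hm himm hJ₁ hφ
  have hfd := h.frenetData hD hφ.smooth hm
  have hp := fun w (hw : w ∈ Metric.ball (0 : ℂ) r) => h.sff_param hD hφ.smooth hw mj
  have hbJ := h.rotBundle_field hD hφ.smooth mj hJ
  have hbJ₀ := h.rotBundle hD hφ.smooth mk hrU hJ₀ hJ₀r
  have hone : ∀ w ∈ Metric.ball (0 : ℂ) r, ∀ ξ ∈ 𝓛 j (φ w), _ := fun w hw ξ hξ =>
    (hp w hw Complex.I ξ).symm.trans ((hOZ φ r hφ w hw (κ w) (hκ w hw) ξ hξ).trans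
      (hp w hw 1 (cact (J (φ w)) (κ w) ξ)))
  have hsξ := (h.planeBundle hD hφ.smooth mj).isSec_proj (contDiffOn_const (c := ξ₀))
  have hse := (h.planeBundle hD hφ.smooth mk).isSec_proj (contDiffOn_const (c := e₀))
  obtain ⟨J'', hJ'', hJJ, hlin, huc⟩ := hfd.exists_local_orientation hj hj' hbJ hbJ₀ hκs hκ0 hone
    hsξ (fun w hw => (hr (mem_image_of_mem φ hw)).2.1) hse
    (fun w hw => (hr (mem_image_of_mem φ hw)).2.2) (fun w hw => by
      obtain ⟨c, hc⟩ := hconf (φ w) (mfderiv 𝓘(ℝ, ℂ) (𝓡 2) φ w (1 : ℂ))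
      refine hfd.conformal_eq_or hj hj' hbJ hbJ₀ hw (c := c) (v := 1) (fun ξ hξ ζ hζ => ?_) (hsξ.2 w hw)
      rw [← hc ξ hξ ζ hζ, hp w hw, hp w hw])
  have hcl : ∀ c : ℂ, ∀ w ∈ Metric.ball (0 : ℂ) r, ∀ ζ ∈ 𝓛 j (φ w),
      splitProj 𝓛 (j + 1) (φ w) ((fderiv ℝ (fun w => splitProj 𝓛 j (φ w)) w 1)
        (cact (J (φ w)) c ζ)) =
      cact (J'' w) c (splitProj 𝓛 (j + 1) (φ w) ((fderiv ℝ (fun w => splitProj 𝓛 j (φ w)) w 1) ζ)) :=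
    fun c w hw ζ hζ => by
      simp only [cact, map_add, map_smul, hlin w hw ζ hζ]
  -- Linearity is known in the direction `1`. The type condition expresses every other direction
  -- through it by composition with a complex multiplication, which commutes with `J`.
  have hlinX : ∀ w ∈ Metric.ball (0 : ℂ) r, ∀ X : TangentSpace (𝓡 2) (φ w), ∀ ζ ∈ 𝓛 j (φ w),
      sff 𝓛 j (φ w) X (J (φ w) ζ) = J'' w (sff 𝓛 j (φ w) X ζ) := fun w hw X ζ hζ => by
    obtain ⟨v, rfl⟩ := (hφ.bijective w hw).2 X
    rw [sff_linear 𝓛 j φ v w, sff_linear 𝓛 j φ v w, hp w hw, hp w hw, hp w hw, hp w hw,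
      hone w hw _ (hbJ.mem hw ζ), hone w hw _ hζ, hlin w hw ζ hζ, map_add, map_smul, map_smul,
      ← hlin w hw _ (hbJ.cact_mem hw _ hζ)]
    simp only [cact, map_add, map_smul]
  refine ⟨φ '' Metric.ball 0 r, hφ.isOpen_image _ subset_rfl hD,
    mem_image_of_mem φ (Metric.mem_ball_self hφ.pos), ?_⟩
  have huc' : ∀ O, IsOpen O → (O ∩ φ '' Metric.ball 0 r).Nonempty →
      SffVanishesOn 𝓛 j (O ∩ φ '' Metric.ball 0 r) → SffVanishesOn 𝓛 j (φ '' Metric.ball 0 r) := by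
    rintro O hO ⟨_, hsO, w₁, hw₁, rfl⟩ hv _ ⟨w, hw, rfl⟩ X ξ hξ
    have hpre : IsOpen (Metric.ball (0 : ℂ) r ∩ φ ⁻¹' O) :=
      hφ.smooth.continuousOn.isOpen_inter_preimage hD hO
    have hz := huc _ hpre ⟨w₁, ⟨hw₁, hsO⟩, hw₁⟩ (fun w hw => by
      rw [← hp w hw.2]
      exact hv _ ⟨hw.1.2, mem_image_of_mem φ hw.2⟩ _ _ (hsξ.2 w hw.2)) w hw
    obtain ⟨v, rfl⟩ := (hφ.bijective w hw).2 X
    rw [sff_linear 𝓛 j φ v w, hp w hw, hp w hw, hone w hw _ hξ, hz ξ hξ,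
      hz _ (hbJ.cact_mem hw _ hξ)]
    simp
  rcases hJJ with rfl | rfl
  · refine ⟨J₀, hJ₀.mono hrU, fun s hs => hJ₀r s (hrU hs), ?_, huc'⟩
    rintro _ ⟨w, hw, rfl⟩ X ζ hζ
    exact hlinX w hw X ζ hζ
  · refine ⟨fun s => -J₀ s, (hJ₀.mono hrU).neg, fun s hs => (hJ₀r s (hrU hs)).neg, ?_, huc'⟩
    rintro _ ⟨w, hw, rfl⟩ X ζ hζ
    exact hlinX w hw X ζ hζ

end IsAlternatingSurface

end Rotations


-- Propagation of orientation and type along the splitting.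

section Orientations

theorem IsRotation.eq_of_apply_eq {V : Type*} [NormedAddCommGroup V] [NormedSpace ℝ V]
    {G : V →L[ℝ] V →L[ℝ] ℝ} {ε : ℝ} {W : Submodule ℝ V} (hG : ∀ A B, G A B = G B A)
    (hW : DefiniteOn G ε W) (h2 : Module.finrank ℝ W = 2) {p J J' : V →L[ℝ] V}
    (hp : IsOrthProj G W p) (hJ : IsRotation G p J) (hJ' : IsRotation G p J') {ξ : V} (hξ : ξ ∈ W)
    (h0 : ξ ≠ 0) (h : J ξ = J' ξ) : J = J' := by
  have hpξ := hp.apply_of_mem hW hξ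
  ext1 A
  rw [← hJ.rot_proj, ← hJ'.rot_proj, ← cact_coef hG hW h2 hp hJ hξ h0 (hp.mem A)]
  simp only [cact, map_add, map_smul, h]
  rw [hJ'.sq, ← h, hJ.sq]

variable {S : Type*} [TopologicalSpace S] [ChartedSpace (EuclideanSpace ℝ (Fin 2)) S]

/-- `η_{j+1}` has conformal values. -/
def IsConformalSff {n : ℕ} (𝓛 : ℕ → S → Submodule ℝ (PEnd n)) (j : ℕ) : Prop :=
  ∀ (s : S) (X : TangentSpace (𝓡 2) s), ∃ c : ℝ, ∀ ξ ∈ 𝓛 j s, ∀ ζ ∈ 𝓛 j s,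
    gform n (sff 𝓛 j s X ξ) (sff 𝓛 j s X ζ) = c * gform n ξ ζ

/-- `η_{j+1}` does not vanish identically. -/
def SffNonzero {n : ℕ} (𝓛 : ℕ → S → Submodule ℝ (PEnd n)) (j : ℕ) : Prop :=
  ∃ (s : S) (X : TangentSpace (𝓡 2) s), ∃ ξ ∈ 𝓛 j s, sff 𝓛 j s X ξ ≠ 0

namespace IsAlternatingSurface

variable {m : ℕ} {σ : S → Hyp (2 * m)} {𝓛 : ℕ → S → Submodule ℝ (PEnd (2 * m))}
  (h : IsAlternatingSurface m σ 𝓛) {i j : ℕ} {s : S}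
include h

/-- Neighbouring planes have opposite signs, so removing the absolute values turns the factor `c`
into `-c`; polarisation gives the bilinear form. -/
theorem isConformalSff (hC : IsSuperconformal m σ 𝓛) (hj : 1 ≤ j) (hj' : j + 1 ≤ 2 * m) :
    IsConformalSff 𝓛 j := by
  intro s X
  have mj : j ∈ Icc 1 (2 * m) := ⟨hj, by omega⟩
  have mk : j + 1 ∈ Icc 1 (2 * m) := ⟨by omega, hj'⟩
  obtain ⟨c, -, hc⟩ := hC (j + 1) ⟨by omega, hj'⟩ s X
  have habs : ∀ i ∈ Icc 1 (2 * m), ∀ A ∈ 𝓛 i s,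
      |gmet (σ s) A A| = (-1) ^ (i + 1) * gform (2 * m) A A := fun i hi A hA => by
    rw [h.gmet_eq hi (h.mem_plin hi hA) hA]
    have h0 : 0 ≤ (-1) ^ (i + 1) * gform (2 * m) A A := by
      by_cases h' : A = 0
      · simp [h']
      · exact (h.definiteOn hi s A hA h').le
    rcases neg_one_pow_eq_or ℝ (i + 1) with e | e
    · rw [e, one_mul] at h0 ⊢
      exact abs_of_nonneg h0
    · rw [e, neg_one_mul] at h0 ⊢
      exact abs_of_nonpos (by linarith)
  have hq : ∀ ξ ∈ 𝓛 j s, gform (2 * m) (sff 𝓛 j s X ξ) (sff 𝓛 j s X ξ) =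
      -c * gform (2 * m) ξ ξ := fun ξ hξ => by
    have := hc ξ hξ
    rw [h.eta_eq_sff hj hj' X (h.mem_plin mj hξ), habs _ mk _ (h.sff_mem hj' X ξ),
      habs j mj ξ hξ, pow_succ] at this
    rcases neg_one_pow_eq_or ℝ (j + 1) with e | e <;> rw [e] at this <;> linarith
  refine ⟨-c, fun ξ hξ ζ hζ => ?_⟩
  have h1 := hq _ ((𝓛 j s).add_mem hξ hζ)
  have h2 := hq ξ hξ
  have h3 := hq ζ hζ
  simp only [map_add, add_apply] at h1
  rw [gform_comm (sff 𝓛 j s X ζ) (sff 𝓛 j s X ξ), gform_comm ζ ξ] at h1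
  linarith

omit h in
theorem sff_eq_cact {J₁ J : S → PEnd (2 * m) →L[ℝ] PEnd (2 * m)}
    (hOZ : IsOneZero σ 𝓛 j J₁ J) {φ : ℂ → S} {r : ℝ} (hφ : IsParam φ r) {w : ℂ}
    (hw : w ∈ Metric.ball (0 : ℂ) r) {κ : ℂ}
    (hκ : coordVec σ φ Complex.I w = cact (J₁ (φ w)) κ (coordVec σ φ 1 w)) (v : ℂ) :
    coordVec σ φ v w = cact (J₁ (φ w)) (v.re + v.im * κ) (coordVec σ φ 1 w) ∧
    ∀ ξ ∈ 𝓛 j (φ w), sff 𝓛 j (φ w) (mfderiv 𝓘(ℝ, ℂ) (𝓡 2) φ w v) ξ =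
      sff 𝓛 j (φ w) (mfderiv 𝓘(ℝ, ℂ) (𝓡 2) φ w (1 : ℂ)) (cact (J (φ w)) (v.re + v.im * κ) ξ) := by
  constructor
  · rw [coordVec_linear, hκ]
    simp only [cact, Complex.add_re, Complex.ofReal_re, Complex.mul_re, Complex.ofReal_im,
      Complex.add_im, Complex.mul_im]
    module
  · intro ξ hξ
    rw [sff_linear, hOZ φ r hφ w hw κ hκ ξ hξ, ← map_smul, ← map_smul, ← map_add]
    congr 1
    simp only [cact, Complex.add_re, Complex.ofReal_re, Complex.mul_re, Complex.ofReal_im,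
      Complex.add_im, Complex.mul_im]
    module

variable [IsManifold (𝓡 2) ∞ S]
variable {J₁ J J' : S → PEnd (2 * m) →L[ℝ] PEnd (2 * m)}

/-- The invariant form of `IsOneZero`. -/
theorem sff_rot_left (hm : 1 ≤ m) (himm : DmapInjective σ) (hj : j ∈ Icc 1 (2 * m))
    (hJ₁ : IsRotField 𝓛 1 J₁) (hJ : IsRotField 𝓛 j J) (hOZ : IsOneZero σ 𝓛 j J₁ J)
    {X Y : TangentSpace (𝓡 2) s} (hXY : dmap (𝓡 2) σ s Y = J₁ s (dmap (𝓡 2) σ s X))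
    {ξ : PEnd (2 * m)} (hξ : ξ ∈ 𝓛 j s) : sff 𝓛 j s Y ξ = sff 𝓛 j s X (J s ξ) := by
  obtain ⟨φ, r, hφ, rfl⟩ := exists_isParam s
  have hw : (0 : ℂ) ∈ Metric.ball (0 : ℂ) r := Metric.mem_ball_self hφ.pos
  have hD : IsOpen (Metric.ball (0 : ℂ) r) := Metric.isOpen_ball
  obtain ⟨κ, -, -, hθ0, hκ⟩ := h.exists_kappa hm himm hJ₁ hφ
  obtain ⟨a, rfl⟩ := (hφ.bijective 0 hw).2 X
  obtain ⟨b, rfl⟩ := (hφ.bijective 0 hw).2 Y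
  obtain ⟨ha, ha'⟩ := sff_eq_cact hOZ hφ hw (hκ 0 hw) a
  obtain ⟨hb, hb'⟩ := sff_eq_cact hOZ hφ hw (hκ 0 hw) b
  have b1 := h.rotBundle_field hD hφ.smooth (i := 1) ⟨le_rfl, by omega⟩ hJ₁
  have bj := h.rotBundle_field hD hφ.smooth hj hJ
  have hθ := (h.isSec_coordVec hD hφ.smooth hm 1).2 0 hw
  change coordVec σ φ b 0 = J₁ (φ 0) (coordVec σ φ a 0) at hXY
  rw [ha, hb, ← cact_I (J₁ (φ 0)) (cact _ _ _), ← b1.cact_mul hw _ _ hθ] at hXY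
  have hab := b1.cact_cancel hw hθ (hθ0 0 hw) hXY
  rw [hb' ξ hξ, ha' _ (bj.mem hw ξ), hab, mul_comm Complex.I, bj.cact_mul hw _ _ hξ, cact_I]

/-- The interior of the zero set is closed, by unique continuation near each point of its closure,
and the surface is connected. -/
theorem sff_eq_zero_of_open [PreconnectedSpace S] (hm : 1 ≤ m) (himm : DmapInjective σ)
    (hj : 1 ≤ j) (hj' : j + 1 ≤ 2 * m) (hconf : IsConformalSff 𝓛 j)
    (hJ₁ : IsRotField 𝓛 1 J₁) (hJ : IsRotField 𝓛 j J) (hOZ : IsOneZero σ 𝓛 j J₁ J)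
    {O : Set S} (hO : IsOpen O) (hne : O.Nonempty) (hv : SffVanishesOn 𝓛 j O) :
    SffVanishesOn 𝓛 j univ := by
  set Z : Set S := interior {s | ∀ X : TangentSpace (𝓡 2) s, ∀ ξ ∈ 𝓛 j s, sff 𝓛 j s X ξ = 0}
  have hOZ' : O ⊆ Z := interior_maximal (fun s hs => hv s hs) hO
  have hZ : Z = univ := by
    refine IsClopen.eq_univ ⟨?_, isOpen_interior⟩ (hne.mono hOZ')
    rw [← closure_subset_iff_isClosed]
    intro s hs
    obtain ⟨V, hV, hsV, K, -, -, -, huc⟩ := h.exists_local_rot hm himm hj hj' hconf hJ₁ hJ hOZ s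
    have h1 := huc Z isOpen_interior (by
      rw [inter_comm]; exact mem_closure_iff.1 hs V hV hsV) fun s hs => interior_subset hs.1
    exact mem_interior.2 ⟨V, fun s hs => h1 s hs, hV, hsV⟩
  intro s _
  have : s ∈ Z := hZ ▸ mem_univ s
  exact interior_subset this

theorem dense_sff_ne_zero [PreconnectedSpace S] (hm : 1 ≤ m) (himm : DmapInjective σ)
    (hj : 1 ≤ j) (hj' : j + 1 ≤ 2 * m) (hconf : IsConformalSff 𝓛 j)
    (hJ₁ : IsRotField 𝓛 1 J₁) (hJ : IsRotField 𝓛 j J) (hOZ : IsOneZero σ 𝓛 j J₁ J)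
    (hnz : SffNonzero 𝓛 j) :
    Dense {s | ∃ X : TangentSpace (𝓡 2) s, ∃ ξ ∈ 𝓛 j s, sff 𝓛 j s X ξ ≠ 0} := by
  rw [dense_iff_inter_open]
  intro O hO hne
  by_contra hcon
  obtain ⟨s, X, ξ, hξ, h0⟩ := hnz
  refine h0 (h.sff_eq_zero_of_open hm himm hj hj' hconf hJ₁ hJ hOZ hO hne ?_ s trivial X ξ hξ)
  intro s hs X ξ hξ
  by_contra h1
  exact hcon ⟨s, hs, X, ξ, hξ, h1⟩

/-- The orientation of `𝓛_j` induces one of `𝓛_{j+1}`. -/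
theorem exists_rotField_succ [PreconnectedSpace S] (hm : 1 ≤ m) (himm : DmapInjective σ)
    (hj : 1 ≤ j) (hj' : j + 1 ≤ 2 * m) (hconf : IsConformalSff 𝓛 j)
    (hJ₁ : IsRotField 𝓛 1 J₁) (hJ : IsRotField 𝓛 j J) (hOZ : IsOneZero σ 𝓛 j J₁ J)
    (hnz : SffNonzero 𝓛 j) :
    ∃ J' : S → PEnd (2 * m) →L[ℝ] PEnd (2 * m), IsRotField 𝓛 (j + 1) J' ∧
      IsLinearOn 𝓛 j J J' univ := by
  have mk : j + 1 ∈ Icc 1 (2 * m) := ⟨by omega, hj'⟩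
  have hdense := h.dense_sff_ne_zero hm himm hj hj' hconf hJ₁ hJ hOZ hnz
  choose V hV hsV K hK hKr hlin _ using
    h.exists_local_rot hm himm hj hj' hconf hJ₁ hJ hOZ
  -- At a point where `η_{j+1} ≠ 0`, linearity determines the rotation on a nonzero vector, hence
  -- entirely. Such points are dense, so continuity gives agreement on the whole overlap.
  have key : ∀ a b, ∀ s ∈ V a ∩ V b, K a s = K b s := by
    intro a b s hs
    by_contra hne
    obtain ⟨A, hA⟩ : ∃ A, K a s A ≠ K b s A := by
      by_contra! hcon
      exact hne (ContinuousLinearMap.ext hcon)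
    have hc : ∀ a, ContinuousOn (fun s => K a s A) (V a) := fun a =>
      ((hK a).clm_apply contMDiffOn_const).continuousOn
    have ho : IsOpen ((V a ∩ V b) ∩ (fun s => K a s A - K b s A) ⁻¹' {0}ᶜ) :=
      (((hc a).mono inter_subset_left).sub
        ((hc b).mono inter_subset_right)).isOpen_inter_preimage
        ((hV a).inter (hV b)) isOpen_compl_singleton
    obtain ⟨t, ⟨⟨hta, htb⟩, ht0⟩, X, ξ, hξ, h0⟩ := hdense.inter_open_nonempty _ ho
      ⟨s, hs, sub_ne_zero.2 hA⟩
    refine ht0 (sub_eq_zero.2 (DFunLike.congr_fun (IsRotation.eq_of_apply_eq gform_comm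
      (h.definiteOn mk t) (h.frenet.rank_two _ mk t) (h.isOrthProj mk t) (hKr a t hta)
      (hKr b t htb) (h.sff_mem hj' X ξ) h0 ?_) A))
    rw [← hlin a t hta X ξ hξ, ← hlin b t htb X ξ hξ]
  refine ⟨fun s => K s s, ⟨fun s => ?_, fun s => hKr s s (hsV s)⟩, fun s _ X ξ hξ =>
    hlin s s (hsV s) X ξ hξ⟩
  refine ((hK s).contMDiffAt ((hV s).mem_nhds (hsV s))).congr_of_eventuallyEq ?_
  filter_upwards [(hV s).mem_nhds (hsV s)] with t ht using key t s t ⟨hsV t, ht⟩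

/-- The wedge identity gives the type wherever `η_{j+1} ≠ 0`. The type condition is closed and these
points are dense. -/
theorem isOneZero_succ [PreconnectedSpace S] (hm : 1 ≤ m) (himm : DmapInjective σ)
    (hj : 1 ≤ j) (hj' : j + 2 ≤ 2 * m) (hconf : IsConformalSff 𝓛 j)
    (hJ₁ : IsRotField 𝓛 1 J₁) (hJ : IsRotField 𝓛 j J) (hOZ : IsOneZero σ 𝓛 j J₁ J)
    (hnz : SffNonzero 𝓛 j) (hJ' : IsRotField 𝓛 (j + 1) J') (hlin : IsLinearOn 𝓛 j J J' univ) :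
    IsOneZero σ 𝓛 (j + 1) J₁ J' := by
  intro φ r hφ w hw κ₀ hκ₀ ζ hζ
  have mj : j ∈ Icc 1 (2 * m) := ⟨hj, by omega⟩
  have mk : j + 1 ∈ Icc 1 (2 * m) := ⟨by omega, by omega⟩
  have ml : j + 2 ∈ Icc 1 (2 * m) := ⟨by omega, hj'⟩
  have hdense := h.dense_sff_ne_zero hm himm hj (by omega) hconf hJ₁ hJ hOZ hnz
  have hD : IsOpen (Metric.ball (0 : ℂ) r) := Metric.isOpen_ball
  have hfd := h.frenetData hD hφ.smooth hm
  obtain ⟨κ, hκs, -, hθ0, hκ⟩ := h.exists_kappa hm himm hJ₁ hφ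
  have b1 := h.rotBundle_field hD hφ.smooth (i := 1) ⟨le_rfl, by omega⟩ hJ₁
  have bj := h.rotBundle_field hD hφ.smooth mj hJ
  have bk := h.rotBundle_field hD hφ.smooth mk hJ'
  have hθ := (h.isSec_coordVec hD hφ.smooth hm 1).2
  obtain rfl : κ₀ = κ w := b1.cact_cancel hw (hθ w hw) (hθ0 w hw) (hκ₀.symm.trans (hκ w hw))
  rw [h.sff_param hD hφ.smooth hw mk, h.sff_param hD hφ.smooth hw mk]
  have hsζ := bk.isSec_proj (contDiffOn_const (c := ζ))
  have c1 := (hfd.isSec_sff mk ml hsζ Complex.I).1.continuousOn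
  have c2 := (hfd.isSec_sff mk ml (ν := fun w => cact (J' (φ w)) (κ w) (splitProj 𝓛 (j + 1) (φ w) ζ))
    ⟨contDiffOn_cact bk.smooth_rot hκs hsζ.1, fun w hw => bk.cact_mem hw _ (hsζ.2 w hw)⟩
    1).1.continuousOn
  have ho := (c1.sub c2).isOpen_inter_preimage hD (isOpen_compl_singleton (x := 0))
  by_contra hne
  obtain ⟨_, ⟨y, ⟨hy, hy0⟩, rfl⟩, X, ξ, hξ, h0⟩ := hdense.inter_open_nonempty _
    (hφ.isOpen_image _ inter_subset_left ho) ⟨φ w, w, ⟨hw, by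
      change _ - _ ≠ (0 : PEnd (2 * m))
      simp only [h.splitProj_of_mem mk hζ]
      exact sub_ne_zero.2 hne⟩, rfl⟩
  obtain ⟨v, rfl⟩ := (hφ.bijective y hy).2 X
  have hp := fun v => h.sff_param hD hφ.smooth hy mj v
  rw [(sff_eq_cact hOZ hφ hy (hκ y hy) v).2 ξ hξ, hp] at h0
  refine hy0 (sub_eq_zero.2 (hfd.one_zero_succ hj hj' bj bk hy (κ := κ y) (fun ξ hξ => ?_)
    (fun ξ hξ => ?_) (bj.cact_mem hy _ hξ) h0 (hsζ.2 y hy)))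
  · rw [← hp, ← hp]
    exact hlin _ trivial _ ξ hξ
  · rw [← hp, ← hp]
    exact hOZ φ r hφ y hy _ (hκ y hy) ξ hξ

/-- The orientation of `𝓛_1` induces orientations of `𝓛_2, …, 𝓛_m`. -/
theorem exists_rotFields [PreconnectedSpace S] (hm : 1 ≤ m) (himm : DmapInjective σ)
    (hC : IsSuperconformal m σ 𝓛) (hJ₁ : IsRotField 𝓛 1 J₁)
    (hnz : ∀ j, 1 ≤ j → j + 1 ≤ m → SffNonzero 𝓛 j) :
    ∃ J : ℕ → S → PEnd (2 * m) →L[ℝ] PEnd (2 * m), J 1 = J₁ ∧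
      (∀ i ∈ Icc 1 m, IsRotField 𝓛 i (J i) ∧ IsOneZero σ 𝓛 i J₁ (J i)) ∧
      ∀ i, 1 ≤ i → i + 1 ≤ m → IsLinearOn 𝓛 i (J i) (J (i + 1)) univ := by
  have key : ∀ k, k + 1 ≤ m → ∃ J : ℕ → S → PEnd (2 * m) →L[ℝ] PEnd (2 * m), J 1 = J₁ ∧
      (∀ i ∈ Icc 1 (k + 1), IsRotField 𝓛 i (J i) ∧ IsOneZero σ 𝓛 i J₁ (J i)) ∧
      ∀ i, 1 ≤ i → i + 1 ≤ k + 1 → IsLinearOn 𝓛 i (J i) (J (i + 1)) univ := by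
    intro k
    induction k with
    | zero =>
      refine fun _ => ⟨fun _ => J₁, rfl, fun i hi => ?_, fun i h1 h2 => by omega⟩
      obtain rfl : i = 1 := le_antisymm hi.2 hi.1
      exact ⟨hJ₁, h.isOneZero_one hm himm (h.isConformalSff hC le_rfl (by omega)) hJ₁⟩
    | succ k ih =>
      intro hk
      obtain ⟨J, hJ1, hJ, hlin⟩ := ih (by omega)
      obtain ⟨hr, ho⟩ := hJ (k + 1) ⟨by omega, le_rfl⟩
      have hc := h.isConformalSff hC (j := k + 1) (by omega) (by omega)
      have hn := hnz (k + 1) (by omega) hk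
      obtain ⟨J', hJ', hl⟩ := h.exists_rotField_succ hm himm (by omega) (by omega) hc hJ₁ hr ho hn
      have ho' := h.isOneZero_succ hm himm (by omega) (by omega) hc hJ₁ hr ho hn hJ' hl
      refine ⟨Function.update J (k + 2) J', ?_, fun i hi => ?_, fun i h1 h2 => ?_⟩
      · rw [Function.update_of_ne (by omega), hJ1]
      · rcases eq_or_ne i (k + 2) with rfl | hne
        · rw [Function.update_self]
          exact ⟨hJ', ho'⟩
        · rw [Function.update_of_ne hne]
          exact hJ i ⟨hi.1, by have := hi.2; omega⟩
      · rw [Function.update_of_ne (by omega)]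
        rcases eq_or_ne i (k + 1) with rfl | hne
        · rw [Function.update_self]
          exact hl
        · rw [Function.update_of_ne (by omega)]
          exact hlin i h1 (by omega)
  obtain ⟨k, rfl⟩ : ∃ k, m = k + 1 := ⟨m - 1, by omega⟩
  exact key k le_rfl

/-- `η_{m+1}` has antilinear values. -/
theorem sff_middle (hm : 1 ≤ m) (himm : DmapInjective σ) (hJ₁ : IsRotField 𝓛 1 J₁)
    (hJ : IsRotField 𝓛 m J) (hOZ : IsOneZero σ 𝓛 m J₁ J) (X : TangentSpace (𝓡 2) s)
    {ξ : PEnd (2 * m)} (hξ : ξ ∈ 𝓛 m s) : sff 𝓛 m s X (J s ξ) =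
      -tauMul (2 * m) (J s (tauMul (2 * m) (sff 𝓛 m s X ξ))) := by
  have mm : m ∈ Icc 1 (2 * m) := ⟨hm, by omega⟩
  obtain ⟨φ, r, hφ, rfl⟩ := exists_isParam s
  have hw : (0 : ℂ) ∈ Metric.ball (0 : ℂ) r := Metric.mem_ball_self hφ.pos
  have hD : IsOpen (Metric.ball (0 : ℂ) r) := Metric.isOpen_ball
  obtain ⟨κ, -, hκ0, hθ0, hκ⟩ := h.exists_kappa hm himm hJ₁ hφ
  have hp := fun v => h.sff_param hD hφ.smooth hw mm v
  have bj := h.rotBundle_field hD hφ.smooth mm hJ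
  have key : ∀ ξ ∈ 𝓛 m (φ 0), _ := fun ξ hξ =>
    (h.frenetData hD hφ.smooth hm).middle_antilinear hm bj hw gform_tauMul tauMul_tauMul
      (fun w _ A => by
        have := h.splitProj_tauMul (s := φ w) mm A
        rwa [show 2 * m + 1 - m = m + 1 by omega] at this) (hκ0 0 hw) (fun ξ hξ => by
      rw [← hp, ← hp]; exact hOZ φ r hφ 0 hw _ (hκ 0 hw) ξ hξ) (ξ := ξ) hξ
  obtain ⟨a, rfl⟩ := (hφ.bijective 0 hw).2 X
  obtain ⟨-, ha'⟩ := sff_eq_cact hOZ hφ hw (hκ 0 hw) a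
  rw [ha' _ (bj.mem hw ξ), ha' _ hξ, hp, hp, ← key _ (bj.cact_mem hw _ hξ)]
  simp only [cact, map_add, map_smul]

end IsAlternatingSurface

end Orientations


-- Tangent projections and the ambient submodules they span.

section Evaluation

variable {n : ℕ} {p : Hyp n}

/-- The endomorphism `v ↦ v_i w`. -/
noncomputable def rankOne (i : Fin (n + 1)) : PVec n →L[ℝ] PEnd n :=
  LinearMap.toContinuousLinearMap
    { toFun := fun w => LinearMap.toContinuousLinearMap
        { toFun := fun v : PVec n => v i • w
          map_add' := fun a b => by rw [Pi.add_apply, add_smul]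
          map_smul' := fun c a => by rw [Pi.smul_apply, smul_assoc, RingHom.id_apply] }
      map_add' := fun a b => by
        ext1 v
        exact smul_add (v i) a b
      map_smul' := fun c a => by
        ext1 v
        exact smul_comm (v i) c a }

theorem rankOne_apply (i : Fin (n + 1)) (w v : PVec n) : rankOne i w v = v i • w := rfl

/-- The endomorphism `v ↦ -q(v, z) w`, `p = [z]`. -/
noncomputable def outer (p : Hyp n) (w : PVec n) : PEnd n :=
  LinearMap.toContinuousLinearMap
    { toFun := fun v : PVec n => -q v (rep p) • w
      map_add' := fun a b => by rw [q_add_left, neg_add, add_smul]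
      map_smul' := fun c a => by rw [q_rsmul_left, ← smul_neg, smul_assoc, RingHom.id_apply] }

theorem outer_apply (w v : PVec n) : outer p w v = -q v (rep p) • w := rfl

theorem outer_rep (w : PVec n) : outer p w (rep p) = w := by
  rw [outer_apply, q_rep, neg_neg, one_smul]

theorem outer_mem_plin (w : PVec n) : outer p w ∈ plin n := fun c v => by
  rw [outer_apply, outer_apply, q_smul_left, ← mul_neg, mul_smul]

/-- Multiplication by a para-complex number. -/
noncomputable def pcMul (c : PC) (A : PEnd n) : PEnd n := re c • A + im c • tauMul n A

theorem pcMul_apply (c : PC) (A : PEnd n) (w : PVec n) : pcMul c A w = c • A w := by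
  conv_rhs => rw [eq_re_add_tau_im c]
  rw [pcMul, add_apply, smul_apply, smul_apply, tauMul_apply, add_smul, smul_assoc, smul_assoc,
    one_smul]

theorem pcMul_mem_plin (c : PC) {A : PEnd n} (hA : A ∈ plin n) : pcMul c A ∈ plin n := fun d w => by
  rw [pcMul_apply, pcMul_apply, hA, smul_comm]

theorem hor_rep (A : PEnd n) : hor p A (rep p) = A (rep p) - lineProj p (A (rep p)) := by
  rw [hor_apply, sub_apply, ContinuousLinearMap.comp_apply, ContinuousLinearMap.comp_apply,
    ContinuousLinearMap.comp_apply, lineProj_rep]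

theorem hor_congr {A B : PEnd n} (hA : A ∈ plin n) (hB : B ∈ plin n)
    (h : A (rep p) = B (rep p)) : hor p A = hor p B :=
  tangent_ext (hor_mem_tangentAt p hA) (hor_mem_tangentAt p hB) (by rw [hor_rep, hor_rep, h])

/-- A self-adjoint para-complex linear projection of `T_p ℍ`, extended to all endomorphisms. -/
structure IsTangentProj (p : Hyp n) (Q : PEnd n →L[ℝ] PEnd n) : Prop where
  mem : ∀ A, Q A ∈ tangentAt p
  hor : ∀ A ∈ plin n, Q (hor p A) = Q A
  tau : ∀ A, Q (tauMul n A) = tauMul n (Q A)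
  selfadj : ∀ A B, gform n (Q A) B = gform n A (Q B)
  idem : ∀ A, Q (Q A) = Q A

/-- For a para-complex linear endomorphism `Q` of `T_p ℍ = Hom(ℓ, ℓ^⊥)`, the endomorphism `L`
of `ℓ^⊥` with `Q A = L A`. -/
noncomputable def leftMul (Q : PEnd n →L[ℝ] PEnd n) : PEnd n :=
  ∑ i, (ContinuousLinearMap.apply ℝ (PVec n) (stdVec i)) ∘L Q ∘L rankOne i

theorem leftMul_apply (Q : PEnd n →L[ℝ] PEnd n) (w : PVec n) :
    leftMul Q w = ∑ i, Q (rankOne i w) (stdVec i) := by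
  rw [leftMul, sum_apply]
  rfl

/-- The projection onto the subspace spanned by `ℓ` and the vectors `A z`, `A` in the image of `Q`. -/
noncomputable def spanProj (p : Hyp n) (Q : PEnd n →L[ℝ] PEnd n) : PEnd n := lineProj p + leftMul Q

namespace IsTangentProj

variable {Q : PEnd n →L[ℝ] PEnd n} (hQ : IsTangentProj p Q)
include hQ

theorem map_pcMul (c : PC) (A : PEnd n) : Q (pcMul c A) = pcMul c (Q A) := by
  rw [pcMul, map_add, map_smul, map_smul, hQ.tau, pcMul]

theorem congr {A B : PEnd n} (hA : A ∈ plin n) (hB : B ∈ plin n)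
    (h : A (rep p) = B (rep p)) : Q A = Q B := by
  rw [← hQ.hor A hA, hor_congr hA hB h, hQ.hor B hB]

/-- The formula by coordinates defines `leftMul` as a visibly smooth function of `Q`. The map `outer
p w` sends `z` to `w`, and para-complex linearity collects the coordinates of `z`. -/
theorem leftMul_eq (w : PVec n) : leftMul Q w = Q (outer p w) (rep p) := by
  have h : ∀ i, Q (rankOne i w) = pcMul (rep p i) (Q (outer p w)) := fun i => by
    rw [← hQ.map_pcMul]
    refine hQ.congr (fun c v => ?_) (pcMul_mem_plin _ (outer_mem_plin w)) ?_
    · rw [rankOne_apply, rankOne_apply, Pi.smul_apply, smul_assoc]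
    · rw [pcMul_apply, outer_rep, rankOne_apply]
  rw [leftMul_apply]
  simp_rw [h, pcMul_apply, ← (hQ.mem _).1]
  rw [← map_sum, sum_smul_stdVec]

theorem leftMul_apply_rep {A : PEnd n} (hA : A ∈ plin n) :
    leftMul Q (A (rep p)) = Q A (rep p) := by
  rw [hQ.leftMul_eq, hQ.congr (outer_mem_plin _) hA (outer_rep _)]

theorem leftMul_mem_plin : leftMul Q ∈ plin n := fun c w => by
  rw [hQ.leftMul_eq, hQ.leftMul_eq, hQ.congr (outer_mem_plin _)
    (pcMul_mem_plin c (outer_mem_plin w)) (by rw [pcMul_apply, outer_rep, outer_rep]),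
    hQ.map_pcMul, pcMul_apply]

theorem leftMul_mul {A : PEnd n} (hA : A ∈ tangentAt p) : leftMul Q * A = Q A := by
  ext1 w
  rw [mul_apply_eq_comp, tangent_apply hA, hQ.leftMul_mem_plin, hQ.leftMul_apply_rep hA.1,
    ← tangent_apply (hQ.mem A)]

theorem lineProj_mul_leftMul : lineProj p * leftMul Q = 0 := by
  ext1 w
  rw [mul_apply_eq_comp, hQ.leftMul_eq]
  exact DFunLike.congr_fun (hQ.mem (outer p w)).2.2 (rep p)

theorem leftMul_mul_lineProj : leftMul Q * lineProj p = 0 := by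
  have h0 : leftMul Q (rep p) = 0 := by
    have h1 : ParaHyp.hor p (lineProj p) = 0 := by
      rw [hor_eq_mul, sub_mul, one_mul, lineProj_mul_self, sub_self, zero_mul]
    have h2 := hQ.leftMul_apply_rep (lineProj_mem_plin p)
    rw [lineProj_rep, ← hQ.hor _ (lineProj_mem_plin p), h1, map_zero] at h2
    exact h2
  ext1 w
  rw [mul_apply_eq_comp, lineProj_apply, hQ.leftMul_mem_plin, h0, smul_zero]
  rfl

theorem leftMul_mul_leftMul : leftMul Q * leftMul Q = leftMul Q := by
  ext1 w
  rw [mul_apply_eq_comp, hQ.leftMul_eq w, hQ.leftMul_apply_rep (hQ.mem _).1, hQ.idem]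

theorem q_leftMul (x y : PVec n) : q (leftMul Q x) y = q x (leftMul Q y) := by
  have hB := outer_mem_plin (p := p) x
  have hC := outer_mem_plin (p := p) y
  have e1 : ∀ A ∈ tangentAt p, ∀ y, q (A (rep p)) (ParaHyp.hor p (outer p y) (rep p)) =
      q (A (rep p)) y := fun A hA y => by
    rw [hor_rep, outer_rep, lineProj_apply, q_sub_right, q_smul_right, q_tangent_rep hA, mul_zero,
      sub_zero]
  have e2 : ∀ A ∈ tangentAt p, ∀ x, q (ParaHyp.hor p (outer p x) (rep p)) (A (rep p)) =
      q x (A (rep p)) := fun A hA x => by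
    rw [← conj_q, e1 A hA, conj_q]
  have hhC := hor_mem_tangentAt p hC
  rw [hQ.leftMul_eq, hQ.leftMul_eq, ← e1 _ (hQ.mem _), ← e2 _ (hQ.mem _),
    q_eq_gform (hQ.mem _) hhC, q_eq_gform (hor_mem_tangentAt p hB) (hQ.mem _),
    hQ.selfadj, hQ.selfadj, hQ.hor _ hC, hQ.tau, hQ.hor _ hC, gform_hor hB (hQ.mem _),
    gform_hor hB (tauMul_mem_tangentAt (hQ.mem _))]

theorem spanProj_mul_self : spanProj p Q * spanProj p Q = spanProj p Q := by
  rw [spanProj, mul_add, add_mul, add_mul, lineProj_mul_self, hQ.leftMul_mul_lineProj,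
    hQ.lineProj_mul_leftMul, hQ.leftMul_mul_leftMul, add_zero, zero_add]

theorem spanProj_mul_lineProj : spanProj p Q * lineProj p = lineProj p := by
  rw [spanProj, add_mul, lineProj_mul_self, hQ.leftMul_mul_lineProj, add_zero]

theorem spanProj_mul {A : PEnd n} (hA : A ∈ tangentAt p) : spanProj p Q * A = Q A := by
  have : lineProj p * A = 0 := hA.2.2
  rw [spanProj, add_mul, this, zero_add, hQ.leftMul_mul hA]

theorem q_spanProj (x y : PVec n) : q (spanProj p Q x) y = q x (spanProj p Q y) := by
  rw [spanProj, add_apply, add_apply, q_add_left, q_add_right, q_lineProj_left, hQ.q_leftMul]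

theorem spanProj_apply (x : PVec n) :
    spanProj p Q x = lineProj p x + Q (outer p x) (rep p) := by
  rw [spanProj, add_apply, hQ.leftMul_eq]

end IsTangentProj

/-- If `ℓ` and the image of `Q` are parallel modulo their span, then the span is constant. -/
theorem fderiv_spanProj {D : Set ℂ} (hD : IsOpen D) {f : ℂ → Hyp n}
    {Q : ℂ → PEnd n →L[ℝ] PEnd n} (hf : ContDiffOn ℝ ∞ (fun w => lineProj (f w)) D)
    (hQ : ContDiffOn ℝ ∞ Q D) (hQp : ∀ w ∈ D, IsTangentProj (f w) (Q w)) {w : ℂ} (hw : w ∈ D) (v : ℂ)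
    (hθ : Q w (hor (f w) (fderiv ℝ (fun w => lineProj (f w)) w v)) =
      hor (f w) (fderiv ℝ (fun w => lineProj (f w)) w v))
    (hpar : ∀ A, Q w A = A → Q w (hor (f w) ((fderiv ℝ Q w v) A)) = hor (f w) ((fderiv ℝ Q w v) A)) :
    fderiv ℝ (fun w => spanProj (f w) (Q w)) w v = 0 := by
  have hT : ContDiffOn ℝ ∞ (fun w => spanProj (f w) (Q w)) D := by
    refine hf.add ?_
    refine ContDiffOn.sum fun i _ => contDiffOn_const.clm_comp (hQ.clm_comp contDiffOn_const)
  have hid : ∀ w ∈ D, spanProj (f w) (Q w) * spanProj (f w) (Q w) = spanProj (f w) (Q w) :=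
    fun w hw => (hQp w hw).spanProj_mul_self
  have hQd := ContDiffOn.differentiableAt_of_isOpen hQ hD hw
  set T := spanProj (f w) (Q w) with hTdef
  set T' := fderiv ℝ (fun w => spanProj (f w) (Q w)) w v with hT'
  set L := lineProj (f w) with hL
  set L' := fderiv ℝ (fun w => lineProj (f w)) w v with hL'
  have hLL : L * L = L := lineProj_mul_self _
  have hTT : (1 - T) * (1 - T) = 1 - T := by
    have : T * T = T := hid w hw
    rw [mul_sub, sub_mul, sub_mul, this]; simp
  have hTL : (1 - T) * L = 0 := by
    rw [sub_mul, one_mul, sub_eq_zero]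
    exact (hQp w hw).spanProj_mul_lineProj.symm
  have hhor : ∀ A, (1 - T) * (A * L) = (1 - T) * hor (f w) A := fun A => by
    rw [hor_eq_mul, mul_assoc (1 - lineProj (f w)), sub_mul 1 (lineProj (f w)), one_mul,
      mul_sub (1 - T), ← mul_assoc (1 - T) (lineProj (f w)), hTL, zero_mul, sub_zero]
  have hfix : ∀ A ∈ tangentAt (f w), Q w A = A → (1 - T) * A = 0 := fun A hA h => by
    rw [sub_mul, one_mul, sub_eq_zero]
    exact (((hQp w hw).spanProj_mul hA).trans h).symm
  have hL'p : L' ∈ plin n := fderiv_mem_plin hD hw (fun w _ => lineProj_mem_plin _) v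
  -- Differentiating `T L = L` moves the derivative onto the line, whose horizontal motion is in the
  -- image of `Q`.
  have h1 : (1 - T) * T' * L = 0 := by
    have e := fderiv_mul_of_contDiffOn hT hf hD hw v
    rw [fderiv_eq_of_eqOn hD hw (fun w hw => (hQp w hw).spanProj_mul_lineProj : EqOn _ _ D)] at e
    have e1 : T' * L = (1 - T) * L' := by
      rw [sub_mul, one_mul]
      exact eq_sub_of_add_eq e.symm
    rw [mul_assoc, ← hLL, ← mul_assoc T', e1, mul_assoc, ← mul_assoc (1 - T), hTT, hhor,
      hfix _ (hor_mem_tangentAt _ hL'p) hθ]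
  -- The same argument for the image of `Q`, using that it is parallel.
  have h2 : ∀ A, Q w A = A → (1 - T) * T' * A = 0 := fun A hA => by
    have hAt : A ∈ tangentAt (f w) := hA ▸ (hQp w hw).mem A
    have hQA : ContDiffOn ℝ ∞ (fun w => Q w A) D := hQ.clm_apply contDiffOn_const
    have e := fderiv_mul_of_contDiffOn hT hQA hD hw v
    rw [fderiv_eq_of_eqOn hD hw (fun w hw => by
      rw [(hQp w hw).spanProj_mul ((hQp w hw).mem A), (hQp w hw).idem] :
        EqOn _ (fun w => Q w A) D), hA] at e
    have e0 : fderiv ℝ (fun w => Q w A) w v = (fderiv ℝ Q w v) A := by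
      rw [fderiv_family_apply hQd (differentiableAt_const A)]; simp
    have e1 : T' * A = (1 - T) * (fderiv ℝ Q w v) A := by
      rw [sub_mul, one_mul, ← e0]
      exact eq_sub_of_add_eq e.symm
    have e2 : A * L = A := hAt.2.1
    have hp : (fderiv ℝ Q w v) A ∈ plin n := by
      rw [← e0]
      exact fderiv_mem_plin hD hw (fun w hw => ((hQp w hw).mem A).1) v
    rw [← e2, ← mul_assoc, mul_assoc (1 - T), e1, ← mul_assoc, hTT, mul_assoc, hhor,
      hfix _ (hor_mem_tangentAt _ hp) (hpar A hA)]
  have h3 : (1 - T) * T' * T = 0 := by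
    ext1 x
    rw [mul_apply_eq_comp, (hQp w hw).spanProj_apply, map_add]
    have a1 := DFunLike.congr_fun h1 x
    have a2 := DFunLike.congr_fun (h2 _ ((hQp w hw).idem (outer (f w) x))) (rep (f w))
    rw [mul_apply_eq_comp] at a1 a2
    rw [a1, a2]
    simp
  -- The adjoint of `h3`. With `T T' T = 0`, valid for every idempotent, the identity `T' = T' T + T
  -- T'` gives `T' = 0`.
  have h4 : T * T' * (1 - T) = 0 := by
    ext1 x
    refine eq_zero_of_q_left fun y => ?_
    have hs : ∀ x y, q (T x) y = q x (T y) := (hQp w hw).q_spanProj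
    have hs' : ∀ x y, q ((1 - T) x) y = q x ((1 - T) y) := fun x y => by
      rw [sub_apply, sub_apply, q_sub_left, q_sub_right, hs]
      rfl
    have hs'' : ∀ x y, q (T' x) y = q x (T' y) := fun x y =>
      q_fderiv_selfadj hD hT (fun w hw => (hQp w hw).q_spanProj) hw v x y
    rw [mul_apply_eq_comp, mul_apply_eq_comp, hs, hs'', hs', ← mul_apply_eq_comp T',
      ← mul_apply_eq_comp (1 - T), ← mul_assoc, h3]
    exact q_zero_right _
  have h5 : T * T' * T = 0 := idempotent_mul_fderiv_mul hD hT hid hw v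
  rw [sub_mul, sub_mul, one_mul, h5, sub_zero] at h3
  rw [mul_sub, mul_one, h5, sub_zero] at h4
  have h6 := fderiv_idempotent hD hT hid hw v
  change T' = T' * T + T * T' at h6
  rw [h6, h3, h4, add_zero]

end Evaluation


-- A vanishing `η` makes the outer part of the splitting parallel.

section Codimension

variable {S : Type*} [TopologicalSpace S] [ChartedSpace (EuclideanSpace ℝ (Fin 2)) S]

/-- The sum of the projections to the `𝓛_k`, `k ∈ K`. -/
noncomputable def partProj {n : ℕ} (𝓛 : ℕ → S → Submodule ℝ (PEnd n)) (K : Finset ℕ) (s : S) :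
    PEnd n →L[ℝ] PEnd n := ∑ k ∈ K, splitProj 𝓛 k s

omit [TopologicalSpace S] [ChartedSpace (EuclideanSpace ℝ (Fin 2)) S] in
theorem partProj_apply {n : ℕ} (𝓛 : ℕ → S → Submodule ℝ (PEnd n)) (K : Finset ℕ) (s : S)
    (A : PEnd n) : partProj 𝓛 K s A = ∑ k ∈ K, splitProj 𝓛 k s A := by
  rw [partProj, sum_apply]

/-- The indices `1, …, a` and `2 m + 1 - a, …, 2 m`. -/
def outerIndices (m a : ℕ) : Finset ℕ := {k ∈ Finset.Icc 1 (2 * m) | k ≤ a ∨ 2 * m - a < k}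

theorem mem_outerIndices {m a k : ℕ} :
    k ∈ outerIndices m a ↔ k ∈ Icc 1 (2 * m) ∧ (k ≤ a ∨ 2 * m - a < k) := by
  rw [outerIndices, Finset.mem_filter, Finset.mem_Icc, mem_Icc]

namespace IsAlternatingSurface

variable {m : ℕ} {σ : S → Hyp (2 * m)} {𝓛 : ℕ → S → Submodule ℝ (PEnd (2 * m))}
  (h : IsAlternatingSurface m σ 𝓛) {a j : ℕ} {s : S}
include h

theorem partProj_apply_of_mem (hj : j ∈ outerIndices m a) {A : PEnd (2 * m)} (hA : A ∈ 𝓛 j s) :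
    partProj 𝓛 (outerIndices m a) s A = A := by
  rw [partProj_apply, Finset.sum_eq_single_of_mem j hj fun k hk hkj =>
    h.splitProj_of_mem_ne (mem_outerIndices.1 hk).1 (mem_outerIndices.1 hj).1 hkj hA]
  exact h.splitProj_of_mem (mem_outerIndices.1 hj).1 hA

theorem partProj_apply_of_notMem (hj : j ∈ Icc 1 (2 * m)) (hj' : j ∉ outerIndices m a)
    {A : PEnd (2 * m)} (hA : A ∈ 𝓛 j s) : partProj 𝓛 (outerIndices m a) s A = 0 := by
  rw [partProj_apply]
  refine Finset.sum_eq_zero fun k hk => h.splitProj_of_mem_ne (mem_outerIndices.1 hk).1 hj ?_ hA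
  rintro rfl
  exact hj' hk

/-- The index set is invariant under `k ↦ 2m + 1 - k`, which makes the partial sum of projections
commute with `τ`. -/
theorem isTangentProj_partProj (s : S) :
    IsTangentProj (σ s) (partProj 𝓛 (outerIndices m a) s) := by
  refine ⟨fun A => ?_, fun A hA => ?_, fun A => ?_, fun A B => ?_, fun A => ?_⟩
  · rw [partProj_apply]
    exact Submodule.sum_mem _ fun k hk =>
      h.le_tangentAt (mem_outerIndices.1 hk).1 s (h.splitProj_mem (mem_outerIndices.1 hk).1 s A)
  · rw [partProj_apply, partProj_apply]
    exact Finset.sum_congr rfl fun k hk => h.splitProj_hor (mem_outerIndices.1 hk).1 hA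
  · rw [partProj_apply, partProj_apply, map_sum]
    refine Finset.sum_nbij' (fun k => 2 * m + 1 - k) (fun k => 2 * m + 1 - k) (fun k hk => ?_)
      (fun k hk => ?_) (fun k hk => ?_) (fun k hk => ?_) (fun k hk => ?_)
    · rw [mem_outerIndices] at hk ⊢
      obtain ⟨⟨h1, h2⟩, h3⟩ := hk
      exact ⟨⟨by omega, by omega⟩, by omega⟩
    · rw [mem_outerIndices] at hk ⊢
      obtain ⟨⟨h1, h2⟩, h3⟩ := hk
      exact ⟨⟨by omega, by omega⟩, by omega⟩
    · rw [mem_outerIndices] at hk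
      obtain ⟨⟨h1, h2⟩, h3⟩ := hk
      omega
    · rw [mem_outerIndices] at hk
      obtain ⟨⟨h1, h2⟩, h3⟩ := hk
      omega
    · obtain ⟨h1, h2⟩ := (mem_outerIndices.1 hk).1
      rw [← h.splitProj_tauMul ⟨by omega, by omega⟩,
        show 2 * m + 1 - (2 * m + 1 - k) = k by omega]
  · rw [partProj_apply, partProj_apply, map_sum, map_sum, sum_apply]
    exact Finset.sum_congr rfl fun k hk =>
      (h.isOrthProj (mem_outerIndices.1 hk).1 s).selfadj gform_comm A B
  · rw [partProj_apply 𝓛 _ s A, map_sum]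
    exact Finset.sum_congr rfl fun k hk => h.partProj_apply_of_mem hk
      (h.splitProj_mem (mem_outerIndices.1 hk).1 s A)

section Param

variable {φ : ℂ → S} {D : Set ℂ} (hD : IsOpen D) (hφ : ContMDiffOn 𝓘(ℝ, ℂ) (𝓡 2) ∞ φ D)
  {w : ℂ} (hw : w ∈ D)
include hD hφ hw

theorem fderiv_splitProj_dual (hj : j ∈ Icc 1 (2 * m)) (v : ℂ) (A : PEnd (2 * m)) :
    (fderiv ℝ (fun w => splitProj 𝓛 (2 * m + 1 - j) (φ w)) w v) (tauMul (2 * m) A) =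
      tauMul (2 * m) ((fderiv ℝ (fun w => splitProj 𝓛 j (φ w)) w v) A) := by
  have hj' : 2 * m + 1 - j ∈ Icc 1 (2 * m) := ⟨by have := hj.2; omega, by have := hj.1; omega⟩
  have d0 := ContDiffOn.differentiableAt_of_isOpen (h.contDiffOn_splitProj_param hφ hj) hD hw
  have d1 := ContDiffOn.differentiableAt_of_isOpen (h.contDiffOn_splitProj_param hφ hj') hD hw
  have h1 : (fun w => splitProj 𝓛 (2 * m + 1 - j) (φ w) (tauMul (2 * m) A)) =
      fun w => tauMul (2 * m) (splitProj 𝓛 j (φ w) A) := funext fun w => h.splitProj_tauMul hj A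
  have h2 := fderiv_family_apply d1 (differentiableAt_const (tauMul (2 * m) A)) v
  have h3 := fderiv_family_apply d0 (differentiableAt_const A) v
  have h4 : fderiv ℝ (fun w => tauMul (2 * m) (splitProj 𝓛 j (φ w) A)) w v =
      tauMul (2 * m) (fderiv ℝ (fun w => splitProj 𝓛 j (φ w) A) w v) :=
    congrArg (fun L => L v) (((tauMul (2 * m)).hasFDerivAt.comp w
      (d0.clm_apply (differentiableAt_const A)).hasFDerivAt).fderiv)
  rw [h1, h4, h3] at h2
  simpa using h2.symm

/-- By tridiagonality the outer planes can leak only through `η_{a+1}` or its image under `𝐏`, and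
both vanish. They contain `𝓛_1`, so the tautological line also moves inside the span. -/
theorem fderiv_spanProj_eq_zero (hm : 1 ≤ m) (ha : 1 ≤ a) (ham : a + 1 ≤ m)
    (hv : SffVanishesOn 𝓛 a univ) (v : ℂ) :
    fderiv ℝ (fun w => spanProj (σ (φ w)) (partProj 𝓛 (outerIndices m a) (φ w))) w v = 0 := by
  have ma : a ∈ Icc 1 (2 * m) := ⟨ha, by omega⟩
  have hfd := h.frenetData hD hφ hm
  have hQ : ContDiffOn ℝ ∞ (fun w => partProj 𝓛 (outerIndices m a) (φ w)) D :=
    ContDiffOn.sum fun k hk => h.contDiffOn_splitProj_param hφ (mem_outerIndices.1 hk).1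
  have hQd := ContDiffOn.differentiableAt_of_isOpen hQ hD hw
  have hQp := fun w (_ : w ∈ D) => h.isTangentProj_partProj (a := a) (φ w)
  refine fderiv_spanProj hD (h.contDiffOn_lineProj_param hφ) hQ hQp hw v ?_ fun A hA => ?_
  · rw [← h.coordVec_eq hD hφ hw]
    exact h.partProj_apply_of_mem (mem_outerIndices.2 ⟨⟨le_rfl, by omega⟩, Or.inl ha⟩)
      ((h.isSec_coordVec hD hφ hm v).2 w hw)
  · have hA' : ∀ A, (fderiv ℝ (fun w => partProj 𝓛 (outerIndices m a) (φ w) A) w v) =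
        (fderiv ℝ (fun w => partProj 𝓛 (outerIndices m a) (φ w)) w v) A := fun A => by
      rw [fderiv_family_apply hQd (differentiableAt_const A)]; simp
    have hp : (fderiv ℝ (fun w => partProj 𝓛 (outerIndices m a) (φ w)) w v) A ∈ plin (2 * m) := by
      rw [← hA']
      exact fderiv_mem_plin hD hw (fun w hw => ((hQp w hw).mem A).1) v
    rw [(hQp w hw).hor _ hp, ← h.sum_splitProj hp, partProj_apply]
    refine Finset.sum_subset (fun k hk => Finset.mem_Icc.2 (mem_outerIndices.1 hk).1)
      fun k hk hkK => ?_
    have mk : k ∈ Icc 1 (2 * m) := Finset.mem_Icc.1 hk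
    have hterm : ∀ l ∈ outerIndices m a, ∀ ξ ∈ 𝓛 l (φ w), splitProj 𝓛 k (φ w)
        ((fderiv ℝ (fun w => partProj 𝓛 (outerIndices m a) (φ w)) w v) ξ) = 0 := by
      intro l hl ξ hξ
      have ml := (mem_outerIndices.1 hl).1
      have hkl : k ≠ l := by rintro rfl; exact hkK hl
      have hs := (h.planeBundle hD hφ ml).isSec_proj (contDiffOn_const (c := ξ))
      have hξ' := h.splitProj_of_mem ml hξ
      have e := fderiv_family_apply hQd (ContDiffOn.differentiableAt_of_isOpen hs.1 hD hw) v
      rw [fderiv_eq_of_eqOn hD hw (fun w hw => h.partProj_apply_of_mem hl (hs.2 w hw) :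
        EqOn _ (fun w => splitProj 𝓛 l (φ w) ξ) D), hξ'] at e
      have e' := congrArg (splitProj 𝓛 k (φ w)) e
      have hz : ∀ B, splitProj 𝓛 k (φ w) (partProj 𝓛 (outerIndices m a) (φ w) B) = 0 := fun B => by
        rw [partProj_apply, map_sum]
        exact Finset.sum_eq_zero fun i hi => h.splitProj_of_mem_ne mk (mem_outerIndices.1 hi).1
          (by rintro rfl; exact hkK hi) (h.splitProj_mem (mem_outerIndices.1 hi).1 _ _)
      rw [map_add, hz, add_zero] at e'
      have e2 := hfd.proj_fderiv mk ml hkl hw hs v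
      rw [← e', e2, hξ']
      rw [mem_outerIndices] at hl hkK
      by_cases hfar : k + 2 ≤ l ∨ l + 2 ≤ k
      · exact hfd.tri k mk l ml hfar w hw v ξ hξ
      · have hva : ∀ ζ ∈ 𝓛 a (φ w), splitProj 𝓛 (a + 1) (φ w)
            ((fderiv ℝ (fun w => splitProj 𝓛 a (φ w)) w v) ζ) = 0 := fun ζ hζ => by
          rw [← h.sff_param hD hφ hw ma]
          exact hv _ trivial _ ζ hζ
        obtain ⟨⟨hk1, hk2⟩, ⟨hl1, hl2⟩⟩ := And.intro mk ml
        -- The two edges of the index set; `𝐏` exchanges them.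
        have hcase : (l = a ∧ k = a + 1) ∨ (l = 2 * m + 1 - a ∧ k = 2 * m + 1 - (a + 1)) := by
          have h1 : ¬(k ≤ a ∨ 2 * m - a < k) := fun h' => hkK ⟨mk, h'⟩
          rcases hl.2 with h2 | h2 <;> omega
        rcases hcase with ⟨rfl, rfl⟩ | ⟨rfl, rfl⟩
        · exact hva ξ hξ
        · have hζ := h.tauMul_mem ml hξ
          rw [show 2 * m + 1 - (2 * m + 1 - a) = a by omega] at hζ
          have e3 := h.fderiv_splitProj_dual hD hφ hw ma v (tauMul (2 * m) ξ)
          rw [tauMul_tauMul] at e3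
          rw [e3, h.splitProj_tauMul ⟨by omega, by omega⟩, hva _ hζ, map_zero]
    rw [← hA]
    rw [partProj_apply 𝓛 _ _ A, map_sum, map_sum]
    exact Finset.sum_eq_zero fun l hl => hterm l hl _
      (h.splitProj_mem (mem_outerIndices.1 hl).1 _ _)

end Param

theorem spanProj_const [IsManifold (𝓡 2) ∞ S] [PreconnectedSpace S] (hm : 1 ≤ m) (ha : 1 ≤ a)
    (ham : a + 1 ≤ m) (hv : SffVanishesOn 𝓛 a univ) (s t : S) :
    spanProj (σ s) (partProj 𝓛 (outerIndices m a) s) =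
      spanProj (σ t) (partProj 𝓛 (outerIndices m a) t) := by
  have hloc : IsLocallyConstant fun s => spanProj (σ s) (partProj 𝓛 (outerIndices m a) s) := by
    rw [IsLocallyConstant.iff_exists_open]
    intro s
    obtain ⟨φ, r, hφ, rfl⟩ := exists_isParam s
    have hD : IsOpen (Metric.ball (0 : ℂ) r) := Metric.isOpen_ball
    have h0 : (0 : ℂ) ∈ Metric.ball (0 : ℂ) r := Metric.mem_ball_self hφ.pos
    refine ⟨φ '' Metric.ball 0 r, hφ.isOpen_image _ subset_rfl hD, mem_image_of_mem φ h0, ?_⟩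
    have hT : ContDiffOn ℝ ∞ (fun w => spanProj (σ (φ w)) (partProj 𝓛 (outerIndices m a) (φ w)))
        (Metric.ball 0 r) := by
      refine (h.contDiffOn_lineProj_param hφ.smooth).add
        (ContDiffOn.sum fun i _ => contDiffOn_const.clm_comp (ContDiffOn.clm_comp ?_ contDiffOn_const))
      exact ContDiffOn.sum fun k hk =>
        h.contDiffOn_splitProj_param hφ.smooth (mem_outerIndices.1 hk).1
    rintro _ ⟨w, hw, rfl⟩
    exact hD.is_const_of_fderiv_eq_zero (Metric.isPreconnected_ball)
      (hT.differentiableOn (by simp)) (fun w hw => ContinuousLinearMap.ext fun v =>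
        h.fderiv_spanProj_eq_zero hD hφ.smooth hw hm ha ham hv v) hw h0
  exact hloc.apply_eq_of_preconnectedSpace s t

end IsAlternatingSurface

end Codimension


-- Orthogonal complements of two vectors and containment in codimension four.

section Codimension

variable {n : ℕ}

/-- The orthogonal complement of two vectors. -/
def orthCompl (a b : PVec n) : Submodule PC (PVec n) where
  carrier := {v | q v a = 0 ∧ q v b = 0}
  add_mem' := fun {x y} hx hy => ⟨by rw [q_add_left, hx.1, hy.1, add_zero],
    by rw [q_add_left, hx.2, hy.2, add_zero]⟩
  zero_mem' := ⟨q_zero_left a, q_zero_left b⟩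
  smul_mem' := fun c x hx => ⟨by rw [q_smul_left, hx.1, mul_zero],
    by rw [q_smul_left, hx.2, mul_zero]⟩

section

variable {a b : PVec n} {g : ℝ} (hg : g ≠ 0) (haa : q a a = g • (1 : PC)) (hbb : q b b = g • (1 : PC))
  (hab : q a b = 0) (hba : q b a = 0)
include hg haa hbb hab hba

theorem orthCompl_nondegenerate {v : PVec n} (hv : v ∈ orthCompl a b)
    (h : ∀ w ∈ orthCompl a b, q v w = 0) : v = 0 := by
  refine eq_zero_of_q_left fun x => ?_
  have hgg : ∀ c : PC, (g⁻¹ • c) * (g • 1) = c := fun c => by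
    rw [smul_mul_smul_comm, mul_one, inv_mul_cancel₀ hg, one_smul]
  have hw : x - (g⁻¹ • q x a) • a - (g⁻¹ • q x b) • b ∈ orthCompl a b := by
    constructor
    · rw [q_sub_left, q_sub_left, q_smul_left, q_smul_left, haa, hba, hgg]; simp
    · rw [q_sub_left, q_sub_left, q_smul_left, q_smul_left, hbb, hab, hgg]; simp
  have h1 := h _ hw
  rw [q_sub_right, q_sub_right, q_smul_right, q_smul_right, hv.1, hv.2] at h1
  simpa using h1

theorem finrank_orthCompl : Module.finrank ℝ ((orthCompl a b).restrictScalars ℝ) + 4 =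
    Module.finrank ℝ (PVec n) := by
  set f : PVec n →ₗ[ℝ] PC × PC :=
    { toFun := fun v => (q v a, q v b)
      map_add' := fun x y => by rw [q_add_left, q_add_left]; rfl
      map_smul' := fun c x => by rw [q_rsmul_left, q_rsmul_left]; rfl } with hf
  have hk : LinearMap.ker f = (orthCompl a b).restrictScalars ℝ := by
    ext v
    rw [LinearMap.mem_ker, Submodule.restrictScalars_mem]
    exact Prod.mk_eq_zero
  have hgg : ∀ c : PC, (g⁻¹ • c) * (g • 1) = c := fun c => by
    rw [smul_mul_smul_comm, mul_one, inv_mul_cancel₀ hg, one_smul]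
  have hs : LinearMap.range f = ⊤ := by
    rw [LinearMap.range_eq_top]
    rintro ⟨c, d⟩
    refine ⟨(g⁻¹ • c) • a + (g⁻¹ • d) • b, ?_⟩
    change (q _ a, q _ b) = _
    rw [q_add_left, q_add_left, q_smul_left, q_smul_left, q_smul_left, q_smul_left, haa, hbb, hab,
      hba, hgg, hgg]
    simp
  have := LinearMap.finrank_range_add_finrank_ker f
  rw [hs, finrank_top, hk] at this
  simp only [Module.finrank_prod, Module.finrank_self] at this
  omega

end

variable {S : Type*} [TopologicalSpace S] [ChartedSpace (EuclideanSpace ℝ (Fin 2)) S]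
  [IsManifold (𝓡 2) ∞ S]

/-- If one of the forms `η_2, …, η_m` vanishes, the surface lies in a subspace of codimension `4`. -/
theorem IsAlternatingSurface.inCodimFour [ConnectedSpace S] {m : ℕ} {σ : S → Hyp (2 * m)}
    {𝓛 : ℕ → S → Submodule ℝ (PEnd (2 * m))} (h : IsAlternatingSurface m σ 𝓛) {a : ℕ}
    (hm : 1 ≤ m) (ha : 1 ≤ a) (ham : a + 1 ≤ m) (hv : SffVanishesOn 𝓛 a univ) : InCodimFour σ := by
  obtain ⟨s₀⟩ : Nonempty S := inferInstance
  have mm : m ∈ Icc 1 (2 * m) := ⟨hm, by omega⟩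
  have mk : m + 1 ∈ Icc 1 (2 * m) := ⟨by omega, by omega⟩
  -- An orthogonal basis of `𝓛_m` at one point, evaluated on the chosen lift. The plane is
  -- isotropic, so `q` is real on it, and the two vectors are `q`-orthogonal of equal nonzero
  -- length. Their complement is therefore nondegenerate of real codimension four.
  obtain ⟨ξ, hξ, h0⟩ := h.exists_ne_zero mm s₀
  obtain ⟨U, -, hs, J, -, hJ⟩ := h.exists_rot_near mm s₀
  have hJ := hJ s₀ hs
  have hζ : J s₀ ξ ∈ 𝓛 m s₀ := by
    rw [← hJ.proj_rot]
    exact h.splitProj_mem mm s₀ _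
  set ζ := J s₀ ξ with hζd
  have hq : ∀ A ∈ 𝓛 m s₀, ∀ B ∈ 𝓛 m s₀, q (A (rep (σ s₀))) (B (rep (σ s₀))) =
      gform (2 * m) A B • (1 : PC) := fun A hA B hB => by
    have hB' := h.tauMul_mem mm hB
    rw [show 2 * m + 1 - m = m + 1 by omega] at hB'
    rw [q_eq_gform (h.le_tangentAt mm s₀ hA) (h.le_tangentAt mm s₀ hB),
      h.orth mm mk (by omega) hA hB', zero_smul, sub_zero]
  have hg : gform (2 * m) ξ ξ ≠ 0 := right_ne_zero_of_mul (h.definiteOn mm s₀ ξ hξ h0).ne'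
  have haa := hq ξ hξ ξ hξ
  have hbb : q (ζ (rep (σ s₀))) (ζ (rep (σ s₀))) = gform (2 * m) ξ ξ • (1 : PC) := by
    rw [hq ζ hζ ζ hζ, hJ.isometry (h.splitProj_of_mem mm hξ)]
  have hab : q (ξ (rep (σ s₀))) (ζ (rep (σ s₀))) = 0 := by
    rw [hq ξ hξ ζ hζ, gform_comm, hJ.orth gform_comm, zero_smul]
  have hba : q (ζ (rep (σ s₀))) (ξ (rep (σ s₀))) = 0 := by
    rw [hq ζ hζ ξ hξ, hJ.orth gform_comm, zero_smul]
  refine ⟨orthCompl (ξ (rep (σ s₀))) (ζ (rep (σ s₀))),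
    fun v hv => orthCompl_nondegenerate hg haa hbb hab hba hv,
    finrank_orthCompl hg haa hbb hab hba, fun s z hz => ?_⟩
  have hQ := fun s => h.isTangentProj_partProj (a := a) s
  have hzs : lineProj (σ s) z.1 = z.1 := by
    rw [← hz, lineProj_toHyp, lineMap_apply, z.2, neg_neg, one_smul]
  have hTz : spanProj (σ s) (partProj 𝓛 (outerIndices m a) s) z.1 = z.1 := by
    have := DFunLike.congr_fun (hQ s).spanProj_mul_lineProj z.1
    rwa [mul_apply_eq_comp, hzs] at this
  rw [h.spanProj_const hm ha ham hv s s₀, (hQ s₀).spanProj_apply] at hTz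
  have hm' : m ∉ outerIndices m a := fun h' => by
    have := (mem_outerIndices.1 h').2
    omega
  have hk' : m + 1 ∉ outerIndices m a := fun h' => by
    have := (mem_outerIndices.1 h').2
    omega
  -- `z` lies in the constant span, computed at `s₀`; there the span consists of the line and outer
  -- planes, and neither `m` nor its partner `m + 1` is an outer index.
  have key : ∀ A ∈ 𝓛 m s₀, q z.1 (A (rep (σ s₀))) = 0 := fun A hA => by
    have hA' := h.tauMul_mem mm hA
    rw [show 2 * m + 1 - m = m + 1 by omega] at hA'
    have hAt := h.le_tangentAt mm s₀ hA
    rw [← hTz, q_add_left, lineProj_apply, q_smul_left, ← conj_q (A _), q_tangent_rep hAt,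
      q_eq_gform ((hQ s₀).mem _) hAt, (hQ s₀).selfadj, (hQ s₀).selfadj,
      h.partProj_apply_of_notMem mm hm' hA, h.partProj_apply_of_notMem mk hk' hA']
    simp only [map_zero, zero_smul, sub_zero, add_zero]
    exact mul_zero _
  exact ⟨key ξ hξ, key ζ hζ⟩

end Codimension


-- Uniqueness of the splitting.

section Uniqueness

variable {S : Type*} [TopologicalSpace S] [ChartedSpace (EuclideanSpace ℝ (Fin 2)) S]
  [IsManifold (𝓡 2) ∞ S]

namespace IsAlternatingSurface

variable {m : ℕ} {σ : S → Hyp (2 * m)} {𝓛 𝓛' : ℕ → S → Submodule ℝ (PEnd (2 * m))}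
  (h : IsAlternatingSurface m σ 𝓛) (h' : IsAlternatingSurface m σ 𝓛') {i j : ℕ} {s : S}
include h h'

/-- The components of one derivative have the same sum in both splittings. Those up to `j` agree and
those beyond `j + 1` vanish, which leaves the component in question. -/
theorem sff_eq_of_eq (hm : 1 ≤ m) (hj : 1 ≤ j) (hj' : j + 1 ≤ 2 * m)
    (heq : ∀ i, 1 ≤ i → i ≤ j → 𝓛' i = 𝓛 i) (X : TangentSpace (𝓡 2) s) {ξ : PEnd (2 * m)}
    (hξ : ξ ∈ 𝓛 j s) : sff 𝓛 j s X ξ = sff 𝓛' j s X ξ := by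
  have mj : j ∈ Icc 1 (2 * m) := ⟨hj, by omega⟩
  obtain ⟨φ, r, hφ, rfl⟩ := exists_isParam s
  have hD : IsOpen (Metric.ball (0 : ℂ) r) := Metric.isOpen_ball
  have h0 : (0 : ℂ) ∈ Metric.ball (0 : ℂ) r := Metric.mem_ball_self hφ.pos
  obtain ⟨v, rfl⟩ : ∃ v : ℂ, mfderiv 𝓘(ℝ, ℂ) (𝓡 2) φ 0 v = X := (hφ.bijective 0 h0).2 X
  have hp : ∀ i, 1 ≤ i → i ≤ j → splitProj 𝓛' i = splitProj 𝓛 i := fun i h1 h2 => by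
    funext s
    rw [splitProj, splitProj, heq i h1 h2]
  refine (h.sff_param hD hφ.smooth h0 mj v ξ).trans
    (Eq.trans ?_ (h'.sff_param hD hφ.smooth h0 mj v ξ).symm)
  rw [hp j hj le_rfl]
  set A := (fderiv ℝ (fun w => splitProj 𝓛 j (φ w)) 0 v) ξ with hA
  have hA' : A ∈ plin (2 * m) := by
    have e := fderiv_family_apply (ContDiffOn.differentiableAt_of_isOpen
      (h.contDiffOn_splitProj_param hφ.smooth mj) hD h0) (differentiableAt_const ξ) v
    simp only [fderiv_fun_const, Pi.zero_apply, zero_apply, map_zero, add_zero] at e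
    rw [hA, ← e]
    exact fderiv_mem_plin hD h0 (fun w _ => h.mem_plin mj (h.splitProj_mem mj _ ξ)) v
  have hsum := (h.sum_splitProj (s := φ 0) hA').trans (h'.sum_splitProj hA').symm
  rw [← sub_eq_zero, ← Finset.sum_sub_distrib, Finset.sum_eq_single_of_mem (j + 1)
    (Finset.mem_Icc.2 ⟨by omega, hj'⟩) fun i hi hne => ?_] at hsum
  · exact sub_eq_zero.1 hsum
  · have mi : i ∈ Icc 1 (2 * m) := Finset.mem_Icc.1 hi
    rcases le_or_gt i j with hij | hij
    · rw [hp i mi.1 hij, sub_self]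
    · have e1 := (h.frenetData hD hφ.smooth hm).tri i mi j mj (by omega) 0 h0 v ξ hξ
      have e2 := (h'.frenetData hD hφ.smooth hm).tri i mi j mj (by omega) 0 h0 v ξ (by
        rw [heq j hj le_rfl]; exact hξ)
      rw [hp j hj le_rfl] at e2
      rw [e1, e2, sub_self]

/-- Where `η_{j+1}` is nonzero, its values fill the whole plane by complex linearity, and they lie
in both candidates. The two families of projections then agree on a dense set, hence everywhere. -/
theorem splitting_succ_eq [PreconnectedSpace S] (hm : 1 ≤ m) (himm : DmapInjective σ)
    (hj : 1 ≤ j) (hj' : j + 1 ≤ 2 * m) (hconf : IsConformalSff 𝓛 j)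
    {J₁ J J' : S → PEnd (2 * m) →L[ℝ] PEnd (2 * m)}
    (hJ₁ : IsRotField 𝓛 1 J₁) (hJ : IsRotField 𝓛 j J) (hOZ : IsOneZero σ 𝓛 j J₁ J)
    (hnz : SffNonzero 𝓛 j) (hJ' : IsRotField 𝓛 (j + 1) J') (hlin : IsLinearOn 𝓛 j J J' univ)
    (heq : ∀ i, 1 ≤ i → i ≤ j → 𝓛' i = 𝓛 i) : 𝓛' (j + 1) = 𝓛 (j + 1) := by
  have mj : j ∈ Icc 1 (2 * m) := ⟨hj, by omega⟩
  have mk : j + 1 ∈ Icc 1 (2 * m) := ⟨by omega, hj'⟩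
  have hdense := h.dense_sff_ne_zero hm himm hj hj' hconf hJ₁ hJ hOZ hnz
  have hpt : ∀ s, (∃ X : TangentSpace (𝓡 2) s, ∃ ξ ∈ 𝓛 j s, sff 𝓛 j s X ξ ≠ 0) →
      𝓛 (j + 1) s = 𝓛' (j + 1) s := by
    rintro s ⟨X, ξ, hξ, h0⟩
    have hr := h'.frenet.rank_two _ mk s
    refine Submodule.eq_of_le_of_finrank_eq (fun B hB => ?_)
      ((h.frenet.rank_two _ mk s).trans hr.symm)
    rw [← cact_coef gform_comm (h.definiteOn mk s) (h.frenet.rank_two _ mk s) (h.isOrthProj mk s)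
      (hJ'.rot s) (h.sff_mem hj' X ξ) h0 hB, cact, ← hlin s trivial X ξ hξ]
    have hJξ : J s ξ ∈ 𝓛 j s := by
      rw [← (hJ.rot s).proj_rot]
      exact h.splitProj_mem mj s _
    rw [h.sff_eq_of_eq h' hm hj hj' heq X hξ, h.sff_eq_of_eq h' hm hj hj' heq X hJξ]
    exact Submodule.add_mem _ (Submodule.smul_mem _ _ (h'.sff_mem hj' X _))
      (Submodule.smul_mem _ _ (h'.sff_mem hj' X _))
  have hproj : ∀ A, (fun s => splitProj 𝓛 (j + 1) s A) = fun s => splitProj 𝓛' (j + 1) s A := by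
    intro A
    refine Continuous.ext_on hdense
      ((h.contMDiff_splitProj mk).clm_apply (contMDiff_const (c := A))).continuous
      ((h'.contMDiff_splitProj mk).clm_apply (contMDiff_const (c := A))).continuous fun s hs => ?_
    rw [splitProj, splitProj, hpt s hs]
  funext s
  ext A
  rw [(h.isOrthProj mk s).mem_iff (h.definiteOn mk s),
    (h'.isOrthProj mk s).mem_iff (h'.definiteOn mk s), congrFun (hproj A) s]

/-- The splitting is determined by the surface. -/
theorem splitting_eq [PreconnectedSpace S] (hm : 1 ≤ m) (himm : DmapInjective σ)
    (hC : IsSuperconformal m σ 𝓛) {J : ℕ → S → PEnd (2 * m) →L[ℝ] PEnd (2 * m)}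
    (hJ : ∀ i ∈ Icc 1 m, IsRotField 𝓛 i (J i) ∧ IsOneZero σ 𝓛 i (J 1) (J i))
    (hlin : ∀ i, 1 ≤ i → i + 1 ≤ m → IsLinearOn 𝓛 i (J i) (J (i + 1)) univ)
    (hnz : ∀ j, 1 ≤ j → j + 1 ≤ m → SffNonzero 𝓛 j) (hi : i ∈ Icc 1 (2 * m)) : 𝓛' i = 𝓛 i := by
  have key : ∀ k, ∀ i, 1 ≤ i → i ≤ k + 1 → i ≤ m → 𝓛' i = 𝓛 i := by
    intro k
    induction k with
    | zero =>
      intro i h1 h2 _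
      obtain rfl : i = 1 := le_antisymm h2 h1
      funext s
      exact SetLike.coe_injective ((h'.frenet.tangent s).trans (h.frenet.tangent s).symm)
    | succ k ih =>
      intro i h1 h2 h3
      rcases eq_or_ne i (k + 2) with rfl | hne
      · have hr := hJ (k + 1) ⟨by omega, by omega⟩
        exact h.splitting_succ_eq h' hm himm (by omega) (by omega)
          (h.isConformalSff hC (by omega) (by omega)) (hJ 1 ⟨le_rfl, hm⟩).1 hr.1 hr.2
          (hnz _ (by omega) h3) (hJ (k + 2) ⟨by omega, h3⟩).1 (hlin _ (by omega) h3)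
          fun i h1 h2 => ih i h1 h2 (by omega)
      · exact ih i h1 (by omega) h3
  -- The planes with index above `m` are the images under `𝐏` of those already identified.
  rcases le_or_gt i m with him | him
  · exact key m i hi.1 (by omega) him
  · funext s
    ext A
    rw [← h'.tauMul_mem_iff hi, ← h.tauMul_mem_iff hi,
      key m (2 * m + 1 - i) (by have := hi.2; omega) (by omega) (by omega)]

end IsAlternatingSurface

end Uniqueness


-- Duality under `𝐏`, holomorphic line bundles and holomorphic forms.

section Structure

variable {S : Type*} [TopologicalSpace S] [ChartedSpace (EuclideanSpace ℝ (Fin 2)) S]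

theorem dmapInjective_of_isSpacelikeImmersion {n : ℕ} {σ : S → Hyp n}
    (hσ : IsSpacelikeImmersion σ) : DmapInjective σ := by
  intro s X hX
  by_contra h0
  have := hσ.2 s X h0
  rw [hX] at this
  simp [gmet, q_zero_left, re] at this

/-- The rotation in the dual bundle. -/
noncomputable def dualRot {n : ℕ} (J : S → PEnd n →L[ℝ] PEnd n) (s : S) : PEnd n →L[ℝ] PEnd n :=
  tauMul n ∘L J s ∘L tauMul n

omit [TopologicalSpace S] [ChartedSpace (EuclideanSpace ℝ (Fin 2)) S] in
theorem dualRot_apply {n : ℕ} {J : S → PEnd n →L[ℝ] PEnd n} {s : S} (A : PEnd n) :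
    dualRot J s A = tauMul n (J s (tauMul n A)) := rfl

namespace IsAlternatingSurface

variable {m : ℕ} {σ : S → Hyp (2 * m)} {𝓛 : ℕ → S → Submodule ℝ (PEnd (2 * m))}
  (h : IsAlternatingSurface m σ 𝓛) {i j : ℕ} {s : S}
  {J J' : S → PEnd (2 * m) →L[ℝ] PEnd (2 * m)} {Jl Jl' J₁l : S → PEnd (2 * m) →ₗ[ℝ] PEnd (2 * m)}
include h

theorem gmet_eq_of_mem (hi : i ∈ Icc 1 (2 * m)) {A B : PEnd (2 * m)} (hA : A ∈ 𝓛 i s)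
    (hB : B ∈ 𝓛 i s) : gmet (σ s) A B = gform (2 * m) A B := h.gmet_eq hi (h.mem_plin hi hA) hB

/-- The given structure matters only on the bundle, so it is composed with the projection. An
isometry of square `-1` is skew. -/
theorem isRotField_of_isComplexStr (hi : i ∈ Icc 1 (2 * m)) (hJ : IsComplexStr σ (𝓛 i) Jl) :
    IsRotField 𝓛 i (fun s => LinearMap.toContinuousLinearMap (Jl s) ∘L splitProj 𝓛 i s) := by
  have hm : ∀ s A, Jl s (splitProj 𝓛 i s A) ∈ 𝓛 i s := fun s A =>
    hJ.mem s _ (h.splitProj_mem hi s A)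
  have hiso : ∀ s, ∀ A ∈ 𝓛 i s, ∀ B ∈ 𝓛 i s,
      gform (2 * m) (Jl s A) (Jl s B) = gform (2 * m) A B := fun s A hA B hB => by
    have e : ∀ A ∈ 𝓛 i s, gform (2 * m) (Jl s A) (Jl s A) = gform (2 * m) A A := fun A hA => by
      rw [← h.gmet_eq_of_mem hi (hJ.mem s A hA) (hJ.mem s A hA), hJ.isometry s A hA,
        h.gmet_eq_of_mem hi hA hA]
    have h1 := e _ ((𝓛 i s).add_mem hA hB)
    simp only [map_add, add_apply] at h1
    rw [e A hA, e B hB, gform_comm (Jl s B) (Jl s A), gform_comm B A] at h1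
    linarith
  have hskew : ∀ s, ∀ A ∈ 𝓛 i s, ∀ B ∈ 𝓛 i s,
      gform (2 * m) (Jl s A) B = -gform (2 * m) A (Jl s B) := fun s A hA B hB => by
    rw [← hiso s A hA _ (hJ.mem s B hB), hJ.sq s B hB, map_neg, neg_neg]
  refine ⟨?_, fun s => ⟨fun A => h.splitProj_of_mem hi (hm s A), fun A => ?_, fun A => ?_,
    fun A B => ?_⟩⟩
  · rw [← contMDiffOn_univ]
    refine contMDiffOn_clm_of_apply (𝓡 2) fun A => ?_
    exact (hJ.smooth univ _ (h.isSection_splitProj hi isOpen_univ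
      (ν := fun _ => A) contMDiffOn_const)).2.1
  · change Jl s (splitProj 𝓛 i s (splitProj 𝓛 i s A)) = Jl s (splitProj 𝓛 i s A)
    rw [h.splitProj_of_mem hi (h.splitProj_mem hi s A)]
  · change Jl s (splitProj 𝓛 i s (Jl s (splitProj 𝓛 i s A))) = _
    rw [h.splitProj_of_mem hi (hm s A), hJ.sq s _ (h.splitProj_mem hi s A)]
  · change gform (2 * m) (Jl s (splitProj 𝓛 i s A)) B =
      -gform (2 * m) A (Jl s (splitProj 𝓛 i s B))
    have p := h.isOrthProj hi s
    rw [← h.splitProj_of_mem hi (hm s A), p.selfadj gform_comm,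
      hskew s _ (h.splitProj_mem hi s A) _ (h.splitProj_mem hi s B), p.selfadj gform_comm,
      h.splitProj_of_mem hi (hm s B)]

theorem isRotField_dualRot (hi : i ∈ Icc 1 (2 * m)) (hJ : IsRotField 𝓛 i J) :
    IsRotField 𝓛 (2 * m + 1 - i) (dualRot J) := by
  have hG : ∀ A B, gform (2 * m) (tauMul (2 * m) A) B = -gform (2 * m) A (tauMul (2 * m) B) :=
    fun A B => by
      conv_lhs => rw [← tauMul_tauMul B]
      rw [gform_tauMul]
  refine ⟨contMDiff_const.clm_comp (hJ.smooth.clm_comp contMDiff_const), fun s =>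
    ⟨fun A => ?_, fun A => ?_, fun A => ?_, fun A B => ?_⟩⟩
  · rw [dualRot_apply, h.splitProj_tauMul hi, (hJ.rot s).proj_rot]
  · rw [dualRot_apply, dualRot_apply, ← tauMul_tauMul A, h.splitProj_tauMul hi, tauMul_tauMul,
      tauMul_tauMul, (hJ.rot s).rot_proj]
  · rw [dualRot_apply, dualRot_apply, tauMul_tauMul, (hJ.rot s).sq, map_neg, ← h.splitProj_tauMul hi,
      tauMul_tauMul]
  · rw [dualRot_apply, dualRot_apply, hG, (hJ.rot s).skew, hG, neg_neg]

theorem rot_mem (hi : i ∈ Icc 1 (2 * m)) (hJ : IsRotField 𝓛 i J) (s : S) (A : PEnd (2 * m)) :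
    J s A ∈ 𝓛 i s := by
  rw [← (hJ.rot s).proj_rot]
  exact h.splitProj_mem hi s _

section Duality

variable [IsManifold (𝓡 2) ∞ S]

/-- Two signs cancel: `𝐏` is an anti-isometry, and opposite off-diagonal components of a metric
connection are minus adjoint. -/
theorem gmet_eta_dual (hm : 1 ≤ m) (hi : i ∈ Icc 2 (2 * m)) (X : TangentSpace (𝓡 2) s)
    {ξ ζ : PEnd (2 * m)} (hξ : ξ ∈ 𝓛 i s) (hζ : ζ ∈ 𝓛 (i - 1) s) :
    gmet (σ s) (eta σ 𝓛 (2 * m + 2 - i) s X (paraP (2 * m) ξ)) (paraP (2 * m) ζ) =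
      gmet (σ s) ξ (eta σ 𝓛 i s X ζ) := by
  obtain ⟨hi1, hi2⟩ := hi
  obtain ⟨j, rfl⟩ : ∃ j, i = j + 1 := ⟨i - 1, by omega⟩
  rw [show j + 1 - 1 = j by omega] at hζ
  have mj : j ∈ Icc 1 (2 * m) := ⟨by omega, by omega⟩
  have mk : j + 1 ∈ Icc 1 (2 * m) := ⟨by omega, hi2⟩
  have mi : 2 * m + 1 - (j + 1) ∈ Icc 1 (2 * m) := ⟨by omega, by omega⟩
  have ml : 2 * m + 1 - j ∈ Icc 1 (2 * m) := ⟨by omega, by omega⟩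
  rw [show 2 * m + 2 - (j + 1) = 2 * m + 1 - (j + 1) + 1 by omega, ← tauMul_eq, ← tauMul_eq]
  have hPξ := h.tauMul_mem mk hξ
  have hPζ := h.tauMul_mem mj hζ
  rw [h.eta_eq_sff mi.1 (by omega) X (h.mem_plin mi hPξ), h.eta_eq_sff mj.1 hi2 X (h.mem_plin mj hζ)]
  obtain ⟨φ, r, hφ, rfl⟩ := exists_isParam s
  have hD : IsOpen (Metric.ball (0 : ℂ) r) := Metric.isOpen_ball
  have h0 : (0 : ℂ) ∈ Metric.ball (0 : ℂ) r := Metric.mem_ball_self hφ.pos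
  obtain ⟨v, rfl⟩ : ∃ v : ℂ, mfderiv 𝓘(ℝ, ℂ) (𝓡 2) φ 0 v = X := (hφ.bijective 0 h0).2 X
  rw [h.sff_param hD hφ.smooth h0 mi, h.sff_param hD hφ.smooth h0 mj,
    h.fderiv_splitProj_dual hD hφ.smooth h0 mk, show 2 * m + 1 - (j + 1) + 1 = 2 * m + 1 - j by omega,
    h.splitProj_tauMul mj,
    h.gmet_eq_of_mem ml (h.tauMul_mem mj (h.splitProj_mem mj _ _)) hPζ,
    h.gmet_eq_of_mem mk hξ (h.splitProj_mem mk _ _), gform_tauMul,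
    (h.frenetData hD hφ.smooth hm).adjoint mk mj (by omega) h0 hξ hζ v, neg_neg]

omit [IsManifold (𝓡 2) ∞ S] in
theorem covOn_paraP (hi : i ∈ Icc 1 (2 * m)) {U : Set S} {ν : S → PEnd (2 * m)}
    (hν : IsSection (𝓡 2) (𝓛 i) U ν) :
    IsSection (𝓡 2) (𝓛 (2 * m + 1 - i)) U (fun t => paraP (2 * m) (ν t)) ∧
      ∀ s ∈ U, ∀ X : TangentSpace (𝓡 2) s,
        covOn (𝓡 2) σ (𝓛 (2 * m + 1 - i)) (fun t => paraP (2 * m) (ν t)) s X =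
          paraP (2 * m) (covOn (𝓡 2) σ (𝓛 i) ν s X) := by
  have hi' : 2 * m + 1 - i ∈ Icc 1 (2 * m) := ⟨by have := hi.2; omega, by have := hi.1; omega⟩
  have hP : IsSection (𝓡 2) (𝓛 (2 * m + 1 - i)) U (fun t => paraP (2 * m) (ν t)) :=
    ⟨hν.1, (tauMul (2 * m)).contMDiff.comp_contMDiffOn hν.2.1, fun s hs =>
      h.tauMul_mem hi (hν.2.2 s hs)⟩
  refine ⟨hP, fun s hs X => ?_⟩
  have hd : MDifferentiableAt (𝓡 2) 𝓘(ℝ, PEnd (2 * m)) ν s :=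
    (hν.2.1.contMDiffAt (hν.1.mem_nhds hs)).mdifferentiableAt (by simp)
  have h1 : mfderiv (𝓡 2) 𝓘(ℝ, PEnd (2 * m)) (fun t => tauMul (2 * m) (ν t)) s =
      (tauMul (2 * m)).comp (mfderiv (𝓡 2) 𝓘(ℝ, PEnd (2 * m)) ν s) :=
    (((tauMul (2 * m)).hasMFDerivAt (x := ν s)).comp s hd.hasMFDerivAt).mfderiv
  have h2 : deriv₁ (𝓡 2) (fun t => tauMul (2 * m) (ν t)) s X =
      tauMul (2 * m) (deriv₁ (𝓡 2) ν s X) := by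
    rw [deriv₁, h1]; rfl
  have e1 := h.covOn_eq hi' hP hs hi' X
  have e2 := h.covOn_eq hi hν hs hi X
  rw [covOn, covOn, e1, e2, ← tauMul_eq, ← h.splitProj_tauMul hi, ← h2]
  rfl

end Duality

section Holomorphic

variable {φ : ℂ → S} {D : Set ℂ} (hD : IsOpen D) (hφ : ContMDiffOn 𝓘(ℝ, ℂ) (𝓡 2) ∞ φ D)
include hD hφ

omit hφ in
theorem isHolSection_iff (hi : i ∈ Icc 1 (2 * m)) (hJ : ∀ s, ∀ A ∈ 𝓛 i s, Jl s A = J s A)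
    {ℓ : ℂ → PEnd (2 * m)} :
    IsHolSection σ (𝓛 i) Jl φ D ℓ ↔ IsHolSec D (fun w => 𝓛 i (φ w))
      (fun w => splitProj 𝓛 i (φ w)) (fun w => J (φ w)) ℓ := by
  have key : (∀ w ∈ D, ℓ w ∈ 𝓛 i (φ w)) → ∀ w ∈ D, ∀ v : ℂ,
      covOn 𝓘(ℝ, ℂ) (fun w => σ (φ w)) (fun w => 𝓛 i (φ w)) ℓ w v =
      splitProj 𝓛 i (φ w) (fderiv ℝ ℓ w v) := fun hm w hw v =>
    h.covOn_param hi (by filter_upwards [hD.mem_nhds hw] with y hy using h.mem_plin hi (hm y hy)) v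
  constructor
  · rintro ⟨h1, h2, h3⟩
    refine ⟨⟨h1, h2⟩, fun w hw => ?_⟩
    exact ((key h2 w hw Complex.I).symm.trans ((h3 w hw).trans (congrArg (Jl (φ w)) (key h2 w hw 1)))).trans
      (hJ _ _ (h.splitProj_mem hi _ _))
  · rintro ⟨⟨h1, h2⟩, h3⟩
    refine ⟨h1, h2, fun w hw => ?_⟩
    exact (key h2 w hw Complex.I).trans (((h3 w hw).trans (hJ _ _ (h.splitProj_mem hi _ _)).symm).trans
      (congrArg (Jl (φ w)) (key h2 w hw 1).symm))

theorem exists_isHolSection (hi : i ∈ Icc 1 (2 * m)) (hr : IsRotField 𝓛 i J)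
    (hJ : ∀ s, ∀ A ∈ 𝓛 i s, Jl s A = J s A) {w₀ : ℂ} (hw : w₀ ∈ D) :
    ∃ D' ⊆ D, IsOpen D' ∧ w₀ ∈ D' ∧ ∃ ℓ, IsHolSection σ (𝓛 i) Jl φ D' ℓ ∧ ∀ w ∈ D', ℓ w ≠ 0 := by
  obtain ⟨ξ, hξ, h0⟩ := h.exists_ne_zero hi (φ w₀)
  have hb := h.rotBundle_field hD hφ hi hr
  have hs := hb.isSec_proj (contDiffOn_const (c := ξ))
  have ho := hs.1.continuousOn.isOpen_inter_preimage hD (isOpen_compl_singleton (x := 0))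
  have hsub : D ∩ (fun w => splitProj 𝓛 i (φ w) ξ) ⁻¹' {0}ᶜ ⊆ D := inter_subset_left
  obtain ⟨D', hD', hoD', hw', ℓ, hℓ, hℓ0⟩ := (hb.mono hsub ho).exists_isHolSec
    (w := w₀) ⟨hw, by
      change splitProj 𝓛 i (φ w₀) ξ ≠ 0
      rwa [h.splitProj_of_mem hi hξ]⟩ (ξ := fun w => splitProj 𝓛 i (φ w) ξ)
    ⟨hs.1.mono hsub, fun w hw => hs.2 w hw.1⟩ fun w hw => hw.2
  exact ⟨D', hD'.trans hsub, hoD', hw', ℓ,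
    (h.isHolSection_iff hoD' hi hJ).2 hℓ, hℓ0⟩

/-- `∂_z` is a holomorphic section of `L_1`. -/
theorem isHolSec_coordVec (hm : 1 ≤ m) (hr : IsRotField 𝓛 1 J)
    (hc : ∀ w ∈ D, coordVec σ φ Complex.I w = J (φ w) (coordVec σ φ 1 w)) :
    IsHolSec D (fun w => 𝓛 1 (φ w)) (fun w => splitProj 𝓛 1 (φ w)) (fun w => J (φ w))
      (coordVec σ φ 1) := by
  have m1 : 1 ∈ Icc 1 (2 * m) := ⟨le_rfl, by omega⟩
  have hb := h.rotBundle_field hD hφ m1 hr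
  have hs := h.isSec_coordVec hD hφ hm 1
  refine ⟨hs, fun w hw => ?_⟩
  -- In conformal coordinates the second coordinate vector is the rotated first one, so the
  -- Cauchy–Riemann equation is exactly the torsion identity.
  rw [← hb.proj_fderiv_rot_apply hs hw, ← fderiv_eq_of_eqOn hD hw (hc : EqOn _ _ D)]
  exact ((h.frenetData hD hφ hm).torsion 1 m1 w hw).symm

end Holomorphic

variable [IsManifold (𝓡 2) ∞ S]

theorem isHolHermitianLineBundle (hi : i ∈ Icc 1 (2 * m)) (hr : IsRotField 𝓛 i J)
    (hJ : ∀ s, ∀ A ∈ 𝓛 i s, Jl s A = J s A) : IsHolHermitianLineBundle σ J₁l (𝓛 i) Jl := by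
  have hmem := h.rot_mem hi hr
  have hsm : ∀ U ν, IsSection (𝓡 2) (𝓛 i) U ν →
      IsSection (𝓡 2) (𝓛 i) U (fun s => J s (ν s)) := fun U ν hν =>
    ⟨hν.1, hr.smooth.contMDiffOn.clm_apply hν.2.1, fun s _ => hmem s _⟩
  have hsec : ∀ U ν, IsSection (𝓡 2) (𝓛 i) U ν →
      IsSection (𝓡 2) (𝓛 i) U (fun s => Jl s (ν s)) := fun U ν hν =>
    ⟨hν.1, (hsm U ν hν).2.1.congr fun s hs => hJ s _ (hν.2.2 s hs), fun s hs => by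
      change Jl s (ν s) ∈ 𝓛 i s
      rw [hJ s _ (hν.2.2 s hs)]
      exact hmem s _⟩
  refine ⟨⟨fun s ξ hξ => by rw [hJ s ξ hξ]; exact hmem s ξ, fun s ξ hξ => ?_, fun s ξ hξ => ?_, hsec⟩,
    fun U ν hν s hs X => ?_, fun U ν hν s hs X => ?_, fun φ D hφ w₀ hw => ?_⟩
  · rw [hJ s ξ hξ, hJ s _ (hmem s ξ), (hr.rot s).sq, h.splitProj_of_mem hi hξ]
  · rw [hJ s ξ hξ, h.gmet_eq_of_mem hi (hmem s ξ) (hmem s ξ),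
      (hr.rot s).isometry (h.splitProj_of_mem hi hξ), h.gmet_eq_of_mem hi hξ hξ]
  · have hd : MDifferentiableAt (𝓡 2) 𝓘(ℝ, PEnd (2 * m)) ν s :=
      (hν.2.1.contMDiffAt (hν.1.mem_nhds hs)).mdifferentiableAt (by simp)
    have e1 : (fun t => gmet (σ t) (ν t) (ν t)) =ᶠ[𝓝 s] fun t => gform (2 * m) (ν t) (ν t) := by
      filter_upwards [hν.1.mem_nhds hs] with t ht
      exact h.gmet_eq_of_mem hi (hν.2.2 t ht) (hν.2.2 t ht)
    have e2 : HasFDerivAt (fun A : PEnd (2 * m) => gform (2 * m) A A)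
        (gform (2 * m) (ν s) + (gform (2 * m)).flip (ν s)) (ν s) := by
      have := ((gform (2 * m)).hasFDerivAt (x := ν s)).clm_apply (hasFDerivAt_id (ν s))
      refine this.congr_fderiv ?_
      ext A
      simp
    have e3 := (e2.hasMFDerivAt.comp s hd.hasMFDerivAt).mfderiv
    have e4 := h.covOn_eq hi hν hs hi X
    have e5 := h.splitProj_mem hi s (deriv₁ (𝓡 2) ν s X)
    rw [covOn, e4, h.gmet_eq_of_mem hi e5 (hν.2.2 s hs), (h.isOrthProj hi s).selfadj gform_comm,
      h.splitProj_of_mem hi (hν.2.2 s hs), e1.mfderiv_eq]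
    refine (congrArg (fun L : TangentSpace (𝓡 2) s →L[ℝ] ℝ => L X) e3).trans ?_
    change gform (2 * m) (ν s) (deriv₁ (𝓡 2) ν s X) + gform (2 * m) (deriv₁ (𝓡 2) ν s X) (ν s) = _
    rw [gform_comm (ν s)]
    exact (two_mul _).symm
  · have e1 := h.covOn_eq hi hν hs hi X
    have e2 := h.covOn_eq hi (hsec U ν hν) hs hi X
    have e3 : (fun t => Jl t (ν t)) =ᶠ[𝓝 s] fun t => J t (ν t) := by
      filter_upwards [hν.1.mem_nhds hs] with t ht using hJ t _ (hν.2.2 t ht)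
    rw [covOn, covOn, e1, e2, hJ s _ (h.splitProj_mem hi s _), deriv₁, e3.mfderiv_eq]
    change splitProj 𝓛 i s (deriv₁ (𝓡 2) (fun t => J t (ν t)) s X) = _
    obtain ⟨φ, r₀, hφ₀, rfl⟩ := exists_isParam s
    obtain ⟨r, hφ, -, hrU⟩ := hφ₀.exists_subset (hν.1.mem_nhds hs)
    have hD : IsOpen (Metric.ball (0 : ℂ) r) := Metric.isOpen_ball
    have h0 : (0 : ℂ) ∈ Metric.ball (0 : ℂ) r := Metric.mem_ball_self hφ.pos
    obtain ⟨v, rfl⟩ : ∃ v : ℂ, mfderiv 𝓘(ℝ, ℂ) (𝓡 2) φ 0 v = X := (hφ.bijective 0 h0).2 X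
    rw [deriv₁_section hD hφ.smooth h0 (hsm U ν hν) hs, deriv₁_section hD hφ.smooth h0 hν hs]
    refine (h.rotBundle_field hD hφ.smooth hi hr).proj_fderiv_rot_apply
      (ν := fun w => ν (φ w)) ⟨?_, fun w hw => hν.2.2 _ (hrU (mem_image_of_mem φ hw))⟩ h0 v
    exact contMDiffOn_iff_contDiffOn.1 (hν.2.1.comp hφ.smooth (image_subset_iff.1 hrU))
  · exact h.exists_isHolSection hφ.isOpen hφ.smooth hi hr hJ hw

variable {J₁ : S → PEnd (2 * m) →L[ℝ] PEnd (2 * m)}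

/-- Stated for any rotation of the target for which `η_{j+1}` is linear. It therefore covers the
middle form too, with the conjugate structure on its target. -/
theorem isHolOneForm (hm : 1 ≤ m) (himm : DmapInjective σ) (hj : 1 ≤ j) (hj' : j + 1 ≤ 2 * m)
    (hJ₁ : IsRotField 𝓛 1 J₁) (hJ₁l : ∀ s, ∀ A ∈ 𝓛 1 s, J₁l s A = J₁ s A) (hr : IsRotField 𝓛 j J)
    (hOZ : IsOneZero σ 𝓛 j J₁ J) (hr' : IsRotField 𝓛 (j + 1) J') (hlin : IsLinearOn 𝓛 j J J' univ)
    (hJ : ∀ s, ∀ A ∈ 𝓛 j s, Jl s A = J s A) (hJ' : ∀ s, ∀ A ∈ 𝓛 (j + 1) s, Jl' s A = J' s A) :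
    IsHolOneForm σ J₁l (𝓛 j) Jl (𝓛 (j + 1)) Jl' (eta σ 𝓛 (j + 1)) := by
  have mj : j ∈ Icc 1 (2 * m) := ⟨hj, by omega⟩
  have mk : j + 1 ∈ Icc 1 (2 * m) := ⟨by omega, hj'⟩
  have he : ∀ (s : S) (X : TangentSpace (𝓡 2) s), ∀ ξ ∈ 𝓛 j s, eta σ 𝓛 (j + 1) s X ξ = sff 𝓛 j s X ξ :=
    fun s X ξ hξ => h.eta_eq_sff hj hj' X (h.mem_plin mj hξ)
  have hone : ∀ (s : S) (X Y : TangentSpace (𝓡 2) s),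
      dmap (𝓡 2) σ s Y = J₁l s (dmap (𝓡 2) σ s X) → ∀ ξ ∈ 𝓛 j s,
      sff 𝓛 j s Y ξ = J' s (sff 𝓛 j s X ξ) := fun s X Y hXY ξ hξ => by
    have hX : dmap (𝓡 2) σ s X ∈ 𝓛 1 s := by
      have : dmap (𝓡 2) σ s X ∈ (𝓛 1 s : Set (PEnd (2 * m))) := by
        rw [h.frenet.tangent]; exact mem_range_self X
      exact this
    rw [hJ₁l s _ hX] at hXY
    rw [h.sff_rot_left hm himm mj hJ₁ hr hOZ hXY hξ, hlin s trivial X ξ hξ]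
  refine ⟨fun s X ξ hξ => ?_, fun s X ξ hξ => ?_, fun s X Y hXY ξ hξ => ?_, fun φ D hφ ℓ hℓ => ?_⟩
  · rw [he s X ξ hξ]
    exact h.sff_mem hj' X ξ
  · have hm := h.rot_mem mj hr s ξ
    rw [hJ s ξ hξ, he s X _ hm, he s X ξ hξ, hJ' s _ (h.sff_mem hj' X ξ), hlin s trivial X ξ hξ]
  · rw [he s Y ξ hξ, he s X ξ hξ, hJ' s _ (h.sff_mem hj' X ξ), hone s X Y hXY ξ hξ]
  · have hD := hφ.isOpen
    have hp := fun w (hw : w ∈ D) => h.sff_param hD hφ.smooth hw mj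
    have hs := (h.frenetData hD hφ.smooth hm).isHolSec_sff hj hj'
      (h.rotBundle_field hD hφ.smooth mk hr') (J := fun w => J (φ w)) (fun w hw ξ hξ => by
        rw [← hp w hw, ← hp w hw]; exact hlin _ trivial _ ξ hξ) (fun w hw ξ hξ => by
        rw [← hp w hw, ← hp w hw]
        exact hone (φ w) (mfderiv 𝓘(ℝ, ℂ) (𝓡 2) φ w (1 : ℂ))
          (mfderiv 𝓘(ℝ, ℂ) (𝓡 2) φ w Complex.I) (hφ.conformal w hw) ξ hξ)
      ((h.isHolSection_iff hD mj hJ).1 hℓ)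
    have e : ∀ w ∈ D, eta σ 𝓛 (j + 1) (φ w) (dx φ w) (ℓ w) = splitProj 𝓛 (j + 1) (φ w)
        ((fderiv ℝ (fun w => splitProj 𝓛 j (φ w)) w 1) (ℓ w)) := fun w hw => by
      rw [he _ _ _ (hℓ.mem w hw)]
      exact hp w hw 1 (ℓ w)
    refine (h.isHolSection_iff hD mk hJ').2 ⟨⟨hs.1.1.congr e, fun w hw => ?_⟩, fun w hw => ?_⟩
    · change eta σ 𝓛 (j + 1) (φ w) (dx φ w) (ℓ w) ∈ 𝓛 (j + 1) (φ w)
      rw [e w hw]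
      exact hs.1.2 w hw
    · rw [fderiv_eq_of_eqOn hD hw (e : EqOn _ _ D)]
      exact hs.2 w hw

end IsAlternatingSurface

end Structure


-- Dual frames and the Toda equations from Frenet data.

section Toda

variable {V : Type*} [NormedAddCommGroup V] [NormedSpace ℝ V]
  {G : V →L[ℝ] V →L[ℝ] ℝ} {P : V →L[ℝ] V} {D : Set ℂ} {w : ℂ}

namespace RotBundle

variable {ε : ℝ} {W : ℂ → Submodule ℝ V} {p J : ℂ → V →L[ℝ] V} (hW : RotBundle G ε D W p J)
include hW

theorem fderiv_gform_self {ℓ : ℂ → V} (hℓ : IsSec D W ℓ) (hw : w ∈ D) {v d : ℂ}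
    (hd : p w (fderiv ℝ ℓ w v) = cact (J w) d (ℓ w)) :
    fderiv ℝ (fun w => G (ℓ w) (ℓ w)) w v = 2 * d.re * G (ℓ w) (ℓ w) := by
  have hℓd := ContDiffOn.differentiableAt_of_isOpen hℓ.1 hW.isOpen hw
  have h0 := (hW.rot w hw).orth hW.symm (ℓ w)
  rw [fderiv_gform hℓd hℓd, hW.symm (ℓ w), ← hW.gform_proj hw _ (hℓ.2 w hw), hd,
    show G (cact (J w) d (ℓ w)) (ℓ w) = d.re * G (ℓ w) (ℓ w) by simp [cact, h0]]
  ring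

/-- The image under `P` of the metric dual of a holomorphic section. -/
theorem isHolSec_dual {W' : ℂ → Submodule ℝ V} {p' J' : ℂ → V →L[ℝ] V}
    (hPP : ∀ A, P (P A) = A) (hP : ∀ w ∈ D, ∀ A ∈ W w, P A ∈ W' w)
    (hpP : ∀ w ∈ D, ∀ A, p' w (P A) = P (p w A)) (hJ' : ∀ w ∈ D, ∀ A, J' w A = -P (J w (P A)))
    {ℓ : ℂ → V} (hℓ : IsHolSec D W p J ℓ) (h0 : ∀ w ∈ D, ℓ w ≠ 0) {c : ℝ} (hc : c ≠ 0) :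
    IsHolSec D W' p' J' (fun w => (c * G (ℓ w) (ℓ w))⁻¹ • P (ℓ w)) := by
  have hne : ∀ w ∈ D, c * G (ℓ w) (ℓ w) ≠ 0 := fun w hw =>
    mul_ne_zero hc (hW.ne_zero hw (hℓ.1.2 w hw) (h0 w hw))
  have hs : ContDiffOn ℝ ∞ (fun w => c * G (ℓ w) (ℓ w)) D :=
    contDiffOn_const.mul (contDiffOn_gform hℓ.1.1 hℓ.1.1)
  refine ⟨⟨(hs.inv hne).smul (P.contDiff.comp_contDiffOn hℓ.1.1), fun w hw =>
    (W' w).smul_mem _ (hP w hw _ (hℓ.1.2 w hw))⟩, fun w hw => ?_⟩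
  have hm := hℓ.1.2 w hw
  have hℓd := ContDiffOn.differentiableAt_of_isOpen hℓ.1.1 hW.isOpen hw
  have hGd := ContDiffOn.differentiableAt_of_isOpen (contDiffOn_gform (G := G) hℓ.1.1 hℓ.1.1) hW.isOpen hw
  -- Dividing by the squared norm subtracts `2 Re d` from the connection coefficient `d`, leaving
  -- minus its conjugate. This is again holomorphic for the conjugate structure `J'`.
  have key : ∀ v d, p w (fderiv ℝ ℓ w v) = cact (J w) d (ℓ w) →
      p' w (fderiv ℝ (fun w => (c * G (ℓ w) (ℓ w))⁻¹ • P (ℓ w)) w v) =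
        (c * G (ℓ w) (ℓ w))⁻¹ • P (cact (J w) (-(starRingEnd ℂ) d) (ℓ w)) := fun v d hd => by
    have h1 := ((hasDerivAt_inv (hne w hw)).comp_hasFDerivAt w (hGd.hasFDerivAt.const_mul c)).smul
      (P.hasFDerivAt.comp w hℓd.hasFDerivAt)
    have h2 : fderiv ℝ (fun w => (c * G (ℓ w) (ℓ w))⁻¹ • P (ℓ w)) w = _ := h1.fderiv
    have h3 := hW.fderiv_gform_self hℓ.1 hw hd
    rw [h2]
    simp only [add_apply, smul_apply, ContinuousLinearMap.comp_apply, map_add, map_smul,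
      ContinuousLinearMap.smulRight_apply, hpP w hw, hW.apply_of_mem hw hm, hd, h3, smul_eq_mul,
      Function.comp_apply]
    have hg := hne w hw
    have e : -((c * G (ℓ w) (ℓ w)) ^ 2)⁻¹ * (c * (2 * d.re * G (ℓ w) (ℓ w))) =
        -(2 * d.re * (c * G (ℓ w) (ℓ w))⁻¹) := by
      rw [show c * (2 * d.re * G (ℓ w) (ℓ w)) = 2 * d.re * (c * G (ℓ w) (ℓ w)) by ring]
      generalize c * G (ℓ w) (ℓ w) = g at hg
      field_simp
    rw [e]
    simp only [cact, map_add, map_smul, Complex.neg_re, Complex.neg_im, Complex.conj_re, Complex.conj_im]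
    module
  set d := coef G (J w) (ℓ w) (p w (fderiv ℝ ℓ w 1)) with hd
  have h1 : p w (fderiv ℝ ℓ w 1) = cact (J w) d (ℓ w) :=
    (hW.cact_coef hw hm (h0 w hw) ((hW.proj w hw).mem _)).symm
  have h2 : p w (fderiv ℝ ℓ w Complex.I) = cact (J w) (Complex.I * d) (ℓ w) := by
    rw [hℓ.2 w hw, h1, hW.cact_mul hw _ _ hm, cact_I]
  rw [key _ _ h1, key _ _ h2, hJ' w hw, map_smul P, hPP, map_smul (J w), map_smul P, ← cact_I (J w),
    ← hW.cact_mul hw _ _ hm, ← smul_neg, ← map_neg]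
  congr 2
  simp only [cact]
  simp
  module

end RotBundle

namespace FrenetData

variable {m : ℕ} {W : ℕ → ℂ → Submodule ℝ V} {p K : ℕ → ℂ → V →L[ℝ] V} {θ₁ θ₂ : ℂ → V}
  (h : FrenetData G P m D W p θ₁ θ₂) (hm : 2 ≤ m)
  (hK : ∀ i ∈ Icc 1 (m + 1), RotBundle G ((-1) ^ (i + 1)) D (W i) (p i) (K i))
  (hlin : ∀ j ∈ Icc 1 m, ∀ w ∈ D, ∀ ξ ∈ W j w, p (j + 1) w ((fderiv ℝ (p j) w 1) (K j w ξ)) =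
    K (j + 1) w (p (j + 1) w ((fderiv ℝ (p j) w 1) ξ)))
  (hone : ∀ j ∈ Icc 1 m, ∀ w ∈ D, ∀ ξ ∈ W j w,
    p (j + 1) w ((fderiv ℝ (p j) w Complex.I) ξ) =
    K (j + 1) w (p (j + 1) w ((fderiv ℝ (p j) w 1) ξ)))
  {ℓ : ℕ → ℂ → V} (hℓ : ∀ i ∈ Icc 1 (m + 1), IsHolSec D (W i) (p i) (K i) (ℓ i))
  (h0 : ∀ i ∈ Icc 1 (m + 1), ∀ w ∈ D, ℓ i w ≠ 0)
include h hm hK hlin hone hℓ h0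

/-- In holomorphic frames the forms `η_i` are given by holomorphic functions `f_i` that satisfy the
affine Toda equations together with the norms of the frames. -/
theorem exists_toda (hℓ₁ : ∀ w ∈ D, ℓ 1 w = θ₁ w) (hθ : ∀ w ∈ D, θ₂ w = K 1 w (θ₁ w)) :
    ∃ f : ℕ → ℂ → ℂ, (∀ j ∈ Icc 1 m, DifferentiableOn ℂ (f (j + 1)) D) ∧
      (∀ j ∈ Icc 1 m, ∀ w ∈ D, p (j + 1) w ((fderiv ℝ (p j) w 1) (ℓ j w)) =
        cact (K (j + 1) w) (f (j + 1) w) (ℓ (j + 1) w)) ∧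
      (∀ (u : ℂ → ℝ) (a : ℝ), a ≠ 0 → (∀ w ∈ D, u w = a * G (ℓ 1 w) (ℓ 1 w)) → ∀ w ∈ D,
        ddbar (fun w => Real.log (u w)) w = G (ℓ 1 w) (ℓ 1 w) / 2 +
          ‖f 2 w‖ ^ 2 * G (ℓ 2 w) (ℓ 2 w) / G (ℓ 1 w) (ℓ 1 w)) ∧
      ∀ j, 1 ≤ j → j + 1 ≤ m → ∀ (u : ℂ → ℝ) (a : ℝ), a ≠ 0 →
        (∀ w ∈ D, u w = a * G (ℓ (j + 1) w) (ℓ (j + 1) w)) → ∀ w ∈ D,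
        ddbar (fun w => Real.log (u w)) w =
          ‖f (j + 2) w‖ ^ 2 * G (ℓ (j + 2) w) (ℓ (j + 2) w) / G (ℓ (j + 1) w) (ℓ (j + 1) w) -
          ‖f (j + 1) w‖ ^ 2 * G (ℓ (j + 1) w) (ℓ (j + 1) w) / G (ℓ j w) (ℓ j w) := by
  have mi : ∀ j, 1 ≤ j → j ≤ m + 1 → j ∈ Icc 1 (m + 1) := fun j h1 h2 => ⟨h1, h2⟩
  have hs : ∀ j ∈ Icc 1 m, IsHolSec D (W (j + 1)) (p (j + 1)) (K (j + 1))
      (fun w => p (j + 1) w ((fderiv ℝ (p j) w 1) (ℓ j w))) := fun j hj =>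
    h.isHolSec_sff hj.1 (by have := hj.2; omega) (hK _ (mi _ (by omega) (by have := hj.2; omega)))
      (hlin j hj) (hone j hj) (hℓ j (mi _ hj.1 (by have := hj.2; omega)))
  have hf : ∀ j ∈ Icc 1 m, ∀ w ∈ D, p (j + 1) w ((fderiv ℝ (p j) w 1) (ℓ j w)) =
      cact (K (j + 1) w) (coef G (K (j + 1) w) (ℓ (j + 1) w)
        (p (j + 1) w ((fderiv ℝ (p (j + 1 - 1)) w 1) (ℓ (j + 1 - 1) w)))) (ℓ (j + 1) w) :=
    fun j hj w hw => by
      have m1 := mi (j + 1) (by omega) (by have := hj.2; omega)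
      exact ((hK _ m1).cact_coef hw ((hℓ _ m1).1.2 w hw) (h0 _ m1 w hw) ((hs j hj).1.2 w hw)).symm
  -- The subtraction is harmless, since this formula is used only at indices `j + 1` with `j ≥ 1`.
  refine ⟨fun i w => coef G (K i w) (ℓ i w) (p i w ((fderiv ℝ (p (i - 1)) w 1) (ℓ (i - 1) w))),
    fun j hj => ?_, hf, fun u a ha hu w hw => ?_, fun j hj hj' u a ha hu w hw => ?_⟩
  · have m1 := mi (j + 1) (by omega) (by have := hj.2; omega)
    exact (hK _ m1).differentiableOn_coef (hℓ _ m1) (h0 _ m1) (hs j hj)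
  · have m1 := mi 1 le_rfl (by omega)
    have m2 := mi 2 (by omega) (by omega)
    have j1 : 1 ∈ Icc 1 m := ⟨le_rfl, by omega⟩
    have hne := (hK 1 m1).ne_zero hw ((hℓ 1 m1).1.2 w hw) (h0 1 m1 w hw)
    have hD := (hK 1 m1).isOpen
    have e : ∀ v, EqOn (fun w => p 1 w (fderiv ℝ (ℓ 1) w v)) (fun w => p 1 w (fderiv ℝ θ₁ w v)) D :=
      fun v y hy => by simp only [fderiv_eq_of_eqOn hD hy (hℓ₁ : EqOn _ _ D)]
    rw [(hK 1 m1).ddbar_log (hℓ 1 m1) (h0 1 m1) hw ha hu, fderiv_eq_of_eqOn hD hw (e _),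
      fderiv_eq_of_eqOn hD hw (e _), hℓ₁ w hw, h.ricci_first (by omega) (hK 1 m1) (hK 2 m2) (hlin 1 j1)
        (hone 1 j1) hθ hw, ← hℓ₁ w hw, hf 1 j1 w hw, (hK 2 m2).gform_cact hw _ ((hℓ 2 m2).1.2 w hw)]
    simp only [Nat.reduceAdd, Nat.reduceSub]
    field_simp
  · have m0 := mi j hj (by omega)
    have m1 := mi (j + 1) (by omega) (by omega)
    have m2 := mi (j + 2) (by omega) (by omega)
    have j0 : j ∈ Icc 1 m := ⟨hj, by omega⟩
    have j1 : j + 1 ∈ Icc 1 m := ⟨by omega, hj'⟩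
    have hne := (hK _ m1).ne_zero hw ((hℓ _ m1).1.2 w hw) (h0 _ m1 w hw)
    have hne0 := (hK _ m0).ne_zero hw ((hℓ _ m0).1.2 w hw) (h0 _ m0 w hw)
    rw [(hK _ m1).ddbar_log (hℓ _ m1) (h0 _ m1) hw ha hu, h.ricci hj (by omega) (hK _ m1) (hK _ m2) (hK _ m0)
      (hlin _ j1) (hone _ j1) (hlin _ j0) (hone _ j0) (hℓ _ m1).1 hw,
      h.gform_adjoint hj (by omega) (hK _ m1) (hK _ m0) (hlin _ j0) hw ((hℓ _ m0).1.2 w hw)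
        (h0 _ m0 w hw) ((hℓ _ m1).1.2 w hw) (hf j j0 w hw), hf (j + 1) j1 w hw,
      (hK _ m2).gform_cact hw _ ((hℓ _ m2).1.2 w hw)]
    simp only [Nat.add_sub_cancel, show j + 2 - 1 = j + 1 from rfl, show j + 1 + 1 = j + 2 from rfl]
    field_simp

end FrenetData

end Toda


-- The structure equations on the surface.

section StructureEquations

variable {S : Type*} [TopologicalSpace S] [ChartedSpace (EuclideanSpace ℝ (Fin 2)) S]

theorem IsRotField.neg {n : ℕ} {𝓛 : ℕ → S → Submodule ℝ (PEnd n)} {i : ℕ}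
    {J : S → PEnd n →L[ℝ] PEnd n} (hJ : IsRotField 𝓛 i J) : IsRotField 𝓛 i (fun s => -J s) :=
  ⟨hJ.smooth.neg, fun s => (hJ.rot s).neg⟩

namespace IsAlternatingSurface

variable {m : ℕ} {σ : S → Hyp (2 * m)} {𝓛 : ℕ → S → Submodule ℝ (PEnd (2 * m))}
  (h : IsAlternatingSurface m σ 𝓛) {i j : ℕ} {s : S}
include h

theorem herm_eq (hi : i ∈ Icc 1 (2 * m)) {A : PEnd (2 * m)} (hA : A ∈ 𝓛 i s) :
    herm (σ s) A = (-1) ^ (i + 1) / 2 * gform (2 * m) A A := by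
  rw [herm, h.gmet_eq_of_mem hi hA hA]
  rcases eq_or_ne A 0 with rfl | h0
  · simp
  have := h.definiteOn hi s A hA h0
  rcases neg_one_pow_eq_or ℝ (i + 1) with e | e <;> rw [e] at this ⊢
  · rw [abs_of_pos (by linarith)]; ring
  · rw [abs_of_neg (by linarith)]; ring

variable [IsManifold (𝓡 2) ∞ S]

/-- `K` is the induced rotation up to index `m` and the conjugate one at `m + 1`. With these,
`η_{m+1}` is linear like the others and all equations come from the same Ricci identities. -/
theorem exists_toda (hm : 2 ≤ m) (himm : DmapInjective σ)
    {K : ℕ → S → PEnd (2 * m) →L[ℝ] PEnd (2 * m)} {J₁ : S → PEnd (2 * m) →ₗ[ℝ] PEnd (2 * m)}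
    (hK : ∀ i ∈ Icc 1 (m + 1), IsRotField 𝓛 i (K i))
    (hOZ : ∀ j ∈ Icc 1 m, IsOneZero σ 𝓛 j (K 1) (K j))
    (hlin : ∀ j ∈ Icc 1 m, IsLinearOn 𝓛 j (K j) (K (j + 1)) univ)
    (hdual : ∀ s A, K (m + 1) s A = -tauMul (2 * m) (K m s (tauMul (2 * m) A)))
    (hJ₁ : ∀ s, ∀ A ∈ 𝓛 1 s, J₁ s A = K 1 s A)
    {φ : ℂ → S} {D : Set ℂ} (hφ : IsHolParam σ J₁ φ D) {ℓ : ℕ → ℂ → PEnd (2 * m)}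
    (hℓ₁ : ∀ w ∈ D, ℓ 1 w = coordVec σ φ 1 w)
    (hℓ : ∀ i ∈ Icc 1 m, IsHolSec D (fun w => 𝓛 i (φ w)) (fun w => splitProj 𝓛 i (φ w))
      (fun w => K i (φ w)) (ℓ i))
    (h0 : ∀ i ∈ Icc 1 m, ∀ w ∈ D, ℓ i w ≠ 0) :
    ∃ f : ℕ → ℂ → ℂ, (∀ j ∈ Icc 1 m, DifferentiableOn ℂ (f (j + 1)) D) ∧
      (∀ j, 1 ≤ j → j + 1 ≤ m → ∀ w ∈ D, eta σ 𝓛 (j + 1) (φ w) (dx φ w) (ℓ j w) =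
        cact (K (j + 1) (φ w)) (f (j + 1) w) (ℓ (j + 1) w)) ∧
      (∀ w ∈ D, eta σ 𝓛 (m + 1) (φ w) (dx φ w) (ℓ m w) =
        cact (K (m + 1) (φ w)) (f (m + 1) w)
          ((herm (σ (φ w)) (ℓ m w))⁻¹ • tauMul (2 * m) (ℓ m w))) ∧
      IsTodaSolution m D (fun i w => herm (σ (φ w)) (ℓ i w)) f := by
  have hD := hφ.isOpen
  have m1 : 1 ∈ Icc 1 m := ⟨le_rfl, by omega⟩
  have mm : m ∈ Icc 1 m := ⟨by omega, le_rfl⟩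
  have m1' : ∀ {i}, i ∈ Icc 1 m → i ∈ Icc 1 (m + 1) := fun hi => ⟨hi.1, hi.2.trans (by omega)⟩
  have m2 : ∀ {i}, i ∈ Icc 1 (m + 1) → i ∈ Icc 1 (2 * m) := fun hi => ⟨hi.1, hi.2.trans (by omega)⟩
  -- The signed constant for which `c · g(ℓ_m, ℓ_m)` is the positive Hermitian norm.
  set c : ℝ := (-1) ^ (m + 1) / 2 with hc
  have hc0 : c ≠ 0 := by rw [hc]; positivity
  have hdat := h.frenetData hD hφ.smooth (by omega)
  have hp := fun {j : ℕ} (hj : j ∈ Icc 1 m) {w : ℂ} (hw : w ∈ D) =>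
    h.sff_param hD hφ.smooth hw (m2 (m1' hj))
  have hR := fun i (hi : i ∈ Icc 1 (m + 1)) => h.rotBundle_field hD hφ.smooth (m2 hi) (hK i hi)
  have hXY : ∀ w ∈ D, coordVec σ φ Complex.I w = K 1 (φ w) (coordVec σ φ 1 w) := fun w hw => by
    rw [← hJ₁ _ _ ((h.isSec_coordVec hD hφ.smooth (by omega) 1).2 w hw)]
    exact hφ.conformal w hw
  -- The given frames, extended at index `m + 1` by the image under `𝐏` of the metric dual of `ℓ_m`.
  set L : ℕ → ℂ → PEnd (2 * m) := fun i w =>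
    if i ≤ m then ℓ i w else (c * gform (2 * m) (ℓ m w) (ℓ m w))⁻¹ • tauMul (2 * m) (ℓ m w) with hL
  have hLℓ : ∀ i, i ≤ m → L i = ℓ i := fun i hi => by
    funext w; simp only [hL, if_pos hi]
  have hLm : L (m + 1) =
      fun w => (c * gform (2 * m) (ℓ m w) (ℓ m w))⁻¹ • tauMul (2 * m) (ℓ m w) := by
    funext w; simp only [hL, if_neg (show ¬ m + 1 ≤ m by omega)]
  have hP : ∀ w, ∀ A ∈ 𝓛 m (φ w), tauMul (2 * m) A ∈ 𝓛 (m + 1) (φ w) := fun w A hA => by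
    have := h.tauMul_mem (m2 (m1' mm)) hA
    rwa [show 2 * m + 1 - m = m + 1 by omega] at this
  have hpP : ∀ w A, splitProj 𝓛 (m + 1) (φ w) (tauMul (2 * m) A) =
      tauMul (2 * m) (splitProj 𝓛 m (φ w) A) := fun w A => by
    have := h.splitProj_tauMul (s := φ w) (m2 (m1' mm)) A
    rwa [show 2 * m + 1 - m = m + 1 by omega] at this
  have hherm : ∀ i ∈ Icc 1 m, ∀ w ∈ D, herm (σ (φ w)) (ℓ i w) =
      (-1) ^ (i + 1) / 2 * gform (2 * m) (ℓ i w) (ℓ i w) := fun i hi w hw =>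
    h.herm_eq (m2 (m1' hi)) ((hℓ i hi).1.2 w hw)
  have hne : ∀ i ∈ Icc 1 m, ∀ w ∈ D, gform (2 * m) (ℓ i w) (ℓ i w) ≠ 0 := fun i hi w hw =>
    (hR i (m1' hi)).ne_zero hw ((hℓ i hi).1.2 w hw) (h0 i hi w hw)
  obtain ⟨f, hf1, hf2, hf3, hf4⟩ := hdat.exists_toda (K := fun i w => K i (φ w)) (ℓ := L) hm hR
    (fun j hj w hw ξ hξ => by
      rw [← hp hj hw, ← hp hj hw]
      exact hlin j hj _ trivial _ ξ hξ)
    (fun j hj w hw ξ hξ => by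
      rw [← hp hj hw, ← hp hj hw, ← hlin j hj _ trivial _ ξ hξ]
      exact h.sff_rot_left (by omega) himm (m2 (m1' hj)) (hK 1 (m1' m1)) (hK j (m1' hj)) (hOZ j hj)
        (hXY w hw) hξ)
    (fun i hi => by
      rcases Nat.lt_or_ge m i with him | him
      · obtain rfl : i = m + 1 := le_antisymm hi.2 him
        rw [hLm]
        exact (hR m (m1' mm)).isHolSec_dual tauMul_tauMul (fun w _ => hP w) (fun w _ => hpP w)
          (fun w _ => hdual (φ w)) (hℓ m mm) (h0 m mm) hc0
      · rw [hLℓ i him]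
        exact hℓ i ⟨hi.1, him⟩)
    (fun i hi w hw => by
      rcases Nat.lt_or_ge m i with him | him
      · obtain rfl : i = m + 1 := le_antisymm hi.2 him
        rw [hLm]
        refine smul_ne_zero (inv_ne_zero (mul_ne_zero hc0 (hne m mm w hw))) fun h1 => h0 m mm w hw ?_
        rw [← tauMul_tauMul (ℓ m w), h1, map_zero]
      · rw [hLℓ i him]
        exact h0 i ⟨hi.1, him⟩ w hw)
    (fun w hw => by rw [hLℓ 1 m1.2]; exact hℓ₁ w hw) hXY
  have he : ∀ j ∈ Icc 1 m, ∀ w ∈ D, eta σ 𝓛 (j + 1) (φ w) (dx φ w) (ℓ j w) =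
      cact (K (j + 1) (φ w)) (f (j + 1) w) (L (j + 1) w) := fun j hj w hw => by
    rw [h.eta_eq_sff hj.1 (by have := hj.2; omega) _ (h.mem_plin (m2 (m1' hj)) ((hℓ j hj).1.2 w hw)),
      ← hf2 j hj w hw, ← hp hj hw, hLℓ j hj.2]
    rfl
  have hf4' : ∀ j k l, 1 ≤ j → k = j + 1 → l = k + 1 → k ≤ m → ∀ w ∈ D,
      ddbar (fun w => Real.log (herm (σ (φ w)) (ℓ k w))) w =
        ‖f l w‖ ^ 2 * gform (2 * m) (L l w) (L l w) / gform (2 * m) (ℓ k w) (ℓ k w) -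
        ‖f k w‖ ^ 2 * gform (2 * m) (ℓ k w) (ℓ k w) / gform (2 * m) (ℓ j w) (ℓ j w) := by
    rintro j _ _ hj rfl rfl hk w hw
    have := hf4 j hj hk (fun w => herm (σ (φ w)) (ℓ (j + 1) w)) ((-1) ^ (j + 1 + 1) / 2) (by positivity)
      (fun w hw => by rw [hLℓ _ hk]; exact hherm _ ⟨by omega, hk⟩ w hw) w hw
    rwa [hLℓ _ hk, hLℓ j (by omega)] at this
  refine ⟨f, hf1, fun j hj hj' w hw => ?_, fun w hw => ?_, ⟨fun w hw => ?_, fun j hj hj' w hw => ?_,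
    fun w hw => ?_⟩⟩
  · rw [he j ⟨hj, by omega⟩ w hw, hLℓ _ hj']
  · rw [he m mm w hw, hLm, hherm m mm w hw]
  · have mj : m - 1 ∈ Icc 1 m := ⟨by omega, by omega⟩
    rw [hf4' (m - 1) m (m + 1) (by omega) (by omega) rfl le_rfl w hw, hLm, hherm m mm w hw,
      hherm _ mj w hw]
    have e1 := hne m mm w hw
    have e2 := hne _ mj w hw
    -- `𝐏` reverses the sign of the metric, so the dual frame contributes `-𝒉_m⁻²`; the quotient of
    -- neighbouring norms of opposite type gives the other sign.
    simp only [map_smul, smul_apply, smul_eq_mul, gform_tauMul]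
    rw [show m - 1 + 1 = m by omega, hc, pow_succ (-1 : ℝ) m]
    rcases neg_one_pow_eq_or ℝ m with e | e <;> rw [e] <;> field_simp <;> ring
  · obtain ⟨k, rfl⟩ : ∃ k, j = k + 1 := ⟨j - 1, by omega⟩
    have mj : k ∈ Icc 1 m := ⟨by omega, by omega⟩
    have mk : k + 1 ∈ Icc 1 m := ⟨by omega, by omega⟩
    have ml : k + 1 + 1 ∈ Icc 1 m := ⟨by omega, by omega⟩
    rw [hf4' k (k + 1) (k + 1 + 1) (by omega) rfl rfl (by omega) w hw, hLℓ _ hj', Nat.add_sub_cancel,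
      hherm _ mk w hw, hherm _ mj w hw, hherm _ ml w hw]
    have e1 := hne _ mk w hw
    have e2 := hne _ mj w hw
    simp only [pow_succ]
    rcases neg_one_pow_eq_or ℝ k with e | e <;> rw [e] <;> field_simp <;> ring
  · have h2 : 2 ∈ Icc 1 m := ⟨by omega, hm⟩
    rw [hf3 (fun w => herm (σ (φ w)) (ℓ 1 w)) ((-1) ^ (1 + 1) / 2) (by positivity)
      (fun w hw => by rw [hLℓ 1 m1.2]; exact hherm 1 m1 w hw) w hw, hLℓ 1 m1.2, hLℓ 2 hm,
      hherm 1 m1 w hw, hherm 2 h2 w hw]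
    have e1 := hne 1 m1 w hw
    field_simp
    ring

end IsAlternatingSurface

end StructureEquations

end ParaHyp

-- Assembly of the theorem.

theorem theoremA {S : Type*} [TopologicalSpace S] [T2Space S] [SecondCountableTopology S]
    [ConnectedSpace S] [ChartedSpace (EuclideanSpace ℝ (Fin 2)) S] [IsManifold (𝓡 2) ∞ S]
    (m : ℕ) (hm : 2 ≤ m) (σ : S → Hyp (2 * m)) (hσ : IsSpacelikeImmersion σ)
    (𝓛 : ℕ → S → Submodule ℝ (PEnd (2 * m)))
    (hF : IsFrenetSplitting m σ 𝓛) (hC : IsSuperconformal m σ 𝓛) (hP : IsPAlternating m σ 𝓛)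
    (hcodim : ¬ InCodimFour σ)
    -- the orientation of `S`, given by the rotation `J₁` by `π/2` in `𝓛_1 = dσ(TS)`
    (J₁ : S → PEnd (2 * m) →ₗ[ℝ] PEnd (2 * m)) (hJ₁ : IsComplexStr σ (𝓛 1) J₁) :
    -- none of `η_2, …, η_m` vanishes identically
    (∀ i ∈ Icc 2 m, ∃ (s : S) (X : TangentSpace (𝓡 2) s), ∃ ξ ∈ 𝓛 (i - 1) s,
      eta σ 𝓛 i s X ξ ≠ 0) ∧
    -- the Frenet splitting is unique
    (∀ 𝓛' : ℕ → S → Submodule ℝ (PEnd (2 * m)), IsFrenetSplitting m σ 𝓛' →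
      IsPAlternating m σ 𝓛' → ∀ i ∈ Icc 1 (2 * m), 𝓛' i = 𝓛 i) ∧
    -- the structural data are determined by those with indices `1, …, m` and `η_{m+1}`
    (∀ i ∈ Icc 2 (2 * m), ∀ (s : S) (X : TangentSpace (𝓡 2) s), ∀ ξ ∈ 𝓛 i s, ∀ ζ ∈ 𝓛 (i - 1) s,
      gmet (σ s) (eta σ 𝓛 (2 * m + 2 - i) s X (paraP (2 * m) ξ)) (paraP (2 * m) ζ) =
        gmet (σ s) ξ (eta σ 𝓛 i s X ζ)) ∧
    (∀ i ∈ Icc 1 (2 * m), ∀ U ν, IsSection (𝓡 2) (𝓛 i) U ν →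
      IsSection (𝓡 2) (𝓛 (2 * m + 1 - i)) U (fun t => paraP (2 * m) (ν t)) ∧
      ∀ s ∈ U, ∀ X : TangentSpace (𝓡 2) s,
        covOn (𝓡 2) σ (𝓛 (2 * m + 1 - i)) (fun t => paraP (2 * m) (ν t)) s X =
          paraP (2 * m) (covOn (𝓡 2) σ (𝓛 i) ν s X)) ∧
    -- the orientation of `𝓛_1` induces orientations of all the `𝓛_i`
    ∃ J : ℕ → S → PEnd (2 * m) →ₗ[ℝ] PEnd (2 * m),
      (∀ s, ∀ ξ ∈ 𝓛 1 s, J 1 s ξ = J₁ s ξ) ∧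
      (∀ i ∈ Icc 1 (2 * m), IsHolHermitianLineBundle σ J₁ (𝓛 i) (J i)) ∧
      (∀ i ∈ Icc 1 (2 * m), ∀ s, ∀ ξ ∈ 𝓛 i s,
        J (2 * m + 1 - i) s (paraP (2 * m) ξ) = paraP (2 * m) (J i s ξ)) ∧
      -- `L_1 = K^{-1}`
      (∀ φ D, IsHolParam σ J₁ φ D →
        IsHolSection σ (𝓛 1) (J 1) φ D (fun w => dmap (𝓡 2) σ (φ w) (dx φ w))) ∧
      -- `η_2, …, η_m` are holomorphic `(1,0)`-forms with values in `Hom_ℂ(L_{i-1}, L_i)`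
      (∀ i ∈ Icc 2 m,
        IsHolOneForm σ J₁ (𝓛 (i - 1)) (J (i - 1)) (𝓛 i) (J i) (eta σ 𝓛 i)) ∧
      -- `η_{m+1}` is one with values in `Hom_ℂ(L_m, \bar L_m)`, `\bar L_m = (𝐏 𝓛_m, -J_{m+1})`
      IsHolOneForm σ J₁ (𝓛 m) (J m) (𝓛 (m + 1)) (fun s => -(J (m + 1) s))
        (eta σ 𝓛 (m + 1)) ∧
      -- the structure equations in a coordinate `z` and holomorphic frames `ℓ_i`, `ℓ_1 = ∂_z`
      (∀ φ D, IsHolParam σ J₁ φ D → ∀ ℓ : ℕ → ℂ → PEnd (2 * m),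
        (∀ w ∈ D, ℓ 1 w = dmap (𝓡 2) σ (φ w) (dx φ w)) →
        (∀ i ∈ Icc 1 m, IsHolSection σ (𝓛 i) (J i) φ D (ℓ i) ∧ ∀ w ∈ D, ℓ i w ≠ 0) →
        ∃ f : ℕ → ℂ → ℂ,
          (∀ i ∈ Icc 2 (m + 1), DifferentiableOn ℂ (f i) D) ∧
          (∀ i ∈ Icc 2 m, ∀ w ∈ D, eta σ 𝓛 i (φ w) (dx φ w) (ℓ (i - 1) w) =
            cmul (J i (φ w)) (f i w) (ℓ i w)) ∧
          (∀ w ∈ D, eta σ 𝓛 (m + 1) (φ w) (dx φ w) (ℓ m w) =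
            cmul (-(J (m + 1) (φ w))) (f (m + 1) w)
              ((herm (σ (φ w)) (ℓ m w))⁻¹ • paraP (2 * m) (ℓ m w))) ∧
          IsTodaSolution m D (fun i w => herm (σ (φ w)) (ℓ i w)) f) := by
  have h : IsAlternatingSurface m σ 𝓛 := ⟨hσ.1, hF, hP⟩
  have himm := dmapInjective_of_isSpacelikeImmersion hσ
  have m1 : 1 ∈ Icc 1 (2 * m) := ⟨le_rfl, by omega⟩
  have hJ₁f := h.isRotField_of_isComplexStr m1 hJ₁
  have hnz : ∀ j, 1 ≤ j → j + 1 ≤ m → SffNonzero 𝓛 j := fun j hj hj' => by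
    by_contra hn
    refine hcodim (h.inCodimFour (by omega) hj hj' fun s _ X ξ hξ => ?_)
    by_contra h0
    exact hn ⟨s, X, ξ, hξ, h0⟩
  obtain ⟨J, hJ1, hJ, hlin⟩ := h.exists_rotFields (by omega) himm hC hJ₁f hnz
  have hJ₁J : ∀ s, ∀ A ∈ 𝓛 1 s, J₁ s A = J 1 s A := fun s A hA => by
    rw [hJ1]
    exact congrArg (J₁ s) (h.splitProj_of_mem m1 hA).symm
  have hOZ : ∀ i ∈ Icc 1 m, IsRotField 𝓛 i (J i) ∧ IsOneZero σ 𝓛 i (J 1) (J i) := by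
    rw [hJ1]
    exact hJ
  have mm : m ∈ Icc 1 m := ⟨by omega, le_rfl⟩
  have mM : ∀ {i}, i ∈ Icc 1 m → i ∈ Icc 1 (2 * m) := fun hi => ⟨hi.1, hi.2.trans (by omega)⟩
  -- Beyond index `m` the orientation is carried over by `𝐏`, so compatibility with `𝐏` holds by
  -- construction.
  set F : ℕ → S → PEnd (2 * m) →L[ℝ] PEnd (2 * m) := fun i =>
    if i ≤ m then J i else dualRot (J (2 * m + 1 - i))
  have hFle : ∀ i, i ≤ m → F i = J i := fun i hi => if_pos hi
  have hFgt : ∀ i, m < i → F i = dualRot (J (2 * m + 1 - i)) := fun i hi => if_neg (not_le.2 hi)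
  have hFrot : ∀ i ∈ Icc 1 (2 * m), IsRotField 𝓛 i (F i) := fun i hi => by
    rcases Nat.lt_or_ge m i with him | him
    · have mi : 2 * m + 1 - i ∈ Icc 1 m := ⟨by have := hi.2; omega, by omega⟩
      have := h.isRotField_dualRot (mM mi) (hOZ _ mi).1
      rwa [show 2 * m + 1 - (2 * m + 1 - i) = i by have := hi.2; omega, ← hFgt i him] at this
    · rw [hFle i him]
      exact (hOZ i ⟨hi.1, him⟩).1
  have hFm : F (m + 1) = dualRot (J m) := by
    rw [hFgt _ (by omega), show 2 * m + 1 - (m + 1) = m by omega]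
  have hFP : ∀ i ∈ Icc 1 (2 * m), ∀ s A,
      F (2 * m + 1 - i) s (tauMul (2 * m) A) = tauMul (2 * m) (F i s A) := fun i hi s A => by
    rcases Nat.lt_or_ge m i with him | him
    · rw [hFgt i him, hFle _ (by omega), dualRot_apply, tauMul_tauMul]
    · rw [hFle i him, hFgt _ (by omega), dualRot_apply, tauMul_tauMul,
        show 2 * m + 1 - (2 * m + 1 - i) = i by have := hi.2; omega]
  -- Antilinearity of the middle form for the orientation induced by `𝐏` is linearity for the
  -- opposite one.
  have hlinm : IsLinearOn 𝓛 m (J m) (fun s => -dualRot (J m) s) univ := fun s _ X ξ hξ =>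
    h.sff_middle (by omega) himm hJ₁f (hJ m mm).1 (hJ m mm).2 X hξ
  have hFl : ∀ i s, ∀ A ∈ 𝓛 i s, ((F i s : PEnd (2 * m) →L[ℝ] PEnd (2 * m)) :
      PEnd (2 * m) →ₗ[ℝ] PEnd (2 * m)) A = F i s A := fun _ _ _ _ => rfl
  have hform : ∀ j, 1 ≤ j → j + 1 ≤ m → IsHolOneForm σ J₁ (𝓛 j) (fun s => (F j s).toLinearMap)
      (𝓛 (j + 1)) (fun s => (F (j + 1) s).toLinearMap) (eta σ 𝓛 (j + 1)) := fun j hj hj' => by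
    have mj : j ∈ Icc 1 m := ⟨hj, by omega⟩
    have mk : j + 1 ∈ Icc 1 m := ⟨by omega, hj'⟩
    exact h.isHolOneForm (by omega) himm hj (by omega) (hOZ 1 ⟨le_rfl, by omega⟩).1 hJ₁J (hOZ j mj).1
      (hOZ j mj).2 (hOZ _ mk).1 (hlin j hj hj') (fun s A _ => by rw [hFle j mj.2]; rfl)
      (fun s A _ => by rw [hFle _ hj']; rfl)
  refine ⟨fun i hi => ?_, fun 𝓛' hF' hP' i hi => ?_, fun i hi s X ξ hξ ζ hζ =>
    h.gmet_eta_dual (by omega) hi X hξ hζ, fun i hi U ν hν => h.covOn_paraP hi hν,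
    fun i s => (F i s).toLinearMap, fun s ξ hξ => ?_, fun i hi =>
    h.isHolHermitianLineBundle hi (hFrot i hi) fun _ _ _ => rfl, fun i hi s ξ _ => hFP i hi s ξ,
    fun φ D hφ => ?_, fun i hi => ?_, ?_, fun φ D hφ ℓ hℓ₁ hℓ => ?_⟩
  · obtain ⟨hi1, hi2⟩ := hi
    obtain ⟨j, rfl⟩ : ∃ j, i = j + 1 := ⟨i - 1, by omega⟩
    obtain ⟨s, X, ξ, hξ, h0⟩ := hnz j (by omega) hi2
    refine ⟨s, X, ξ, hξ, ?_⟩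
    rwa [h.eta_eq_sff (by omega) (by omega) X (h.mem_plin ⟨by omega, by omega⟩ hξ)]
  · exact h.splitting_eq ⟨hσ.1, hF', hP'⟩ (by omega) himm hC hOZ hlin hnz hi
  · rw [hJ₁J s ξ hξ, ← hFle 1 (by omega)]
    rfl
  · refine (h.isHolSection_iff hφ.isOpen m1 (J := F 1) (hFl 1)).2
      (h.isHolSec_coordVec hφ.isOpen hφ.smooth (by omega) (hFrot 1 m1) fun w hw => ?_)
    rw [hFle 1 (by omega), ← hJ₁J _ _ ((h.isSec_coordVec hφ.isOpen hφ.smooth (by omega) 1).2 w hw)]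
    exact hφ.conformal w hw
  · obtain ⟨hi1, hi2⟩ := hi
    obtain ⟨j, rfl⟩ : ∃ j, i = j + 1 := ⟨i - 1, by omega⟩
    exact hform j (by omega) hi2
  · have hr := h.isRotField_dualRot (mM mm) (hOZ m mm).1
    rw [show 2 * m + 1 - m = m + 1 by omega] at hr
    exact h.isHolOneForm (by omega) himm (by omega) (by omega) (hOZ 1 ⟨le_rfl, by omega⟩).1 hJ₁J
      (hOZ m mm).1 (hOZ m mm).2 hr.neg hlinm (fun s A _ => by change F m s A = _; rw [hFle m le_rfl])
      (fun s A _ => by change -(F (m + 1) s A) = _; rw [hFm]; rfl)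
  -- `K` differs from `F` by a sign at index `m + 1`, the conjugate structure of the bundle
  -- receiving `η_{m+1}`; its values at larger indices play no role.
  · set K : ℕ → S → PEnd (2 * m) →L[ℝ] PEnd (2 * m) := fun i =>
      if i ≤ m then J i else fun s => -dualRot (J m) s
    have hKle : ∀ i, i ≤ m → K i = J i := fun i hi => if_pos hi
    have hKm : K (m + 1) = fun s => -dualRot (J m) s := if_neg (by omega)
    have hr := h.isRotField_dualRot (mM mm) (hOZ m mm).1
    rw [show 2 * m + 1 - m = m + 1 by omega] at hr
    have hℓJ : ∀ i ∈ Icc 1 m, IsHolSec D (fun w => 𝓛 i (φ w)) (fun w => splitProj 𝓛 i (φ w))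
        (fun w => K i (φ w)) (ℓ i) := fun i hi =>
      (h.isHolSection_iff hφ.isOpen (mM hi) fun s A _ => by
        change F i s A = _
        rw [hKle i hi.2, hFle i hi.2]).1 (hℓ i hi).1
    obtain ⟨f, hf1, hf2, hf3, hf4⟩ := h.exists_toda hm himm (K := K)
      (fun i hi => by
        rcases Nat.lt_or_ge m i with him | him
        · obtain rfl : i = m + 1 := le_antisymm hi.2 him
          rw [hKm]
          exact hr.neg
        · rw [hKle i him]
          exact (hOZ i ⟨hi.1, him⟩).1)
      (fun j hj => by
        rw [hKle j hj.2, hKle 1 (by omega)]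
        exact (hOZ j hj).2)
      (fun j hj => by
        rw [hKle j hj.2]
        rcases Nat.lt_or_ge m (j + 1) with hjm | hjm
        · obtain rfl : j = m := le_antisymm hj.2 (by omega)
          rw [hKm]
          exact hlinm
        · rw [hKle _ hjm]
          exact hlin j hj.1 hjm)
      (fun s A => by rw [hKm, hKle m le_rfl]; rfl)
      (fun s A hA => by rw [hKle 1 (by omega)]; exact hJ₁J s A hA) hφ hℓ₁ hℓJ fun i hi => (hℓ i hi).2
    refine ⟨f, fun i hi => ?_, fun i hi w hw => ?_, fun w hw => ?_, hf4⟩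
    · obtain ⟨hi1, hi2⟩ := hi
      obtain ⟨j, rfl⟩ : ∃ j, i = j + 1 := ⟨i - 1, by omega⟩
      exact hf1 j ⟨by omega, by omega⟩
    · obtain ⟨hi1, hi2⟩ := hi
      obtain ⟨j, rfl⟩ : ∃ j, i = j + 1 := ⟨i - 1, by omega⟩
      have := hf2 j (by omega) hi2 w hw
      rw [hKle _ hi2, ← hFle _ hi2] at this
      exact this
    · have := hf3 w hw
      rw [hKm, ← hFm] at this
      exact this
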